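/- **Setting.** Let $k$ be a field and let $H$ be a Hopf algebra over $k$ with bijective antipode $\mathcal S$. Write ${}^H_H\mathcal{YD}$ for the braided monoidal category of left Yetter–Drinfeld modules over $H$ (left modules and left comodules with $\delta(hv)=h_{(1)}v_{(-1)}\mathcal S(h_{(3)})\otimes h_{(2)}v_{(0)}$, braiding $v\otimes w\mapsto v_{(-1)}w\otimes v_{(0)}$). For a Hopf algebra $R$ in ${}^H_H\mathcal{YD}$, with comultiplication $x\mapsto x^{(1)}\otimes x^{(2)}$ and counit $\varepsilon$, let $R\#H$ be its bosonization, the Hopf algebra $R\otimes H$ with the smash product multiplication $(r\#h)(r'\#h')=r(h_{(1)}r')\#h_{(2)}h'$ and the cosmash product comultiplication $\Delta(r\#h)=r^{(1)}\#(r^{(2)})_{(-1)}h_{(1)}\otimes (r^{(2)})_{(0)}\#h_{(2)}$. Let $\pi:R\#H\to H$, $\pi(r\#h)=\varepsilon(r)h$, and $\vartheta:R\#H\to R$, $\vartheta(r\#h)=r\varepsilon(h)$. The antipode of $R\#H$ is again denoted by $\mathcal S$. **Dual pairs.** Let $R$ and $R^\vee$ be Hopf algebras in ${}^H_H\mathcal{YD}$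 whose antipodes are bijective, and let $\langle\;,\;\rangle:R^\vee\otimes R\to k$ be a bilinear form. For subspaces $E\subseteq R$ let $E^\perp=\{\xi\in R^\vee\mid\langle\xi,E\rangle=0\}$; the finite topology on $R^\vee$ has the $E^\perp$ with $\dim E<\infty$ as a basis of neighbourhoods of $0$, and the finite topology on $R$ is defined symmetrically; on $R^\vee\otimes R^\vee$ the subspaces $E^\perp\otimes R^\vee+R^\vee\otimes E'^\perp$ ($E,E'\subseteq R$ finite-dimensional) form a basis of neighbourhoods of $0$, and similarly on $R\otimes R$. Assume that $(R,R^\vee)$ with $\langle\;,\;\rangle$ is a dual pair of Hopf algebras in ${}^H_H\mathcal{YD}$, that is: 1. every finite-dimensional subspace of $R$ is contained in a finite-dimensional Yetter–Drinfeld submodule of $R$, and likewise for $R^\vee$; 2. $\langle\;,\;\rangle$ is non-degenerate; 3. for all $h\in H$, $\xi,\eta\in R^\vee$ and $x,y\in R$, $$\langle h\xi,x\rangle=\langle\xi,\mathcal S(h)x\rangle,\qquad \xi_{(-1)}\langle\xi_{(0)},x\rangle=\mathcal S^{-1}(x_{(-1)})\langle\xi,x_{(0)}\rangle,$$ $$\langle\xi,xy\rangle=\langle\xi^{(1)},y\rangle\langle\xi^{(2)},x\rangle,\qquad\langle1,x\rangle=\varepsilon(x),$$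 $$\langle\xi\eta,x\rangle=\langle\xi,x^{(2)}\rangle\langle\eta,x^{(1)}\rangle,\qquad\langle\xi,1\rangle=\varepsilon(\xi);$$ 4. the comultiplications of $R$ and of $R^\vee$ are continuous for the finite topologies. **The two categories.** Let $\mathcal{YD}^{R\#H}_H$ be the category whose objects are the vector spaces $M$ with a right $H$-module structure and a right $R\#H$-comodule structure $m\mapsto m_{[0]}\otimes m_{[1]}$ such that $\delta(mh)=m_{[0]}h_{(2)}\otimes\mathcal S(h_{(1)})\,m_{[1]}\,h_{(3)}$ (where $H\subseteq R\#H$). Let ${}^{\quad\;\;\,H}_{R^\vee\#H}\mathcal{YD}$ be the category whose objects are the vector spaces $M$ with a left $R^\vee\#H$-module structure and a left $H$-comodule structure such that $\delta(bm)=\pi(b_{(1)})m_{(-1)}\pi(\mathcal S(b_{(3)}))\otimes b_{(2)}m_{(0)}$. Morphisms are the linear maps that are both module and comodule maps. Both categories are monoidal, with the tensor product over $k$ carrying the diagonal action and coaction, and with unit object $k$. Let ${}^{\quad\;\;\,H}_{R^\vee\#H}\mathcal{YD}_{\mathrm{rat}}$ be the full monoidal subcategory of those $M$ that are rational over $R^\vee$: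 for every $m\in M$ there is a finite-dimensional subspace $E\subseteq R$ with $E^\perp m=0$. **Theorem.** For $M\in\mathcal{YD}^{R\#H}_H$ let $F(M)=M$ as a vector space, with left $H$-action, left $R^\vee$-action and left $H$-coaction $$hm=m\,\mathcal S^{-1}(h),\qquad \xi m=\langle\xi,\vartheta\mathcal S(m_{[1]})\rangle\,m_{[0]},\qquad \delta^H_{F(M)}(m)=\pi\mathcal S(m_{[1]})\otimes m_{[0]}$$ for $h\in H$, $\xi\in R^\vee$, $m\in M$, and let $F(f)=f$ for morphisms $f$. With $(\xi\#h)m=\xi(hm)$, $F(M)$ is then an object of ${}^{\quad\;\;\,H}_{R^\vee\#H}\mathcal{YD}$ that is rational over $R^\vee$, and $$F:\mathcal{YD}^{R\#H}_H\longrightarrow{}^{\quad\;\;\,H}_{R^\vee\#H}\mathcal{YD}_{\mathrm{rat}}$$ is an isomorphism of categories: there is a functor $G$ with $FG=\mathrm{id}$ and $GF=\mathrm{id}$. Moreover, with the maps $$\varphi_{M,N}:F(M)\otimes F(N)\to F(M\otimes N),\qquad m\otimes n\mapsto m\,\pi\mathcal S^{-1}(n_{[1]})\otimes n_{[0]},$$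 and with the identity of $k$ as unit constraint, $(F,\varphi)$ is a (strong) monoidal functor. Hence $(F,\varphi)$ is a monoidal isomorphism. -/

import Mathlib

open scoped TensorProduct
open Coalgebra HopfAlgebra

universe u v w x y

namespace RelYD

section Shortcut

variable {k M N : Type*} [CommSemiring k] [AddCommMonoid M] [AddCommMonoid N] [Module k M]
  [Module k N]

instance : AddMonoidHomClass (M →ₗ[k] N) M N where
  map_add f := f.map_add
  map_zero f := f.map_zero

instance : ZeroHomClass (M →ₗ[k] N) M N := ⟨fun f => f.map_zero⟩

instance : AddHomClass (M →ₗ[k] N) M N := ⟨fun f => f.map_add⟩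

instance : AddMonoidHomClass (M ≃ₗ[k] N) M N where
  map_add f := f.map_add
  map_zero f := f.map_zero

instance : ZeroHomClass (M ≃ₗ[k] N) M N := ⟨fun f => f.map_zero⟩

instance : AddHomClass (M ≃ₗ[k] N) M N := ⟨fun f => f.map_add⟩

end Shortcut


section Shortcut2

variable {k M N : Type*} [CommSemiring k] [Semiring M] [Semiring N] [Algebra k M]
  [Algebra k N]

instance : AddMonoidHomClass (M →ₐ[k] N) M N where
  map_add f := f.map_add
  map_zero f := f.map_zero

instance : ZeroHomClass (M →ₐ[k] N) M N := ⟨fun f => f.map_zero⟩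

instance : AddHomClass (M →ₐ[k] N) M N := ⟨fun f => f.map_add⟩

end Shortcut2

section Convolution

variable {k : Type u} [Field k] {B : Type v} [Ring B] [HopfAlgebra k B]
variable {X Y Z X' Y' Z' W : Type*}
  [AddCommMonoid X] [Module k X] [AddCommMonoid Y] [Module k Y] [AddCommMonoid Z] [Module k Z]
  [AddCommMonoid X'] [Module k X'] [AddCommMonoid Y'] [Module k Y'] [AddCommMonoid Z'] [Module k Z']
  [AddCommMonoid W] [Module k W]

/-- `conv μ f g b = ∑ μ (f b₍₁₎) (g b₍₂₎)`. -/
noncomputable def conv (μ : X →ₗ[k] Y →ₗ[k] Z) (f : B →ₗ[k] X) (g : B →ₗ[k] Y) : B →ₗ[k] Z :=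
  TensorProduct.lift (μ.compl₁₂ f g) ∘ₗ comul

theorem lift_conv_congr {μ : X →ₗ[k] Y →ₗ[k] Z} {f : B →ₗ[k] X} {g : B →ₗ[k] Y}
    {T : B ⊗[k] B →ₗ[k] Z} (h : ∀ a b, μ (f a) (g b) = T (a ⊗ₜ b)) (b : B) :
    conv μ f g b = T (comul b) := by
  have : TensorProduct.lift (μ.compl₁₂ f g) = T := TensorProduct.ext' (by simpa using h)
  simp [conv, this]

theorem conv_congr {μ : X →ₗ[k] Y →ₗ[k] Z} {f : B →ₗ[k] X} {g : B →ₗ[k] Y}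
    {μ' : X' →ₗ[k] Y' →ₗ[k] Z} {f' : B →ₗ[k] X'} {g' : B →ₗ[k] Y'}
    (h : ∀ a b, μ (f a) (g b) = μ' (f' a) (g' b)) : conv μ f g = conv μ' f' g' := by
  ext b
  exact lift_conv_congr (T := TensorProduct.lift (μ'.compl₁₂ f' g')) (by simpa using h) b

theorem map_conv (F : Z →ₗ[k] W) (μ : X →ₗ[k] Y →ₗ[k] Z) (f : B →ₗ[k] X) (g : B →ₗ[k] Y) (b : B) :
    F (conv μ f g b) = conv (μ.compr₂ F) f g b :=
  (lift_conv_congr (T := F ∘ₗ TensorProduct.lift (μ.compl₁₂ f g)) (by simp) b).symm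

theorem conv_assoc {W' T' : Type*} [AddCommMonoid W'] [Module k W'] [AddCommMonoid T'] [Module k T']
    {μ₁ : Z →ₗ[k] W →ₗ[k] X'} {μ₂ : X →ₗ[k] Y →ₗ[k] Z}
    {f : B →ₗ[k] X} {g : B →ₗ[k] Y} {h : B →ₗ[k] W}
    {μ₃ : Y' →ₗ[k] T' →ₗ[k] X'} {μ₄ : Z' →ₗ[k] W' →ₗ[k] T'}
    {f' : B →ₗ[k] Y'} {g' : B →ₗ[k] Z'} {h' : B →ₗ[k] W'}
    (H : ∀ a b c, μ₁ (μ₂ (f a) (g b)) (h c) = μ₃ (f' a) (μ₄ (g' b) (h' c))) :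
    conv μ₁ (conv μ₂ f g) h = conv μ₃ f' (conv μ₄ g' h') := by
  ext b
  let T : B ⊗[k] (B ⊗[k] B) →ₗ[k] X' :=
    TensorProduct.lift (μ₃.compl₁₂ f' (TensorProduct.lift (μ₄.compl₁₂ g' h')))
  have h1 : TensorProduct.lift (μ₁.compl₁₂ (conv μ₂ f g) h) =
      T ∘ₗ (TensorProduct.assoc k B B B).toLinearMap ∘ₗ comul.rTensor B := by
    refine TensorProduct.ext' fun a c => ?_
    have : ∀ t : B ⊗[k] B, μ₁ (TensorProduct.lift (μ₂.compl₁₂ f g) t) (h c) =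
        T (TensorProduct.assoc k B B B (t ⊗ₜ c)) := by
      intro t
      induction t with
      | zero => simp
      | tmul a b => simp [T, H]
      | add s t hs ht => simp [TensorProduct.add_tmul, hs, ht]
    simpa [conv] using this (comul a)
  have h2 : TensorProduct.lift (μ₃.compl₁₂ f' (conv μ₄ g' h')) = T ∘ₗ comul.lTensor B :=
    TensorProduct.ext' fun a c => by simp [T, conv]
  have := congrArg T (coassoc_apply (R := k) b)
  change TensorProduct.lift (μ₁.compl₁₂ (conv μ₂ f g) h) (comul b) =
    TensorProduct.lift (μ₃.compl₁₂ f' (conv μ₄ g' h')) (comul b)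
  rw [h1, h2]
  exact this

theorem conv_counit_right (μ : X →ₗ[k] Y →ₗ[k] Z) (f : B →ₗ[k] X) {g : B →ₗ[k] Y} {e : Y}
    (hg : ∀ b, g b = counit (R := k) b • e) (b : B) : conv μ f g b = μ (f b) e := by
  have := lift_conv_congr (μ := μ) (f := f) (g := g)
    (T := (μ.flip e ∘ₗ f) ∘ₗ (TensorProduct.rid k B).toLinearMap ∘ₗ counit.lTensor B)
    (by intro a b; simp [hg]) b
  simpa using this

theorem conv_counit_left (μ : X →ₗ[k] Y →ₗ[k] Z) {f : B →ₗ[k] X} (g : B →ₗ[k] Y) {e : X}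
    (hf : ∀ b, f b = counit (R := k) b • e) (b : B) : conv μ f g b = μ e (g b) := by
  have := lift_conv_congr (μ := μ) (f := f) (g := g)
    (T := (μ e ∘ₗ g) ∘ₗ (TensorProduct.lid k B).toLinearMap ∘ₗ counit.rTensor B)
    (by intro a b; simp [hf]) b
  simpa using this

theorem conv_cancel_right {μ : X →ₗ[k] Y →ₗ[k] X} {ν : Y →ₗ[k] Y →ₗ[k] Y} {e : Y}
    (H : ∀ x y z, μ (μ x y) z = μ x (ν y z)) (he : ∀ x, μ x e = x) (f : B →ₗ[k] X)
    {g h : B →ₗ[k] Y} (hgh : ∀ b, conv ν g h b = counit (R := k) b • e) :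
    conv μ (conv μ f g) h = f := by
  rw [conv_assoc (μ₃ := μ) (μ₄ := ν) (f' := f) (g' := g) (h' := h) (fun a b c => H _ _ _)]
  ext b
  rw [conv_counit_right _ _ hgh, he]

theorem conv_cancel_left {μ : Y →ₗ[k] X →ₗ[k] X} {ν : Y →ₗ[k] Y →ₗ[k] Y} {e : Y}
    (H : ∀ x y z, μ x (μ y z) = μ (ν x y) z) (he : ∀ x, μ e x = x) (f : B →ₗ[k] X)
    {g h : B →ₗ[k] Y} (hgh : ∀ b, conv ν g h b = counit (R := k) b • e) :
    conv μ g (conv μ h f) = f := by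
  rw [← conv_assoc (μ₁ := μ) (μ₂ := ν) (f := g) (g := h) (h := f) (fun a b c => (H _ _ _).symm)]
  ext b
  rw [conv_counit_left _ _ hgh, he]

/-- Compare `conv` at a product with a bilinear expression in the two factors. -/
theorem conv_mul_eq {μ : X →ₗ[k] Y →ₗ[k] Z} {f : B →ₗ[k] X} {g : B →ₗ[k] Y}
    {μ₁ : X' →ₗ[k] Y' →ₗ[k] W} {f₁ : B →ₗ[k] X'} {g₁ : B →ₗ[k] Y'}
    {μ₂ : X' →ₗ[k] Y' →ₗ[k] Z'} {f₂ : B →ₗ[k] X'} {g₂ : B →ₗ[k] Y'}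
    {ν : W →ₗ[k] Z' →ₗ[k] Z}
    (H : ∀ a b c d, μ (f (a * c)) (g (b * d)) = ν (μ₁ (f₁ a) (g₁ b)) (μ₂ (f₂ c) (g₂ d))) (b b' : B) :
    conv μ f g (b * b') = ν (conv μ₁ f₁ g₁ b) (conv μ₂ f₂ g₂ b') := by
  simp only [conv, LinearMap.comp_apply, Bialgebra.comul_mul]
  generalize comul (R := k) b = s
  generalize comul (R := k) b' = t
  induction s with
  | zero => simp
  | add s s' hs hs' => simp [add_mul, hs, hs']
  | tmul a b =>
    induction t with
    | zero => simp
    | add s s' hs hs' => simp [mul_add, hs, hs']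
    | tmul c d => simpa using H a b c d

end Convolution

section Tensor

variable {k : Type u} [Field k] {B : Type v} [Ring B] [HopfAlgebra k B]
  {C : Type w} [Ring C] [HopfAlgebra k C]
variable {M N P M' N' : Type*} [AddCommGroup M] [Module k M] [AddCommGroup N] [Module k N]
  [AddCommGroup P] [Module k P] [AddCommGroup M'] [Module k M'] [AddCommGroup N'] [Module k N']

/-- The diagonal action on `M ⊗ N`: `b` acts as `∑ b₍₁₎ ⊗ b₍₂₎`. It is used for left and for
right actions. -/
noncomputable def tensorAct (aM : B →ₗ[k] Module.End k M) (aN : B →ₗ[k] Module.End k N) :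
    B →ₗ[k] Module.End k (M ⊗[k] N) :=
  conv (TensorProduct.mapBilinear (RingHom.id k) M N M N) aM aN

/-- The trivial action on `k`: `b` acts as multiplication by `ε b`. It is used for left and for
right actions. -/
noncomputable def trivAct (k : Type u) [Field k] (B : Type v) [Ring B] [HopfAlgebra k B] :
    B →ₗ[k] Module.End k k :=
  (LinearMap.mul k k) ∘ₗ counit

/-- The diagonal left coaction `m ⊗ n ↦ ∑ m₍₋₁₎ n₍₋₁₎ ⊗ (m₍₀₎ ⊗ n₍₀₎)`. -/
noncomputable def tensorCoactLeft (cM : M →ₗ[k] C ⊗[k] M) (cN : N →ₗ[k] C ⊗[k] N) :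
    M ⊗[k] N →ₗ[k] C ⊗[k] (M ⊗[k] N) :=
  (LinearMap.mul' k C).rTensor (M ⊗[k] N) ∘ₗ
    (TensorProduct.tensorTensorTensorComm k C M C N).toLinearMap ∘ₗ TensorProduct.map cM cN

/-- The diagonal right coaction `m ⊗ n ↦ ∑ (m₍₀₎ ⊗ n₍₀₎) ⊗ m₍₁₎ n₍₁₎`. -/
noncomputable def tensorCoactRight (cM : M →ₗ[k] M ⊗[k] C) (cN : N →ₗ[k] N ⊗[k] C) :
    M ⊗[k] N →ₗ[k] (M ⊗[k] N) ⊗[k] C :=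
  (LinearMap.mul' k C).lTensor (M ⊗[k] N) ∘ₗ
    (TensorProduct.tensorTensorTensorComm k M C N C).toLinearMap ∘ₗ TensorProduct.map cM cN

/-- The trivial left coaction `a ↦ 1 ⊗ a` on `k`. -/
noncomputable def trivCoactLeft (k : Type u) [Field k] (C : Type w) [Ring C] [HopfAlgebra k C] :
    k →ₗ[k] C ⊗[k] k :=
  TensorProduct.mk k C k 1

/-- The trivial right coaction `a ↦ a ⊗ 1` on `k`. -/
noncomputable def trivCoactRight (k : Type u) [Field k] (C : Type w) [Ring C] [HopfAlgebra k C] :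
    k →ₗ[k] k ⊗[k] C :=
  (TensorProduct.mk k k C).flip 1

/-- The map `b ↦ ∑ c ⊗ m ↦ ρ(b₍₁₎) c ρ(S b₍₃₎) ⊗ b₍₂₎ m`. -/
noncomputable def adLeft (ρ : B →ₐc[k] C) (act : B →ₗ[k] Module.End k M) :
    B →ₗ[k] Module.End k (C ⊗[k] M) :=
  conv (LinearMap.mul k (Module.End k (C ⊗[k] M)))
    (conv (LinearMap.mul k (Module.End k (C ⊗[k] M)))
      (LinearMap.rTensorHom M ∘ₗ LinearMap.mul k C ∘ₗ (ρ : B →ₗ[k] C))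
      (LinearMap.lTensorHom C ∘ₗ act))
    (LinearMap.rTensorHom M ∘ₗ (LinearMap.mul k C).flip ∘ₗ (ρ : B →ₗ[k] C) ∘ₗ antipode k)

/-- The map `b ↦ ∑ m ⊗ c ↦ m b₍₂₎ ⊗ S(ρ(b₍₁₎)) c ρ(b₍₃₎)`. -/
noncomputable def adRight (ρ : B →ₐc[k] C) (act : B →ₗ[k] Module.End k M) :
    B →ₗ[k] Module.End k (M ⊗[k] C) :=
  conv (LinearMap.mul k (Module.End k (M ⊗[k] C)))
    (conv (LinearMap.mul k (Module.End k (M ⊗[k] C)))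
      (LinearMap.lTensorHom M ∘ₗ LinearMap.mul k C ∘ₗ antipode k ∘ₗ (ρ : B →ₗ[k] C))
      (LinearMap.rTensorHom C ∘ₗ act))
    (LinearMap.lTensorHom M ∘ₗ (LinearMap.mul k C).flip ∘ₗ (ρ : B →ₗ[k] C))

/-- `act` (written `b m`) and `coact` make `M` a left `B`-module and a left `C`-comodule such that
`δ(b m) = ∑ ρ(b₍₁₎) m₍₋₁₎ ρ(S b₍₃₎) ⊗ b₍₂₎ m₍₀₎`. -/
structure IsLeftYD (ρ : B →ₐc[k] C) (act : B →ₗ[k] Module.End k M) (coact : M →ₗ[k] C ⊗[k] M) :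
    Prop where
  act_one : ∀ m, act 1 m = m
  act_mul : ∀ b b' m, act (b * b') m = act b (act b' m)
  coassoc : ∀ m, TensorProduct.assoc k C C M (comul.rTensor M (coact m)) =
    coact.lTensor C (coact m)
  counit : ∀ m, counit.rTensor M (coact m) = (1 : k) ⊗ₜ[k] m
  compat : ∀ b m, coact (act b m) = adLeft ρ act b (coact m)

/-- `act` (`act b m` is written `m b`) and `coact` make `M` a right `B`-module and a right
`C`-comodule such that `δ(m b) = ∑ m₍₀₎ b₍₂₎ ⊗ S(ρ(b₍₁₎)) m₍₁₎ ρ(b₍₃₎)`. -/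
structure IsRightYD (ρ : B →ₐc[k] C) (act : B →ₗ[k] Module.End k M) (coact : M →ₗ[k] M ⊗[k] C) :
    Prop where
  act_one : ∀ m, act 1 m = m
  act_mul : ∀ b b' m, act (b * b') m = act b' (act b m)
  coassoc : ∀ m, TensorProduct.assoc k M C C (coact.rTensor C (coact m)) =
    comul.lTensor M (coact m)
  counit : ∀ m, counit.lTensor M (coact m) = m ⊗ₜ[k] (1 : k)
  compat : ∀ b m, coact (act b m) = adRight ρ act b (coact m)

/-- `f` is linear over `B` and colinear over `C` (left coactions). -/
structure IsLeftHom (aM : B →ₗ[k] Module.End k M) (cM : M →ₗ[k] C ⊗[k] M)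
    (aN : B →ₗ[k] Module.End k N) (cN : N →ₗ[k] C ⊗[k] N) (f : M →ₗ[k] N) : Prop where
  map_act : ∀ b m, f (aM b m) = aN b (f m)
  map_coact : ∀ m, cN (f m) = f.lTensor C (cM m)

/-- `f` is linear over `B` and colinear over `C` (right coactions). -/
structure IsRightHom (aM : B →ₗ[k] Module.End k M) (cM : M →ₗ[k] M ⊗[k] C)
    (aN : B →ₗ[k] Module.End k N) (cN : N →ₗ[k] N ⊗[k] C) (f : M →ₗ[k] N) : Prop where
  map_act : ∀ b m, f (aM b m) = aN b (f m)
  map_coact : ∀ m, cN (f m) = f.rTensor C (cM m)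

end Tensor

section TensorLemmas

variable {k : Type u} [Field k] {B : Type v} [Ring B] [HopfAlgebra k B]
  {C : Type w} [Ring C] [HopfAlgebra k C]
variable {M N P M' N' : Type*} [AddCommGroup M] [Module k M] [AddCommGroup N] [Module k N]
  [AddCommGroup P] [Module k P] [AddCommGroup M'] [Module k M'] [AddCommGroup N'] [Module k N']

theorem tensorAct_apply (aM : B →ₗ[k] Module.End k M) (aN : B →ₗ[k] Module.End k N) (b : B)
    (x : M ⊗[k] N) :
    tensorAct aM aN b x = TensorProduct.homTensorHomMap (RingHom.id k) M N M N
      (TensorProduct.map aM aN (comul b)) x := by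
  rw [tensorAct, lift_conv_congr (T := TensorProduct.homTensorHomMap (RingHom.id k) M N M N ∘ₗ
    TensorProduct.map aM aN) (by intro a b; simp)]
  rfl

theorem tensorAct_one {aM : B →ₗ[k] Module.End k M} {aN : B →ₗ[k] Module.End k N}
    (hM : ∀ m, aM 1 m = m) (hN : ∀ n, aN 1 n = n) (x : M ⊗[k] N) : tensorAct aM aN 1 x = x := by
  have h1 : aM 1 = LinearMap.id := LinearMap.ext hM
  have h2 : aN 1 = LinearMap.id := LinearMap.ext hN
  simp [tensorAct_apply, Algebra.TensorProduct.one_def, h1, h2]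

theorem tensorAct_mul {aM : B →ₗ[k] Module.End k M} {aN : B →ₗ[k] Module.End k N}
    (hM : ∀ b b' m, aM (b * b') m = aM b (aM b' m))
    (hN : ∀ b b' m, aN (b * b') m = aN b (aN b' m)) (b b' : B) (x : M ⊗[k] N) :
    tensorAct aM aN (b * b') x = tensorAct aM aN b (tensorAct aM aN b' x) := by
  have := conv_mul_eq (μ := TensorProduct.mapBilinear (RingHom.id k) M N M N) (f := aM) (g := aN)
    (μ₁ := TensorProduct.mapBilinear (RingHom.id k) M N M N) (f₁ := aM) (g₁ := aN)
    (μ₂ := TensorProduct.mapBilinear (RingHom.id k) M N M N) (f₂ := aM) (g₂ := aN)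
    (ν := LinearMap.mul k (Module.End k (M ⊗[k] N)))
    (by intro a b c d; ext m n; simp [hM, hN]) b b'
  exact congrArg (fun f => f x) this

theorem tensorAct_mul_op {aM : B →ₗ[k] Module.End k M} {aN : B →ₗ[k] Module.End k N}
    (hM : ∀ b b' m, aM (b * b') m = aM b' (aM b m))
    (hN : ∀ b b' m, aN (b * b') m = aN b' (aN b m)) (b b' : B) (x : M ⊗[k] N) :
    tensorAct aM aN (b * b') x = tensorAct aM aN b' (tensorAct aM aN b x) := by
  have := conv_mul_eq (μ := TensorProduct.mapBilinear (RingHom.id k) M N M N) (f := aM) (g := aN)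
    (μ₁ := TensorProduct.mapBilinear (RingHom.id k) M N M N) (f₁ := aM) (g₁ := aN)
    (μ₂ := TensorProduct.mapBilinear (RingHom.id k) M N M N) (f₂ := aM) (g₂ := aN)
    (ν := (LinearMap.mul k (Module.End k (M ⊗[k] N))).flip)
    (by intro a b c d; ext m n; simp [hM, hN]) b b'
  exact congrArg (fun f => f x) this

theorem tensorAct_natural {aM : B →ₗ[k] Module.End k M} {aN : B →ₗ[k] Module.End k N}
    {aM' : B →ₗ[k] Module.End k M'} {aN' : B →ₗ[k] Module.End k N'} {f : M →ₗ[k] M'}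
    {g : N →ₗ[k] N'} (hf : ∀ b m, f (aM b m) = aM' b (f m))
    (hg : ∀ b m, g (aN b m) = aN' b (g m)) (b : B) (x : M ⊗[k] N) :
    TensorProduct.map f g (tensorAct aM aN b x) = tensorAct aM' aN' b (TensorProduct.map f g x) := by
  simp only [tensorAct_apply]
  generalize comul (R := k) b = t
  induction t with
  | zero => simp
  | add s t hs ht => simp [hs, ht]
  | tmul a b =>
    induction x with
    | zero => simp
    | add s t hs ht => simp only [map_add, hs, ht]
    | tmul m n => simp [hf, hg]

theorem tensorAct_assoc (aM : B →ₗ[k] Module.End k M) (aN : B →ₗ[k] Module.End k N)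
    (aP : B →ₗ[k] Module.End k P) (b : B) (x : (M ⊗[k] N) ⊗[k] P) :
    TensorProduct.assoc k M N P (tensorAct (tensorAct aM aN) aP b x) =
      tensorAct aM (tensorAct aN aP) b (TensorProduct.assoc k M N P x) := by
  have key := conv_assoc (f := aM) (g := aN) (h := aP) (f' := aM) (g' := aN) (h' := aP)
    (μ₁ := (TensorProduct.mapBilinear (RingHom.id k) (M ⊗[k] N) P (M ⊗[k] N) P).compr₂
      (LinearMap.llcomp k _ _ _ (TensorProduct.assoc k M N P).toLinearMap))
    (μ₂ := TensorProduct.mapBilinear (RingHom.id k) M N M N)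
    (μ₃ := (TensorProduct.mapBilinear (RingHom.id k) M (N ⊗[k] P) M (N ⊗[k] P)).compr₂
      ((LinearMap.llcomp k _ _ _).flip (TensorProduct.assoc k M N P).toLinearMap))
    (μ₄ := TensorProduct.mapBilinear (RingHom.id k) N P N P)
    (by intro a b c; ext m n p; simp)
  have h := LinearMap.congr_fun (LinearMap.congr_fun key b) x
  rw [← map_conv, ← map_conv] at h
  exact h

theorem trivAct_apply (b : B) (a : k) : trivAct k B b a = counit (R := k) b * a := rfl

theorem tensorAct_lid (aM : B →ₗ[k] Module.End k M) (b : B) (x : k ⊗[k] M) :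
    TensorProduct.lid k M (tensorAct (trivAct k B) aM b x) = aM b (TensorProduct.lid k M x) := by
  have h := conv_counit_left (TensorProduct.mapBilinear (RingHom.id k) k M k M) aM
    (f := trivAct k B) (e := LinearMap.id) (by intro b; ext; simp [trivAct_apply]) b
  rw [tensorAct, h]
  induction x with
  | zero => simp
  | add s t hs ht => simp only [map_add, hs, ht]
  | tmul a m => simp

theorem tensorAct_rid (aM : B →ₗ[k] Module.End k M) (b : B) (x : M ⊗[k] k) :
    TensorProduct.rid k M (tensorAct aM (trivAct k B) b x) = aM b (TensorProduct.rid k M x) := by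
  have h := conv_counit_right (TensorProduct.mapBilinear (RingHom.id k) M k M k) aM
    (g := trivAct k B) (e := LinearMap.id) (by intro b; ext; simp [trivAct_apply]) b
  rw [tensorAct, h]
  induction x with
  | zero => simp
  | add s t hs ht => simp only [map_add, hs, ht]
  | tmul a m => simp

/-- The pairing of `C ⊗ M` and `C ⊗ N` behind the diagonal left coaction. -/
noncomputable def mixL (k : Type u) [Field k] (C : Type w) [Ring C] [Algebra k C]
    (M N : Type*) [AddCommGroup M] [Module k M] [AddCommGroup N] [Module k N] :
    (C ⊗[k] M) ⊗[k] (C ⊗[k] N) →ₗ[k] C ⊗[k] (M ⊗[k] N) :=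
  (LinearMap.mul' k C).rTensor (M ⊗[k] N) ∘ₗ
    (TensorProduct.tensorTensorTensorComm k C M C N).toLinearMap

/-- The pairing of `M ⊗ C` and `N ⊗ C` behind the diagonal right coaction. -/
noncomputable def mixR (k : Type u) [Field k] (C : Type w) [Ring C] [Algebra k C]
    (M N : Type*) [AddCommGroup M] [Module k M] [AddCommGroup N] [Module k N] :
    (M ⊗[k] C) ⊗[k] (N ⊗[k] C) →ₗ[k] (M ⊗[k] N) ⊗[k] C :=
  (LinearMap.mul' k C).lTensor (M ⊗[k] N) ∘ₗ
    (TensorProduct.tensorTensorTensorComm k M C N C).toLinearMap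

@[simp] theorem mixL_tmul (c d : C) (m : M) (n : N) :
    mixL k C M N ((c ⊗ₜ m) ⊗ₜ (d ⊗ₜ n)) = (c * d) ⊗ₜ (m ⊗ₜ n) := by simp [mixL]

@[simp] theorem mixR_tmul (c d : C) (m : M) (n : N) :
    mixR k C M N ((m ⊗ₜ c) ⊗ₜ (n ⊗ₜ d)) = (m ⊗ₜ n) ⊗ₜ (c * d) := by simp [mixR]

theorem tensorCoactLeft_tmul (cM : M →ₗ[k] C ⊗[k] M) (cN : N →ₗ[k] C ⊗[k] N) (m : M) (n : N) :
    tensorCoactLeft cM cN (m ⊗ₜ n) = mixL k C M N (cM m ⊗ₜ cN n) := rfl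

theorem tensorCoactRight_tmul (cM : M →ₗ[k] M ⊗[k] C) (cN : N →ₗ[k] N ⊗[k] C) (m : M) (n : N) :
    tensorCoactRight cM cN (m ⊗ₜ n) = mixR k C M N (cM m ⊗ₜ cN n) := rfl

/-- Two bilinear expressions agree once they agree on pure tensors. -/
theorem bilin_ind {X₁ X₂ Y₁ Y₂ Z : Type*} [AddCommMonoid X₁] [Module k X₁] [AddCommMonoid X₂]
    [Module k X₂] [AddCommMonoid Y₁] [Module k Y₁] [AddCommMonoid Y₂] [Module k Y₂]
    [AddCommMonoid Z] [Module k Z] {F G : (X₁ ⊗[k] X₂) ⊗[k] (Y₁ ⊗[k] Y₂) →ₗ[k] Z}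
    (h : ∀ a b c d, F ((a ⊗ₜ b) ⊗ₜ (c ⊗ₜ d)) = G ((a ⊗ₜ b) ⊗ₜ (c ⊗ₜ d)))
    (x : (X₁ ⊗[k] X₂) ⊗[k] (Y₁ ⊗[k] Y₂)) : F x = G x := by
  congr 1
  ext a b c d
  exact h a b c d

theorem tensorCoactLeft_coassoc {cM : M →ₗ[k] C ⊗[k] M} {cN : N →ₗ[k] C ⊗[k] N}
    (hM : ∀ m, TensorProduct.assoc k C C M (comul.rTensor M (cM m)) = cM.lTensor C (cM m))
    (hN : ∀ m, TensorProduct.assoc k C C N (comul.rTensor N (cN m)) = cN.lTensor C (cN m))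
    (x : M ⊗[k] N) :
    TensorProduct.assoc k C C (M ⊗[k] N) (comul.rTensor (M ⊗[k] N) (tensorCoactLeft cM cN x)) =
      (tensorCoactLeft cM cN).lTensor C (tensorCoactLeft cM cN x) := by
  induction x with
  | zero => simp
  | add s t hs ht => simp only [map_add, hs, ht]
  | tmul m n =>
    rw [tensorCoactLeft_tmul]
    let W : (C ⊗[k] (C ⊗[k] M)) ⊗[k] (C ⊗[k] (C ⊗[k] N)) →ₗ[k] C ⊗[k] (C ⊗[k] (M ⊗[k] N)) :=
      (mixL k C M N).lTensor C ∘ₗ mixL k C (C ⊗[k] M) (C ⊗[k] N)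
    have h1 : ∀ t, TensorProduct.assoc k C C (M ⊗[k] N) (comul.rTensor (M ⊗[k] N)
        (mixL k C M N t)) = W (TensorProduct.map
          ((TensorProduct.assoc k C C M).toLinearMap ∘ₗ comul.rTensor M)
          ((TensorProduct.assoc k C C N).toLinearMap ∘ₗ comul.rTensor N) t) := by
      refine bilin_ind (F := (TensorProduct.assoc k C C (M ⊗[k] N)).toLinearMap ∘ₗ
        comul.rTensor (M ⊗[k] N) ∘ₗ mixL k C M N) (G := W ∘ₗ TensorProduct.map _ _) ?_
      intro c m d n
      simp only [LinearMap.comp_apply, mixL_tmul, LinearMap.rTensor_tmul, Bialgebra.comul_mul,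
        TensorProduct.map_tmul, LinearEquiv.coe_coe]
      generalize comul (R := k) c = s
      generalize comul (R := k) d = t
      induction s with
      | zero => simp
      | add s s' hs hs' => simp only [add_mul, TensorProduct.add_tmul, map_add, hs, hs']
      | tmul a b =>
        induction t with
        | zero => simp
        | add s s' hs hs' =>
          simp only [mul_add, TensorProduct.add_tmul, TensorProduct.tmul_add, map_add, hs, hs']
        | tmul a' b' => simp [W]
    have h2 : ∀ t, (tensorCoactLeft cM cN).lTensor C (mixL k C M N t) =
        W (TensorProduct.map (cM.lTensor C) (cN.lTensor C) t) := by
      refine bilin_ind (F := (tensorCoactLeft cM cN).lTensor C ∘ₗ mixL k C M N)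
        (G := W ∘ₗ TensorProduct.map _ _) ?_
      intro c m d n
      simp [W, tensorCoactLeft_tmul]
    rw [h1, h2]
    simp [hM, hN]

theorem tensorCoactRight_coassoc {cM : M →ₗ[k] M ⊗[k] C} {cN : N →ₗ[k] N ⊗[k] C}
    (hM : ∀ m, TensorProduct.assoc k M C C (cM.rTensor C (cM m)) = comul.lTensor M (cM m))
    (hN : ∀ m, TensorProduct.assoc k N C C (cN.rTensor C (cN m)) = comul.lTensor N (cN m))
    (x : M ⊗[k] N) :
    TensorProduct.assoc k (M ⊗[k] N) C C
      ((tensorCoactRight cM cN).rTensor C (tensorCoactRight cM cN x)) =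
      comul.lTensor (M ⊗[k] N) (tensorCoactRight cM cN x) := by
  induction x with
  | zero => simp
  | add s t hs ht => simp only [map_add, hs, ht]
  | tmul m n =>
    rw [tensorCoactRight_tmul]
    let W : ((M ⊗[k] C) ⊗[k] C) ⊗[k] ((N ⊗[k] C) ⊗[k] C) →ₗ[k] ((M ⊗[k] N) ⊗[k] C) ⊗[k] C :=
      (mixR k C M N).rTensor C ∘ₗ mixR k C (M ⊗[k] C) (N ⊗[k] C)
    have h1 : ∀ t, (TensorProduct.assoc k (M ⊗[k] N) C C).symm (comul.lTensor (M ⊗[k] N)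
        (mixR k C M N t)) = W (TensorProduct.map
          ((TensorProduct.assoc k M C C).symm.toLinearMap ∘ₗ comul.lTensor M)
          ((TensorProduct.assoc k N C C).symm.toLinearMap ∘ₗ comul.lTensor N) t) := by
      refine bilin_ind (F := (TensorProduct.assoc k (M ⊗[k] N) C C).symm.toLinearMap ∘ₗ
        comul.lTensor (M ⊗[k] N) ∘ₗ mixR k C M N) (G := W ∘ₗ TensorProduct.map _ _) ?_
      intro m c n d
      simp only [LinearMap.comp_apply, mixR_tmul, LinearMap.lTensor_tmul, Bialgebra.comul_mul,
        TensorProduct.map_tmul, LinearEquiv.coe_coe]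
      generalize comul (R := k) c = s
      generalize comul (R := k) d = t
      induction s with
      | zero => simp
      | add s s' hs hs' =>
        simp only [add_mul, TensorProduct.add_tmul, TensorProduct.tmul_add, map_add, hs, hs']
      | tmul a b =>
        induction t with
        | zero => simp
        | add s s' hs hs' =>
          simp only [mul_add, TensorProduct.tmul_add, map_add, hs, hs']
        | tmul a' b' => simp [W]
    have h2 : ∀ t, (tensorCoactRight cM cN).rTensor C (mixR k C M N t) =
        W (TensorProduct.map (cM.rTensor C) (cN.rTensor C) t) := by
      refine bilin_ind (F := (tensorCoactRight cM cN).rTensor C ∘ₗ mixR k C M N)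
        (G := W ∘ₗ TensorProduct.map _ _) ?_
      intro c m d n
      simp [W, tensorCoactRight_tmul]
    rw [← LinearEquiv.eq_symm_apply, h1, h2]
    simp only [TensorProduct.map_tmul, LinearMap.comp_apply, LinearEquiv.coe_coe, ← hM, ← hN,
      LinearEquiv.symm_apply_apply]

theorem tensorCoactLeft_counit {cM : M →ₗ[k] C ⊗[k] M} {cN : N →ₗ[k] C ⊗[k] N}
    (hM : ∀ m, counit.rTensor M (cM m) = (1 : k) ⊗ₜ[k] m)
    (hN : ∀ m, counit.rTensor N (cN m) = (1 : k) ⊗ₜ[k] m) (x : M ⊗[k] N) :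
    counit.rTensor (M ⊗[k] N) (tensorCoactLeft cM cN x) = (1 : k) ⊗ₜ[k] x := by
  induction x with
  | zero => simp
  | add s t hs ht => simp only [map_add, hs, ht, TensorProduct.tmul_add]
  | tmul m n =>
    rw [tensorCoactLeft_tmul]
    have h1 : ∀ t, counit.rTensor (M ⊗[k] N) (mixL k C M N t) =
        mixL k k M N (TensorProduct.map (counit.rTensor M) (counit.rTensor N) t) := by
      refine bilin_ind (F := counit.rTensor (M ⊗[k] N) ∘ₗ mixL k C M N)
        (G := mixL k k M N ∘ₗ TensorProduct.map _ _) ?_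
      intro c m d n
      simp
    rw [h1]
    simp [hM, hN]

theorem tensorCoactRight_counit {cM : M →ₗ[k] M ⊗[k] C} {cN : N →ₗ[k] N ⊗[k] C}
    (hM : ∀ m, counit.lTensor M (cM m) = m ⊗ₜ[k] (1 : k))
    (hN : ∀ m, counit.lTensor N (cN m) = m ⊗ₜ[k] (1 : k)) (x : M ⊗[k] N) :
    counit.lTensor (M ⊗[k] N) (tensorCoactRight cM cN x) = x ⊗ₜ[k] (1 : k) := by
  induction x with
  | zero => simp
  | add s t hs ht => simp only [map_add, hs, ht, TensorProduct.add_tmul]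
  | tmul m n =>
    rw [tensorCoactRight_tmul]
    have h1 : ∀ t, counit.lTensor (M ⊗[k] N) (mixR k C M N t) =
        mixR k k M N (TensorProduct.map (counit.lTensor M) (counit.lTensor N) t) := by
      refine bilin_ind (F := counit.lTensor (M ⊗[k] N) ∘ₗ mixR k C M N)
        (G := mixR k k M N ∘ₗ TensorProduct.map _ _) ?_
      intro c m d n
      simp
    rw [h1]
    simp [hM, hN]

theorem tensorCoactLeft_natural {cM : M →ₗ[k] C ⊗[k] M} {cN : N →ₗ[k] C ⊗[k] N}
    {cM' : M' →ₗ[k] C ⊗[k] M'} {cN' : N' →ₗ[k] C ⊗[k] N'} {f : M →ₗ[k] M'} {g : N →ₗ[k] N'}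
    (hf : ∀ m, cM' (f m) = f.lTensor C (cM m)) (hg : ∀ m, cN' (g m) = g.lTensor C (cN m))
    (x : M ⊗[k] N) : tensorCoactLeft cM' cN' (TensorProduct.map f g x) =
      (TensorProduct.map f g).lTensor C (tensorCoactLeft cM cN x) := by
  induction x with
  | zero => simp
  | add s t hs ht => simp only [map_add, hs, ht]
  | tmul m n =>
    rw [TensorProduct.map_tmul, tensorCoactLeft_tmul, tensorCoactLeft_tmul, hf, hg,
      ← TensorProduct.map_tmul]
    refine bilin_ind (F := mixL k C M' N' ∘ₗ TensorProduct.map (f.lTensor C) (g.lTensor C))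
      (G := (TensorProduct.map f g).lTensor C ∘ₗ mixL k C M N) ?_ _
    intro c m d n
    simp

theorem tensorCoactRight_natural {cM : M →ₗ[k] M ⊗[k] C} {cN : N →ₗ[k] N ⊗[k] C}
    {cM' : M' →ₗ[k] M' ⊗[k] C} {cN' : N' →ₗ[k] N' ⊗[k] C} {f : M →ₗ[k] M'} {g : N →ₗ[k] N'}
    (hf : ∀ m, cM' (f m) = f.rTensor C (cM m)) (hg : ∀ m, cN' (g m) = g.rTensor C (cN m))
    (x : M ⊗[k] N) : tensorCoactRight cM' cN' (TensorProduct.map f g x) =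
      (TensorProduct.map f g).rTensor C (tensorCoactRight cM cN x) := by
  induction x with
  | zero => simp
  | add s t hs ht => simp only [map_add, hs, ht]
  | tmul m n =>
    rw [TensorProduct.map_tmul, tensorCoactRight_tmul, tensorCoactRight_tmul, hf, hg,
      ← TensorProduct.map_tmul]
    refine bilin_ind (F := mixR k C M' N' ∘ₗ TensorProduct.map (f.rTensor C) (g.rTensor C))
      (G := (TensorProduct.map f g).rTensor C ∘ₗ mixR k C M N) ?_ _
    intro c m d n
    simp

theorem tensorCoactLeft_assoc (cM : M →ₗ[k] C ⊗[k] M) (cN : N →ₗ[k] C ⊗[k] N)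
    (cP : P →ₗ[k] C ⊗[k] P) (x : (M ⊗[k] N) ⊗[k] P) :
    tensorCoactLeft cM (tensorCoactLeft cN cP) (TensorProduct.assoc k M N P x) =
      (TensorProduct.assoc k M N P).toLinearMap.lTensor C
        (tensorCoactLeft (tensorCoactLeft cM cN) cP x) := by
  induction x with
  | zero => simp
  | add s t hs ht => simp only [map_add, hs, ht]
  | tmul x p =>
    induction x with
    | zero => simp
    | add s t hs ht => simp only [map_add, TensorProduct.add_tmul, hs, ht]
    | tmul m n =>
      simp only [TensorProduct.assoc_tmul, tensorCoactLeft_tmul]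
      generalize cM m = s
      generalize cN n = t
      generalize cP p = r
      induction s with
      | zero => simp
      | add s s' hs hs' => simp only [map_add, TensorProduct.add_tmul, hs, hs']
      | tmul c m =>
        induction t with
        | zero => simp
        | add s s' hs hs' =>
          simp only [map_add, TensorProduct.add_tmul, TensorProduct.tmul_add, hs, hs']
        | tmul d n =>
          induction r with
          | zero => simp
          | add s s' hs hs' => simp only [map_add, TensorProduct.tmul_add, hs, hs']
          | tmul e p => simp [mul_assoc]

theorem tensorCoactRight_assoc (cM : M →ₗ[k] M ⊗[k] C) (cN : N →ₗ[k] N ⊗[k] C)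
    (cP : P →ₗ[k] P ⊗[k] C) (x : (M ⊗[k] N) ⊗[k] P) :
    tensorCoactRight cM (tensorCoactRight cN cP) (TensorProduct.assoc k M N P x) =
      (TensorProduct.assoc k M N P).toLinearMap.rTensor C
        (tensorCoactRight (tensorCoactRight cM cN) cP x) := by
  induction x with
  | zero => simp
  | add s t hs ht => simp only [map_add, hs, ht]
  | tmul x p =>
    induction x with
    | zero => simp
    | add s t hs ht => simp only [map_add, TensorProduct.add_tmul, hs, ht]
    | tmul m n =>
      simp only [TensorProduct.assoc_tmul, tensorCoactRight_tmul]
      generalize cM m = s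
      generalize cN n = t
      generalize cP p = r
      induction s with
      | zero => simp
      | add s s' hs hs' => simp only [map_add, TensorProduct.add_tmul, hs, hs']
      | tmul c m =>
        induction t with
        | zero => simp
        | add s s' hs hs' =>
          simp only [map_add, TensorProduct.add_tmul, TensorProduct.tmul_add, hs, hs']
        | tmul d n =>
          induction r with
          | zero => simp
          | add s s' hs hs' => simp only [map_add, TensorProduct.tmul_add, hs, hs']
          | tmul e p => simp [mul_assoc]

theorem tensorCoactLeft_lid (cM : M →ₗ[k] C ⊗[k] M) (x : k ⊗[k] M) :
    cM (TensorProduct.lid k M x) = (TensorProduct.lid k M).toLinearMap.lTensor C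
      (tensorCoactLeft (trivCoactLeft k C) cM x) := by
  induction x with
  | zero => simp
  | add s t hs ht => simp only [map_add, hs, ht]
  | tmul a m =>
    rw [tensorCoactLeft_tmul, TensorProduct.lid_tmul, map_smul]
    generalize cM m = s
    induction s with
    | zero => simp
    | add s s' hs hs' => simp only [map_add, smul_add, TensorProduct.tmul_add, hs, hs']
    | tmul c m => simp [trivCoactLeft]

theorem tensorCoactLeft_rid (cM : M →ₗ[k] C ⊗[k] M) (x : M ⊗[k] k) :
    cM (TensorProduct.rid k M x) = (TensorProduct.rid k M).toLinearMap.lTensor C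
      (tensorCoactLeft cM (trivCoactLeft k C) x) := by
  induction x with
  | zero => simp
  | add s t hs ht => simp only [map_add, hs, ht]
  | tmul m a =>
    rw [tensorCoactLeft_tmul, TensorProduct.rid_tmul, map_smul]
    generalize cM m = s
    induction s with
    | zero => simp
    | add s s' hs hs' => simp only [map_add, smul_add, TensorProduct.add_tmul, hs, hs']
    | tmul c m => simp [trivCoactLeft]

theorem tensorCoactRight_lid (cM : M →ₗ[k] M ⊗[k] C) (x : k ⊗[k] M) :
    cM (TensorProduct.lid k M x) = (TensorProduct.lid k M).toLinearMap.rTensor C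
      (tensorCoactRight (trivCoactRight k C) cM x) := by
  induction x with
  | zero => simp
  | add s t hs ht => simp only [map_add, hs, ht]
  | tmul a m =>
    rw [tensorCoactRight_tmul, TensorProduct.lid_tmul, map_smul]
    generalize cM m = s
    induction s with
    | zero => simp
    | add s s' hs hs' => simp only [map_add, smul_add, TensorProduct.tmul_add, hs, hs']
    | tmul c m => simp [trivCoactRight, TensorProduct.smul_tmul']

theorem tensorCoactRight_rid (cM : M →ₗ[k] M ⊗[k] C) (x : M ⊗[k] k) :
    cM (TensorProduct.rid k M x) = (TensorProduct.rid k M).toLinearMap.rTensor C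
      (tensorCoactRight cM (trivCoactRight k C) x) := by
  induction x with
  | zero => simp
  | add s t hs ht => simp only [map_add, hs, ht]
  | tmul m a =>
    rw [tensorCoactRight_tmul, TensorProduct.rid_tmul, map_smul]
    generalize cM m = s
    induction s with
    | zero => simp
    | add s s' hs hs' => simp only [map_add, smul_add, TensorProduct.add_tmul, hs, hs']
    | tmul c m => simp [trivCoactRight, TensorProduct.smul_tmul']

end TensorLemmas

section Compat

variable {k : Type u} [Field k] {B : Type v} [Ring B] [HopfAlgebra k B]
  {C : Type w} [Ring C] [HopfAlgebra k C]
variable {M N : Type*} [AddCommGroup M] [Module k M] [AddCommGroup N] [Module k N]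

/-- `f, g ↦ g ∘ f`. -/
noncomputable abbrev revComp (k : Type u) [Field k] (M X Y : Type*) [AddCommGroup M] [Module k M]
    [AddCommGroup X] [Module k X] [AddCommGroup Y] [Module k Y] :
    (M →ₗ[k] X) →ₗ[k] (X →ₗ[k] Y) →ₗ[k] (M →ₗ[k] Y) :=
  (LinearMap.llcomp k M X Y).flip

theorem conv_antipode_right {X : Type*} [AddCommMonoid X] [Module k X]
    (f : C →ₗ[k] X) (ρ : B →ₐc[k] C) (b : B) :
    conv ((LinearMap.mul k C).compr₂ f) (ρ : B →ₗ[k] C) ((ρ : B →ₗ[k] C) ∘ₗ antipode k) b =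
      counit (R := k) b • f 1 := by
  rw [lift_conv_congr (T := f ∘ₗ (ρ : B →ₗ[k] C) ∘ₗ LinearMap.mul' k B ∘ₗ
    (antipode k).lTensor B) (by intro a b; simp)]
  simp only [LinearMap.comp_apply, mul_antipode_lTensor_comul_apply]
  simp [Algebra.algebraMap_eq_smul_one]

theorem conv_antipode_left {X : Type*} [AddCommMonoid X] [Module k X]
    (f : C →ₗ[k] X) (ρ : B →ₐc[k] C) (b : B) :
    conv ((LinearMap.mul k C).compr₂ f) ((ρ : B →ₗ[k] C) ∘ₗ antipode k) (ρ : B →ₗ[k] C) b =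
      counit (R := k) b • f 1 := by
  rw [lift_conv_congr (T := f ∘ₗ (ρ : B →ₗ[k] C) ∘ₗ LinearMap.mul' k B ∘ₗ
    (antipode k).rTensor B) (by intro a b; simp)]
  simp only [LinearMap.comp_apply, mul_antipode_rTensor_comul_apply]
  simp [Algebra.algebraMap_eq_smul_one]

theorem conv_antipode_right' {X : Type*} [AddCommMonoid X] [Module k X]
    (f : C →ₗ[k] X) (ρ : B →ₐc[k] C) (b : B) :
    conv ((LinearMap.mul k C).compr₂ f) (ρ : B →ₗ[k] C) (antipode k ∘ₗ (ρ : B →ₗ[k] C)) b =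
      counit (R := k) b • f 1 := by
  rw [lift_conv_congr (T := f ∘ₗ LinearMap.mul' k C ∘ₗ (antipode k).lTensor C ∘ₗ
    TensorProduct.map (ρ : B →ₗ[k] C) (ρ : B →ₗ[k] C)) (by intro a b; simp)]
  have : TensorProduct.map (ρ : B →ₗ[k] C) (ρ : B →ₗ[k] C) (comul b) = comul (R := k) (ρ b) :=
    CoalgHomClass.map_comp_comul_apply ρ b
  simp only [LinearMap.comp_apply, this, mul_antipode_lTensor_comul_apply]
  simp [Algebra.algebraMap_eq_smul_one]

theorem conv_antipode_left' {X : Type*} [AddCommMonoid X] [Module k X]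
    (f : C →ₗ[k] X) (ρ : B →ₐc[k] C) (b : B) :
    conv ((LinearMap.mul k C).compr₂ f) (antipode k ∘ₗ (ρ : B →ₗ[k] C)) (ρ : B →ₗ[k] C) b =
      counit (R := k) b • f 1 := by
  rw [lift_conv_congr (T := f ∘ₗ LinearMap.mul' k C ∘ₗ (antipode k).rTensor C ∘ₗ
    TensorProduct.map (ρ : B →ₗ[k] C) (ρ : B →ₗ[k] C)) (by intro a b; simp)]
  have : TensorProduct.map (ρ : B →ₗ[k] C) (ρ : B →ₗ[k] C) (comul b) = comul (R := k) (ρ b) :=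
    CoalgHomClass.map_comp_comul_apply ρ b
  simp only [LinearMap.comp_apply, this, mul_antipode_rTensor_comul_apply]
  simp [Algebra.algebraMap_eq_smul_one]

variable (ρ : B →ₐc[k] C)

/-- `b ↦ (c ⊗ m ↦ ρ(b) c ⊗ m)`. -/
noncomputable abbrev lmulL (M : Type*) [AddCommGroup M] [Module k M] :
    B →ₗ[k] Module.End k (C ⊗[k] M) :=
  LinearMap.rTensorHom M ∘ₗ LinearMap.mul k C ∘ₗ (ρ : B →ₗ[k] C)

/-- `b ↦ (c ⊗ m ↦ c ρ(b) ⊗ m)`. -/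
noncomputable abbrev rmulL (M : Type*) [AddCommGroup M] [Module k M] :
    B →ₗ[k] Module.End k (C ⊗[k] M) :=
  LinearMap.rTensorHom M ∘ₗ (LinearMap.mul k C).flip ∘ₗ (ρ : B →ₗ[k] C)

/-- `b ↦ (m ⊗ c ↦ m ⊗ ρ(b) c)`. -/
noncomputable abbrev lmulR (M : Type*) [AddCommGroup M] [Module k M] :
    B →ₗ[k] Module.End k (M ⊗[k] C) :=
  LinearMap.lTensorHom M ∘ₗ LinearMap.mul k C ∘ₗ (ρ : B →ₗ[k] C)

/-- `b ↦ (m ⊗ c ↦ m ⊗ c ρ(b))`. -/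
noncomputable abbrev rmulR (M : Type*) [AddCommGroup M] [Module k M] :
    B →ₗ[k] Module.End k (M ⊗[k] C) :=
  LinearMap.lTensorHom M ∘ₗ (LinearMap.mul k C).flip ∘ₗ (ρ : B →ₗ[k] C)

/-- `b ↦ (m ↦ m₍₋₁₎ ⊗ b m₍₀₎)`. -/
noncomputable abbrev actCoL (act : B →ₗ[k] Module.End k M) (cM : M →ₗ[k] C ⊗[k] M) :
    B →ₗ[k] (M →ₗ[k] C ⊗[k] M) :=
  (LinearMap.llcomp k M (C ⊗[k] M) (C ⊗[k] M)).flip cM ∘ₗ LinearMap.lTensorHom C ∘ₗ act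

/-- `b ↦ (m ↦ m₍₀₎ b ⊗ m₍₁₎)`. -/
noncomputable abbrev actCoR (act : B →ₗ[k] Module.End k M) (cM : M →ₗ[k] M ⊗[k] C) :
    B →ₗ[k] (M →ₗ[k] M ⊗[k] C) :=
  (LinearMap.llcomp k M (M ⊗[k] C) (M ⊗[k] C)).flip cM ∘ₗ LinearMap.rTensorHom C ∘ₗ act

/-- The antipode-free compatibility
`∑ (b₍₁₎ m)₍₋₁₎ ρ(b₍₂₎) ⊗ (b₍₁₎ m)₍₀₎ = ∑ ρ(b₍₁₎) m₍₋₁₎ ⊗ b₍₂₎ m₍₀₎`. -/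
def FreeLeft (act : B →ₗ[k] Module.End k M) (cM : M →ₗ[k] C ⊗[k] M) : Prop :=
  conv (revComp k M (C ⊗[k] M) (C ⊗[k] M)) (LinearMap.llcomp k M M (C ⊗[k] M) cM ∘ₗ act)
      (rmulL ρ M) =
    conv (LinearMap.llcomp k M (C ⊗[k] M) (C ⊗[k] M)) (lmulL ρ M) (actCoL act cM)

/-- The antipode-free compatibility
`∑ (m b₍₂₎)₍₀₎ ⊗ ρ(b₍₁₎) (m b₍₂₎)₍₁₎ = ∑ m₍₀₎ b₍₁₎ ⊗ m₍₁₎ ρ(b₍₂₎)`. -/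
def FreeRight (act : B →ₗ[k] Module.End k M) (cM : M →ₗ[k] M ⊗[k] C) : Prop :=
  conv (LinearMap.llcomp k M (M ⊗[k] C) (M ⊗[k] C)) (lmulR ρ M)
      (LinearMap.llcomp k M M (M ⊗[k] C) cM ∘ₗ act) =
    conv (revComp k M (M ⊗[k] C) (M ⊗[k] C)) (actCoR act cM) (rmulR ρ M)

theorem adLeft_comp (act : B →ₗ[k] Module.End k M) (cM : M →ₗ[k] C ⊗[k] M) (b : B) :
    adLeft ρ act b ∘ₗ cM = conv (revComp k M (C ⊗[k] M) (C ⊗[k] M))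
      (conv (LinearMap.llcomp k M (C ⊗[k] M) (C ⊗[k] M)) (lmulL ρ M) (actCoL act cM))
      (rmulL ρ M ∘ₗ antipode k) b := by
  have h1 : ∀ a (d : C), conv (LinearMap.mul k (Module.End k (C ⊗[k] M))) (lmulL ρ M)
      (LinearMap.lTensorHom C ∘ₗ act) a ∘ₗ ((LinearMap.mul k C).flip d).rTensor M ∘ₗ cM =
      ((LinearMap.mul k C).flip d).rTensor M ∘ₗ
      conv (LinearMap.llcomp k M (C ⊗[k] M) (C ⊗[k] M)) (lmulL ρ M) (actCoL act cM) a := by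
    intro a d
    have e1 := map_conv ((LinearMap.llcomp k M (C ⊗[k] M) (C ⊗[k] M)).flip
      (((LinearMap.mul k C).flip d).rTensor M ∘ₗ cM))
      (LinearMap.mul k (Module.End k (C ⊗[k] M))) (lmulL ρ M) (LinearMap.lTensorHom C ∘ₗ act) a
    have e2 := map_conv (LinearMap.llcomp k M (C ⊗[k] M) (C ⊗[k] M)
      (((LinearMap.mul k C).flip d).rTensor M))
      (LinearMap.llcomp k M (C ⊗[k] M) (C ⊗[k] M)) (lmulL ρ M) (actCoL act cM) a
    refine e1.trans (Eq.trans ?_ e2.symm)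
    congr 1
    refine conv_congr fun x y => ?_
    have : lmulL ρ M x ∘ₗ (act y).lTensor C ∘ₗ ((LinearMap.mul k C).flip d).rTensor M =
        ((LinearMap.mul k C).flip d).rTensor M ∘ₗ lmulL ρ M x ∘ₗ (act y).lTensor C := by
      ext c m; simp [mul_assoc]
    exact congrArg (fun f => f ∘ₗ cM) this
  have h2 := map_conv ((LinearMap.llcomp k M (C ⊗[k] M) (C ⊗[k] M)).flip cM)
    (LinearMap.mul k (Module.End k (C ⊗[k] M)))
    (conv (LinearMap.mul k (Module.End k (C ⊗[k] M))) (lmulL ρ M) (LinearMap.lTensorHom C ∘ₗ act))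
    (rmulL ρ M ∘ₗ antipode k) b
  refine h2.trans ?_
  congr 1
  exact conv_congr fun x y => h1 x _

theorem adRight_comp (act : B →ₗ[k] Module.End k M) (cM : M →ₗ[k] M ⊗[k] C) (b : B) :
    adRight ρ act b ∘ₗ cM = conv (LinearMap.llcomp k M (M ⊗[k] C) (M ⊗[k] C))
      (LinearMap.lTensorHom M ∘ₗ LinearMap.mul k C ∘ₗ antipode k ∘ₗ (ρ : B →ₗ[k] C))
      (conv (revComp k M (M ⊗[k] C) (M ⊗[k] C)) (actCoR act cM) (rmulR ρ M)) b := by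
  have h1 : adRight ρ act = conv (LinearMap.mul k (Module.End k (M ⊗[k] C)))
      (LinearMap.lTensorHom M ∘ₗ LinearMap.mul k C ∘ₗ antipode k ∘ₗ (ρ : B →ₗ[k] C))
      (conv (LinearMap.mul k (Module.End k (M ⊗[k] C))) (LinearMap.rTensorHom C ∘ₗ act)
        (rmulR ρ M)) :=
    conv_assoc (fun a b c => by simp [mul_assoc])
  have h2 : ∀ a, conv (LinearMap.mul k (Module.End k (M ⊗[k] C))) (LinearMap.rTensorHom C ∘ₗ act)
        (rmulR ρ M) a ∘ₗ cM =
      conv (revComp k M (M ⊗[k] C) (M ⊗[k] C)) (actCoR act cM) (rmulR ρ M) a := by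
    intro a
    refine (map_conv ((LinearMap.llcomp k M (M ⊗[k] C) (M ⊗[k] C)).flip cM) _ _ _ a).trans ?_
    congr 1
    refine conv_congr fun x y => ?_
    have : (act x).rTensor C ∘ₗ rmulR ρ M y = rmulR ρ M y ∘ₗ (act x).rTensor C := by
      ext m c; simp
    exact congrArg (fun f => f ∘ₗ cM) this
  rw [h1]
  refine (map_conv ((LinearMap.llcomp k M (M ⊗[k] C) (M ⊗[k] C)).flip cM) _ _ _ b).trans ?_
  congr 1
  refine conv_congr fun x y => ?_
  rw [← h2]
  rfl

theorem rmulL_cancel (b : B) :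
    conv (LinearMap.mul k (Module.End k (C ⊗[k] M))).flip (rmulL ρ M ∘ₗ antipode k) (rmulL ρ M) b =
      counit (R := k) b • 1 := by
  have h := conv_antipode_left
    ((LinearMap.rTensorHom M : _ →ₗ[k] Module.End k (C ⊗[k] M)) ∘ₗ (LinearMap.mul k C).flip) ρ b
  have e : ((LinearMap.rTensorHom M : _ →ₗ[k] Module.End k (C ⊗[k] M)) ∘ₗ
    (LinearMap.mul k C).flip) 1 = 1 := by ext; simp
  rw [e] at h
  rw [← h]
  congr 1
  refine conv_congr fun x y => ?_
  ext c m
  simp [mul_assoc]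

theorem rmulL_cancel' (b : B) :
    conv (LinearMap.mul k (Module.End k (C ⊗[k] M))).flip (rmulL ρ M) (rmulL ρ M ∘ₗ antipode k) b =
      counit (R := k) b • 1 := by
  have h := conv_antipode_right
    ((LinearMap.rTensorHom M : _ →ₗ[k] Module.End k (C ⊗[k] M)) ∘ₗ (LinearMap.mul k C).flip) ρ b
  have e : ((LinearMap.rTensorHom M : _ →ₗ[k] Module.End k (C ⊗[k] M)) ∘ₗ
    (LinearMap.mul k C).flip) 1 = 1 := by ext; simp
  rw [e] at h
  rw [← h]
  congr 1
  refine conv_congr fun x y => ?_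
  ext c m
  simp [mul_assoc]

theorem lmulR_cancel (b : B) :
    conv (LinearMap.mul k (Module.End k (M ⊗[k] C)))
      (LinearMap.lTensorHom M ∘ₗ LinearMap.mul k C ∘ₗ antipode k ∘ₗ (ρ : B →ₗ[k] C)) (lmulR ρ M) b =
      counit (R := k) b • 1 := by
  have h := conv_antipode_left'
    ((LinearMap.lTensorHom M : _ →ₗ[k] Module.End k (M ⊗[k] C)) ∘ₗ LinearMap.mul k C) ρ b
  have e : ((LinearMap.lTensorHom M : _ →ₗ[k] Module.End k (M ⊗[k] C)) ∘ₗ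
    LinearMap.mul k C) 1 = 1 := by ext; simp
  rw [e] at h
  rw [← h]
  congr 1
  refine conv_congr fun x y => ?_
  ext c m
  simp [mul_assoc]

theorem lmulR_cancel' (b : B) :
    conv (LinearMap.mul k (Module.End k (M ⊗[k] C))) (lmulR ρ M)
      (LinearMap.lTensorHom M ∘ₗ LinearMap.mul k C ∘ₗ antipode k ∘ₗ (ρ : B →ₗ[k] C)) b =
      counit (R := k) b • 1 := by
  have h := conv_antipode_right'
    ((LinearMap.lTensorHom M : _ →ₗ[k] Module.End k (M ⊗[k] C)) ∘ₗ LinearMap.mul k C) ρ b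
  have e : ((LinearMap.lTensorHom M : _ →ₗ[k] Module.End k (M ⊗[k] C)) ∘ₗ
    LinearMap.mul k C) 1 = 1 := by ext; simp
  rw [e] at h
  rw [← h]
  congr 1
  refine conv_congr fun x y => ?_
  ext c m
  simp [mul_assoc]

theorem revComp_cancel_right {X : Type*} [AddCommGroup X] [Module k X] (f : B →ₗ[k] (M →ₗ[k] X))
    {g h : B →ₗ[k] Module.End k X}
    (hgh : ∀ b, conv (LinearMap.mul k (Module.End k X)).flip g h b = counit (R := k) b • 1) :
    conv (revComp k M X X) (conv (revComp k M X X) f g) h = f :=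
  conv_cancel_right (ν := (LinearMap.mul k (Module.End k X)).flip) (e := 1)
    (fun _ _ _ => rfl) (fun _ => rfl) f hgh

theorem llcomp_cancel_left {X : Type*} [AddCommGroup X] [Module k X] (f : B →ₗ[k] (M →ₗ[k] X))
    {g h : B →ₗ[k] Module.End k X}
    (hgh : ∀ b, conv (LinearMap.mul k (Module.End k X)) g h b = counit (R := k) b • 1) :
    conv (LinearMap.llcomp k M X X) g (conv (LinearMap.llcomp k M X X) h f) = f :=
  conv_cancel_left (ν := LinearMap.mul k (Module.End k X)) (e := 1)
    (fun _ _ _ => rfl) (fun _ => rfl) f hgh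

theorem freeLeft_iff (act : B →ₗ[k] Module.End k M) (cM : M →ₗ[k] C ⊗[k] M) :
    FreeLeft ρ act cM ↔ ∀ b m, cM (act b m) = adLeft ρ act b (cM m) := by
  constructor
  · intro h b m
    have h1 := revComp_cancel_right (LinearMap.llcomp k M M (C ⊗[k] M) cM ∘ₗ act) (rmulL_cancel' ρ)
    rw [FreeLeft] at h
    rw [h] at h1
    have h2 := adLeft_comp ρ act cM b
    rw [h1] at h2
    exact (LinearMap.congr_fun h2 m).symm
  · intro h
    have h1 : LinearMap.llcomp k M M (C ⊗[k] M) cM ∘ₗ act = _ :=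
      LinearMap.ext fun b => (LinearMap.ext (h b) : cM ∘ₗ act b = adLeft ρ act b ∘ₗ cM).trans
        (adLeft_comp ρ act cM b)
    rw [FreeLeft, h1]
    exact revComp_cancel_right _ (rmulL_cancel ρ)

theorem freeRight_iff (act : B →ₗ[k] Module.End k M) (cM : M →ₗ[k] M ⊗[k] C) :
    FreeRight ρ act cM ↔ ∀ b m, cM (act b m) = adRight ρ act b (cM m) := by
  constructor
  · intro h b m
    have h1 := llcomp_cancel_left (LinearMap.llcomp k M M (M ⊗[k] C) cM ∘ₗ act) (lmulR_cancel ρ)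
    rw [FreeRight] at h
    rw [h] at h1
    have h2 := adRight_comp ρ act cM b
    rw [h1] at h2
    exact (LinearMap.congr_fun h2 m).symm
  · intro h
    have h0 : ∀ b, cM ∘ₗ act b = adRight ρ act b ∘ₗ cM := fun b => LinearMap.ext (h b)
    have h1 : LinearMap.llcomp k M M (M ⊗[k] C) cM ∘ₗ act =
        conv (LinearMap.llcomp k M (M ⊗[k] C) (M ⊗[k] C))
          (LinearMap.lTensorHom M ∘ₗ LinearMap.mul k C ∘ₗ antipode k ∘ₗ (ρ : B →ₗ[k] C))
          (conv (revComp k M (M ⊗[k] C) (M ⊗[k] C)) (actCoR act cM) (rmulR ρ M)) := by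
      ext1 b
      rw [← adRight_comp, ← h0]
      rfl
    rw [FreeRight, h1]
    exact llcomp_cancel_left _ (lmulR_cancel' ρ)

/-- `f, g ↦ mixL ∘ (f ⊗ g)`. -/
noncomputable def omegaL (k : Type u) [Field k] (C : Type w) [Ring C] [Algebra k C]
    (M N : Type*) [AddCommGroup M] [Module k M] [AddCommGroup N] [Module k N] :
    (M →ₗ[k] C ⊗[k] M) →ₗ[k] (N →ₗ[k] C ⊗[k] N) →ₗ[k] (M ⊗[k] N →ₗ[k] C ⊗[k] (M ⊗[k] N)) :=
  (TensorProduct.mapBilinear (RingHom.id k) M N (C ⊗[k] M) (C ⊗[k] N)).compr₂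
    (LinearMap.llcomp k _ _ _ (mixL k C M N))

/-- `f, g ↦ mixR ∘ (f ⊗ g)`. -/
noncomputable def omegaR (k : Type u) [Field k] (C : Type w) [Ring C] [Algebra k C]
    (M N : Type*) [AddCommGroup M] [Module k M] [AddCommGroup N] [Module k N] :
    (M →ₗ[k] M ⊗[k] C) →ₗ[k] (N →ₗ[k] N ⊗[k] C) →ₗ[k] (M ⊗[k] N →ₗ[k] (M ⊗[k] N) ⊗[k] C) :=
  (TensorProduct.mapBilinear (RingHom.id k) M N (M ⊗[k] C) (N ⊗[k] C)).compr₂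
    (LinearMap.llcomp k _ _ _ (mixR k C M N))

theorem omegaL_tmul (f : M →ₗ[k] C ⊗[k] M) (g : N →ₗ[k] C ⊗[k] N) (m : M) (n : N) :
    omegaL k C M N f g (m ⊗ₜ n) = mixL k C M N (f m ⊗ₜ g n) := rfl

theorem omegaR_tmul (f : M →ₗ[k] M ⊗[k] C) (g : N →ₗ[k] N ⊗[k] C) (m : M) (n : N) :
    omegaR k C M N f g (m ⊗ₜ n) = mixR k C M N (f m ⊗ₜ g n) := rfl

theorem freeLeft_tensor {aM : B →ₗ[k] Module.End k M} {cM : M →ₗ[k] C ⊗[k] M}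
    {aN : B →ₗ[k] Module.End k N} {cN : N →ₗ[k] C ⊗[k] N} (hM : FreeLeft ρ aM cM)
    (hN : FreeLeft ρ aN cN) : FreeLeft ρ (tensorAct aM aN) (tensorCoactLeft cM cN) := by
  have a1 : LinearMap.llcomp k _ _ _ (tensorCoactLeft cM cN) ∘ₗ tensorAct aM aN =
      conv (omegaL k C M N) (LinearMap.llcomp k M M (C ⊗[k] M) cM ∘ₗ aM)
        (LinearMap.llcomp k N N (C ⊗[k] N) cN ∘ₗ aN) := by
    ext1 b
    refine (map_conv (LinearMap.llcomp k _ _ _ (tensorCoactLeft cM cN)) _ _ _ b).trans ?_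
    congr 1
    refine conv_congr fun x y => ?_
    ext m n
    rfl
  have a2 : conv (omegaL k C M N) (actCoL aM cM) (actCoL aN cN) =
      actCoL (tensorAct aM aN) (tensorCoactLeft cM cN) := by
    ext1 b
    refine Eq.symm ((map_conv ((LinearMap.llcomp k _ _ _).flip (tensorCoactLeft cM cN) ∘ₗ
      LinearMap.lTensorHom C) _ _ _ b).trans ?_)
    congr 1
    refine conv_congr fun x y => ?_
    ext m n
    refine bilin_ind (F := (TensorProduct.map (aM x) (aN y)).lTensor C ∘ₗ mixL k C M N)
      (G := mixL k C M N ∘ₗ TensorProduct.map ((aM x).lTensor C) ((aN y).lTensor C)) ?_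
      (cM m ⊗ₜ cN n)
    intro a b c d
    simp
  rw [FreeLeft, a1, ← a2]
  have b1 := conv_assoc (μ₁ := revComp k _ _ _) (μ₂ := omegaL k C M N)
    (f := LinearMap.llcomp k M M (C ⊗[k] M) cM ∘ₗ aM)
    (g := LinearMap.llcomp k N N (C ⊗[k] N) cN ∘ₗ aN) (h := rmulL ρ (M ⊗[k] N))
    (μ₃ := omegaL k C M N) (μ₄ := revComp k _ _ _)
    (f' := LinearMap.llcomp k M M (C ⊗[k] M) cM ∘ₗ aM)
    (g' := LinearMap.llcomp k N N (C ⊗[k] N) cN ∘ₗ aN) (h' := rmulL ρ N) (by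
      intro a b c
      ext m n
      refine bilin_ind (F := rmulL ρ (M ⊗[k] N) c ∘ₗ mixL k C M N)
        (G := mixL k C M N ∘ₗ (rmulL ρ N c).lTensor _) ?_ (cM (aM a m) ⊗ₜ cN (aN b n))
      intro a b c d
      simp [mul_assoc])
  have b2 := conv_assoc (μ₁ := omegaL k C M N) (μ₂ := revComp k _ _ _)
    (f := LinearMap.llcomp k M M (C ⊗[k] M) cM ∘ₗ aM) (g := rmulL ρ M) (h := actCoL aN cN)
    (μ₃ := omegaL k C M N) (μ₄ := LinearMap.llcomp k N (C ⊗[k] N) (C ⊗[k] N))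
    (f' := LinearMap.llcomp k M M (C ⊗[k] M) cM ∘ₗ aM) (g' := lmulL ρ N) (h' := actCoL aN cN) (by
      intro a b c
      ext m n
      refine bilin_ind (F := mixL k C M N ∘ₗ (rmulL ρ M b).rTensor _)
        (G := mixL k C M N ∘ₗ (lmulL ρ N b).lTensor _) ?_
        (cM (aM a m) ⊗ₜ (aN c).lTensor C (cN n))
      intro a b c d
      simp [mul_assoc])
  have b3 := conv_assoc (μ₁ := omegaL k C M N) (μ₂ := LinearMap.llcomp k _ _ _)
    (f := lmulL ρ M) (g := actCoL aM cM) (h := actCoL aN cN)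
    (μ₃ := LinearMap.llcomp k _ _ _) (μ₄ := omegaL k C M N)
    (f' := lmulL ρ (M ⊗[k] N)) (g' := actCoL aM cM) (h' := actCoL aN cN) (by
      intro a b c
      ext m n
      refine bilin_ind (F := mixL k C M N ∘ₗ (lmulL ρ M a).rTensor _)
        (G := lmulL ρ (M ⊗[k] N) a ∘ₗ mixL k C M N) ?_
        ((aM b).lTensor C (cM m) ⊗ₜ (aN c).lTensor C (cN n))
      intro a b c d
      simp [mul_assoc])
  rw [b1, hN, ← b2, hM, b3]

theorem freeRight_tensor {aM : B →ₗ[k] Module.End k M} {cM : M →ₗ[k] M ⊗[k] C}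
    {aN : B →ₗ[k] Module.End k N} {cN : N →ₗ[k] N ⊗[k] C} (hM : FreeRight ρ aM cM)
    (hN : FreeRight ρ aN cN) : FreeRight ρ (tensorAct aM aN) (tensorCoactRight cM cN) := by
  have a1 : LinearMap.llcomp k _ _ _ (tensorCoactRight cM cN) ∘ₗ tensorAct aM aN =
      conv (omegaR k C M N) (LinearMap.llcomp k M M (M ⊗[k] C) cM ∘ₗ aM)
        (LinearMap.llcomp k N N (N ⊗[k] C) cN ∘ₗ aN) := by
    ext1 b
    refine (map_conv (LinearMap.llcomp k _ _ _ (tensorCoactRight cM cN)) _ _ _ b).trans ?_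
    congr 1
    refine conv_congr fun x y => ?_
    ext m n
    rfl
  have a2 : conv (omegaR k C M N) (actCoR aM cM) (actCoR aN cN) =
      actCoR (tensorAct aM aN) (tensorCoactRight cM cN) := by
    ext1 b
    refine Eq.symm ((map_conv ((LinearMap.llcomp k _ _ _).flip (tensorCoactRight cM cN) ∘ₗ
      LinearMap.rTensorHom C) _ _ _ b).trans ?_)
    congr 1
    refine conv_congr fun x y => ?_
    ext m n
    refine bilin_ind (F := (TensorProduct.map (aM x) (aN y)).rTensor C ∘ₗ mixR k C M N)
      (G := mixR k C M N ∘ₗ TensorProduct.map ((aM x).rTensor C) ((aN y).rTensor C)) ?_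
      (cM m ⊗ₜ cN n)
    intro a b c d
    simp
  rw [FreeRight, a1, ← a2]
  have b1 := conv_assoc (μ₁ := omegaR k C M N) (μ₂ := LinearMap.llcomp k _ _ _)
    (f := lmulR ρ M) (g := LinearMap.llcomp k M M (M ⊗[k] C) cM ∘ₗ aM)
    (h := LinearMap.llcomp k N N (N ⊗[k] C) cN ∘ₗ aN)
    (μ₃ := LinearMap.llcomp k _ _ _) (μ₄ := omegaR k C M N)
    (f' := lmulR ρ (M ⊗[k] N)) (g' := LinearMap.llcomp k M M (M ⊗[k] C) cM ∘ₗ aM)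
    (h' := LinearMap.llcomp k N N (N ⊗[k] C) cN ∘ₗ aN) (by
      intro a b c
      ext m n
      refine bilin_ind (F := mixR k C M N ∘ₗ (lmulR ρ M a).rTensor _)
        (G := lmulR ρ (M ⊗[k] N) a ∘ₗ mixR k C M N) ?_ (cM (aM b m) ⊗ₜ cN (aN c n))
      intro a b c d
      simp [mul_assoc])
  have b2 := conv_assoc (μ₁ := omegaR k C M N) (μ₂ := revComp k _ _ _)
    (f := actCoR aM cM) (g := rmulR ρ M) (h := LinearMap.llcomp k N N (N ⊗[k] C) cN ∘ₗ aN)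
    (μ₃ := omegaR k C M N) (μ₄ := LinearMap.llcomp k N (N ⊗[k] C) (N ⊗[k] C))
    (f' := actCoR aM cM) (g' := lmulR ρ N)
    (h' := LinearMap.llcomp k N N (N ⊗[k] C) cN ∘ₗ aN) (by
      intro a b c
      ext m n
      refine bilin_ind (F := mixR k C M N ∘ₗ (rmulR ρ M b).rTensor _)
        (G := mixR k C M N ∘ₗ (lmulR ρ N b).lTensor _) ?_
        ((aM a).rTensor C (cM m) ⊗ₜ cN (aN c n))
      intro a b c d
      simp [mul_assoc])
  have b3 := conv_assoc (μ₁ := revComp k _ _ _) (μ₂ := omegaR k C M N)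
    (f := actCoR aM cM) (g := actCoR aN cN) (h := rmulR ρ (M ⊗[k] N))
    (μ₃ := omegaR k C M N) (μ₄ := revComp k _ _ _)
    (f' := actCoR aM cM) (g' := actCoR aN cN) (h' := rmulR ρ N) (by
      intro a b c
      ext m n
      refine bilin_ind (F := rmulR ρ (M ⊗[k] N) c ∘ₗ mixR k C M N)
        (G := mixR k C M N ∘ₗ (rmulR ρ N c).lTensor _) ?_
        ((aM a).rTensor C (cM m) ⊗ₜ (aN b).rTensor C (cN n))
      intro a b c d
      simp [mul_assoc])
  rw [← b1, hM, b2, hN, ← b3]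

theorem IsLeftYD.tensor {aM : B →ₗ[k] Module.End k M} {cM : M →ₗ[k] C ⊗[k] M}
    {aN : B →ₗ[k] Module.End k N} {cN : N →ₗ[k] C ⊗[k] N} {ρ : B →ₐc[k] C}
    (hM : IsLeftYD ρ aM cM) (hN : IsLeftYD ρ aN cN) :
    IsLeftYD ρ (tensorAct aM aN) (tensorCoactLeft cM cN) where
  act_one := tensorAct_one hM.act_one hN.act_one
  act_mul := tensorAct_mul hM.act_mul hN.act_mul
  coassoc := tensorCoactLeft_coassoc hM.coassoc hN.coassoc
  counit := tensorCoactLeft_counit hM.counit hN.counit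
  compat := (freeLeft_iff ρ _ _).1 (freeLeft_tensor ρ ((freeLeft_iff ρ _ _).2 hM.compat)
    ((freeLeft_iff ρ _ _).2 hN.compat))

theorem IsRightYD.tensor {aM : B →ₗ[k] Module.End k M} {cM : M →ₗ[k] M ⊗[k] C}
    {aN : B →ₗ[k] Module.End k N} {cN : N →ₗ[k] N ⊗[k] C} {ρ : B →ₐc[k] C}
    (hM : IsRightYD ρ aM cM) (hN : IsRightYD ρ aN cN) :
    IsRightYD ρ (tensorAct aM aN) (tensorCoactRight cM cN) where
  act_one := tensorAct_one hM.act_one hN.act_one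
  act_mul := tensorAct_mul_op hM.act_mul hN.act_mul
  coassoc := tensorCoactRight_coassoc hM.coassoc hN.coassoc
  counit := tensorCoactRight_counit hM.counit hN.counit
  compat := (freeRight_iff ρ _ _).1 (freeRight_tensor ρ ((freeRight_iff ρ _ _).2 hM.compat)
    ((freeRight_iff ρ _ _).2 hN.compat))

theorem isLeftYD_triv (ρ : B →ₐc[k] C) : IsLeftYD ρ (trivAct k B) (trivCoactLeft k C) where
  act_one m := by simp [trivAct]
  act_mul b b' m := by simp [trivAct, mul_assoc]
  coassoc m := by simp [trivCoactLeft, Algebra.TensorProduct.one_def]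
  counit m := by simp [trivCoactLeft]
  compat := (freeLeft_iff ρ _ _).1 <| by
    ext b
    have h1 := conv_counit_left (revComp k k (C ⊗[k] k) (C ⊗[k] k))
      (f := LinearMap.llcomp k k k (C ⊗[k] k) (trivCoactLeft k C) ∘ₗ trivAct k B) (rmulL ρ k)
      (e := trivCoactLeft k C) (by intro b; ext; simp [trivAct, trivCoactLeft, ← TensorProduct.tmul_smul]) b
    have h2 := conv_counit_right (LinearMap.llcomp k k (C ⊗[k] k) (C ⊗[k] k)) (lmulL ρ k)
      (g := actCoL (trivAct k B) (trivCoactLeft k C))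
      (e := trivCoactLeft k C) (by intro b; ext; simp [trivAct, trivCoactLeft, ← TensorProduct.tmul_smul]) b
    rw [h1, h2]
    simp [trivCoactLeft]

theorem isRightYD_triv (ρ : B →ₐc[k] C) : IsRightYD ρ (trivAct k B) (trivCoactRight k C) where
  act_one m := by simp [trivAct]
  act_mul b b' m := by simp [trivAct, mul_left_comm, mul_assoc]
  coassoc m := by simp [trivCoactRight, Algebra.TensorProduct.one_def]
  counit m := by simp [trivCoactRight]
  compat := (freeRight_iff ρ _ _).1 <| by
    ext b
    have h1 := conv_counit_right (LinearMap.llcomp k k (k ⊗[k] C) (k ⊗[k] C)) (lmulR ρ k)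
      (g := LinearMap.llcomp k k k (k ⊗[k] C) (trivCoactRight k C) ∘ₗ trivAct k B)
      (e := trivCoactRight k C)
      (by intro b; ext; simp [trivAct, trivCoactRight, TensorProduct.smul_tmul']) b
    have h2 := conv_counit_left (revComp k k (k ⊗[k] C) (k ⊗[k] C))
      (f := actCoR (trivAct k B) (trivCoactRight k C)) (rmulR ρ k)
      (e := trivCoactRight k C)
      (by intro b; ext; simp [trivAct, trivCoactRight, TensorProduct.smul_tmul']) b
    rw [h1, h2]
    simp [trivCoactRight]

end Compat

section Categories

open CategoryTheory MonoidalCategory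

variable {k : Type u} [Field k] {B : Type v} [Ring B] [HopfAlgebra k B]
  {C : Type w} [Ring C] [HopfAlgebra k C]

/-- The objects of the category of left relative Yetter-Drinfeld modules over `ρ : B → C`: left
`B`-modules and left `C`-comodules satisfying the Yetter-Drinfeld condition relative to `ρ`. -/
structure LeftYD (ρ : B →ₐc[k] C) where
  carrier : Type u
  [addCommGroup : AddCommGroup carrier]
  [module : Module k carrier]
  act : B →ₗ[k] Module.End k carrier
  coact : carrier →ₗ[k] C ⊗[k] carrier
  isYD : IsLeftYD ρ act coact

/-- The objects of the category of right relative Yetter-Drinfeld modules over `ρ : B → C`: right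
`B`-modules (`act b m` is `m b`) and right `C`-comodules satisfying the Yetter-Drinfeld condition
relative to `ρ`. -/
structure RightYD (ρ : B →ₐc[k] C) where
  carrier : Type u
  [addCommGroup : AddCommGroup carrier]
  [module : Module k carrier]
  act : B →ₗ[k] Module.End k carrier
  coact : carrier →ₗ[k] carrier ⊗[k] C
  isYD : IsRightYD ρ act coact

attribute [instance] LeftYD.addCommGroup LeftYD.module RightYD.addCommGroup RightYD.module

variable {ρ : B →ₐc[k] C}

/-- Left `B`-linear and left `C`-colinear maps. -/
@[ext] structure LeftYD.Hom (M N : LeftYD ρ) where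
  lin : M.carrier →ₗ[k] N.carrier
  isHom : IsLeftHom M.act M.coact N.act N.coact lin

/-- Right `B`-linear and right `C`-colinear maps. -/
@[ext] structure RightYD.Hom (M N : RightYD ρ) where
  lin : M.carrier →ₗ[k] N.carrier
  isHom : IsRightHom M.act M.coact N.act N.coact lin

instance : Category (LeftYD ρ) where
  Hom := LeftYD.Hom
  id M := ⟨LinearMap.id, ⟨fun _ _ => rfl, fun _ => by simp⟩⟩
  comp f g := ⟨g.lin ∘ₗ f.lin, ⟨fun b m => by simp [f.isHom.map_act, g.isHom.map_act],
    fun m => by simp [f.isHom.map_coact, g.isHom.map_coact, LinearMap.lTensor_comp_apply]⟩⟩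

instance : Category (RightYD ρ) where
  Hom := RightYD.Hom
  id M := ⟨LinearMap.id, ⟨fun _ _ => rfl, fun _ => by simp⟩⟩
  comp f g := ⟨g.lin ∘ₗ f.lin, ⟨fun b m => by simp [f.isHom.map_act, g.isHom.map_act],
    fun m => by simp [f.isHom.map_coact, g.isHom.map_coact, LinearMap.rTensor_comp_apply]⟩⟩

@[ext] theorem LeftYD.hom_ext {M N : LeftYD ρ} {f g : M ⟶ N} (h : f.lin = g.lin) : f = g :=
  LeftYD.Hom.ext h

@[ext] theorem RightYD.hom_ext {M N : RightYD ρ} {f g : M ⟶ N} (h : f.lin = g.lin) : f = g :=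
  RightYD.Hom.ext h

@[simp] theorem LeftYD.id_lin (M : LeftYD ρ) : (𝟙 M : M ⟶ M).lin = LinearMap.id := rfl
@[simp] theorem RightYD.id_lin (M : RightYD ρ) : (𝟙 M : M ⟶ M).lin = LinearMap.id := rfl
@[simp] theorem LeftYD.comp_lin {M N P : LeftYD ρ} (f : M ⟶ N) (g : N ⟶ P) :
    (f ≫ g).lin = g.lin ∘ₗ f.lin := rfl
@[simp] theorem RightYD.comp_lin {M N P : RightYD ρ} (f : M ⟶ N) (g : N ⟶ P) :
    (f ≫ g).lin = g.lin ∘ₗ f.lin := rfl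

/-- A linear isomorphism that is a morphism is an isomorphism. -/
def LeftYD.isoMk {M N : LeftYD ρ} (e : M.carrier ≃ₗ[k] N.carrier)
    (h : IsLeftHom M.act M.coact N.act N.coact e.toLinearMap) : M ≅ N where
  hom := ⟨e.toLinearMap, h⟩
  inv := ⟨e.symm.toLinearMap, ⟨fun b n => e.injective <| by
      have := h.map_act b (e.symm n)
      simp at this
      simp [this], fun n => by
      have := h.map_coact (e.symm n)
      simp only [LinearEquiv.coe_coe, LinearEquiv.apply_symm_apply] at this
      simp only [LinearEquiv.coe_coe, this, ← LinearMap.lTensor_comp_apply]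
      simp⟩⟩
  hom_inv_id := by ext; simp
  inv_hom_id := by ext; simp

/-- A linear isomorphism that is a morphism is an isomorphism. -/
def RightYD.isoMk {M N : RightYD ρ} (e : M.carrier ≃ₗ[k] N.carrier)
    (h : IsRightHom M.act M.coact N.act N.coact e.toLinearMap) : M ≅ N where
  hom := ⟨e.toLinearMap, h⟩
  inv := ⟨e.symm.toLinearMap, ⟨fun b n => e.injective <| by
      have := h.map_act b (e.symm n)
      simp at this
      simp [this], fun n => by
      have := h.map_coact (e.symm n)
      simp only [LinearEquiv.coe_coe, LinearEquiv.apply_symm_apply] at this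
      simp only [LinearEquiv.coe_coe, this, ← LinearMap.rTensor_comp_apply]
      simp⟩⟩
  hom_inv_id := by ext; simp
  inv_hom_id := by ext; simp

/-- The tensor product of `f` and `g` is a morphism. -/
theorem IsLeftHom.tensor {M M' N N' : LeftYD ρ} (f : M ⟶ M') (g : N ⟶ N') :
    IsLeftHom (tensorAct M.act N.act) (tensorCoactLeft M.coact N.coact)
      (tensorAct M'.act N'.act) (tensorCoactLeft M'.coact N'.coact)
      (TensorProduct.map f.lin g.lin) :=
  ⟨tensorAct_natural f.isHom.map_act g.isHom.map_act,
    tensorCoactLeft_natural f.isHom.map_coact g.isHom.map_coact⟩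

/-- The tensor product of `f` and `g` is a morphism. -/
theorem IsRightHom.tensor {M M' N N' : RightYD ρ} (f : M ⟶ M') (g : N ⟶ N') :
    IsRightHom (tensorAct M.act N.act) (tensorCoactRight M.coact N.coact)
      (tensorAct M'.act N'.act) (tensorCoactRight M'.coact N'.coact)
      (TensorProduct.map f.lin g.lin) :=
  ⟨tensorAct_natural f.isHom.map_act g.isHom.map_act,
    tensorCoactRight_natural f.isHom.map_coact g.isHom.map_coact⟩

noncomputable instance : MonoidalCategoryStruct (LeftYD ρ) where
  tensorObj M N :=
    { carrier := M.carrier ⊗[k] N.carrier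
      act := tensorAct M.act N.act
      coact := tensorCoactLeft M.coact N.coact
      isYD := M.isYD.tensor N.isYD }
  tensorUnit := { carrier := k, act := trivAct k B, coact := trivCoactLeft k C, isYD := isLeftYD_triv ρ }
  tensorHom f g := ⟨TensorProduct.map f.lin g.lin, IsLeftHom.tensor f g⟩
  whiskerLeft M _ _ g := ⟨TensorProduct.map (𝟙 M : M ⟶ M).lin g.lin, IsLeftHom.tensor (𝟙 M) g⟩
  whiskerRight f N := ⟨TensorProduct.map f.lin (𝟙 N : N ⟶ N).lin, IsLeftHom.tensor f (𝟙 N)⟩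
  associator M N P := LeftYD.isoMk (TensorProduct.assoc k M.carrier N.carrier P.carrier)
    ⟨tensorAct_assoc _ _ _, tensorCoactLeft_assoc _ _ _⟩
  leftUnitor M := LeftYD.isoMk (TensorProduct.lid k M.carrier)
    ⟨tensorAct_lid _, tensorCoactLeft_lid _⟩
  rightUnitor M := LeftYD.isoMk (TensorProduct.rid k M.carrier)
    ⟨tensorAct_rid _, tensorCoactLeft_rid _⟩

noncomputable instance : MonoidalCategoryStruct (RightYD ρ) where
  tensorObj M N :=
    { carrier := M.carrier ⊗[k] N.carrier
      act := tensorAct M.act N.act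
      coact := tensorCoactRight M.coact N.coact
      isYD := M.isYD.tensor N.isYD }
  tensorUnit := { carrier := k, act := trivAct k B, coact := trivCoactRight k C, isYD := isRightYD_triv ρ }
  tensorHom f g := ⟨TensorProduct.map f.lin g.lin, IsRightHom.tensor f g⟩
  whiskerLeft M _ _ g := ⟨TensorProduct.map (𝟙 M : M ⟶ M).lin g.lin, IsRightHom.tensor (𝟙 M) g⟩
  whiskerRight f N := ⟨TensorProduct.map f.lin (𝟙 N : N ⟶ N).lin, IsRightHom.tensor f (𝟙 N)⟩
  associator M N P := RightYD.isoMk (TensorProduct.assoc k M.carrier N.carrier P.carrier)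
    ⟨tensorAct_assoc _ _ _, tensorCoactRight_assoc _ _ _⟩
  leftUnitor M := RightYD.isoMk (TensorProduct.lid k M.carrier)
    ⟨tensorAct_lid _, tensorCoactRight_lid _⟩
  rightUnitor M := RightYD.isoMk (TensorProduct.rid k M.carrier)
    ⟨tensorAct_rid _, tensorCoactRight_rid _⟩

/-- The underlying vector space. -/
def LeftYD.forget (ρ : B →ₐc[k] C) : LeftYD ρ ⥤ ModuleCat.{u} k where
  obj M := ModuleCat.of k M.carrier
  map f := ModuleCat.ofHom f.lin

/-- The underlying vector space. -/
def RightYD.forget (ρ : B →ₐc[k] C) : RightYD ρ ⥤ ModuleCat.{u} k where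
  obj M := ModuleCat.of k M.carrier
  map f := ModuleCat.ofHom f.lin

instance : (LeftYD.forget ρ).Faithful where
  map_injective h := LeftYD.hom_ext (congrArg ModuleCat.Hom.hom h)

instance : (RightYD.forget ρ).Faithful where
  map_injective h := RightYD.hom_ext (congrArg ModuleCat.Hom.hom h)

/-- The tensor product has the diagonal action and coaction. -/
noncomputable instance : MonoidalCategory (LeftYD ρ) :=
  Monoidal.induced (LeftYD.forget ρ)
    { μIso := fun _ _ => Iso.refl _
      εIso := Iso.refl _
      whiskerLeft_eq := by intros; ext; rfl
      whiskerRight_eq := by intros; ext; rfl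
      tensorHom_eq := by intros; ext; rfl
      associator_eq := by
        intro X Y Z
        apply ModuleCat.hom_ext
        apply TensorProduct.ext_threefold
        intros
        rfl
      leftUnitor_eq := by
        intro X
        apply ModuleCat.hom_ext
        apply TensorProduct.ext'
        intros
        rfl
      rightUnitor_eq := by
        intro X
        apply ModuleCat.hom_ext
        apply TensorProduct.ext'
        intros
        rfl }

/-- The tensor product has the diagonal action and coaction. -/
noncomputable instance : MonoidalCategory (RightYD ρ) :=
  Monoidal.induced (RightYD.forget ρ)
    { μIso := fun _ _ => Iso.refl _
      εIso := Iso.refl _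
      whiskerLeft_eq := by intros; ext; rfl
      whiskerRight_eq := by intros; ext; rfl
      tensorHom_eq := by intros; ext; rfl
      associator_eq := by
        intro X Y Z
        apply ModuleCat.hom_ext
        apply TensorProduct.ext_threefold
        intros
        rfl
      leftUnitor_eq := by
        intro X
        apply ModuleCat.hom_ext
        apply TensorProduct.ext'
        intros
        rfl
      rightUnitor_eq := by
        intro X
        apply ModuleCat.hom_ext
        apply TensorProduct.ext'
        intros
        rfl }

end Categories

section Braided

variable {k : Type u} [Field k] {H : Type v} [Ring H] [HopfAlgebra k H]

/-- The braiding `V ⊗ W → W ⊗ V`, `v ⊗ w ↦ ∑ v₍₋₁₎ w ⊗ v₍₀₎`. -/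
noncomputable def braid {V W : Type*} [AddCommGroup V] [Module k V] [AddCommGroup W] [Module k W]
    (cV : V →ₗ[k] H ⊗[k] V) (aW : H →ₗ[k] Module.End k W) : V ⊗[k] W →ₗ[k] W ⊗[k] V :=
  (TensorProduct.lift aW).rTensor V ∘ₗ (TensorProduct.rightComm k H V W).toLinearMap ∘ₗ
    cV.rTensor W

/-- The multiplication `(m ⊗ m) (id ⊗ c ⊗ id)` of the braided tensor product `R ⊗ R`, that is,
`(a ⊗ b) (a' ⊗ b') = ∑ a (b₍₋₁₎ a') ⊗ b₍₀₎ b'`. -/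
noncomputable def braidedMul {R : Type w} [Ring R] [Algebra k R] (act : H →ₗ[k] Module.End k R)
    (coact : R →ₗ[k] H ⊗[k] R) : (R ⊗[k] R) ⊗[k] (R ⊗[k] R) →ₗ[k] R ⊗[k] R :=
  TensorProduct.map (LinearMap.mul' k R) (LinearMap.mul' k R) ∘ₗ
    (TensorProduct.assoc k R R (R ⊗[k] R)).symm.toLinearMap ∘ₗ
    ((TensorProduct.assoc k R R R).toLinearMap ∘ₗ (braid coact act).rTensor R ∘ₗ
      (TensorProduct.assoc k R R R).symm.toLinearMap).lTensor R ∘ₗ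
    (TensorProduct.assoc k R R (R ⊗[k] R)).toLinearMap

/-- A Hopf algebra `R` in the braided monoidal category of left Yetter-Drinfeld modules over `H`:
an algebra and a coalgebra with a Yetter-Drinfeld structure over `H` and an antipode such that all
structure maps are left `H`-linear and left `H`-colinear, `Δ` and `ε` are algebra maps (for the
braided tensor product), and the antipode is the convolution inverse of the identity. -/
class YDHopfAlgebra (k : Type u) [Field k] (H : Type v) [Ring H] [HopfAlgebra k H]
    (R : Type w) [Ring R] [Algebra k R] [Coalgebra k R] where
  act : H →ₗ[k] Module.End k R
  coact : R →ₗ[k] H ⊗[k] R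
  antipode : R →ₗ[k] R
  isYD : IsLeftYD (BialgHom.id k H) act coact
  mul_hom : IsLeftHom (tensorAct act act) (tensorCoactLeft coact coact) act coact
    (LinearMap.mul' k R)
  unit_hom : IsLeftHom (trivAct k H) (trivCoactLeft k H) act coact (Algebra.linearMap k R)
  comul_hom : IsLeftHom act coact (tensorAct act act) (tensorCoactLeft coact coact)
    (comul : R →ₗ[k] R ⊗[k] R)
  counit_hom : IsLeftHom act coact (trivAct k H) (trivCoactLeft k H) (counit : R →ₗ[k] k)
  antipode_hom : IsLeftHom act coact act coact antipode
  comul_one : comul (R := k) (1 : R) = 1 ⊗ₜ[k] 1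
  comul_mul : ∀ r s : R, comul (R := k) (r * s) =
    braidedMul act coact (comul (R := k) r ⊗ₜ[k] comul (R := k) s)
  counit_one : counit (R := k) (1 : R) = 1
  counit_mul : ∀ r s : R, counit (R := k) (r * s) = counit r * counit s
  mul_antipode_rTensor : ∀ r : R, LinearMap.mul' k R (antipode.rTensor R (comul r)) =
    algebraMap k R (counit r)
  mul_antipode_lTensor : ∀ r : R, LinearMap.mul' k R (antipode.lTensor R (comul r)) =
    algebraMap k R (counit r)

/-- The bosonization `R # H`, with underlying vector space `R ⊗ H`. -/
def Bosonization (k : Type u) [Field k] (H : Type v) [Ring H] [HopfAlgebra k H]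
    (R : Type w) [Ring R] [Algebra k R] : Type (max w v) :=
  R ⊗[k] H

namespace Bosonization

open YDHopfAlgebra (act coact)

variable {R : Type w} [Ring R] [Algebra k R] [Coalgebra k R]

noncomputable instance : AddCommGroup (Bosonization k H R) :=
  inferInstanceAs (AddCommGroup (R ⊗[k] H))

noncomputable instance : Module k (Bosonization k H R) :=
  inferInstanceAs (Module k (R ⊗[k] H))

/-- The identification of `R ⊗ H` with the bosonization; `mk (r ⊗ h)` is `r # h`. -/
noncomputable def mk : R ⊗[k] H ≃ₗ[k] Bosonization k H R := LinearEquiv.refl k _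

variable [YDHopfAlgebra k H R]

/-- Left multiplication by `r # 1`. -/
noncomputable def lmulR (r : R) : R ⊗[k] H →ₗ[k] R ⊗[k] H :=
  (LinearMap.mul k R r).rTensor H

/-- Left multiplication by `1 # h`: `r' ⊗ h' ↦ ∑ h₍₁₎ r' ⊗ h₍₂₎ h'`. -/
noncomputable def lmulH : H →ₗ[k] Module.End k (R ⊗[k] H) :=
  tensorAct act (LinearMap.mul k H)

/-- Left multiplication: `(r ⊗ h) (r' ⊗ h') = ∑ r (h₍₁₎ r') ⊗ h₍₂₎ h'`. -/
noncomputable def lmul : R ⊗[k] H →ₗ[k] Module.End k (R ⊗[k] H) :=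
  TensorProduct.lift ((LinearMap.mul k (Module.End k (R ⊗[k] H))).compl₁₂
    (LinearMap.rTensorHom H ∘ₗ LinearMap.mul k R) lmulH)

theorem lmul_tmul (r : R) (h : H) (x : R ⊗[k] H) :
    lmul (r ⊗ₜ[k] h) x = lmulR r (lmulH h x) := rfl

theorem lmulH_one (x : R ⊗[k] H) : lmulH (1 : H) x = x :=
  tensorAct_one (YDHopfAlgebra.isYD (k := k) (H := H) (R := R)).act_one (by simp) x

theorem lmulH_mul (h h' : H) (x : R ⊗[k] H) : lmulH (h * h') x = lmulH h (lmulH h' x) :=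
  tensorAct_mul (YDHopfAlgebra.isYD (k := k) (H := H) (R := R)).act_mul (by simp [mul_assoc]) h h' x

theorem lmulH_apply (h : H) (x : R ⊗[k] H) :
    lmulH h x = TensorProduct.homTensorHomMap (RingHom.id k) R H R H
      (TensorProduct.map act (LinearMap.mul k H) (comul h)) x :=
  tensorAct_apply _ _ _ _

theorem lmulH_lmulR (h : H) (r : R) (x : R ⊗[k] H) :
    lmulH h (lmulR r x) = lmul (lmulH h (r ⊗ₜ[k] 1)) x := by
  have e1 : lmulR r x = (LinearMap.mul' k R).rTensor H
      ((TensorProduct.assoc k R R H).symm (r ⊗ₜ[k] x)) := by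
    induction x with
    | zero => simp
    | add s t hs ht => simp only [map_add, TensorProduct.tmul_add, hs, ht]
    | tmul r' h' => simp [lmulR]
  have e2 := tensorAct_natural (f := LinearMap.mul' k R) (g := LinearMap.id)
    (aN := LinearMap.mul k H) (aN' := LinearMap.mul k H)
    (YDHopfAlgebra.mul_hom (k := k) (H := H) (R := R)).map_act (fun _ _ => rfl) h
    ((TensorProduct.assoc k R R H).symm (r ⊗ₜ[k] x))
  have e3 := tensorAct_assoc (act : H →ₗ[k] Module.End k R) (act : H →ₗ[k] Module.End k R)
    (LinearMap.mul k H) h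
    ((TensorProduct.assoc k R R H).symm (r ⊗ₜ[k] x))
  rw [← LinearEquiv.eq_symm_apply, LinearEquiv.apply_symm_apply] at e3
  rw [e3] at e2
  rw [e1]
  refine e2.symm.trans ?_
  rw [tensorAct_apply, lmulH_apply]
  generalize comul (R := k) h = t
  induction t with
  | zero => simp
  | add s t hs ht => simp only [map_add, LinearMap.add_apply, hs, ht]
  | tmul a b =>
    simp only [TensorProduct.map_tmul, TensorProduct.homTensorHomMap_apply, LinearMap.mul_apply',
      mul_one]
    rw [lmul_tmul]
    change _ = lmulR _ (tensorAct act (LinearMap.mul k H) b x)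
    generalize tensorAct (act : H →ₗ[k] Module.End k R) (LinearMap.mul k H) b x = y
    induction y with
    | zero => simp
    | add s t hs ht => simp only [map_add, TensorProduct.tmul_add, hs, ht]
    | tmul r' h' => simp [lmulR]

theorem lmul_lmulR (r : R) (z x : R ⊗[k] H) : lmul (lmulR r z) x = lmulR r (lmul z x) := by
  induction z with
  | zero => simp
  | add s t hs ht => simp only [map_add, LinearMap.add_apply, hs, ht]
  | tmul r' h' =>
    simp only [lmulR, LinearMap.rTensor_tmul, lmul_tmul, LinearMap.mul_apply']
    rw [← LinearMap.rTensor_comp_apply]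
    congr 2
    ext; simp [mul_assoc]

theorem lmul_rmul (h : H) (z x : R ⊗[k] H) :
    lmul (((LinearMap.mul k H).flip h).lTensor R z) x = lmul z (lmulH h x) := by
  induction z with
  | zero => simp
  | add s t hs ht => simp only [map_add, LinearMap.add_apply, hs, ht]
  | tmul r' h' => simp [lmul_tmul, lmulH_mul]

theorem lmulH_tmul (h : H) (r : R) (h' : H) : lmulH h (r ⊗ₜ[k] h') =
    ((LinearMap.mul k H).flip h').lTensor R (lmulH h (r ⊗ₜ[k] 1)) := by
  simp only [lmulH_apply]
  generalize comul (R := k) h = t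
  induction t with
  | zero => simp
  | add s t hs ht => simp only [map_add, LinearMap.add_apply, hs, ht]
  | tmul a b => simp

theorem lmul_assoc (a b x : R ⊗[k] H) : lmul (lmul a b) x = lmul a (lmul b x) := by
  induction a with
  | zero => simp
  | add s t hs ht => simp only [map_add, LinearMap.add_apply, hs, ht]
  | tmul r h =>
    induction b with
    | zero => simp
    | add s t hs ht => simp only [map_add, LinearMap.add_apply, hs, ht]
    | tmul r' h' =>
      rw [lmul_tmul, lmulH_tmul, lmul_lmulR, lmul_rmul, ← lmulH_lmulR]
      rfl

theorem act_unit (h : H) : (act h : R →ₗ[k] R) 1 = counit (R := k) h • (1 : R) := by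
  have := (YDHopfAlgebra.unit_hom (k := k) (H := H) (R := R)).map_act h 1
  simp [trivAct, Algebra.algebraMap_eq_smul_one] at this
  exact this.symm

theorem lmulH_unit (h : H) : lmulH h ((1 : R) ⊗ₜ[k] (1 : H)) = (1 : R) ⊗ₜ[k] h := by
  have e : lmulH h ((1 : R) ⊗ₜ[k] (1 : H)) =
      TensorProduct.map ((LinearMap.toSpanSingleton k R 1)) LinearMap.id
        (counit.rTensor H (comul h)) := by
    rw [lmulH_apply]
    generalize comul (R := k) h = t
    induction t with
    | zero => simp
    | add s t hs ht => simp only [map_add, LinearMap.add_apply, hs, ht]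
    | tmul a b => simp [act_unit]
  rw [e]
  simp

theorem one_lmul (x : R ⊗[k] H) : lmul ((1 : R) ⊗ₜ[k] (1 : H)) x = x := by
  rw [lmul_tmul, lmulH_one]
  induction x with
  | zero => simp
  | add s t hs ht => simp only [map_add, hs, ht]
  | tmul r h => simp [lmulR]

theorem lmul_one (x : R ⊗[k] H) : lmul x ((1 : R) ⊗ₜ[k] (1 : H)) = x := by
  induction x with
  | zero => simp
  | add s t hs ht => simp only [map_add, LinearMap.add_apply, hs, ht]
  | tmul r h => simp [lmul_tmul, lmulH_unit, lmulR]

/-- The smash product algebra `(r # h) (r' # h') = ∑ r (h₍₁₎ r') # h₍₂₎ h'`. -/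
noncomputable instance : Ring (Bosonization k H R) :=
  { (inferInstance : AddCommGroup (Bosonization k H R)) with
    mul := fun a b => mk (lmul (mk.symm a) (mk.symm b))
    one := mk (1 ⊗ₜ[k] 1)
    mul_assoc := fun a b c => lmul_assoc (k := k) (H := H) (R := R) a b c
    left_distrib := fun a b c => (lmul (k := k) (H := H) (R := R) a).map_add b c
    right_distrib := fun a b c =>
      LinearMap.congr_fun ((lmul (k := k) (H := H) (R := R)).map_add a b) c
    zero_mul := fun a => LinearMap.congr_fun ((lmul (k := k) (H := H) (R := R)).map_zero) a
    mul_zero := fun a => (lmul (k := k) (H := H) (R := R) a).map_zero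
    one_mul := fun a => one_lmul (k := k) (H := H) (R := R) a
    mul_one := fun a => lmul_one (k := k) (H := H) (R := R) a }

noncomputable instance : Algebra k (Bosonization k H R) :=
  Algebra.ofModule
    (fun c a b => LinearMap.congr_fun ((lmul (k := k) (H := H) (R := R)).map_smul c a) b)
    (fun c a b => (lmul (k := k) (H := H) (R := R) a).map_smul c b)

theorem mk_mul (x y : R ⊗[k] H) : (mk x * mk y : Bosonization k H R) = mk (lmul x y) := rfl

theorem mk_one : (mk (1 ⊗ₜ[k] 1) : Bosonization k H R) = 1 := rfl

/-- The multiplication formula of the smash product. -/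
theorem mk_tmul_mul (r r' : R) (h h' : H) :
    (mk (r ⊗ₜ[k] h) * mk (r' ⊗ₜ[k] h') : Bosonization k H R) =
      mk (TensorProduct.map (LinearMap.mul k R r ∘ₗ (act : H →ₗ[k] Module.End k R).flip r')
        ((LinearMap.mul k H).flip h') (comul h)) := by
  rw [mk_mul, lmul_tmul, lmulH_apply]
  congr 1
  generalize comul (R := k) h = t
  induction t with
  | zero => simp
  | add s t hs ht => simp only [map_add, LinearMap.add_apply, hs, ht]
  | tmul a b => simp [lmulR]

/-- The inclusion `R → R # H`, `r ↦ r # 1`. -/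
noncomputable def inclR : R →ₐ[k] Bosonization k H R :=
  AlgHom.ofLinearMap (mk.toLinearMap ∘ₗ (TensorProduct.mk k R H).flip 1) rfl (fun r s => by
    simp [mk_mul, lmul_tmul, lmulH_one, lmulR])

/-- The inclusion `H → R # H`, `h ↦ 1 # h`. -/
noncomputable def inclH : H →ₐ[k] Bosonization k H R :=
  AlgHom.ofLinearMap (mk.toLinearMap ∘ₗ TensorProduct.mk k R H 1) rfl (fun r s => by
    simp only [LinearMap.comp_apply, TensorProduct.mk_apply, LinearEquiv.coe_coe, mk_mul, lmul_tmul]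
    rw [lmulH_tmul, lmulH_unit]
    simp [lmulR])

theorem inclR_apply (r : R) : (inclR r : Bosonization k H R) = mk (r ⊗ₜ[k] 1) := rfl

theorem inclH_apply (h : H) : (inclH h : Bosonization k H R) = mk (1 ⊗ₜ[k] h) := rfl

theorem inclR_mul_inclH (r : R) (h : H) :
    (inclR r * inclH h : Bosonization k H R) = mk (r ⊗ₜ[k] h) := by
  rw [inclR_apply, inclH_apply, mk_mul, lmul_tmul, lmulH_one]
  simp [lmulR]

theorem inclH_mul_inclR (h : H) (r : R) : (inclH h * inclR r : Bosonization k H R) =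
    mk (TensorProduct.map ((act : H →ₗ[k] Module.End k R).flip r) LinearMap.id (comul h)) := by
  rw [inclR_apply, inclH_apply, mk_tmul_mul]
  congr 3
  · ext; simp
  · ext; simp

section Lift

variable {X : Type*} [Semiring X] [Algebra k X]

theorem mul_induction {p : Bosonization k H R → Prop} (a : Bosonization k H R)
    (h0 : ∀ r h, p (inclR r * inclH h)) (h1 : ∀ a b, p a → p b → p (a + b)) : p a := by
  obtain ⟨x, rfl⟩ := (mk (k := k) (H := H) (R := R)).surjective a
  induction x with
  | zero => simpa using h0 0 0
  | add s t hs ht => rw [map_add]; exact h1 _ _ hs ht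
  | tmul r h => rw [← inclR_mul_inclH]; exact h0 r h

/-- Algebra maps out of the smash product. -/
noncomputable def lift (f : R →ₐ[k] X) (g : H →ₐ[k] X)
    (hc : ∀ h r, g h * f r = LinearMap.mul' k X (TensorProduct.map
      (f.toLinearMap ∘ₗ (act : H →ₗ[k] Module.End k R).flip r) g.toLinearMap (comul h))) :
    Bosonization k H R →ₐ[k] X :=
  AlgHom.ofLinearMap
    (LinearMap.mul' k X ∘ₗ TensorProduct.map f.toLinearMap g.toLinearMap ∘ₗ mk.symm.toLinearMap)
    (by rw [← mk_one]; simp)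
    (by
      set F := LinearMap.mul' k X ∘ₗ TensorProduct.map f.toLinearMap g.toLinearMap with hF
      suffices h : ∀ x y : R ⊗[k] H, F (lmul x y) = F x * F y from fun a b => h _ _
      intro x y
      induction x with
      | zero => simp
      | add s t hs ht => simp only [map_add, LinearMap.add_apply, hs, ht, add_mul]
      | tmul r h =>
        induction y with
        | zero => simp
        | add s t hs ht => simp only [map_add, hs, ht, mul_add]
        | tmul r' h' =>
          have e1 : ∀ z, F (lmulR r z) = f r * F z := by
            intro z
            induction z with
            | zero => simp
            | add s t hs ht => simp only [map_add, hs, ht, mul_add]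
            | tmul a b => simp [lmulR, hF, mul_assoc]
          have e2 : ∀ z, F (((LinearMap.mul k H).flip h').lTensor R z) = F z * g h' := by
            intro z
            induction z with
            | zero => simp
            | add s t hs ht => simp only [map_add, hs, ht, add_mul]
            | tmul a b => simp [hF, mul_assoc]
          have e3 : F (lmulH h (r' ⊗ₜ[k] 1)) = g h * f r' := by
            rw [hc, lmulH_apply]
            generalize comul (R := k) h = t
            induction t with
            | zero => simp
            | add s t hs ht => simp only [map_add, LinearMap.add_apply, hs, ht]
            | tmul a b => simp [hF]
          rw [lmul_tmul, lmulH_tmul, e1, e2, e3]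
          simp [hF, mul_assoc])

theorem lift_mk (f : R →ₐ[k] X) (g : H →ₐ[k] X) (hc) (r : R) (h : H) :
    lift f g hc (mk (r ⊗ₜ[k] h)) = f r * g h := rfl

@[simp] theorem lift_inclR (f : R →ₐ[k] X) (g : H →ₐ[k] X) (hc) (r : R) :
    lift f g hc (inclR r) = f r := by
  rw [inclR_apply, lift_mk, map_one, mul_one]

@[simp] theorem lift_inclH (f : R →ₐ[k] X) (g : H →ₐ[k] X) (hc) (h : H) :
    lift f g hc (inclH h) = g h := by
  rw [inclH_apply, lift_mk, map_one, one_mul]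

theorem algHom_ext {F G : Bosonization k H R →ₐ[k] X} (h1 : ∀ r, F (inclR r) = G (inclR r))
    (h2 : ∀ h, F (inclH h) = G (inclH h)) : F = G := by
  ext a
  refine mul_induction (p := fun a => F a = G a) a (fun r h => ?_) (fun a b ha hb => ?_)
  · rw [map_mul, map_mul, h1, h2]
  · rw [map_add, map_add, ha, hb]

end Lift

end Bosonization

end Braided

section BosonizationHopf

variable {k : Type u} [Field k] {H : Type v} [Ring H] [HopfAlgebra k H]

namespace Bosonization

open YDHopfAlgebra (act coact)

variable {R : Type w} [Ring R] [Algebra k R] [Coalgebra k R] [YDHopfAlgebra k H R]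

/-- The coaction of `R` as an algebra map. -/
noncomputable def coactHom : R →ₐ[k] H ⊗[k] R :=
  AlgHom.ofLinearMap coact
    (by
      have := (YDHopfAlgebra.unit_hom (k := k) (H := H) (R := R)).map_coact 1
      simpa [trivCoactLeft, Algebra.TensorProduct.one_def] using this)
    (fun r s => by
      have := (YDHopfAlgebra.mul_hom (k := k) (H := H) (R := R)).map_coact (r ⊗ₜ s)
      rw [LinearMap.mul'_apply] at this
      rw [this, tensorCoactLeft_tmul]
      generalize (coact r : H ⊗[k] R) = a
      generalize (coact s : H ⊗[k] R) = b
      induction a with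
      | zero => simp
      | add s t hs ht => simp only [map_add, TensorProduct.add_tmul, hs, ht, add_mul]
      | tmul h x =>
        induction b with
        | zero => simp
        | add s t hs ht => simp only [map_add, TensorProduct.tmul_add, hs, ht, mul_add]
        | tmul h' x' => simp)

theorem coactHom_apply (r : R) : coactHom (k := k) (H := H) r = coact r := rfl

/-- `h ⊗ r ↦ (1 # h) ⊗ (r # 1)`. -/
noncomputable def J : H ⊗[k] R →ₐ[k] Bosonization k H R ⊗[k] Bosonization k H R :=
  Algebra.TensorProduct.map inclH inclR

@[simp] theorem J_tmul (h : H) (r : R) :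
    (J (h ⊗ₜ[k] r) : Bosonization k H R ⊗[k] Bosonization k H R) = inclH h ⊗ₜ inclR r := by
  simp [J]

/-- `r ↦ ∑ (1 # r₍₋₁₎) ⊗ (r₍₀₎ # 1)`. -/
noncomputable def u : R →ₐ[k] Bosonization k H R ⊗[k] Bosonization k H R := J.comp coactHom

theorem u_apply (r : R) : (u r : Bosonization k H R ⊗[k] Bosonization k H R) = J (coact r) := rfl

/-- `a ⊗ b ↦ ∑ (a # b₍₋₁₎) ⊗ (b₍₀₎ # 1)`. -/
noncomputable def Phi : R ⊗[k] R →ₗ[k] Bosonization k H R ⊗[k] Bosonization k H R :=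
  TensorProduct.lift ((LinearMap.mul k (Bosonization k H R ⊗[k] Bosonization k H R)).compl₁₂
    ((TensorProduct.mk k _ _).flip 1 ∘ₗ inclR.toLinearMap) u.toLinearMap)

@[simp] theorem Phi_tmul (a b : R) :
    (Phi (a ⊗ₜ[k] b) : Bosonization k H R ⊗[k] Bosonization k H R) = (inclR a ⊗ₜ 1) * u b := by
  simp [Phi]

theorem coact_coassoc (m : R) : TensorProduct.assoc k H H R (comul.rTensor R (coact m)) =
    coact.lTensor H (coact m) :=
  (YDHopfAlgebra.isYD (k := k) (H := H) (R := R)).coassoc m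

theorem u_mul_inclR (b c : R) :
    (u b * (inclR c ⊗ₜ 1) : Bosonization k H R ⊗[k] Bosonization k H R) =
      Phi (braid (k := k) (H := H) coact act (b ⊗ₜ[k] c)) := by
  let T : H ⊗[k] (H ⊗[k] R) →ₗ[k] Bosonization k H R ⊗[k] Bosonization k H R :=
    TensorProduct.lift ((LinearMap.mul k (Bosonization k H R ⊗[k] Bosonization k H R)).compl₁₂
      ((TensorProduct.mk k _ _).flip 1 ∘ₗ inclR.toLinearMap ∘ₗ
        (act : H →ₗ[k] Module.End k R).flip c) J.toLinearMap)
  have h1 : (u b : Bosonization k H R ⊗[k] Bosonization k H R) * (inclR c ⊗ₜ 1) =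
      T (TensorProduct.assoc k H H R (comul.rTensor R (coact b))) := by
    rw [u_apply]
    generalize (coact b : H ⊗[k] R) = t
    induction t with
    | zero => simp
    | add s t hs ht => simp only [map_add, add_mul, hs, ht]
    | tmul h r =>
      rw [J_tmul, Algebra.TensorProduct.tmul_mul_tmul, mul_one, inclH_mul_inclR,
        LinearMap.rTensor_tmul]
      generalize comul (R := k) h = s
      induction s with
      | zero => simp
      | add s t hs ht => simp only [map_add, TensorProduct.add_tmul, hs, ht]
      | tmul a b => simp [T, ← inclR_mul_inclH]
  have h2 : (Phi (braid (k := k) (H := H) coact act (b ⊗ₜ[k] c)) : Bosonization k H R ⊗[k] Bosonization k H R) =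
      T (coact.lTensor H (coact b)) := by
    simp only [braid, LinearMap.comp_apply, LinearMap.rTensor_tmul]
    generalize (coact b : H ⊗[k] R) = t
    induction t with
    | zero => simp
    | add s t hs ht => simp only [map_add, TensorProduct.add_tmul, hs, ht]
    | tmul h r => simp [T, u_apply]
  rw [h1, h2, coact_coassoc]

theorem Phi_lmul (a : R) (z : R ⊗[k] R) :
    (Phi ((LinearMap.mul k R a).rTensor R z) : Bosonization k H R ⊗[k] Bosonization k H R) =
      (inclR a ⊗ₜ 1) * Phi z := by
  induction z with
  | zero => simp
  | add s t hs ht => simp only [map_add, mul_add, hs, ht]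
  | tmul b c =>
    rw [LinearMap.rTensor_tmul, Phi_tmul, Phi_tmul, ← mul_assoc]
    simp

theorem Phi_rmul (d : R) (z : R ⊗[k] R) :
    (Phi (((LinearMap.mul k R).flip d).lTensor R z) :
      Bosonization k H R ⊗[k] Bosonization k H R) = Phi z * u d := by
  induction z with
  | zero => simp
  | add s t hs ht => simp only [map_add, add_mul, hs, ht]
  | tmul b c =>
    rw [LinearMap.lTensor_tmul, Phi_tmul, Phi_tmul, mul_assoc]
    simp

theorem braidedMul_tmul (a b c d : R) :
    braidedMul (k := k) (H := H) act coact ((a ⊗ₜ[k] b) ⊗ₜ[k] (c ⊗ₜ[k] d)) =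
      (LinearMap.mul k R a).rTensor R (((LinearMap.mul k R).flip d).lTensor R
        (braid (k := k) (H := H) coact act (b ⊗ₜ c))) := by
  simp only [braidedMul, LinearMap.comp_apply, LinearEquiv.coe_coe, TensorProduct.assoc_tmul,
    LinearMap.lTensor_tmul, TensorProduct.assoc_symm_tmul, LinearMap.rTensor_tmul]
  generalize braid (k := k) (H := H) coact act (b ⊗ₜ[k] c) = t
  induction t with
  | zero => simp
  | add s t hs ht => simp only [map_add, TensorProduct.add_tmul, TensorProduct.tmul_add, hs, ht]
  | tmul x y => simp

theorem Phi_braidedMul (x y : R ⊗[k] R) :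
    (Phi (braidedMul (k := k) (H := H) act coact (x ⊗ₜ[k] y)) :
      Bosonization k H R ⊗[k] Bosonization k H R) = Phi x * Phi y := by
  induction x with
  | zero => simp
  | add s t hs ht => simp only [map_add, TensorProduct.add_tmul, hs, ht, add_mul]
  | tmul a b =>
    induction y with
    | zero => simp
    | add s t hs ht => simp only [map_add, TensorProduct.tmul_add, hs, ht, mul_add]
    | tmul c d =>
      rw [braidedMul_tmul, Phi_lmul, Phi_rmul, ← u_mul_inclR, Phi_tmul, Phi_tmul]
      simp only [mul_assoc]

theorem Phi_comul_mul (r s : R) :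
    (Phi (comul (r * s)) : Bosonization k H R ⊗[k] Bosonization k H R) =
      Phi (comul (R := k) r) * Phi (comul (R := k) s) := by
  rw [YDHopfAlgebra.comul_mul (k := k) (H := H), Phi_braidedMul]

/-- The comultiplication on `R`. -/
noncomputable def comulR : R →ₐ[k] Bosonization k H R ⊗[k] Bosonization k H R :=
  AlgHom.ofLinearMap (Phi ∘ₗ comul)
    (by simp [YDHopfAlgebra.comul_one (k := k) (H := H), Algebra.TensorProduct.one_def])
    (fun r s => Phi_comul_mul r s)

theorem comulR_apply (r : R) : (comulR r : Bosonization k H R ⊗[k] Bosonization k H R) =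
    Phi (comul r) := rfl

/-- The comultiplication on `H`. -/
noncomputable def comulH : H →ₐ[k] Bosonization k H R ⊗[k] Bosonization k H R :=
  (Algebra.TensorProduct.map inclH inclH).comp (Bialgebra.comulAlgHom k H)

theorem comulH_apply (h : H) : (comulH h : Bosonization k H R ⊗[k] Bosonization k H R) =
    Algebra.TensorProduct.map inclH inclH (comul (R := k) h) := rfl

/-- Convolution of maps into an algebra. -/
noncomputable abbrev cmul {X : Type*} [Ring X] [Algebra k X] (f g : H →ₗ[k] X) : H →ₗ[k] X :=
  conv (LinearMap.mul k X) f g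

theorem cmul_assoc {X : Type*} [Ring X] [Algebra k X] (f g h : H →ₗ[k] X) :
    cmul (cmul f g) h = cmul f (cmul g h) := conv_assoc (by simp [mul_assoc])

theorem cmul_mul {X : Type*} [Ring X] [Algebra k X] (f g : H →ₗ[k] X) (x : X) (h : H) :
    cmul f g h * x = cmul f ((LinearMap.mul k X).flip x ∘ₗ g) h := by
  have := map_conv ((LinearMap.mul k X).flip x) (LinearMap.mul k X) f g h
  simp only [LinearMap.flip_apply, LinearMap.mul_apply'] at this
  rw [this]
  exact LinearMap.congr_fun (conv_congr (by simp [mul_assoc])) h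

theorem cmul_mul_left {X : Type*} [Ring X] [Algebra k X] (f g : H →ₗ[k] X) (x : X) (h : H) :
    x * cmul f g h = cmul (LinearMap.mul k X x ∘ₗ f) g h := by
  have := map_conv (LinearMap.mul k X x) (LinearMap.mul k X) f g h
  simp only [LinearMap.mul_apply'] at this
  rw [this]
  exact LinearMap.congr_fun (conv_congr (by simp [mul_assoc])) h

theorem cmul_zero_left {X : Type*} [Ring X] [Algebra k X] (g : H →ₗ[k] X) : cmul 0 g = 0 := by
  ext h
  exact lift_conv_congr (T := 0) (by simp) h

theorem cmul_add_left {X : Type*} [Ring X] [Algebra k X] (f f' g : H →ₗ[k] X) :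
    cmul (f + f') g = cmul f g + cmul f' g := by
  ext h
  exact lift_conv_congr (T := TensorProduct.lift ((LinearMap.mul k X).compl₁₂ f g) +
    TensorProduct.lift ((LinearMap.mul k X).compl₁₂ f' g)) (by simp) h

theorem cmul_mul_middle {X : Type*} [Ring X] [Algebra k X] (f g : H →ₗ[k] X) (x : X) :
    cmul ((LinearMap.mul k X).flip x ∘ₗ f) g = cmul f (LinearMap.mul k X x ∘ₗ g) :=
  conv_congr (by simp [mul_assoc])

/-- `h ↦ (1 # h) ⊗ 1`. -/
noncomputable def gam : H →ₗ[k] Bosonization k H R ⊗[k] Bosonization k H R :=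
  (TensorProduct.mk k _ _).flip 1 ∘ₗ inclH.toLinearMap

/-- `h ↦ 1 ⊗ (1 # h)`. -/
noncomputable def del : H →ₗ[k] Bosonization k H R ⊗[k] Bosonization k H R :=
  TensorProduct.mk k _ _ 1 ∘ₗ inclH.toLinearMap

/-- `h ↦ h a ⊗ 1`. -/
noncomputable def alp (a : R) : H →ₗ[k] Bosonization k H R ⊗[k] Bosonization k H R :=
  (TensorProduct.mk k _ _).flip 1 ∘ₗ inclR.toLinearMap ∘ₗ (act : H →ₗ[k] Module.End k R).flip a

/-- `h ↦ u (h b)`. -/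
noncomputable def bet (b : R) : H →ₗ[k] Bosonization k H R ⊗[k] Bosonization k H R :=
  u.toLinearMap ∘ₗ (act : H →ₗ[k] Module.End k R).flip b

/-- `h ↦ ∑ b₍₋₁₎ ⊗ h b₍₀₎`. -/
noncomputable def kap (b : R) : H →ₗ[k] Bosonization k H R ⊗[k] Bosonization k H R :=
  J.toLinearMap ∘ₗ (LinearMap.lTensorHom H ∘ₗ (act : H →ₗ[k] Module.End k R)).flip (coact b)

theorem comulH_eq : (comulH : H →ₐ[k] Bosonization k H R ⊗[k] Bosonization k H R).toLinearMap =
    cmul gam del := by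
  ext h
  refine (lift_conv_congr (T := (Algebra.TensorProduct.map inclH inclH).toLinearMap) ?_ h).symm
  simp [gam, del]

theorem gam_mul (a : R) : (LinearMap.mul k (Bosonization k H R ⊗[k] Bosonization k H R)).flip
    (inclR a ⊗ₜ 1) ∘ₗ gam = cmul (alp a) gam := by
  ext h
  have := lift_conv_congr (μ := LinearMap.mul k (Bosonization k H R ⊗[k] Bosonization k H R))
    (f := alp a) (g := gam) (T := (TensorProduct.mk k _ _).flip 1 ∘ₗ mk.toLinearMap ∘ₗ
      (TensorProduct.map ((act : H →ₗ[k] Module.End k R).flip a) LinearMap.id))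
    (by intro x y; simp [alp, gam, inclR_mul_inclH]) h
  rw [this]
  simp [gam, inclH_mul_inclR]

theorem del_comm (x : Bosonization k H R) :
    (LinearMap.mul k (Bosonization k H R ⊗[k] Bosonization k H R)).flip (x ⊗ₜ 1) ∘ₗ del =
    LinearMap.mul k (Bosonization k H R ⊗[k] Bosonization k H R) (x ⊗ₜ 1) ∘ₗ del := by
  ext h
  simp [del]

theorem J_rmul (y : H) (t : H ⊗[k] R) :
    (J (((LinearMap.mul k H).flip y).rTensor R t) : Bosonization k H R ⊗[k] Bosonization k H R) =
      J t * (inclH y ⊗ₜ 1) := by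
  induction t with
  | zero => simp
  | add s t hs ht => simp only [map_add, add_mul, hs, ht]
  | tmul g r => simp

theorem J_lmul (y : H) (t : H ⊗[k] R) :
    (J ((LinearMap.mul k H y).rTensor R t) : Bosonization k H R ⊗[k] Bosonization k H R) =
      (inclH y ⊗ₜ 1) * J t := by
  induction t with
  | zero => simp
  | add s t hs ht => simp only [map_add, mul_add, hs, ht]
  | tmul g r => simp

theorem bet_gam (b : R) : cmul (bet b) gam = cmul gam (kap (k := k) (H := H) b) := by
  have hfree := (freeLeft_iff (BialgHom.id k H) (act : H →ₗ[k] Module.End k R) coact).2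
    (YDHopfAlgebra.isYD (k := k) (H := H) (R := R)).compat
  unfold FreeLeft at hfree
  ext h
  let F : (R →ₗ[k] H ⊗[k] R) →ₗ[k] Bosonization k H R ⊗[k] Bosonization k H R :=
    J.toLinearMap ∘ₗ LinearMap.applyₗ b
  have e := congrArg F (LinearMap.congr_fun hfree h)
  rw [map_conv, map_conv] at e
  refine (LinearMap.congr_fun (conv_congr ?_) h).trans
    (e.trans (LinearMap.congr_fun (conv_congr ?_) h))
  · intro x y
    have := J_rmul (k := k) (H := H) (R := R) y (coact ((act : H →ₗ[k] Module.End k R) x b))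
    simpa [bet, gam, F, u_apply] using this.symm
  · intro x y
    have := J_lmul (k := k) (H := H) (R := R) x
      (LinearMap.lTensor H ((act : H →ₗ[k] Module.End k R) y) (coact b))
    simpa [kap, gam, F] using this

theorem kap_del (b : R) : cmul (kap b) del = (LinearMap.mul k
    (Bosonization k H R ⊗[k] Bosonization k H R)).flip (u b) ∘ₗ del := by
  ext h
  rw [u_apply, kap]
  generalize (coact b : H ⊗[k] R) = t
  induction t with
  | zero => simp [cmul_zero_left]
  | add s t hs ht =>
    simp only [map_add, LinearMap.comp_add, LinearMap.add_comp, cmul_add_left,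
      LinearMap.add_apply, hs, ht]
  | tmul g r =>
    have := lift_conv_congr (μ := LinearMap.mul k (Bosonization k H R ⊗[k] Bosonization k H R))
      (f := J.toLinearMap ∘ₗ
        (LinearMap.lTensorHom H ∘ₗ (act : H →ₗ[k] Module.End k R)).flip (g ⊗ₜ r)) (g := del)
      (T := TensorProduct.mk k _ _ (inclH g) ∘ₗ mk.toLinearMap ∘ₗ
        (TensorProduct.map ((act : H →ₗ[k] Module.End k R).flip r) LinearMap.id))
      (by intro x y; simp [del, inclR_mul_inclH]) h
    rw [this]
    simp [del, inclH_mul_inclR]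

/-- `h ↦ Φ (h t)`. -/
noncomputable def PhiAct (t : R ⊗[k] R) :
    H →ₗ[k] Bosonization k H R ⊗[k] Bosonization k H R :=
  Phi ∘ₗ (tensorAct (act : H →ₗ[k] Module.End k R) (act : H →ₗ[k] Module.End k R)).flip t

theorem alp_bet (a b : R) : cmul (alp a) (bet b) = PhiAct (k := k) (H := H) (a ⊗ₜ b) := by
  ext h
  let F : Module.End k (R ⊗[k] R) →ₗ[k] Bosonization k H R ⊗[k] Bosonization k H R :=
    Phi ∘ₗ LinearMap.applyₗ (a ⊗ₜ b)
  have := map_conv F (TensorProduct.mapBilinear (RingHom.id k) R R R R)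
    (act : H →ₗ[k] Module.End k R) (act : H →ₗ[k] Module.End k R) h
  refine Eq.trans (LinearMap.congr_fun (conv_congr ?_) h) this.symm
  intro x y
  simp [alp, bet, F]

theorem comulH_mul_Phi (t : R ⊗[k] R) (h : H) :
    (comulH h : Bosonization k H R ⊗[k] Bosonization k H R) * Phi t =
      cmul (PhiAct t) comulH.toLinearMap h := by
  induction t with
  | zero => simp [PhiAct, cmul_zero_left]
  | add s t hs ht =>
    simp only [PhiAct, map_add, mul_add, hs, ht, LinearMap.comp_add, cmul_add_left,
      LinearMap.add_apply]
  | tmul a b =>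
    have e1 : ∀ h, comulH h * (inclR a ⊗ₜ 1) =
        cmul (alp a) (comulH : H →ₐ[k] Bosonization k H R ⊗[k] Bosonization k H R).toLinearMap h := by
      intro h
      rw [← AlgHom.toLinearMap_apply, comulH_eq, cmul_mul, del_comm, ← cmul_mul_middle, gam_mul,
        cmul_assoc]
    have e2 : (LinearMap.mul k (Bosonization k H R ⊗[k] Bosonization k H R)).flip (u b) ∘ₗ
        comulH.toLinearMap =
        cmul (bet b) (comulH : H →ₐ[k] Bosonization k H R ⊗[k] Bosonization k H R).toLinearMap := by
      rw [comulH_eq, ← cmul_assoc, bet_gam, cmul_assoc, kap_del]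
      ext h
      exact cmul_mul _ _ _ _
    rw [Phi_tmul, ← mul_assoc, e1, cmul_mul, e2, ← cmul_assoc, alp_bet]

theorem comulH_mul_comulR (h : H) (r : R) :
    (comulH h : Bosonization k H R ⊗[k] Bosonization k H R) * comulR r =
      LinearMap.mul' k (Bosonization k H R ⊗[k] Bosonization k H R)
      (TensorProduct.map ((comulR : R →ₐ[k] Bosonization k H R ⊗[k] Bosonization k H R).toLinearMap ∘ₗ
          (act : H →ₗ[k] Module.End k R).flip r)
        (comulH : H →ₐ[k] Bosonization k H R ⊗[k] Bosonization k H R).toLinearMap (comul h)) := by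
  rw [comulR_apply, comulH_mul_Phi]
  refine lift_conv_congr (T := LinearMap.mul' k (Bosonization k H R ⊗[k] Bosonization k H R) ∘ₗ
    TensorProduct.map ((comulR : R →ₐ[k] Bosonization k H R ⊗[k] Bosonization k H R).toLinearMap ∘ₗ
      (act : H →ₗ[k] Module.End k R).flip r) comulH.toLinearMap) ?_ h
  intro x y
  have := (YDHopfAlgebra.comul_hom (k := k) (H := H) (R := R)).map_act x r
  simp [PhiAct, comulR_apply, this]

/-- The comultiplication `r # h ↦ ∑ r₍₁₎ # (r₍₂₎)₍₋₁₎ h₍₁₎ ⊗ (r₍₂₎)₍₀₎ # h₍₂₎`. -/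
noncomputable def comulHom :
    Bosonization k H R →ₐ[k] Bosonization k H R ⊗[k] Bosonization k H R :=
  lift comulR comulH comulH_mul_comulR

/-- The counit of `R` as an algebra map. -/
noncomputable def counitR : R →ₐ[k] k :=
  AlgHom.ofLinearMap counit (YDHopfAlgebra.counit_one (k := k) (H := H))
    (YDHopfAlgebra.counit_mul (k := k) (H := H))

/-- The counit `r # h ↦ ε(r) ε(h)`. -/
noncomputable def counitHom : Bosonization k H R →ₐ[k] k :=
  lift (counitR (k := k) (H := H)) (Bialgebra.counitAlgHom k H) (by
    intro h r
    have : ∀ x, counit (R := k) ((act : H →ₗ[k] Module.End k R) x r) = counit (R := k) x * counit r :=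
      fun x => (YDHopfAlgebra.counit_hom (k := k) (H := H) (R := R)).map_act x r
    have e : LinearMap.mul' k k (TensorProduct.map ((counitR (k := k) (H := H)).toLinearMap ∘ₗ
        (act : H →ₗ[k] Module.End k R).flip r) (Bialgebra.counitAlgHom k H).toLinearMap (comul h)) =
        counit r * counit (R := k) (TensorProduct.lid k H (counit.rTensor H (comul h))) := by
      generalize comul (R := k) h = t
      induction t with
      | zero => simp
      | add s t hs ht => simp only [map_add, hs, ht, mul_add]
      | tmul a b => simp [counitR, this]; ring
    rw [e]
    simp [counitR, mul_comm])

end Bosonization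

end BosonizationHopf

section BosonizationHopf2

variable {k : Type u} [Field k] {H : Type v} [Ring H] [HopfAlgebra k H]

namespace Bosonization

open YDHopfAlgebra (act coact)

variable {R : Type w} [Ring R] [Algebra k R] [Coalgebra k R] [YDHopfAlgebra k H R]

theorem coact_counit (m : R) : counit.rTensor R (coact m : H ⊗[k] R) = (1 : k) ⊗ₜ[k] m :=
  (YDHopfAlgebra.isYD (k := k) (H := H) (R := R)).counit m

theorem coact_counit_right (r : R) :
    counit.lTensor H (coact r : H ⊗[k] R) = (1 : H) ⊗ₜ[k] counit (R := k) r :=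
  ((YDHopfAlgebra.counit_hom (k := k) (H := H) (R := R)).map_coact r).symm

@[simp] theorem counitHom_inclR (r : R) :
    counitHom (inclR r : Bosonization k H R) = counit (R := k) r := lift_inclR _ _ _ r

@[simp] theorem counitHom_inclH (h : H) :
    counitHom (inclH h : Bosonization k H R) = counit (R := k) h := lift_inclH _ _ _ h

@[simp] theorem comulHom_inclR (r : R) :
    comulHom (inclR r : Bosonization k H R) = Phi (comul (R := k) r) := lift_inclR _ _ _ r

@[simp] theorem comulHom_inclH (h : H) : comulHom (inclH h : Bosonization k H R) =
    Algebra.TensorProduct.map inclH inclH (comul (R := k) h) := lift_inclH _ _ _ h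

theorem rTensor_comulHom : (Algebra.TensorProduct.map counitHom (.id k (Bosonization k H R))).comp
    comulHom = (Algebra.TensorProduct.lid k (Bosonization k H R)).symm := by
  refine algHom_ext (fun r => ?_) (fun h => ?_)
  · have hu : ∀ b : R, Algebra.TensorProduct.map counitHom (.id k (Bosonization k H R)) (u b) =
        1 ⊗ₜ inclR b := by
      intro b
      have : ∀ t : H ⊗[k] R,
          Algebra.TensorProduct.map counitHom (.id k (Bosonization k H R)) (J t) =
          (inclR (k := k) (H := H) (R := R)).toLinearMap.lTensor k (counit.rTensor R t) := by
        intro t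
        induction t with
        | zero => simp
        | add s t hs ht => simp only [map_add, hs, ht]
        | tmul g r => simp
      rw [u_apply, this, coact_counit]
      simp
    have hP : ∀ t : R ⊗[k] R,
        Algebra.TensorProduct.map counitHom (.id k (Bosonization k H R)) (Phi t) =
        (inclR (k := k) (H := H) (R := R)).toLinearMap.lTensor k (counit.rTensor R t) := by
      intro t
      induction t with
      | zero => simp
      | add s t hs ht => simp only [map_add, hs, ht]
      | tmul a b =>
        rw [Phi_tmul, map_mul, hu]
        simp
    simp only [AlgHom.comp_apply, comulHom_inclR, hP]
    simp
  · have hP : ∀ t : H ⊗[k] H,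
        Algebra.TensorProduct.map counitHom (.id k (Bosonization k H R))
          (Algebra.TensorProduct.map (inclH (k := k) (H := H) (R := R)) (inclH (k := k) (H := H) (R := R)) t) =
        (inclH (k := k) (H := H) (R := R)).toLinearMap.lTensor k (counit.rTensor H t) := by
      intro t
      induction t with
      | zero => simp
      | add s t hs ht => simp only [map_add, hs, ht]
      | tmul a b => simp
    simp only [AlgHom.comp_apply, comulHom_inclH, hP]
    simp

theorem lTensor_comulHom : (Algebra.TensorProduct.map (.id k (Bosonization k H R)) counitHom).comp
    comulHom = (Algebra.TensorProduct.rid k k (Bosonization k H R)).symm := by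
  refine algHom_ext (fun r => ?_) (fun h => ?_)
  · have hu : ∀ b : R, Algebra.TensorProduct.map (.id k (Bosonization k H R)) counitHom (u b) =
        1 ⊗ₜ counit (R := k) b := by
      intro b
      have : ∀ t : H ⊗[k] R,
          Algebra.TensorProduct.map (.id k (Bosonization k H R)) counitHom (J t) =
          (inclH (k := k) (H := H) (R := R)).toLinearMap.rTensor k (counit.lTensor H t) := by
        intro t
        induction t with
        | zero => simp
        | add s t hs ht => simp only [map_add, hs, ht]
        | tmul g r => simp
      rw [u_apply, this, coact_counit_right]
      simp
    have hP : ∀ t : R ⊗[k] R,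
        Algebra.TensorProduct.map (.id k (Bosonization k H R)) counitHom (Phi t) =
        (inclR (k := k) (H := H) (R := R)).toLinearMap.rTensor k (counit.lTensor R t) := by
      intro t
      induction t with
      | zero => simp
      | add s t hs ht => simp only [map_add, hs, ht]
      | tmul a b =>
        rw [Phi_tmul, map_mul, hu]
        simp
    simp only [AlgHom.comp_apply, comulHom_inclR, hP]
    simp
  · have hP : ∀ t : H ⊗[k] H,
        Algebra.TensorProduct.map (.id k (Bosonization k H R)) counitHom
          (Algebra.TensorProduct.map (inclH (k := k) (H := H) (R := R)) (inclH (k := k) (H := H) (R := R)) t) =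
        (inclH (k := k) (H := H) (R := R)).toLinearMap.rTensor k (counit.lTensor H t) := by
      intro t
      induction t with
      | zero => simp
      | add s t hs ht => simp only [map_add, hs, ht]
      | tmul a b => simp
    simp only [AlgHom.comp_apply, comulHom_inclH, hP]
    simp

/-- `c ↦ ∑ c₍₋₂₎ ⊗ c₍₋₁₎ ⊗ c₍₀₎`. -/
noncomputable def U : R →ₗ[k] Bosonization k H R ⊗[k] (Bosonization k H R ⊗[k] Bosonization k H R) :=
  TensorProduct.map (inclH (k := k) (H := H) (R := R)).toLinearMap u.toLinearMap ∘ₗ coact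

theorem assoc_comul_u (c : R) :
    Algebra.TensorProduct.assoc k k k _ _ _
      (Algebra.TensorProduct.map comulHom (.id k (Bosonization k H R)) (u c)) = U c := by
  let T : H ⊗[k] (H ⊗[k] R) →ₗ[k]
      Bosonization k H R ⊗[k] (Bosonization k H R ⊗[k] Bosonization k H R) :=
    TensorProduct.map (inclH (k := k) (H := H) (R := R)).toLinearMap J.toLinearMap
  have h1 : ∀ t : H ⊗[k] R, Algebra.TensorProduct.assoc k k k _ _ _
      (Algebra.TensorProduct.map comulHom (.id k (Bosonization k H R)) (J t)) =
      T (TensorProduct.assoc k H H R (comul.rTensor R t)) := by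
    intro t
    induction t with
    | zero => simp
    | add s t hs ht => simp only [map_add, hs, ht]
    | tmul g r =>
      simp only [J_tmul, Algebra.TensorProduct.map_tmul, comulHom_inclH, LinearMap.rTensor_tmul,
        AlgHom.id_apply]
      generalize comul (R := k) g = s
      induction s with
      | zero => simp
      | add s t hs ht => simp only [map_add, TensorProduct.add_tmul, hs, ht]
      | tmul a b => simp [T]
  rw [u_apply, h1, coact_coassoc, U]
  simp only [LinearMap.comp_apply]
  generalize (coact c : H ⊗[k] R) = t
  induction t with
  | zero => simp
  | add s t hs ht => simp only [map_add, hs, ht]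
  | tmul g r => simp [T, u_apply]

/-- `b ⊗ c ↦ (u b ⊗ 1) U c`. -/
noncomputable def V : R ⊗[k] R →ₗ[k]
    Bosonization k H R ⊗[k] (Bosonization k H R ⊗[k] Bosonization k H R) :=
  TensorProduct.lift ((LinearMap.mul k
      (Bosonization k H R ⊗[k] (Bosonization k H R ⊗[k] Bosonization k H R))).compl₁₂
    ((Algebra.TensorProduct.assoc k k k (Bosonization k H R) (Bosonization k H R)
      (Bosonization k H R)).toLinearMap ∘ₗ (TensorProduct.mk k _ _).flip 1 ∘ₗ u.toLinearMap) U)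

theorem V_tmul (b c : R) : V (k := k) (H := H) (b ⊗ₜ c) =
    Algebra.TensorProduct.assoc k k k (Bosonization k H R) (Bosonization k H R)
      (Bosonization k H R) (u b ⊗ₜ 1) * U c := rfl

theorem map_comul_u (b : R) :
    Algebra.TensorProduct.map (.id k (Bosonization k H R)) comulHom (u b) = V (comul b) := by
  have h1 : ∀ t : H ⊗[k] R, Algebra.TensorProduct.map (.id k (Bosonization k H R)) comulHom (J t) =
      TensorProduct.map (inclH (k := k) (H := H) (R := R)).toLinearMap Phi (comul.lTensor H t) := by
    intro t
    induction t with
    | zero => simp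
    | add s t hs ht => simp only [map_add, hs, ht]
    | tmul g r => simp
  have h2 := (YDHopfAlgebra.comul_hom (k := k) (H := H) (R := R)).map_coact b
  rw [u_apply, h1, ← h2]
  generalize comul (R := k) b = t
  induction t with
  | zero => simp
  | add s t hs ht => simp only [map_add, hs, ht]
  | tmul b c =>
    rw [tensorCoactLeft_tmul, V_tmul, u_apply, U, LinearMap.comp_apply]
    generalize (coact b : H ⊗[k] R) = s
    generalize (coact c : H ⊗[k] R) = t
    induction s with
    | zero => simp
    | add s t hs ht => simp only [map_add, TensorProduct.add_tmul, hs, ht, add_mul]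
    | tmul g x =>
      induction t with
      | zero => simp
      | add s t hs ht => simp only [map_add, TensorProduct.tmul_add, hs, ht, mul_add]
      | tmul h y => simp

/-- `a ⊗ t ↦ a V(t)`. -/
noncomputable def Om : R ⊗[k] (R ⊗[k] R) →ₗ[k]
    Bosonization k H R ⊗[k] (Bosonization k H R ⊗[k] Bosonization k H R) :=
  TensorProduct.lift ((LinearMap.mul k
      (Bosonization k H R ⊗[k] (Bosonization k H R ⊗[k] Bosonization k H R))).compl₁₂
    ((TensorProduct.mk k _ _).flip 1 ∘ₗ inclR.toLinearMap) V)

theorem Om_tmul (a : R) (t : R ⊗[k] R) : Om (k := k) (H := H) (a ⊗ₜ t) =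
    (inclR a ⊗ₜ 1) * V t := rfl

theorem map_id_comul_Phi (t : R ⊗[k] R) :
    Algebra.TensorProduct.map (.id k (Bosonization k H R)) comulHom (Phi t) =
      Om (comul.lTensor R t) := by
  induction t with
  | zero => simp
  | add s t hs ht => simp only [map_add, hs, ht]
  | tmul a b =>
    rw [Phi_tmul, map_mul, map_comul_u, LinearMap.lTensor_tmul, Om_tmul]
    simp

theorem map_comul_id_Phi (t : R ⊗[k] R) :
    Algebra.TensorProduct.assoc k k k _ _ _
      (Algebra.TensorProduct.map comulHom (.id k (Bosonization k H R)) (Phi t)) =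
      Om (TensorProduct.assoc k R R R (comul.rTensor R t)) := by
  induction t with
  | zero => simp
  | add s t hs ht => simp only [map_add, hs, ht]
  | tmul a b =>
    rw [Phi_tmul, map_mul, map_mul, assoc_comul_u, LinearMap.rTensor_tmul,
      Algebra.TensorProduct.map_tmul, comulHom_inclR, map_one]
    generalize comul (R := k) a = s
    induction s with
    | zero => simp
    | add s t hs ht => simp only [map_add, TensorProduct.add_tmul, add_mul, hs, ht]
    | tmul x y =>
      rw [TensorProduct.assoc_tmul, Om_tmul, V_tmul, Phi_tmul]
      refine Eq.trans ?_ (mul_assoc _ _ _)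
      congr 1
      have : ((inclR x ⊗ₜ 1 * u y) ⊗ₜ[k] 1 : (Bosonization k H R ⊗[k] Bosonization k H R) ⊗[k]
          Bosonization k H R) = ((inclR x ⊗ₜ 1) ⊗ₜ 1) * (u y ⊗ₜ 1) := by simp
      rw [this, map_mul]
      rfl

theorem coassoc_comulHom : (Algebra.TensorProduct.assoc k k k (Bosonization k H R)
      (Bosonization k H R) (Bosonization k H R)).toAlgHom.comp
      ((Algebra.TensorProduct.map (comulHom (k := k) (H := H) (R := R)) (.id k (Bosonization k H R))).comp (comulHom (k := k) (H := H) (R := R))) =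
    (Algebra.TensorProduct.map (.id k (Bosonization k H R)) (comulHom (k := k) (H := H) (R := R))).comp (comulHom (k := k) (H := H) (R := R)) := by
  refine algHom_ext (fun r => ?_) (fun h => ?_)
  · simp only [AlgHom.comp_apply, comulHom_inclR, map_id_comul_Phi, ← coassoc_apply]
    exact map_comul_id_Phi _
  · have h1 : ∀ t : H ⊗[k] H, Algebra.TensorProduct.assoc k k k _ _ _
        (Algebra.TensorProduct.map comulHom (.id k (Bosonization k H R))
          (Algebra.TensorProduct.map (inclH (k := k) (H := H) (R := R)) (inclH (k := k) (H := H) (R := R)) t)) =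
        TensorProduct.map (inclH (k := k) (H := H) (R := R)).toLinearMap (TensorProduct.map (inclH (k := k) (H := H) (R := R)).toLinearMap inclH.toLinearMap)
          (TensorProduct.assoc k H H H (comul.rTensor H t)) := by
      intro t
      induction t with
      | zero => simp
      | add s t hs ht => simp only [map_add, hs, ht]
      | tmul g r =>
        simp only [Algebra.TensorProduct.map_tmul, comulHom_inclH, LinearMap.rTensor_tmul,
          AlgHom.id_apply]
        generalize comul (R := k) g = s
        induction s with
        | zero => simp
        | add s t hs ht => simp only [map_add, TensorProduct.add_tmul, hs, ht]
        | tmul a b => simp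
    have h2 : ∀ t : H ⊗[k] H,
        (Algebra.TensorProduct.map (.id k (Bosonization k H R)) comulHom
          (Algebra.TensorProduct.map (inclH (k := k) (H := H) (R := R)) (inclH (k := k) (H := H) (R := R)) t)) =
        TensorProduct.map (inclH (k := k) (H := H) (R := R)).toLinearMap (TensorProduct.map (inclH (k := k) (H := H) (R := R)).toLinearMap inclH.toLinearMap)
          (comul.lTensor H t) := by
      intro t
      induction t with
      | zero => simp
      | add s t hs ht => simp only [map_add, hs, ht]
      | tmul g r =>
        simp only [Algebra.TensorProduct.map_tmul, comulHom_inclH, LinearMap.lTensor_tmul,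
          AlgHom.id_apply, TensorProduct.map_tmul]
        rfl
    simp only [AlgHom.comp_apply, comulHom_inclH, h2, ← coassoc_apply]
    exact h1 _

noncomputable instance : Bialgebra k (Bosonization k H R) :=
  Bialgebra.ofAlgHom comulHom counitHom coassoc_comulHom rTensor_comulHom lTensor_comulHom

theorem comul_eq (a : Bosonization k H R) : comul (R := k) a = comulHom a := rfl

theorem counit_eq (a : Bosonization k H R) : counit (R := k) a = counitHom a := rfl

/-- The antipode on `R`: `r ↦ ∑ (1 # S(r₍₋₁₎)) (S_R(r₍₀₎) # 1)`. -/
noncomputable def antipodeR : R →ₗ[k] Bosonization k H R :=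
  TensorProduct.lift ((LinearMap.mul k (Bosonization k H R)).compl₁₂
    (inclH.toLinearMap ∘ₗ antipode k)
    (inclR.toLinearMap ∘ₗ YDHopfAlgebra.antipode H)) ∘ₗ coact

/-- The antipode `r # h ↦ ∑ (1 # S(h)) (1 # S(r₍₋₁₎)) (S_R(r₍₀₎) # 1)`. -/
noncomputable def antipodeMap : Bosonization k H R →ₗ[k] Bosonization k H R :=
  TensorProduct.lift ((LinearMap.mul k (Bosonization k H R)).flip.compl₁₂
    antipodeR (inclH.toLinearMap ∘ₗ antipode k)) ∘ₗ mk.symm.toLinearMap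

theorem antipodeMap_apply (r : R) (h : H) :
    antipodeMap (inclR r * inclH h : Bosonization k H R) =
      inclH (antipode k h) * antipodeR r := by
  rw [inclR_mul_inclH]; rfl

end Bosonization

end BosonizationHopf2

section BosonizationAntipode

variable {k : Type u} [Field k] {H : Type v} [Ring H] [HopfAlgebra k H]

namespace Bosonization

open YDHopfAlgebra (act coact)

variable {R : Type w} [Ring R] [Algebra k R] [Coalgebra k R] [YDHopfAlgebra k H R]

theorem antipodeR_apply (r : R) : (antipodeR r : Bosonization k H R) =
    TensorProduct.lift ((LinearMap.mul k (Bosonization k H R)).compl₁₂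
      (inclH.toLinearMap ∘ₗ antipode k)
      (inclR.toLinearMap ∘ₗ YDHopfAlgebra.antipode H)) (coact r) := rfl

theorem antipodeMap_inclR (r : R) : antipodeMap (inclR r : Bosonization k H R) = antipodeR r := by
  have := antipodeMap_apply (k := k) (H := H) r 1
  simpa using this

theorem antipodeMap_mul_inclH (b : Bosonization k H R) (h : H) :
    antipodeMap (b * inclH h) = inclH (antipode k h) * antipodeMap b := by
  refine mul_induction (p := fun b => antipodeMap (b * inclH h) =
    inclH (antipode k h) * antipodeMap b) b (fun r g => ?_) (fun a b ha hb => ?_)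
  · rw [mul_assoc, ← map_mul, antipodeMap_apply, antipodeMap_apply, antipode_mul_antidistrib,
      map_mul, mul_assoc]
  · rw [add_mul, map_add, map_add, ha, hb, mul_add]

theorem inclH_coact_antipodeR (b : R) :
    TensorProduct.lift ((LinearMap.mul k (Bosonization k H R)).compl₁₂
      inclH.toLinearMap antipodeR) (coact b) = inclR (YDHopfAlgebra.antipode (k := k) H b) := by
  let T : H ⊗[k] (H ⊗[k] R) →ₗ[k] Bosonization k H R :=
    TensorProduct.lift ((LinearMap.mul k (Bosonization k H R)).compl₁₂ inclH.toLinearMap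
      (TensorProduct.lift ((LinearMap.mul k (Bosonization k H R)).compl₁₂
      (inclH.toLinearMap ∘ₗ antipode k)
      (inclR.toLinearMap ∘ₗ YDHopfAlgebra.antipode H))))
  have h1 : ∀ t : H ⊗[k] R, TensorProduct.lift ((LinearMap.mul k (Bosonization k H R)).compl₁₂
      inclH.toLinearMap antipodeR) t = T (coact.lTensor H t) := by
    intro t
    induction t with
    | zero => simp
    | add s t hs ht => simp only [map_add, hs, ht]
    | tmul g r => simp [T, antipodeR_apply]
  have h2 : ∀ t : H ⊗[k] R, T (TensorProduct.assoc k H H R (comul.rTensor R t)) =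
      inclR (YDHopfAlgebra.antipode (k := k) H (TensorProduct.lid k R (counit.rTensor R t))) := by
    intro t
    induction t with
    | zero => simp
    | add s t hs ht => simp only [map_add, hs, ht]
    | tmul g r =>
      have h3 : ∀ s : H ⊗[k] H, T (TensorProduct.assoc k H H R (s ⊗ₜ r)) =
          inclH (LinearMap.mul' k H ((antipode k).lTensor H s)) *
            inclR (YDHopfAlgebra.antipode (k := k) H r) := by
        intro s
        induction s with
        | zero => simp
        | add s t hs ht => simp only [map_add, TensorProduct.add_tmul, add_mul, hs, ht]
        | tmul a b => simp [T, mul_assoc]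
      rw [LinearMap.rTensor_tmul, h3, mul_antipode_lTensor_comul_apply]
      simp [Algebra.algebraMap_eq_smul_one]
  rw [h1, ← coact_coassoc, h2, coact_counit]
  simp

theorem lTensor_antipode_Phi (t : R ⊗[k] R) :
    LinearMap.mul' k (Bosonization k H R) (antipodeMap.lTensor _ (Phi t)) =
      inclR (LinearMap.mul' k R ((YDHopfAlgebra.antipode (k := k) H).lTensor R t)) := by
  induction t with
  | zero => simp
  | add s t hs ht => simp only [map_add, hs, ht]
  | tmul a b =>
    rw [Phi_tmul, LinearMap.lTensor_tmul, LinearMap.mul'_apply, map_mul inclR, ← inclH_coact_antipodeR,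
      u_apply]
    generalize (coact b : H ⊗[k] R) = s
    induction s with
    | zero => simp
    | add s t hs ht => simp only [map_add, mul_add, hs, ht]
    | tmul g r => simp [antipodeMap_inclR, mul_assoc]

theorem rTensor_antipode_Phi (r : R) :
    LinearMap.mul' k (Bosonization k H R) (antipodeMap.rTensor _ (Phi (comul (R := k) r))) =
      algebraMap k _ (counit (R := k) r) := by
  let W : H ⊗[k] (R ⊗[k] R) →ₗ[k] Bosonization k H R :=
    TensorProduct.lift ((LinearMap.mul k (Bosonization k H R)).compl₁₂
      (inclH.toLinearMap ∘ₗ antipode k)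
      (inclR.toLinearMap ∘ₗ LinearMap.mul' k R ∘ₗ (YDHopfAlgebra.antipode (k := k) H).rTensor R))
  have h1 : ∀ t : R ⊗[k] R,
      LinearMap.mul' k (Bosonization k H R) (antipodeMap.rTensor _ (Phi t)) =
        W (tensorCoactLeft coact coact t) := by
    intro t
    induction t with
    | zero => simp
    | add s t hs ht => simp only [map_add, hs, ht]
    | tmul a b =>
      rw [tensorCoactLeft_tmul, Phi_tmul, u_apply]
      generalize (coact b : H ⊗[k] R) = s
      induction s with
      | zero => simp
      | add s t hs ht => simp only [map_add, TensorProduct.tmul_add, mul_add, hs, ht]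
      | tmul g x =>
        rw [J_tmul, Algebra.TensorProduct.tmul_mul_tmul, one_mul, LinearMap.rTensor_tmul,
          LinearMap.mul'_apply, antipodeMap_apply, antipodeR_apply]
        generalize (coact a : H ⊗[k] R) = t
        induction t with
        | zero => simp
        | add s t hs ht => simp only [map_add, TensorProduct.add_tmul, add_mul, mul_add, hs, ht]
        | tmul h y => simp [W, antipode_mul_antidistrib, mul_assoc]
  have h2 : ∀ t : H ⊗[k] R, W (comul.lTensor H t) =
      TensorProduct.lift ((LinearMap.mul k (Bosonization k H R)).compl₁₂
        (inclH.toLinearMap ∘ₗ antipode k) (Algebra.linearMap k _)) (counit.lTensor H t) := by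
    intro t
    induction t with
    | zero => simp
    | add s t hs ht => simp only [map_add, hs, ht]
    | tmul h y =>
      have := YDHopfAlgebra.mul_antipode_rTensor (k := k) (H := H) y
      simp [W, this]
  have h3 := (YDHopfAlgebra.comul_hom (k := k) (H := H) (R := R)).map_coact r
  rw [h1, h3, h2, coact_counit_right]
  simp

theorem antipode_mul_map (z : Bosonization k H R ⊗[k] Bosonization k H R) (h : H) :
    LinearMap.mul' k (Bosonization k H R) (antipodeMap.lTensor _
      (z * Algebra.TensorProduct.map inclH inclH (comul (R := k) h))) =
      counit (R := k) h • LinearMap.mul' k (Bosonization k H R) (antipodeMap.lTensor _ z) := by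
  induction z with
  | zero => simp
  | add s t hs ht => simp only [map_add, add_mul, smul_add, hs, ht]
  | tmul p q =>
    have : ∀ t : H ⊗[k] H, LinearMap.mul' k (Bosonization k H R) (antipodeMap.lTensor _
        ((p ⊗ₜ q) * Algebra.TensorProduct.map inclH inclH t)) =
        p * inclH (LinearMap.mul' k H ((antipode k).lTensor H t)) * antipodeMap q := by
      intro t
      induction t with
      | zero => simp
      | add s t hs ht => simp only [map_add, add_mul, mul_add, hs, ht]
      | tmul a b => simp [antipodeMap_mul_inclH, mul_assoc]
    rw [this, mul_antipode_lTensor_comul_apply]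
    simp [Algebra.algebraMap_eq_smul_one]

theorem antipode_mul_map' (c : k) (z : Bosonization k H R ⊗[k] Bosonization k H R)
    (hz : LinearMap.mul' k (Bosonization k H R) (antipodeMap.rTensor _ z) = algebraMap k _ c)
    (h : H) :
    LinearMap.mul' k (Bosonization k H R) (antipodeMap.rTensor _
      (z * Algebra.TensorProduct.map inclH inclH (comul (R := k) h))) =
      algebraMap k _ (c * counit (R := k) h) := by
  have e : ∀ a b : H, LinearMap.mul' k (Bosonization k H R) (antipodeMap.rTensor _
      (z * (inclH a ⊗ₜ inclH b))) = inclH (antipode k a) *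
        LinearMap.mul' k (Bosonization k H R) (antipodeMap.rTensor _ z) * inclH b := by
    intro a b
    clear hz
    induction z with
    | zero => simp
    | add s t hs ht => simp only [map_add, add_mul, mul_add, hs, ht]
    | tmul p q => simp [antipodeMap_mul_inclH, mul_assoc]
  have : ∀ t : H ⊗[k] H, LinearMap.mul' k (Bosonization k H R) (antipodeMap.rTensor _
      (z * Algebra.TensorProduct.map inclH inclH t)) =
      c • inclH (LinearMap.mul' k H ((antipode k).rTensor H t)) := by
    intro t
    induction t with
    | zero => simp
    | add s t hs ht => simp only [map_add, smul_add, mul_add, hs, ht]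
    | tmul a b =>
      rw [Algebra.TensorProduct.map_tmul, e, hz]
      simp [Algebra.algebraMap_eq_smul_one]
  rw [this, mul_antipode_rTensor_comul_apply]
  simp [Algebra.algebraMap_eq_smul_one, mul_smul]

noncomputable instance : HopfAlgebra k (Bosonization k H R) where
  antipode := antipodeMap
  mul_antipode_rTensor_comul := by
    ext a
    refine mul_induction (p := fun a => LinearMap.mul' k (Bosonization k H R)
      (antipodeMap.rTensor _ (comulHom a)) = algebraMap k _ (counitHom a)) a
      (fun r h => ?_) (fun a b ha hb => ?_)
    · rw [map_mul comulHom, map_mul counitHom, comulHom_inclR, comulHom_inclH, counitHom_inclR, counitHom_inclH]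
      exact antipode_mul_map' _ _ (rTensor_antipode_Phi r) h
    · simp only [map_add, ha, hb]
  mul_antipode_lTensor_comul := by
    ext a
    refine mul_induction (p := fun a => LinearMap.mul' k (Bosonization k H R)
      (antipodeMap.lTensor _ (comulHom a)) = algebraMap k _ (counitHom a)) a
      (fun r h => ?_) (fun a b ha hb => ?_)
    · rw [map_mul comulHom, map_mul counitHom, comulHom_inclR, comulHom_inclH, counitHom_inclR, counitHom_inclH,
        antipode_mul_map, lTensor_antipode_Phi, YDHopfAlgebra.mul_antipode_lTensor]
      simp [Algebra.algebraMap_eq_smul_one, smul_smul, mul_comm]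
    · simp only [map_add, ha, hb]

theorem counit_act (x : H) (r : R) :
    counit (R := k) ((act : H →ₗ[k] Module.End k R) x r) = counit (R := k) x * counit (R := k) r :=
  (YDHopfAlgebra.counit_hom (k := k) (H := H) (R := R)).map_act x r

/-- The projection `R # H → H` as an algebra map. -/
noncomputable def projAlg : Bosonization k H R →ₐ[k] H :=
  lift ((Algebra.ofId k H).comp (counitR (k := k) (H := H))) (AlgHom.id k H) (by
    intro h r
    have e : LinearMap.mul' k H (TensorProduct.map (((Algebra.ofId k H).comp
        (counitR (k := k) (H := H))).toLinearMap ∘ₗ (act : H →ₗ[k] Module.End k R).flip r)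
        (AlgHom.id k H).toLinearMap (comul h)) =
        counit (R := k) r • (TensorProduct.lid k H (counit.rTensor H (comul h))) := by
      generalize comul (R := k) h = t
      induction t with
      | zero => simp
      | add s t hs ht => simp only [map_add, hs, ht, smul_add]
      | tmul a b =>
        simp [counitR, counit_act, Algebra.ofId_apply, Algebra.algebraMap_eq_smul_one, smul_smul,
          mul_comm]
    rw [e]
    simp [counitR, Algebra.ofId_apply, Algebra.algebraMap_eq_smul_one])

@[simp] theorem projAlg_inclR (r : R) : projAlg (inclR r : Bosonization k H R) =
    algebraMap k H (counit r) := lift_inclR _ _ _ r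

@[simp] theorem projAlg_inclH (h : H) : projAlg (inclH h : Bosonization k H R) = h :=
  lift_inclH _ _ _ h

/-- The projection `π : R # H → H`, `r # h ↦ ε(r) h`. -/
noncomputable def proj (k : Type u) [Field k] (H : Type v) [Ring H] [HopfAlgebra k H]
    (R : Type w) [Ring R] [Algebra k R] [Coalgebra k R] [YDHopfAlgebra k H R] :
    Bosonization k H R →ₐc[k] H :=
  BialgHom.ofAlgHom projAlg
    (algHom_ext (fun r => by
        simp only [AlgHom.comp_apply, projAlg_inclR]
        simp [counit_eq, Algebra.algebraMap_eq_smul_one])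
      (fun h => by
        simp only [AlgHom.comp_apply, projAlg_inclH]
        simp [counit_eq]))
    (algHom_ext (fun r => by
        have hu : ∀ t : H ⊗[k] R, Algebra.TensorProduct.map projAlg projAlg
            (J (k := k) (H := H) (R := R) t) =
            (Algebra.linearMap k H).lTensor H (counit.lTensor H t) := by
          intro t
          induction t with
          | zero => simp
          | add s t hs ht => simp only [map_add, hs, ht]
          | tmul g r => simp
        have hP : ∀ t : R ⊗[k] R, Algebra.TensorProduct.map projAlg projAlg
            (Phi (k := k) (H := H) (R := R) t) =
            algebraMap k _ (LinearMap.mul' k k (TensorProduct.map counit counit t)) := by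
          intro t
          induction t with
          | zero => simp
          | add s t hs ht => simp only [map_add, hs, ht]
          | tmul a b =>
            rw [Phi_tmul, map_mul, u_apply, hu, coact_counit_right]
            simp [Algebra.algebraMap_eq_smul_one, Algebra.TensorProduct.one_def, smul_smul,
              TensorProduct.smul_tmul', mul_comm]
        have hc : ∀ t : R ⊗[k] R, LinearMap.mul' k k (TensorProduct.map counit counit t) =
            counit (R := k) (TensorProduct.lid k R (counit.rTensor R t)) := by
          intro t
          induction t with
          | zero => simp
          | add s t hs ht => simp only [map_add, hs, ht]
          | tmul a b => simp
        simp only [AlgHom.comp_apply, projAlg_inclR]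
        change Algebra.TensorProduct.map projAlg projAlg
          (comulHom (inclR r : Bosonization k H R)) = _
        rw [comulHom_inclR, hP, hc]
        simp)
      (fun h => by
        have hP : ∀ t : H ⊗[k] H, Algebra.TensorProduct.map projAlg projAlg
            (Algebra.TensorProduct.map (inclH (k := k) (H := H) (R := R))
              (inclH (k := k) (H := H) (R := R)) t) = t := by
          intro t
          induction t with
          | zero => simp
          | add s t hs ht => simp only [map_add, hs, ht]
          | tmul a b => simp
        simp only [AlgHom.comp_apply, projAlg_inclH]
        change Algebra.TensorProduct.map projAlg projAlg
          (comulHom (inclH h : Bosonization k H R)) = _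
        rw [comulHom_inclH, hP]
        rfl))

theorem proj_mk (r : R) (h : H) : proj k H R (mk (r ⊗ₜ h)) = counit (R := k) r • h := by
  change projAlg (mk (r ⊗ₜ h)) = _
  rw [← inclR_mul_inclH, map_mul, projAlg_inclR, projAlg_inclH, Algebra.smul_def]

/-- The inclusion `H → R # H` as a map of bialgebras. -/
noncomputable def incl (k : Type u) [Field k] (H : Type v) [Ring H] [HopfAlgebra k H]
    (R : Type w) [Ring R] [Algebra k R] [Coalgebra k R] [YDHopfAlgebra k H R] :
    H →ₐc[k] Bosonization k H R :=
  BialgHom.ofAlgHom inclH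
    (by
      ext h
      simp [counit_eq])
    (by
      ext h
      exact (comulHom_inclH h).symm)

/-- The map `ϑ : R # H → R`, `r # h ↦ r ε(h)`. -/
noncomputable def theta (k : Type u) [Field k] (H : Type v) [Ring H] [HopfAlgebra k H]
    (R : Type w) [Ring R] [Algebra k R] : Bosonization k H R →ₗ[k] R :=
  (TensorProduct.rid k R).toLinearMap ∘ₗ counit.lTensor R ∘ₗ mk.symm.toLinearMap

theorem theta_mk (r : R) (h : H) :
    theta k H R (mk (r ⊗ₜ h)) = counit (R := k) h • r := by
  simp [theta]

end Bosonization

end BosonizationAntipode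

section DualPair

variable {k : Type u} [Field k] {H : Type v} [Ring H] [HopfAlgebra k H]

open YDHopfAlgebra (act coact)
open Bosonization (proj incl theta inclR inclH)

/-- The inverse of a bijective antipode. -/
noncomputable def antipodeInv (hH : Function.Bijective (antipode k : H →ₗ[k] H)) : H →ₗ[k] H :=
  (LinearEquiv.ofBijective (antipode k) hH).symm.toLinearMap

/-- `X` is a subobject of the Yetter-Drinfeld module `V`: a submodule and a subcomodule. -/
structure IsSubobject {V : Type*} [AddCommGroup V] [Module k V] (aV : H →ₗ[k] Module.End k V)
    (cV : V →ₗ[k] H ⊗[k] V) (X : Submodule k V) : Prop where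
  act_mem : ∀ h, ∀ v ∈ X, aV h v ∈ X
  coact_mem : ∀ v ∈ X, cV v ∈ LinearMap.range (X.subtype.lTensor H)

/-- `{v | ⟨v, w⟩ = 0 for all w ∈ E}`. -/
def perp {V W : Type*} [AddCommGroup V] [Module k V] [AddCommGroup W] [Module k W]
    (p : V →ₗ[k] W →ₗ[k] k) (E : Submodule k W) : Submodule k V where
  carrier := {v | ∀ w ∈ E, p v w = 0}
  add_mem' := fun ha hb w hw => by rw [map_add, LinearMap.add_apply, ha w hw, hb w hw, add_zero]
  zero_mem' := fun w _ => by simp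
  smul_mem' := fun c v hv w hw => by rw [map_smul, LinearMap.smul_apply, hv w hw, smul_zero]

/-- The comultiplication `Δ : V → V ⊗ V` is continuous for the finite topology on `V` defined by
the pairing with `W`, whose basic neighbourhoods of `0` are the `perp p E` with `E` finite
dimensional; the basic neighbourhoods of `0` in `V ⊗ V` are the subspaces
`perp p E ⊗ V + V ⊗ perp p E'`. -/
def ComulContinuous {V W : Type*} [AddCommGroup V] [Module k V] [Coalgebra k V] [AddCommGroup W]
    [Module k W] (p : V →ₗ[k] W →ₗ[k] k) : Prop :=
  ∀ E E' : Submodule k W, FiniteDimensional k E → FiniteDimensional k E' →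
    ∃ E₁ : Submodule k W, FiniteDimensional k E₁ ∧ ∀ v ∈ perp p E₁,
      comul (R := k) v ∈ LinearMap.range ((perp p E).subtype.rTensor V) ⊔
        LinearMap.range ((perp p E').subtype.lTensor V)

variable {R : Type w} [Ring R] [Algebra k R] [Coalgebra k R] [YDHopfAlgebra k H R]
  {Rd : Type x} [Ring Rd] [Algebra k Rd] [Coalgebra k Rd] [YDHopfAlgebra k H Rd]

/-- `(R, R^∨)` together with `⟨ , ⟩ : R^∨ ⊗ R → k` is a dual pair of Hopf algebras in the category
of left Yetter-Drinfeld modules over `H`; here `Rd` is `R^∨` and `p ξ x` is `⟨ξ, x⟩`. -/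
structure IsDualPair (hH : Function.Bijective (antipode k : H →ₗ[k] H))
    (p : Rd →ₗ[k] R →ₗ[k] k) : Prop where
  /-- the finite-dimensional subobjects of `R` are cofinal in the finite-dimensional subspaces -/
  cofinal : ∀ E : Submodule k R, FiniteDimensional k E → ∃ E₁ : Submodule k R,
    FiniteDimensional k E₁ ∧ IsSubobject (H := H) act coact E₁ ∧ E ≤ E₁
  /-- the finite-dimensional subobjects of `R^∨` are cofinal in the finite-dimensional subspaces -/
  cofinal_dual : ∀ E : Submodule k Rd, FiniteDimensional k E → ∃ E₁ : Submodule k Rd,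
    FiniteDimensional k E₁ ∧ IsSubobject (H := H) act coact E₁ ∧ E ≤ E₁
  nondegenerate : p.Nondegenerate
  /-- `⟨h ξ, x⟩ = ⟨ξ, S(h) x⟩` -/
  pair_act : ∀ (h : H) (ξ : Rd) (x : R), p (act (k := k) h ξ) x = p ξ (act (k := k) (antipode k h) x)
  /-- `ξ₍₋₁₎ ⟨ξ₍₀₎, x⟩ = S⁻¹(x₍₋₁₎) ⟨ξ, x₍₀₎⟩` -/
  pair_coact : ∀ (ξ : Rd) (x : R), (p.flip x).lTensor H (coact ξ) =
    TensorProduct.map (antipodeInv hH) (p ξ) (coact x)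
  /-- `⟨ξ, x y⟩ = ⟨ξ₍₁₎, y⟩ ⟨ξ₍₂₎, x⟩` -/
  pair_mul : ∀ (ξ : Rd) (x y : R), p ξ (x * y) =
    LinearMap.mul' k k (TensorProduct.map (p.flip y) (p.flip x) (comul ξ))
  /-- `⟨1, x⟩ = ε(x)` -/
  one_pair : ∀ x : R, p 1 x = counit x
  /-- `⟨ξ η, x⟩ = ⟨ξ, x₍₂₎⟩ ⟨η, x₍₁₎⟩` -/
  mul_pair : ∀ (ξ η : Rd) (x : R), p (ξ * η) x =
    LinearMap.mul' k k (TensorProduct.map (p η) (p ξ) (comul x))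
  /-- `⟨ξ, 1⟩ = ε(ξ)` -/
  pair_one : ∀ ξ : Rd, p ξ 1 = counit ξ
  comul_continuous_dual : ComulContinuous p
  comul_continuous : ComulContinuous p.flip

open CategoryTheory MonoidalCategory

/-- The objects which are rational as `R^∨`-modules by restriction: each element is annihilated by
`perp p E` for some finite-dimensional subspace `E` of `R`. -/
def rational (p : Rd →ₗ[k] R →ₗ[k] k) : ObjectProperty (LeftYD (proj k H Rd)) := fun N =>
  ∀ n : N.carrier, ∃ E : Submodule k R, FiniteDimensional k E ∧
    ∀ ξ ∈ perp p E, N.act (inclR ξ) n = 0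

section

variable {hH : Function.Bijective (antipode k : H →ₗ[k] H)} {p : Rd →ₗ[k] R →ₗ[k] k}

theorem antipode_antipodeInv (h : H) : antipode k (antipodeInv hH h) = h :=
  (LinearEquiv.ofBijective (antipode k) hH).apply_symm_apply h

/-- `∑ S⁻¹(h₍₂₎) h₍₁₎` and `∑ h₍₂₎ S⁻¹(h₍₁₎)` are `ε(h)`. -/
theorem mul_antipodeInv (h : H) : LinearMap.mul' k H (TensorProduct.comm k H H
    ((antipodeInv hH).rTensor H (comul h))) = algebraMap k H (counit h) := by
  apply hH.1
  have : ∀ t : H ⊗[k] H, antipode k (LinearMap.mul' k H (TensorProduct.comm k H H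
      ((antipodeInv hH).rTensor H t))) = LinearMap.mul' k H ((antipode k).lTensor H t) := by
    intro t
    induction t with
    | zero => simp
    | add s t hs ht => simp only [map_add, hs, ht]
    | tmul a b => simp [antipode_mul_antidistrib, antipode_antipodeInv]
  rw [this, mul_antipode_lTensor_comul_apply]
  simp [Algebra.algebraMap_eq_smul_one]

/-- `∑ (1 # h₍₂₎) (S⁻¹(h₍₁₎) ξ # 1) = ξ # h`. -/
theorem sum_inclH_inclR (hH : Function.Bijective (antipode k : H →ₗ[k] H)) (ξ : Rd) (h : H) :
    TensorProduct.lift ((LinearMap.mul k (Bosonization k H Rd)).flip.compl₁₂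
      (inclR.toLinearMap ∘ₗ (act : H →ₗ[k] Module.End k Rd).flip ξ ∘ₗ antipodeInv hH)
      inclH.toLinearMap) (comul h) = inclR ξ * inclH h := by
  let T : H ⊗[k] (H ⊗[k] H) →ₗ[k] Bosonization k H Rd :=
    Bosonization.mk.toLinearMap ∘ₗ ((act : H →ₗ[k] Module.End k Rd).flip ξ ∘ₗ
      LinearMap.mul' k H ∘ₗ (TensorProduct.comm k H H).toLinearMap ∘ₗ
      (antipodeInv hH).rTensor H).rTensor H ∘ₗ (TensorProduct.assoc k H H H).symm.toLinearMap
  have h1 : ∀ t : H ⊗[k] H, TensorProduct.lift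
      ((LinearMap.mul k (Bosonization k H Rd)).flip.compl₁₂
      (inclR.toLinearMap ∘ₗ (act : H →ₗ[k] Module.End k Rd).flip ξ ∘ₗ antipodeInv hH)
      inclH.toLinearMap) t = T (comul.lTensor H t) := by
    intro t
    induction t with
    | zero => simp
    | add s t hs ht => simp only [map_add, hs, ht]
    | tmul a b =>
      simp only [TensorProduct.lift.tmul, LinearMap.compl₁₂_apply, LinearMap.comp_apply,
        LinearMap.flip_apply, LinearMap.mul_apply', AlgHom.toLinearMap_apply,
        Bosonization.inclH_mul_inclR, LinearMap.lTensor_tmul]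
      generalize comul (R := k) b = s
      induction s with
      | zero => simp
      | add s t hs ht => simp only [map_add, TensorProduct.tmul_add, hs, ht]
      | tmul c d =>
        have := (YDHopfAlgebra.isYD (k := k) (H := H) (R := Rd)).act_mul
        simp [T, this]
  rw [h1, ← coassoc_apply]
  have h2 : ∀ t : H ⊗[k] H, T (TensorProduct.assoc k H H H (comul.rTensor H t)) =
      Bosonization.mk (ξ ⊗ₜ TensorProduct.lid k H (counit.rTensor H t)) := by
    intro t
    induction t with
    | zero => simp
    | add s t hs ht => simp only [map_add, TensorProduct.tmul_add, hs, ht]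
    | tmul a b =>
      have := (YDHopfAlgebra.isYD (k := k) (H := H) (R := Rd)).act_one
      simp [T, mul_antipodeInv, Algebra.algebraMap_eq_smul_one, this, TensorProduct.smul_tmul]
  rw [h2, Bosonization.inclR_mul_inclH]
  simp

theorem mem_range_lTensor_perp {V W : Type*} [AddCommGroup V] [Module k V] [AddCommGroup W]
    [Module k W] (p : V →ₗ[k] W →ₗ[k] k) (E : Submodule k W) (t : H ⊗[k] V)
    (ht : ∀ x ∈ E, (p.flip x).lTensor H t = 0) :
    t ∈ LinearMap.range ((perp p E).subtype.lTensor H) := by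
  let b := Module.Basis.ofVectorSpace k H
  obtain ⟨c, rfl⟩ := TensorProduct.eq_repr_basis_left b t
  have hc : ∀ i, c i ∈ perp p E := by
    intro i x hx
    have h1 := ht x hx
    let d := c.mapRange (p.flip x) (map_zero _)
    have h2 : d.sum (fun i n => b i ⊗ₜ[k] n) = 0 := by
      rw [← h1, Finsupp.sum_mapRange_index (by simp)]
      simp [Finsupp.sum, map_sum]
    have := TensorProduct.sum_tmul_basis_left_eq_zero b d h2
    exact DFunLike.congr_fun this i
  refine Submodule.sum_mem _ fun i _ => ⟨b i ⊗ₜ ⟨c i, hc i⟩, by simp⟩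

namespace IsDualPair

theorem perp_act (hp : IsDualPair hH p) {E : Submodule k R}
    (hE : IsSubobject (H := H) act coact E) (h : H) {ξ : Rd} (hξ : ξ ∈ perp p E) :
    act (k := k) h ξ ∈ perp p E := fun x hx => by
  rw [hp.pair_act]
  exact hξ _ (hE.act_mem _ _ hx)

theorem perp_coact (hp : IsDualPair hH p) {E : Submodule k R}
    (hE : IsSubobject (H := H) act coact E) {ξ : Rd} (hξ : ξ ∈ perp p E) :
    coact ξ ∈ LinearMap.range ((perp p E).subtype.lTensor H) := by
  refine mem_range_lTensor_perp p E _ fun x hx => ?_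
  rw [hp.pair_coact]
  obtain ⟨t, ht⟩ := hE.coact_mem x hx
  rw [← ht]
  clear ht
  induction t with
  | zero => simp
  | add s t hs ht => simp only [map_add, hs, ht, add_zero]
  | tmul a y => simp [hξ y y.2]

theorem isMonoidal (hp : IsDualPair hH p) : (rational (H := H) p).IsMonoidal where
  prop_unit := fun n => by
    refine ⟨Submodule.span k {1}, inferInstance, fun ξ hξ => ?_⟩
    have h1 : p ξ 1 = 0 := hξ 1 (Submodule.mem_span_singleton_self 1)
    rw [hp.pair_one] at h1
    change counit (R := k) (inclR ξ : Bosonization k H Rd) * n = 0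
    rw [Bosonization.counit_eq, Bosonization.counitHom_inclR, h1, zero_mul]
  prop_tensor := fun M N hM hN x => by
    change M.carrier ⊗[k] N.carrier at x
    change ∃ E : Submodule k R, FiniteDimensional k E ∧ ∀ ξ ∈ perp p E,
      tensorAct M.act N.act (inclR ξ) x = 0
    induction x with
    | zero => exact ⟨⊥, inferInstance, fun ξ _ => map_zero _⟩
    | add x y hx hy =>
      obtain ⟨E, hE, h1⟩ := hx
      obtain ⟨E', hE', h2⟩ := hy
      refine ⟨E ⊔ E', inferInstance, fun ξ hξ => ?_⟩
      rw [map_add, h1 ξ fun w hw => hξ w (Submodule.mem_sup_left hw),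
        h2 ξ fun w hw => hξ w (Submodule.mem_sup_right hw), add_zero]
    | tmul m n =>
      obtain ⟨E, hE, h1⟩ := hM m
      obtain ⟨E', hE', h2⟩ := hN n
      obtain ⟨E₁, hE₁, hs, hle⟩ := hp.cofinal (E ⊔ E') inferInstance
      replace h1 : ∀ ξ ∈ perp p E₁, M.act (inclR ξ) m = 0 := fun ξ hξ =>
        h1 ξ fun w hw => hξ w (hle (Submodule.mem_sup_left hw))
      replace h2 : ∀ ξ ∈ perp p E₁, N.act (inclR ξ) n = 0 := fun ξ hξ =>
        h2 ξ fun w hw => hξ w (hle (Submodule.mem_sup_right hw))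
      have h3 : ∀ ξ ∈ perp p E₁, ∀ h : H, M.act (inclR ξ * inclH h) m = 0 := by
        intro ξ hξ h
        rw [← sum_inclH_inclR hH]
        generalize comul (R := k) h = t
        induction t with
        | zero => simp
        | add s t hs ht => simp only [map_add, LinearMap.add_apply, hs, ht, add_zero]
        | tmul a b =>
          have := h1 _ (hp.perp_act hs (antipodeInv hH a) hξ)
          simp [M.isYD.act_mul, this]
      obtain ⟨E₂, hE₂, hc⟩ := hp.comul_continuous_dual E₁ E₁ hE₁ hE₁
      refine ⟨E₂, hE₂, fun ξ hξ => ?_⟩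
      rw [tensorAct_apply, Bosonization.comul_eq, Bosonization.comulHom_inclR]
      let G : Rd ⊗[k] Rd →ₗ[k] M.carrier ⊗[k] N.carrier := LinearMap.applyₗ (m ⊗ₜ n) ∘ₗ
        TensorProduct.homTensorHomMap (RingHom.id k) M.carrier N.carrier M.carrier N.carrier ∘ₗ
        TensorProduct.map M.act N.act ∘ₗ Bosonization.Phi
      change G (comul ξ) = 0
      suffices hle : LinearMap.range ((perp p E₁).subtype.rTensor Rd) ⊔
          LinearMap.range ((perp p E₁).subtype.lTensor Rd) ≤ LinearMap.ker G from hle (hc ξ hξ)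
      refine sup_le ?_ ?_
      · rintro _ ⟨t, rfl⟩
        rw [LinearMap.mem_ker]
        induction t with
        | zero => simp
        | add s t hs ht => simp only [map_add, hs, ht, add_zero]
        | tmul a b =>
          simp only [G, LinearMap.rTensor_tmul, LinearMap.comp_apply, Bosonization.Phi_tmul,
            Bosonization.u_apply]
          generalize (coact b : H ⊗[k] Rd) = s
          induction s with
          | zero => simp
          | add s t hs ht => simp only [map_add, mul_add, hs, ht, add_zero]
          | tmul h y => simp [h3 a a.2 h]
      · rintro _ ⟨t, rfl⟩
        rw [LinearMap.mem_ker]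
        induction t with
        | zero => simp
        | add s t hs ht => simp only [map_add, hs, ht, add_zero]
        | tmul a b =>
          simp only [G, LinearMap.lTensor_tmul, LinearMap.comp_apply, Bosonization.Phi_tmul,
            Bosonization.u_apply]
          obtain ⟨s, hs⟩ := hp.perp_coact hs b.2
          simp only [Submodule.subtype_apply, ← hs]
          clear hs
          induction s with
          | zero => simp
          | add s t hs ht => simp only [map_add, mul_add, hs, ht, add_zero]
          | tmul h y => simp [h2 y y.2]

end IsDualPair

/-- The full subcategory of the left relative Yetter-Drinfeld modules (left `R^∨ # H`-modules and
left `H`-comodules) consisting of the objects that are rational over `R^∨`. -/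
def RatYD (_ : IsDualPair hH p) : Type _ := (rational (H := H) p).FullSubcategory

noncomputable instance (hp : IsDualPair hH p) : Category (RatYD hp) :=
  inferInstanceAs (Category (rational (H := H) p).FullSubcategory)

noncomputable instance (hp : IsDualPair hH p) : MonoidalCategory (RatYD hp) :=
  have := hp.isMonoidal
  inferInstanceAs (MonoidalCategory (rational (H := H) p).FullSubcategory)

end

/-- The action `h m = m S⁻¹(h)` of `H`. -/
noncomputable def firstActH (hH : Function.Bijective (antipode k : H →ₗ[k] H))
    (M : RightYD (incl k H R)) : H →ₗ[k] Module.End k M.carrier :=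
  M.act ∘ₗ antipodeInv hH

/-- The action `ξ m = ⟨ξ, ϑ(S(m₍₁₎))⟩ m₍₀₎` of `R^∨`. -/
noncomputable def firstActR (p : Rd →ₗ[k] R →ₗ[k] k) (M : RightYD (incl k H R)) :
    Rd →ₗ[k] Module.End k M.carrier where
  toFun ξ := (TensorProduct.rid k M.carrier).toLinearMap ∘ₗ
    (p ξ ∘ₗ theta k H R ∘ₗ antipode k).lTensor M.carrier ∘ₗ M.coact
  map_add' ξ η := by
    simp only [map_add, LinearMap.add_comp, LinearMap.lTensor_add, LinearMap.comp_add]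
  map_smul' c ξ := by
    simp only [map_smul, LinearMap.smul_comp, LinearMap.lTensor_smul, LinearMap.comp_smul,
      RingHom.id_apply]

/-- The action of `R^∨ # H`: `(ξ # h) m = ξ (h m)`. -/
noncomputable def firstAct (hH : Function.Bijective (antipode k : H →ₗ[k] H))
    (p : Rd →ₗ[k] R →ₗ[k] k) (M : RightYD (incl k H R)) :
    Bosonization k H Rd →ₗ[k] Module.End k M.carrier :=
  TensorProduct.lift ((LinearMap.mul k (Module.End k M.carrier)).compl₁₂
    (firstActR p M) (firstActH hH M)) ∘ₗ Bosonization.mk.symm.toLinearMap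

/-- The coaction `m ↦ π(S(m₍₁₎)) ⊗ m₍₀₎` of `H`. -/
noncomputable def firstCoact (M : RightYD (incl k H R)) : M.carrier →ₗ[k] H ⊗[k] M.carrier :=
  (TensorProduct.comm k M.carrier H).toLinearMap ∘ₗ
    ((proj k H R : Bosonization k H R →ₗ[k] H) ∘ₗ antipode k).lTensor M.carrier ∘ₗ M.coact

/-- The map `φ : m ⊗ n ↦ m S⁻¹(π(n₍₁₎)) ⊗ n₍₀₎`. -/
noncomputable def firstTensorator (hH : Function.Bijective (antipode k : H →ₗ[k] H))
    (M N : RightYD (incl k H R)) :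
    M.carrier ⊗[k] N.carrier →ₗ[k] M.carrier ⊗[k] N.carrier :=
  (TensorProduct.lift M.act.flip).rTensor N.carrier ∘ₗ
    (TensorProduct.assoc k M.carrier H N.carrier).symm.toLinearMap ∘ₗ
    ((TensorProduct.comm k N.carrier H).toLinearMap ∘ₗ
      (antipodeInv hH ∘ₗ (proj k H R : Bosonization k H R →ₗ[k] H)).lTensor N.carrier ∘ₗ
      N.coact).lTensor M.carrier

theorem firstHom (hH : Function.Bijective (antipode k : H →ₗ[k] H)) (p : Rd →ₗ[k] R →ₗ[k] k)
    {M N : RightYD (incl k H R)} (f : M ⟶ N) :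
    IsLeftHom (firstAct hH p M) (firstCoact M) (firstAct hH p N) (firstCoact N) f.lin where
  map_act a m := by
    have h1 : ∀ ξ m, f.lin (firstActR p M ξ m) = firstActR p N ξ (f.lin m) := by
      intro ξ m
      simp only [firstActR, LinearMap.coe_mk, AddHom.coe_mk, LinearMap.comp_apply,
        f.isHom.map_coact]
      generalize M.coact m = t
      induction t with
      | zero => simp
      | add s t hs ht => simp only [map_add, hs, ht]
      | tmul m a => simp
    have h2 : ∀ h m, f.lin (firstActH hH M h m) = firstActH hH N h (f.lin m) :=
      fun h m => f.isHom.map_act _ m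
    obtain ⟨x, rfl⟩ := (Bosonization.mk (k := k) (H := H) (R := Rd)).surjective a
    induction x with
    | zero => simp
    | add s t hs ht => simp only [map_add, LinearMap.add_apply, hs, ht]
    | tmul ξ h => simp [firstAct, h1, h2]
  map_coact m := by
    simp only [firstCoact, LinearMap.comp_apply, f.isHom.map_coact]
    generalize M.coact m = t
    induction t with
    | zero => simp
    | add s t hs ht => simp only [map_add, hs, ht]
    | tmul m a => simp

/-- The functor `F` with `F(M) = M` as a vector space and `F(f) = f`; the arguments `hYD` and
`hrat` say that the actions and coactions above define rational relative Yetter-Drinfeld modules. -/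
noncomputable def firstFunctor {hH : Function.Bijective (antipode k : H →ₗ[k] H)}
    {p : Rd →ₗ[k] R →ₗ[k] k} (hp : IsDualPair hH p)
    (hYD : ∀ M : RightYD (incl k H R), IsLeftYD (proj k H Rd) (firstAct hH p M) (firstCoact M))
    (hrat : ∀ M : RightYD (incl k H R),
      rational p ⟨M.carrier, firstAct hH p M, firstCoact M, hYD M⟩) :
    RightYD (incl k H R) ⥤ RatYD hp where
  obj M := ⟨⟨M.carrier, firstAct hH p M, firstCoact M, hYD M⟩, hrat M⟩
  map f := ⟨⟨f.lin, firstHom hH p f⟩⟩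

end DualPair

end RelYD

open CategoryTheory RelYD

/-!
The functor is a composite of three passages, each of which is bijective on structures over a fixed
vector space and preserves and reflects morphisms.

* *From right to left.* Since the antipodes of `H` and `R # H` are bijective
  (`Bosonization.antipode_bijective`), `b m = m S⁻¹(b)` and `m ↦ S(m₍₁₎) ⊗ m₍₀₎` exchange right
  and left `H`-modules with a compatible `R # H`-coaction (`isLeftYD_leftAct_iff`).
* *From `R # H`-comodules to comodules in the braided category.* A left `R # H`-coaction that is
  compatible with the action of `H` is the same as a coaction of `H` together with one of `R`,
  namely its images under `π` and `ϑ`, such that `M` is an `R`-comodule in the category of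
  Yetter-Drinfeld modules over `H` (`IsLeftYD.isYDComodule`, `IsYDComodule.isLeftYD`).
* *From `R`-comodules to `R^∨`-modules.* For a non-degenerate pairing,
  `c ↦ (ξ ↦ ⟨ξ, m₍₋₁₎⟩ m₍₀₎)` is a bijection between linear maps `c : M → R ⊗ M` and rational
  families of endomorphisms of `M` indexed by `R^∨` (`pairAct_injective`, `exists_pairAct_eq`).
  Because the pairing exchanges products and coproducts and respects the `H`-structures,
  comodules in the braided category correspond to modules (`isYDModule_pairAct_iff`). Modules over
  `R^∨` in this category are in turn `R^∨ # H`-modules with a compatible `H`-coaction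
  (`IsYDModule.isLeftYD`, `IsLeftYD.isYDModule`).

The whole functor is therefore bijective on objects and fully faithful, so it has a strict inverse
(`exists_inverse_functor`, `IsDualPair.exists_inverse`).

The compatibility conditions contain antipodes. They are handled in an equivalent form without
antipodes, `FreeLeft` and `FreeRight`, which is an equation between convolution products of maps
from the acting Hopf algebra. In this form the condition at `b b'` follows from those at `b` and
`b'`, so that over `R^∨ # H` it need only be checked on `R^∨` and on `H` (`CompatAt.mul`).

For the monoidal structure, let `F` be the functor. Passing from right to left reverses the order
of the factors in the diagonal structures: on `F (M ⊗ N)` `H` acts by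
`h₍₂₎ m ⊗ h₍₁₎ n`, and the coaction is `n₍₋₁₎ m₍₋₁₎ ⊗ m₍₀₎ ⊗ n₍₀₎`. The twist
`m ⊗ n ↦ n₍₋₁₎ m ⊗ n₍₀₎` turns these into the diagonal structures of `F M ⊗ F N`
(`twist_coTensorAct`, `tensorCoactLeft_twist`). It is also linear over `R^∨`: evaluating
`ξ` on a product in `R` splits it into `ξ₍₁₎` and `ξ₍₂₎` (`IsDualPair.ev_crossMul`), and
`twist_crossAct` moves `ξ₍₁₎` across the coaction of the second factor. So the twist is a morphism
`F (M ⊗ N) ⟶ F M ⊗ F N` (`IsDualPair.isLeftHom_twist`); it is associative (`twist_assoc`) and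
invertible, and its inverse is the prescribed tensorator (`firstTensorator_eq`,
`IsDualPair.exists_monoidal`).
-/


namespace RelYD

/-! ### Antipodes and their inverses -/

section Antipode

variable {k : Type u} [Field k] {B : Type v} [Ring B] [HopfAlgebra k B]

theorem conv_left_inv_eq_right_inv {X : Type*} [Ring X] [Algebra k X] {f g h : B →ₗ[k] X}
    (hfg : ∀ b, conv (LinearMap.mul k X) f g b = counit (R := k) b • (1 : X))
    (hgh : ∀ b, conv (LinearMap.mul k X) g h b = counit (R := k) b • (1 : X)) : f = h := by
  rw [← conv_cancel_right (μ := LinearMap.mul k X) (ν := LinearMap.mul k X) (e := 1)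
    (fun x y z => mul_assoc x y z) (fun x => mul_one x) f hgh]
  ext b
  rw [conv_counit_left _ _ hfg, LinearMap.mul_apply', one_mul]

theorem conv_mul_cancel_left {X : Type*} [Ring X] [Algebra k X] {g h : B →ₗ[k] X}
    (hgh : ∀ b, conv (LinearMap.mul k X) g h b = counit (R := k) b • (1 : X)) (f : B →ₗ[k] X) :
    conv (LinearMap.mul k X) g (conv (LinearMap.mul k X) h f) = f :=
  conv_cancel_left (ν := LinearMap.mul k X) (e := 1) (fun x y z => (mul_assoc x y z).symm)
    (fun x => one_mul x) f hgh

/-- The antipode is anti-comultiplicative: both sides are convolution inverse to `Δ`. -/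
theorem comul_antipode (b : B) : comul (R := k) (antipode k b) =
    TensorProduct.comm k B B (TensorProduct.map (antipode k) (antipode k) (comul (R := k) b)) := by
  let g : B →ₗ[k] B ⊗[k] B := (TensorProduct.mk k B B).flip 1
  let d : B →ₗ[k] B ⊗[k] B := TensorProduct.mk k B B 1
  have hgd : (comul : B →ₗ[k] B ⊗[k] B) = conv (LinearMap.mul k (B ⊗[k] B)) g d := by
    ext b
    exact (lift_conv_congr (T := LinearMap.id) (by intro x y; simp [g, d]) b).symm
  have hS : (TensorProduct.comm k B B).toLinearMap ∘ₗ
      TensorProduct.map (antipode k) (antipode k) ∘ₗ (comul : B →ₗ[k] B ⊗[k] B) =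
      conv (LinearMap.mul k (B ⊗[k] B)) (d ∘ₗ antipode k) (g ∘ₗ antipode k) := by
    ext b
    exact (lift_conv_congr (T := (TensorProduct.comm k B B).toLinearMap ∘ₗ
      TensorProduct.map (antipode k) (antipode k)) (by intro x y; simp [g, d]) b).symm
  have h1 : ∀ b, conv (LinearMap.mul k (B ⊗[k] B)) (comul ∘ₗ antipode k) comul b =
      counit (R := k) b • (1 : B ⊗[k] B) := by
    intro b
    rw [lift_conv_congr (T := comul ∘ₗ LinearMap.mul' k B ∘ₗ (antipode k).rTensor B)
      (by intro x y; simp [Bialgebra.comul_mul])]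
    simp only [LinearMap.comp_apply, mul_antipode_rTensor_comul_apply]
    simp [Algebra.algebraMap_eq_smul_one, Bialgebra.comul_one]
  have hd : ∀ b, conv (LinearMap.mul k (B ⊗[k] B)) d (d ∘ₗ antipode k) b =
      counit (R := k) b • (1 : B ⊗[k] B) := by
    intro b
    rw [lift_conv_congr (T := d ∘ₗ LinearMap.mul' k B ∘ₗ (antipode k).lTensor B)
      (by intro x y; simp [d])]
    simp only [LinearMap.comp_apply, mul_antipode_lTensor_comul_apply]
    simp [d, Algebra.algebraMap_eq_smul_one, Algebra.TensorProduct.one_def]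
  have hg : ∀ b, conv (LinearMap.mul k (B ⊗[k] B)) g (g ∘ₗ antipode k) b =
      counit (R := k) b • (1 : B ⊗[k] B) := by
    intro b
    rw [lift_conv_congr (T := g ∘ₗ LinearMap.mul' k B ∘ₗ (antipode k).lTensor B)
      (by intro x y; simp [g])]
    simp only [LinearMap.comp_apply, mul_antipode_lTensor_comul_apply]
    simp [g, Algebra.algebraMap_eq_smul_one, Algebra.TensorProduct.one_def,
      TensorProduct.smul_tmul']
  have h2 : ∀ b, conv (LinearMap.mul k (B ⊗[k] B)) comul ((TensorProduct.comm k B B).toLinearMap ∘ₗ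
      TensorProduct.map (antipode k) (antipode k) ∘ₗ (comul : B →ₗ[k] B ⊗[k] B)) b =
      counit (R := k) b • (1 : B ⊗[k] B) := by
    intro b
    rw [hS]
    conv_lhs => rw [hgd]
    refine (LinearMap.congr_fun (Bosonization.cmul_assoc g d _) b).trans ?_
    unfold Bosonization.cmul
    rw [conv_mul_cancel_left hd, hg]
  exact LinearMap.congr_fun (conv_left_inv_eq_right_inv h1 h2) b

theorem antipodeInv_antipode {hB : Function.Bijective (antipode k : B →ₗ[k] B)} (b : B) :
    antipodeInv hB (antipode k b) = b :=
  (LinearEquiv.ofBijective (antipode k) hB).symm_apply_apply b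

theorem antipodeInv_mul (hB : Function.Bijective (antipode k : B →ₗ[k] B)) (a b : B) :
    antipodeInv hB (a * b) = antipodeInv hB b * antipodeInv hB a := by
  apply hB.1
  rw [antipode_mul_antidistrib, antipode_antipodeInv, antipode_antipodeInv, antipode_antipodeInv]

theorem antipodeInv_one (hB : Function.Bijective (antipode k : B →ₗ[k] B)) :
    antipodeInv hB (1 : B) = 1 := by
  apply hB.1
  rw [antipode_antipodeInv, antipode_one]

theorem counit_antipodeInv (hB : Function.Bijective (antipode k : B →ₗ[k] B)) (b : B) :
    counit (R := k) (antipodeInv hB b) = counit (R := k) b := by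
  conv_rhs => rw [← antipode_antipodeInv (hH := hB) b, counit_antipode]

theorem comul_antipodeInv (hB : Function.Bijective (antipode k : B →ₗ[k] B)) (b : B) :
    comul (R := k) (antipodeInv hB b) = TensorProduct.comm k B B
      (TensorProduct.map (antipodeInv hB) (antipodeInv hB) (comul (R := k) b)) := by
  obtain ⟨c, rfl⟩ := hB.2 b
  rw [antipodeInv_antipode, comul_antipode]
  generalize comul (R := k) c = t
  induction t with
  | zero => simp only [map_zero]
  | add s t hs ht => simp only [map_add, ← hs, ← ht]
  | tmul x y => simp only [TensorProduct.map_tmul, TensorProduct.comm_tmul, antipodeInv_antipode]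

/-- Since `S⁻¹` is anti-comultiplicative, `∑ μ (f S⁻¹(b)₍₁₎) (g S⁻¹(b)₍₂₎)` is
`∑ μ (f S⁻¹(b₍₂₎)) (g S⁻¹(b₍₁₎))`. -/
theorem conv_antipodeInv {X Y Z : Type*} [AddCommMonoid X] [Module k X] [AddCommMonoid Y]
    [Module k Y] [AddCommMonoid Z] [Module k Z] (hB : Function.Bijective (antipode k : B →ₗ[k] B))
    (μ : X →ₗ[k] Y →ₗ[k] Z) (f : B →ₗ[k] X) (g : B →ₗ[k] Y) (b : B) :
    conv μ f g (antipodeInv hB b) =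
      conv μ.flip (g ∘ₗ antipodeInv hB) (f ∘ₗ antipodeInv hB) b := by
  refine Eq.trans ?_ (lift_conv_congr (T := TensorProduct.lift (μ.compl₁₂ f g) ∘ₗ
    (TensorProduct.comm k B B).toLinearMap ∘ₗ TensorProduct.map (antipodeInv hB) (antipodeInv hB))
    (by intro x y; simp) b).symm
  simp only [conv, LinearMap.comp_apply, comul_antipodeInv, LinearEquiv.coe_coe]

end Antipode

/-! ### From right to left relative Yetter-Drinfeld modules -/

section Sides

variable {k : Type u} [Field k] {B : Type v} [Ring B] [HopfAlgebra k B]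
  {C : Type w} [Ring C] [HopfAlgebra k C] {M : Type y} [AddCommGroup M] [Module k M]

/-- The left action `b m = m S⁻¹(b)`. -/
noncomputable def leftAct (hB : Function.Bijective (antipode k : B →ₗ[k] B))
    (aM : B →ₗ[k] Module.End k M) : B →ₗ[k] Module.End k M :=
  aM ∘ₗ antipodeInv hB

/-- `m ⊗ c ↦ S(c) ⊗ m`. -/
noncomputable def flipAntipode (k : Type u) [Field k] (C : Type w) [Ring C] [HopfAlgebra k C]
    (M : Type y) [AddCommGroup M] [Module k M] : M ⊗[k] C →ₗ[k] C ⊗[k] M :=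
  (TensorProduct.comm k M C).toLinearMap ∘ₗ (antipode k).lTensor M

@[simp] theorem flipAntipode_tmul (m : M) (c : C) :
    flipAntipode k C M (m ⊗ₜ c) = antipode k c ⊗ₜ m := rfl

theorem flipAntipode_bijective (hC : Function.Bijective (antipode k : C →ₗ[k] C)) :
    Function.Bijective (flipAntipode k C M) :=
  ((TensorProduct.congr (LinearEquiv.refl k M) (LinearEquiv.ofBijective (antipode k) hC)).trans
    (TensorProduct.comm k M C)).bijective

/-- The left coaction `m ↦ S(m₍₁₎) ⊗ m₍₀₎`. -/
noncomputable def leftCoact (cM : M →ₗ[k] M ⊗[k] C) : M →ₗ[k] C ⊗[k] M :=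
  flipAntipode k C M ∘ₗ cM

/-- `m ⊗ (c ⊗ d) ↦ S(d) ⊗ (S(c) ⊗ m)`. -/
noncomputable def flipAntipode₂ (hC : Function.Bijective (antipode k : C →ₗ[k] C)) :
    M ⊗[k] (C ⊗[k] C) ≃ₗ[k] C ⊗[k] (C ⊗[k] M) :=
  (TensorProduct.comm k M (C ⊗[k] C)).trans
    ((TensorProduct.congr (TensorProduct.comm k C C) (LinearEquiv.refl k M)).trans
      ((TensorProduct.assoc k C C M).trans
        (TensorProduct.congr (LinearEquiv.ofBijective (antipode k) hC)
          (TensorProduct.congr (LinearEquiv.ofBijective (antipode k) hC) (LinearEquiv.refl k M)))))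

theorem leftCoact_coassoc_iff (hC : Function.Bijective (antipode k : C →ₗ[k] C))
    (cM : M →ₗ[k] M ⊗[k] C) (m : M) :
    TensorProduct.assoc k C C M (comul.rTensor M (leftCoact cM m)) =
      (leftCoact cM).lTensor C (leftCoact cM m) ↔
    TensorProduct.assoc k M C C (cM.rTensor C (cM m)) = comul.lTensor M (cM m) := by
  have h1 : (TensorProduct.assoc k C C M).toLinearMap ∘ₗ comul.rTensor M ∘ₗ flipAntipode k C M =
      (flipAntipode₂ hC).toLinearMap ∘ₗ comul.lTensor M := by
    refine TensorProduct.ext' fun m c => ?_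
    simp only [LinearMap.comp_apply, flipAntipode_tmul, LinearMap.rTensor_tmul, comul_antipode,
      LinearMap.lTensor_tmul]
    generalize comul (R := k) c = t
    induction t with
    | zero => simp only [map_zero, TensorProduct.zero_tmul, TensorProduct.tmul_zero]
    | add s t hs ht => simp only [map_add, TensorProduct.add_tmul, TensorProduct.tmul_add, hs, ht]
    | tmul x y => rfl
  have h2 : (leftCoact cM).lTensor C ∘ₗ flipAntipode k C M =
      (flipAntipode₂ hC).toLinearMap ∘ₗ (TensorProduct.assoc k M C C).toLinearMap ∘ₗ
        cM.rTensor C := by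
    refine TensorProduct.ext' fun m c => ?_
    simp only [LinearMap.comp_apply, flipAntipode_tmul, LinearMap.rTensor_tmul,
      LinearMap.lTensor_tmul, leftCoact]
    generalize cM m = t
    induction t with
    | zero => simp only [map_zero, TensorProduct.zero_tmul, TensorProduct.tmul_zero]
    | add s t hs ht => simp only [map_add, TensorProduct.add_tmul, TensorProduct.tmul_add, hs, ht]
    | tmul x y => rfl
  have e1 := LinearMap.congr_fun h1 (cM m)
  have e2 := LinearMap.congr_fun h2 (cM m)
  simp only [LinearMap.comp_apply, LinearEquiv.coe_coe] at e1 e2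
  rw [leftCoact] at e2 ⊢
  rw [LinearMap.comp_apply, e1, e2, (flipAntipode₂ hC).injective.eq_iff, eq_comm]

theorem leftCoact_counit_iff (cM : M →ₗ[k] M ⊗[k] C) (m : M) :
    counit.rTensor M (leftCoact cM m) = (1 : k) ⊗ₜ[k] m ↔
      counit.lTensor M (cM m) = m ⊗ₜ[k] (1 : k) := by
  have h1 : counit.rTensor M ∘ₗ flipAntipode k C M =
      (TensorProduct.comm k M k).toLinearMap ∘ₗ counit.lTensor M := by
    refine TensorProduct.ext' fun m c => ?_
    simp
  have e1 := LinearMap.congr_fun h1 (cM m)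
  simp only [LinearMap.comp_apply, LinearEquiv.coe_coe] at e1
  rw [leftCoact, LinearMap.comp_apply, e1, ← TensorProduct.comm_tmul,
    (TensorProduct.comm k M k).injective.eq_iff]

/-- Passing from the right to the left through the antipode turns the right form of the
antipode-free compatibility at `S⁻¹(b)` into the left form at `b`. -/
theorem freeLeft_leftAct_iff (hB : Function.Bijective (antipode k : B →ₗ[k] B))
    (hC : Function.Bijective (antipode k : C →ₗ[k] C)) (ρ : B →ₐc[k] C)
    (hρ : ∀ b, ρ (antipode k b) = antipode k (ρ b)) (aM : B →ₗ[k] Module.End k M)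
    (cM : M →ₗ[k] M ⊗[k] C) :
    FreeLeft ρ (leftAct hB aM) (leftCoact cM) ↔ FreeRight ρ aM cM := by
  have hρ' : ∀ b, antipode k (ρ (antipodeInv hB b)) = ρ b := fun b => by
    rw [← hρ, antipode_antipodeInv]
  have c1 : ∀ y, rmulL ρ M y ∘ₗ flipAntipode k C M =
      flipAntipode k C M ∘ₗ lmulR ρ M (antipodeInv hB y) := fun y => by
    refine TensorProduct.ext' fun m c => ?_
    simp [antipode_mul_antidistrib, hρ']
  have c2 : ∀ x y, lmulL ρ M x ∘ₗ (leftAct hB aM y).lTensor C ∘ₗ flipAntipode k C M =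
      flipAntipode k C M ∘ₗ rmulR ρ M (antipodeInv hB x) ∘ₗ
        (aM (antipodeInv hB y)).rTensor C := fun x y => by
    refine TensorProduct.ext' fun m c => ?_
    simp [antipode_mul_antidistrib, hρ', leftAct]
  have e1 : ∀ b, conv (revComp k M (C ⊗[k] M) (C ⊗[k] M))
      (LinearMap.llcomp k M M (C ⊗[k] M) (leftCoact cM) ∘ₗ leftAct hB aM) (rmulL ρ M) b =
      flipAntipode k C M ∘ₗ conv (LinearMap.llcomp k M (M ⊗[k] C) (M ⊗[k] C)) (lmulR ρ M)
        (LinearMap.llcomp k M M (M ⊗[k] C) cM ∘ₗ aM) (antipodeInv hB b) := by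
    intro b
    rw [conv_antipodeInv]
    refine Eq.trans ?_ (map_conv (LinearMap.llcomp k M _ _ (flipAntipode k C M)) _ _ _ b).symm
    congr 1
    refine conv_congr fun x y => ?_
    exact congrArg (fun f => f ∘ₗ cM ∘ₗ aM (antipodeInv hB x)) (c1 y)
  have e2 : ∀ b, conv (LinearMap.llcomp k M (C ⊗[k] M) (C ⊗[k] M)) (lmulL ρ M)
      (actCoL (leftAct hB aM) (leftCoact cM)) b =
      flipAntipode k C M ∘ₗ conv (revComp k M (M ⊗[k] C) (M ⊗[k] C)) (actCoR aM cM) (rmulR ρ M)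
        (antipodeInv hB b) := by
    intro b
    rw [conv_antipodeInv]
    refine Eq.trans ?_ (map_conv (LinearMap.llcomp k M _ _ (flipAntipode k C M)) _ _ _ b).symm
    congr 1
    refine conv_congr fun x y => ?_
    exact congrArg (fun f => f ∘ₗ cM) (c2 x y)
  rw [FreeLeft, FreeRight]
  constructor
  · intro h
    ext1 b
    have h1 := LinearMap.congr_fun h (antipode k b)
    rw [e1, e2, antipodeInv_antipode] at h1
    ext1 m
    exact (flipAntipode_bijective hC).1 (LinearMap.congr_fun h1 m)
  · intro h
    ext1 b
    rw [e1, e2, h]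

/-- For bijective antipodes, `b m = m S⁻¹(b)` and `m ↦ S(m₍₁₎) ⊗ m₍₀₎` turn right relative
Yetter-Drinfeld modules into left ones, and every left one arises in this way. -/
theorem isLeftYD_leftAct_iff (hB : Function.Bijective (antipode k : B →ₗ[k] B))
    (hC : Function.Bijective (antipode k : C →ₗ[k] C)) (ρ : B →ₐc[k] C)
    (hρ : ∀ b, ρ (antipode k b) = antipode k (ρ b)) (aM : B →ₗ[k] Module.End k M)
    (cM : M →ₗ[k] M ⊗[k] C) :
    IsLeftYD ρ (leftAct hB aM) (leftCoact cM) ↔ IsRightYD ρ aM cM := by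
  constructor
  · intro h
    refine ⟨fun m => ?_, fun b b' m => ?_, fun m => ?_, fun m => ?_, ?_⟩
    · have := h.act_one m
      rwa [leftAct, LinearMap.comp_apply, antipodeInv_one] at this
    · have := h.act_mul (antipode k b') (antipode k b) m
      simpa only [leftAct, LinearMap.comp_apply, ← antipode_mul_antidistrib,
        antipodeInv_antipode] using this
    · exact (leftCoact_coassoc_iff hC cM m).1 (h.coassoc m)
    · exact (leftCoact_counit_iff cM m).1 (h.counit m)
    · exact (freeRight_iff ρ _ _).1 ((freeLeft_leftAct_iff hB hC ρ hρ aM cM).1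
        ((freeLeft_iff ρ _ _).2 h.compat))
  · intro h
    refine ⟨fun m => ?_, fun b b' m => ?_, fun m => ?_, fun m => ?_, ?_⟩
    · rw [leftAct, LinearMap.comp_apply, antipodeInv_one, h.act_one]
    · simp only [leftAct, LinearMap.comp_apply, antipodeInv_mul, h.act_mul]
    · exact (leftCoact_coassoc_iff hC cM m).2 (h.coassoc m)
    · exact (leftCoact_counit_iff cM m).2 (h.counit m)
    · exact (freeLeft_iff ρ _ _).1 ((freeLeft_leftAct_iff hB hC ρ hρ aM cM).2
        ((freeRight_iff ρ _ _).2 h.compat))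

end Sides


/-! ### The twist of a module along a comodule -/

section Twist

variable {k : Type u} [Field k] {C : Type w} [Ring C] [HopfAlgebra k C]
  {M : Type*} [AddCommGroup M] [Module k M] {X : Type*} [AddCommGroup X] [Module k X]

/-- The map `x ⊗ m ↦ ∑ f(m₍₋₁₎) x ⊗ m₍₀₎` for a left coaction `c` on `M`. -/
noncomputable def twist (c : M →ₗ[k] C ⊗[k] M) (f : C →ₗ[k] Module.End k X) :
    X ⊗[k] M →ₗ[k] X ⊗[k] M :=
  (TensorProduct.lift f.flip).rTensor M ∘ₗ (TensorProduct.assoc k X C M).symm.toLinearMap ∘ₗ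
    c.lTensor X

theorem twist_tmul (c : M →ₗ[k] C ⊗[k] M) (f : C →ₗ[k] Module.End k X) (x : X) (m : M) :
    twist c f (x ⊗ₜ m) = (f.flip x).rTensor M (c m) := by
  simp only [twist, LinearMap.comp_apply, LinearMap.lTensor_tmul, LinearEquiv.coe_coe]
  generalize c m = t
  induction t with
  | zero => simp only [map_zero, TensorProduct.tmul_zero]
  | add s t hs ht => simp only [map_add, TensorProduct.tmul_add, hs, ht]
  | tmul a m => simp

/-- Both sides are `x ⊗ m ↦ ∑ f(m₍₋₁₎) g(m₍₋₂₎) x ⊗ m₍₀₎`. -/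
theorem twist_twist {c : M →ₗ[k] C ⊗[k] M}
    (hc : ∀ m, TensorProduct.assoc k C C M (comul.rTensor M (c m)) = c.lTensor C (c m))
    (f g : C →ₗ[k] Module.End k X) (x : X ⊗[k] M) :
    twist c f (twist c g x) = twist c (conv (LinearMap.mul k (Module.End k X)).flip g f) x := by
  induction x with
  | zero => simp only [map_zero]
  | add s t hs ht => simp only [map_add, hs, ht]
  | tmul x m =>
    let W : C ⊗[k] (C ⊗[k] M) →ₗ[k] X ⊗[k] M :=
      TensorProduct.lift ((LinearMap.rTensorHom M ∘ₗ f.flip) ∘ₗ g.flip x)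
    have h1 : ∀ t : C ⊗[k] M, twist c f ((g.flip x).rTensor M t) = W (c.lTensor C t) := by
      intro t
      induction t with
      | zero => simp only [map_zero]
      | add s t hs ht => simp only [map_add, hs, ht]
      | tmul a m => simp [W, twist_tmul]
    have h2 : ∀ t : C ⊗[k] M, W (TensorProduct.assoc k C C M (comul.rTensor M t)) =
        ((conv (LinearMap.mul k (Module.End k X)).flip g f).flip x).rTensor M t := by
      intro t
      induction t with
      | zero => simp only [map_zero]
      | add s t hs ht => simp only [map_add, hs, ht]
      | tmul a m =>
        simp only [LinearMap.rTensor_tmul, LinearMap.flip_apply, conv, LinearMap.comp_apply]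
        generalize comul (R := k) a = s
        induction s with
        | zero => simp only [map_zero, TensorProduct.zero_tmul, LinearMap.zero_apply]
        | add s t hs ht =>
          simp only [map_add, TensorProduct.add_tmul, LinearMap.add_apply, hs, ht]
        | tmul a b => simp [W]
    rw [twist_tmul, h1, ← hc, h2, twist_tmul]

theorem twist_counit {c : M →ₗ[k] C ⊗[k] M}
    (hc : ∀ m, counit.rTensor M (c m) = (1 : k) ⊗ₜ[k] m) {f : C →ₗ[k] Module.End k X}
    (hf : ∀ b, f b = counit (R := k) b • (1 : Module.End k X)) (x : X ⊗[k] M) :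
    twist c f x = x := by
  induction x with
  | zero => simp only [map_zero]
  | add s t hs ht => simp only [map_add, hs, ht]
  | tmul x m =>
    have e : f.flip x = LinearMap.toSpanSingleton k X x ∘ₗ counit := by
      ext b
      simp [hf]
    rw [twist_tmul, e, LinearMap.rTensor_comp_apply, hc]
    simp

theorem twist_cancel {c : M →ₗ[k] C ⊗[k] M}
    (hc : ∀ m, TensorProduct.assoc k C C M (comul.rTensor M (c m)) = c.lTensor C (c m))
    (hc' : ∀ m, counit.rTensor M (c m) = (1 : k) ⊗ₜ[k] m) {f g : C →ₗ[k] Module.End k X}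
    (hfg : ∀ b, conv (LinearMap.mul k (Module.End k X)).flip g f b =
      counit (R := k) b • (1 : Module.End k X)) (x : X ⊗[k] M) :
    twist c f (twist c g x) = x := by
  rw [twist_twist hc, twist_counit hc' hfg]

/-- `∑ f(b₍₂₎ S⁻¹(b₍₁₎)) = ε(b)` for a representation `f`. -/
theorem conv_antipodeInv_left (hC : Function.Bijective (antipode k : C →ₗ[k] C))
    {f : C →ₗ[k] Module.End k X} (h1 : f 1 = 1) (hf : ∀ a b, f (a * b) = f a * f b) (b : C) :
    conv (LinearMap.mul k (Module.End k X)).flip (f ∘ₗ antipodeInv hC) f b =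
      counit (R := k) b • (1 : Module.End k X) := by
  rw [lift_conv_congr (T := f ∘ₗ LinearMap.mul' k C ∘ₗ (TensorProduct.comm k C C).toLinearMap ∘ₗ
    (antipodeInv hC).rTensor C) (by intro x y; simp [hf])]
  simp only [LinearMap.comp_apply, LinearEquiv.coe_coe, mul_antipodeInv]
  simp [Algebra.algebraMap_eq_smul_one, h1]

/-- `∑ S⁻¹(b₍₂₎) b₍₁₎ = ε(b)`. -/
theorem antipodeInv_mul_cancel (hC : Function.Bijective (antipode k : C →ₗ[k] C)) (b : C) :
    LinearMap.mul' k C (TensorProduct.comm k C C ((antipodeInv hC).lTensor C (comul b))) =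
      algebraMap k C (counit b) := by
  apply hC.1
  have : ∀ t : C ⊗[k] C, antipode k (LinearMap.mul' k C (TensorProduct.comm k C C
      ((antipodeInv hC).lTensor C t))) = LinearMap.mul' k C ((antipode k).rTensor C t) := by
    intro t
    induction t with
    | zero => simp
    | add s t hs ht => simp only [map_add, hs, ht]
    | tmul a b => simp [antipode_mul_antidistrib, antipode_antipodeInv]
  rw [this, mul_antipode_rTensor_comul_apply]
  simp [Algebra.algebraMap_eq_smul_one]

/-- `∑ f(S⁻¹(b₍₂₎) b₍₁₎) = ε(b)` for a representation `f`. -/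
theorem conv_antipodeInv_right (hC : Function.Bijective (antipode k : C →ₗ[k] C))
    {f : C →ₗ[k] Module.End k X} (h1 : f 1 = 1) (hf : ∀ a b, f (a * b) = f a * f b) (b : C) :
    conv (LinearMap.mul k (Module.End k X)).flip f (f ∘ₗ antipodeInv hC) b =
      counit (R := k) b • (1 : Module.End k X) := by
  rw [lift_conv_congr (T := f ∘ₗ LinearMap.mul' k C ∘ₗ (TensorProduct.comm k C C).toLinearMap ∘ₗ
    (antipodeInv hC).lTensor C) (by intro x y; simp [hf])]
  simp only [LinearMap.comp_apply, LinearEquiv.coe_coe, antipodeInv_mul_cancel]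
  simp [Algebra.algebraMap_eq_smul_one, h1]

/-- For a comodule `M` and a module `X`, the map `x ⊗ m ↦ ∑ m₍₋₁₎ x ⊗ m₍₀₎` is bijective with
inverse `x ⊗ m ↦ ∑ S⁻¹(m₍₋₁₎) x ⊗ m₍₀₎`. -/
noncomputable def twistEquiv (hC : Function.Bijective (antipode k : C →ₗ[k] C))
    (c : M →ₗ[k] C ⊗[k] M) (f : C →ₗ[k] Module.End k X)
    (hc : ∀ m, TensorProduct.assoc k C C M (comul.rTensor M (c m)) = c.lTensor C (c m))
    (hc' : ∀ m, counit.rTensor M (c m) = (1 : k) ⊗ₜ[k] m)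
    (h1 : f 1 = 1) (hf : ∀ a b, f (a * b) = f a * f b) : X ⊗[k] M ≃ₗ[k] X ⊗[k] M :=
  LinearEquiv.ofLinearMap (twist c f) (twist c (f ∘ₗ antipodeInv hC))
    (LinearMap.ext fun x => twist_cancel hc hc' (conv_antipodeInv_left hC h1 hf) x)
    (LinearMap.ext fun x => twist_cancel hc hc' (conv_antipodeInv_right hC h1 hf) x)

end Twist

/-! ### The antipode and the comultiplication of the bosonization -/

namespace Bosonization

open RelYD.YDHopfAlgebra (act coact)

variable {k : Type u} [Field k] {H : Type v} [Ring H] [HopfAlgebra k H]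
  {R : Type w} [Ring R] [Algebra k R] [Coalgebra k R] [YDHopfAlgebra k H R]

theorem incl_antipode (h : H) : incl k H R (antipode k h) = antipode k (incl k H R h) := by
  have h1 := antipodeMap_mul_inclH (1 : Bosonization k H R) h
  have h2 : (antipodeMap 1 : Bosonization k H R) = 1 :=
    antipode_one (R := k) (A := Bosonization k H R)
  rw [one_mul, h2, mul_one] at h1
  exact h1.symm

/-- The antipode of `R # H` is bijective, as the composition of the bijections
`r # h ↦ ∑ r₍₋₁₎ h ⊗ r₍₀₎`, `S ⊗ S_R` and the multiplication `H ⊗ R → R # H`. -/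
theorem antipode_bijective (hH : Function.Bijective (antipode k : H →ₗ[k] H))
    (hR : Function.Bijective (YDHopfAlgebra.antipode H : R →ₗ[k] R)) :
    Function.Bijective (antipode k : Bosonization k H R →ₗ[k] Bosonization k H R) := by
  have hYD := YDHopfAlgebra.isYD (k := k) (H := H) (R := R)
  let e₁ : R ⊗[k] H ≃ₗ[k] H ⊗[k] R := (TensorProduct.comm k R H).trans
    (twistEquiv hH coact (LinearMap.mul k H) hYD.coassoc hYD.counit (by ext; simp)
      (by intro a b; ext; simp [mul_assoc]))
  let e₂ : H ⊗[k] R ≃ₗ[k] H ⊗[k] R :=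
    TensorProduct.congr (LinearEquiv.ofBijective (antipode k) hH)
      (LinearEquiv.ofBijective (YDHopfAlgebra.antipode H) hR)
  let e₃ : H ⊗[k] R ≃ₗ[k] Bosonization k H R := ((TensorProduct.comm k H R).trans
    (twistEquiv hH comul (act : H →ₗ[k] Module.End k R) coassoc_apply rTensor_counit_comul
      (LinearMap.ext hYD.act_one) (fun a b => LinearMap.ext (hYD.act_mul a b)))).trans mk
  have h3 : ∀ h r, e₃ (h ⊗ₜ r) = inclH h * inclR r := by
    intro h r
    rw [inclH_mul_inclR]
    change mk (twist comul (act : H →ₗ[k] Module.End k R) (r ⊗ₜ h)) = _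
    rw [twist_tmul]
    rfl
  suffices hS : (antipode k : Bosonization k H R →ₗ[k] Bosonization k H R) =
      (((mk.symm.trans e₁).trans e₂).trans e₃).toLinearMap by
    rw [hS]
    exact LinearEquiv.bijective _
  ext a
  refine mul_induction (p := fun a => antipode k a = e₃ (e₂ (e₁ (mk.symm a)))) a
    (fun r h => ?_) (fun a b ha hb => by simp only [map_add, ha, hb])
  refine (antipodeMap_apply r h).trans ?_
  rw [antipodeR_apply, inclR_mul_inclH, LinearEquiv.symm_apply_apply]
  change _ = e₃ (e₂ (twist coact (LinearMap.mul k H) (h ⊗ₜ r)))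
  rw [twist_tmul]
  generalize (coact r : H ⊗[k] R) = t
  induction t with
  | zero => simp only [map_zero, mul_zero]
  | add s t hs ht => simp only [map_add, mul_add, hs, ht]
  | tmul g x =>
    rw [LinearMap.rTensor_tmul, TensorProduct.congr_tmul, h3]
    simp [antipode_mul_antidistrib, mul_assoc]

theorem theta_inclR_mul (r : R) (a : Bosonization k H R) :
    theta k H R (inclR r * a) = r * theta k H R a := by
  refine mul_induction (p := fun a => theta k H R (inclR r * a) = r * theta k H R a) a
    (fun r' h => ?_) (fun a b ha hb => by simp only [mul_add, map_add, ha, hb])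
  rw [← mul_assoc, ← map_mul, inclR_mul_inclH, inclR_mul_inclH, theta_mk, theta_mk, mul_smul_comm]

theorem theta_mul_inclH (a : Bosonization k H R) (h : H) :
    theta k H R (a * inclH h) = counit (R := k) h • theta k H R a := by
  refine mul_induction (p := fun a => theta k H R (a * inclH h) =
    counit (R := k) h • theta k H R a) a
    (fun r' h' => ?_) (fun a b ha hb => by simp only [add_mul, map_add, smul_add, ha, hb])
  rw [mul_assoc, ← map_mul, inclR_mul_inclH, inclR_mul_inclH, theta_mk, theta_mk,
    Bialgebra.counit_mul, mul_comm, mul_smul]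

@[simp] theorem theta_inclR (r : R) : theta k H R (inclR r) = r := by
  rw [inclR_apply, theta_mk]
  simp

theorem theta_inclH_mul (h : H) (a : Bosonization k H R) :
    theta k H R (inclH h * a) = (act h : R →ₗ[k] R) (theta k H R a) := by
  refine mul_induction (p := fun a => theta k H R (inclH h * a) =
    (act h : R →ₗ[k] R) (theta k H R a)) a
    (fun r h' => ?_) (fun a b ha hb => by simp only [mul_add, map_add, ha, hb])
  have h1 : ∀ t : H ⊗[k] H, theta k H R (mk (TensorProduct.map
      ((act : H →ₗ[k] Module.End k R).flip r) LinearMap.id t)) =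
      (act : H →ₗ[k] Module.End k R) (TensorProduct.rid k H (counit.lTensor H t)) r := by
    intro t
    induction t with
    | zero => simp
    | add s t hs ht => simp only [map_add, LinearMap.add_apply, hs, ht]
    | tmul a b => simp [theta_mk]
  rw [← mul_assoc, theta_mul_inclH, inclH_mul_inclR, h1, theta_mul_inclH]
  simp

theorem comul_inclR_mul_inclH (r : R) (h : H) :
    comul (R := k) (inclR r * inclH h : Bosonization k H R) = Phi (comul (R := k) r) *
      Algebra.TensorProduct.map inclH inclH (comul (R := k) h) := by
  rw [comul_eq, map_mul, comulHom_inclR, comulHom_inclH]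

/-- `∑ a₍₁₎ ⊗ π(a₍₂₎) = ∑ (r # h₍₁₎) ⊗ h₍₂₎` for `a = r # h`. -/
theorem lTensor_proj_comul (r : R) (h : H) :
    (proj k H R : Bosonization k H R →ₗ[k] H).lTensor (Bosonization k H R)
      (comul (inclR r * inclH h)) =
    (LinearMap.mul k (Bosonization k H R) (inclR r) ∘ₗ inclH.toLinearMap).rTensor H (comul h) := by
  have hp : ∀ h, proj k H R (inclH h) = h := projAlg_inclH
  have hp' : ∀ r, proj k H R (inclR r) = algebraMap k H (counit r) := projAlg_inclR
  -- The second factor of `Phi (a ⊗ b)` lies in `R`, where `π` is the counit.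
  have hu : ∀ b : R, (proj k H R : Bosonization k H R →ₗ[k] H).lTensor (Bosonization k H R) (u b) =
      counit (R := k) b • 1 := by
    intro b
    have : ∀ t : H ⊗[k] R,
        (proj k H R : Bosonization k H R →ₗ[k] H).lTensor (Bosonization k H R) (J t) =
        TensorProduct.map inclH.toLinearMap (Algebra.linearMap k H) (counit.lTensor H t) := by
      intro t
      induction t with
      | zero => simp only [map_zero]
      | add s t hs ht => simp only [map_add, hs, ht]
      | tmul g r => simp [hp']
    rw [u_apply, this, coact_counit_right]
    simp [Algebra.TensorProduct.one_def, Algebra.algebraMap_eq_smul_one]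
  have hP : ∀ (t : R ⊗[k] R) (x y : H),
      (proj k H R : Bosonization k H R →ₗ[k] H).lTensor (Bosonization k H R)
        (Phi t * (inclH x ⊗ₜ inclH y)) =
      (inclR (TensorProduct.rid k R (counit.lTensor R t)) * inclH x) ⊗ₜ y := by
    intro t x y
    have hm : ∀ z z' : Bosonization k H R ⊗[k] Bosonization k H R,
        (proj k H R : Bosonization k H R →ₗ[k] H).lTensor (Bosonization k H R) (z * z') =
        (proj k H R : Bosonization k H R →ₗ[k] H).lTensor (Bosonization k H R) z *
        (proj k H R : Bosonization k H R →ₗ[k] H).lTensor (Bosonization k H R) z' :=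
      fun z z' => map_mul (Algebra.TensorProduct.map (.id k (Bosonization k H R))
        (projAlg (k := k) (H := H) (R := R))) z z'
    induction t with
    | zero => simp only [map_zero, zero_mul, TensorProduct.zero_tmul]
    | add s t hs ht => simp only [map_add, add_mul, TensorProduct.add_tmul, hs, ht]
    | tmul a b =>
      rw [Phi_tmul, hm, hm, hu]
      simp [hp, TensorProduct.smul_tmul']
  rw [comul_inclR_mul_inclH]
  have h1 : ∀ s : H ⊗[k] H,
      (proj k H R : Bosonization k H R →ₗ[k] H).lTensor (Bosonization k H R)
        (Phi (comul (R := k) r) * Algebra.TensorProduct.map inclH inclH s) =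
      (LinearMap.mul k (Bosonization k H R) (inclR r) ∘ₗ inclH.toLinearMap).rTensor H s := by
    intro s
    induction s with
    | zero => simp only [map_zero, mul_zero]
    | add s t hs ht => simp only [map_add, mul_add, hs, ht]
    | tmul x y =>
      rw [Algebra.TensorProduct.map_tmul, hP]
      simp
  exact h1 _

/-- `∑ ϑ(a₍₁₎) ⊗ π(a₍₂₎)` recovers `a`. -/
theorem map_theta_proj_comul (a : Bosonization k H R) :
    TensorProduct.map (theta k H R) (proj k H R : Bosonization k H R →ₗ[k] H) (comul a) =
      mk.symm a := by
  refine mul_induction (p := fun a => TensorProduct.map (theta k H R)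
    (proj k H R : Bosonization k H R →ₗ[k] H) (comul a) = mk.symm a) a
    (fun r h => ?_) (fun a b ha hb => by simp only [map_add, ha, hb])
  rw [← LinearMap.rTensor_comp_lTensor, LinearMap.comp_apply, lTensor_proj_comul,
    ← LinearMap.rTensor_comp_apply, inclR_mul_inclH, LinearEquiv.symm_apply_apply]
  have : theta k H R ∘ₗ LinearMap.mul k (Bosonization k H R) (inclR r) ∘ₗ inclH.toLinearMap =
      LinearMap.toSpanSingleton k R r ∘ₗ counit := by
    ext x
    simp [inclR_mul_inclH, theta_mk]
  rw [this, LinearMap.rTensor_comp_apply, rTensor_counit_comul]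
  simp

/-- `a ⊗ b ↦ ∑ a b₍₋₁₎ ⊗ b₍₀₎`. -/
noncomputable def smashCoact : R ⊗[k] R →ₗ[k] Bosonization k H R ⊗[k] R :=
  TensorProduct.lift ((LinearMap.rTensorHom R ∘ₗ LinearMap.mul k (Bosonization k H R) ∘ₗ
    inclR.toLinearMap).compl₂ (inclH.toLinearMap.rTensor R ∘ₗ coact))

theorem smashCoact_tmul (a b : R) : (smashCoact (a ⊗ₜ b) : Bosonization k H R ⊗[k] R) =
    (LinearMap.mul k (Bosonization k H R) (inclR a) ∘ₗ inclH.toLinearMap).rTensor R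
      (coact b) := by
  rw [LinearMap.rTensor_comp_apply]
  rfl

theorem lTensor_theta_Phi (t : R ⊗[k] R) :
    (theta k H R).lTensor (Bosonization k H R) (Phi t) = smashCoact t := by
  induction t with
  | zero => simp only [map_zero]
  | add s t hs ht => simp only [map_add, hs, ht]
  | tmul a b =>
    rw [Phi_tmul, smashCoact_tmul, u_apply]
    generalize (coact b : H ⊗[k] R) = s
    induction s with
    | zero => simp only [map_zero, mul_zero]
    | add s t hs ht => simp only [map_add, mul_add, hs, ht]
    | tmul g c => simp

/-- `∑ a₍₁₎ ⊗ ϑ(a₍₂₎) = ∑ r₍₁₎ (r₍₂₎)₍₋₁₎ h ⊗ (r₍₂₎)₍₀₎` for `a = r # h`. -/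
theorem lTensor_theta_comul (r : R) (h : H) :
    (theta k H R).lTensor (Bosonization k H R) (comul (inclR r * inclH h)) =
    ((LinearMap.mul k (Bosonization k H R)).flip (inclH h)).rTensor R (smashCoact (comul r)) := by
  have h1 : ∀ (z : Bosonization k H R ⊗[k] Bosonization k H R) (s : H ⊗[k] H),
      (theta k H R).lTensor (Bosonization k H R) (z * Algebra.TensorProduct.map inclH inclH s) =
      ((LinearMap.mul k (Bosonization k H R)).flip
        (inclH (TensorProduct.rid k H (counit.lTensor H s)))).rTensor R
        ((theta k H R).lTensor (Bosonization k H R) z) := by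
    intro z s
    induction s with
    | zero => simp only [map_zero, mul_zero, LinearMap.rTensor_zero, LinearMap.zero_apply]
    | add s t hs ht =>
      simp only [map_add, mul_add, hs, ht, LinearMap.rTensor_add, LinearMap.add_apply]
    | tmul x y =>
      induction z with
      | zero => simp only [map_zero, zero_mul]
      | add s t hs ht => simp only [map_add, add_mul, hs, ht]
      | tmul a b => simp [theta_mul_inclH, TensorProduct.smul_tmul']
  rw [comul_inclR_mul_inclH, h1, lTensor_theta_Phi, lTensor_counit_comul]
  simp

/-- The projection `ϑ` is a coalgebra map. -/
theorem map_theta_theta_comul (a : Bosonization k H R) :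
    TensorProduct.map (theta k H R) (theta k H R) (comul a) = comul (theta k H R a) := by
  refine mul_induction (p := fun a => TensorProduct.map (theta k H R) (theta k H R) (comul a) =
    comul (theta k H R a)) a (fun r h => ?_) (fun a b ha hb => by simp only [map_add, ha, hb])
  have h1 : ∀ t : R ⊗[k] R, (theta k H R).rTensor R
      (((LinearMap.mul k (Bosonization k H R)).flip (inclH h)).rTensor R (smashCoact t)) =
      counit (R := k) h • t := by
    intro t
    induction t with
    | zero => simp only [map_zero, smul_zero]
    | add s t hs ht => simp only [map_add, smul_add, hs, ht]
    | tmul a b =>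
      have e : theta k H R ∘ₗ (LinearMap.mul k (Bosonization k H R)).flip (inclH h) ∘ₗ
          LinearMap.mul k (Bosonization k H R) (inclR a) ∘ₗ inclH.toLinearMap =
          counit (R := k) h • (LinearMap.toSpanSingleton k R a ∘ₗ counit) := by
        ext x
        simp [theta_mul_inclH]
      rw [smashCoact_tmul, ← LinearMap.rTensor_comp_apply, ← LinearMap.rTensor_comp_apply,
        LinearMap.comp_assoc, e,
        LinearMap.rTensor_smul, LinearMap.smul_apply, LinearMap.rTensor_comp_apply, coact_counit]
      simp
  rw [← LinearMap.rTensor_comp_lTensor, LinearMap.comp_apply, lTensor_theta_comul, h1,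
    theta_mul_inclH, theta_inclR, map_smul]

/-- `∑ π(a₍₁₎) ⊗ ϑ(a₍₂₎) = ∑ r₍₋₁₎ h ⊗ r₍₀₎` for `a = r # h`. -/
theorem map_proj_theta_comul (r : R) (h : H) :
    TensorProduct.map (proj k H R : Bosonization k H R →ₗ[k] H) (theta k H R)
      (comul (inclR r * inclH h)) =
    ((LinearMap.mul k H).flip h).rTensor R (coact r) := by
  have h1 : ∀ t : R ⊗[k] R, (proj k H R : Bosonization k H R →ₗ[k] H).rTensor R
      (((LinearMap.mul k (Bosonization k H R)).flip (inclH h)).rTensor R (smashCoact t)) =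
      ((LinearMap.mul k H).flip h).rTensor R
        (coact (TensorProduct.lid k R (counit.rTensor R t))) := by
    intro t
    induction t with
    | zero => simp only [map_zero]
    | add s t hs ht => simp only [map_add, hs, ht]
    | tmul a b =>
      have e : (proj k H R : Bosonization k H R →ₗ[k] H) ∘ₗ
          (LinearMap.mul k (Bosonization k H R)).flip (inclH h) ∘ₗ
          LinearMap.mul k (Bosonization k H R) (inclR a) ∘ₗ inclH.toLinearMap =
          counit (R := k) a • ((LinearMap.mul k H).flip h) := by
        ext x
        have : proj k H R (inclR a * inclH x * inclH h) = counit (R := k) a • (x * h) := by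
          rw [mul_assoc, ← map_mul, inclR_mul_inclH, proj_mk]
        simpa using this
      rw [smashCoact_tmul, ← LinearMap.rTensor_comp_apply, ← LinearMap.rTensor_comp_apply,
        LinearMap.comp_assoc, e]
      simp [LinearMap.rTensor_smul]
  rw [← LinearMap.rTensor_comp_lTensor, LinearMap.comp_apply, lTensor_theta_comul, h1,
    rTensor_counit_comul]
  simp

end Bosonization


/-! ### Corestriction along coalgebra maps -/

section Corestrict

variable {k : Type u} [Field k] {B : Type v} [Ring B] [HopfAlgebra k B]
  {C : Type w} [Ring C] [HopfAlgebra k C] {D : Type x} [Ring D] [HopfAlgebra k D]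
  {M : Type*} [AddCommGroup M] [Module k M]

/-- Corestriction along a map that respects comultiplications preserves coassociativity. -/
theorem coassoc_corestrict {E : Type*} [AddCommGroup E] [Module k E] [Coalgebra k E]
    {f : C →ₗ[k] E} (hf : ∀ c, TensorProduct.map f f (comul (R := k) c) = comul (R := k) (f c))
    {c : M →ₗ[k] C ⊗[k] M}
    (hc : ∀ m, TensorProduct.assoc k C C M (comul.rTensor M (c m)) = c.lTensor C (c m)) (m : M) :
    TensorProduct.assoc k E E M (comul.rTensor M (f.rTensor M (c m))) =
      (f.rTensor M ∘ₗ c).lTensor E (f.rTensor M (c m)) := by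
  have h1 : (f.rTensor M ∘ₗ c).lTensor E (f.rTensor M (c m)) =
      TensorProduct.map f (f.rTensor M) (c.lTensor C (c m)) := by
    generalize c m = t
    induction t with
    | zero => simp only [map_zero]
    | add s t hs ht => simp only [map_add, hs, ht]
    | tmul a m => simp
  rw [h1, ← hc]
  generalize c m = t
  induction t with
  | zero => simp only [map_zero]
  | add s t hs ht => simp only [map_add, hs, ht]
  | tmul a m =>
    simp only [LinearMap.rTensor_tmul, ← hf]
    generalize comul (R := k) a = s
    induction s with
    | zero => simp only [map_zero, TensorProduct.zero_tmul]
    | add s t hs ht => simp only [map_add, TensorProduct.add_tmul, hs, ht]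
    | tmul a b => simp

theorem freeLeft_corestrict {ρ : B →ₐc[k] C} {τ : B →ₐc[k] D} (σ : C →ₐc[k] D)
    (hσ : ∀ b, σ (ρ b) = τ b) {act : B →ₗ[k] Module.End k M} {c : M →ₗ[k] C ⊗[k] M}
    (h : FreeLeft ρ act c) : FreeLeft τ act ((σ : C →ₗ[k] D).rTensor M ∘ₗ c) := by
  have h1 : ∀ y, rmulL τ M y ∘ₗ (σ : C →ₗ[k] D).rTensor M =
      (σ : C →ₗ[k] D).rTensor M ∘ₗ rmulL ρ M y := fun y => by
    refine TensorProduct.ext' fun a m => ?_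
    simp [hσ]
  have h2 : ∀ x y, lmulL τ M x ∘ₗ (act y).lTensor D ∘ₗ (σ : C →ₗ[k] D).rTensor M =
      (σ : C →ₗ[k] D).rTensor M ∘ₗ lmulL ρ M x ∘ₗ (act y).lTensor C := fun x y => by
    refine TensorProduct.ext' fun a m => ?_
    simp [hσ]
  rw [FreeLeft] at h ⊢
  ext1 b
  have e := congrArg (LinearMap.llcomp k M _ _ ((σ : C →ₗ[k] D).rTensor M))
    (LinearMap.congr_fun h b)
  rw [map_conv, map_conv] at e
  refine (LinearMap.congr_fun (conv_congr fun x y => ?_) b).trans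
    (e.trans (LinearMap.congr_fun (conv_congr fun x y => ?_) b))
  · exact congrArg (fun f => f ∘ₗ c ∘ₗ act x) (h1 y)
  · exact (congrArg (fun f => f ∘ₗ c) (h2 x y)).symm

theorem conv_comp {X Y Z : Type*} [AddCommMonoid X] [Module k X] [AddCommMonoid Y] [Module k Y]
    [AddCommMonoid Z] [Module k Z] (τ : B →ₐc[k] C) (μ : X →ₗ[k] Y →ₗ[k] Z) (f : C →ₗ[k] X)
    (g : C →ₗ[k] Y) (b : B) :
    conv μ f g (τ b) = conv μ (f ∘ₗ (τ : B →ₗ[k] C)) (g ∘ₗ (τ : B →ₗ[k] C)) b := by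
  refine Eq.trans ?_ (lift_conv_congr (T := TensorProduct.lift (μ.compl₁₂ f g) ∘ₗ
    TensorProduct.map (τ : B →ₗ[k] C) (τ : B →ₗ[k] C)) (by intro x y; simp) b).symm
  have : TensorProduct.map (τ : B →ₗ[k] C) (τ : B →ₗ[k] C) (comul b) = comul (R := k) (τ b) :=
    CoalgHomClass.map_comp_comul_apply τ b
  rw [LinearMap.comp_apply, this]
  rfl

end Corestrict

/-! ### Comodules over the bosonization as braided comodules -/

section Glue

variable {k : Type u} [Field k] {H : Type v} [Ring H] [HopfAlgebra k H]
  {R : Type w} [Ring R] [Algebra k R] {M : Type*} [AddCommGroup M] [Module k M]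

/-- `r ⊗ (h ⊗ m) ↦ (r # h) ⊗ m`. -/
noncomputable def glue (k : Type u) [Field k] (H : Type v) [Ring H] [HopfAlgebra k H]
    (R : Type w) [Ring R] [Algebra k R] (M : Type*) [AddCommGroup M] [Module k M] :
    R ⊗[k] (H ⊗[k] M) →ₗ[k] Bosonization k H R ⊗[k] M :=
  Bosonization.mk.toLinearMap.rTensor M ∘ₗ (TensorProduct.assoc k R H M).symm.toLinearMap

@[simp] theorem glue_tmul (r : R) (h : H) (m : M) :
    glue k H R M (r ⊗ₜ (h ⊗ₜ m)) = Bosonization.mk (r ⊗ₜ h) ⊗ₜ m := rfl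

end Glue

section Comodule

open RelYD.YDHopfAlgebra (act coact)
open RelYD.Bosonization (proj incl theta inclR inclH)

variable {k : Type u} [Field k] {H : Type v} [Ring H] [HopfAlgebra k H]
  {R : Type w} [Ring R] [Algebra k R] [Coalgebra k R] [YDHopfAlgebra k H R]
  {M : Type*} [AddCommGroup M] [Module k M]

/-- `M` is a left `R`-comodule in the category of left Yetter-Drinfeld modules over `H`: a
Yetter-Drinfeld module with an `R`-coaction that is `H`-linear and `H`-colinear. -/
structure IsYDComodule (aH : H →ₗ[k] Module.End k M) (cH : M →ₗ[k] H ⊗[k] M)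
    (cR : M →ₗ[k] R ⊗[k] M) : Prop where
  isYD : IsLeftYD (BialgHom.id k H) aH cH
  coassoc : ∀ m, TensorProduct.assoc k R R M (comul.rTensor M (cR m)) = cR.lTensor R (cR m)
  counit : ∀ m, counit.rTensor M (cR m) = (1 : k) ⊗ₜ[k] m
  hom : IsLeftHom aH cH (tensorAct act aH) (tensorCoactLeft coact cH) cR

/-- The coaction of `R # H` composed of coactions of `R` and `H`. -/
noncomputable def glueCoact (cH : M →ₗ[k] H ⊗[k] M) (cR : M →ₗ[k] R ⊗[k] M) :
    M →ₗ[k] Bosonization k H R ⊗[k] M :=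
  glue k H R M ∘ₗ cH.lTensor R ∘ₗ cR

/-- The `R`-coaction `m ↦ ϑ(m₍₋₁₎) ⊗ m₍₀₎` behind a coaction of `R # H`. -/
noncomputable def thetaCoact (c : M →ₗ[k] Bosonization k H R ⊗[k] M) : M →ₗ[k] R ⊗[k] M :=
  (theta k H R).rTensor M ∘ₗ c

/-- The `H`-coaction `m ↦ π(m₍₋₁₎) ⊗ m₍₀₎` behind a coaction of `R # H`. -/
noncomputable def projCoact (c : M →ₗ[k] Bosonization k H R ⊗[k] M) : M →ₗ[k] H ⊗[k] M :=
  (proj k H R : Bosonization k H R →ₗ[k] H).rTensor M ∘ₗ c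

/-- A coaction of `R # H` is determined by the coactions of `R` and `H` behind it, because
`∑ ϑ(a₍₁₎) ⊗ π(a₍₂₎)` recovers `a`. -/
theorem glueCoact_thetaCoact_projCoact {c : M →ₗ[k] Bosonization k H R ⊗[k] M}
    (hc : ∀ m, TensorProduct.assoc k _ _ M (comul.rTensor M (c m)) =
      c.lTensor (Bosonization k H R) (c m)) :
    glueCoact (projCoact c) (thetaCoact c) = c := by
  ext m
  have h1 : (projCoact c).lTensor R (thetaCoact c m) =
      TensorProduct.map (theta k H R) ((proj k H R : Bosonization k H R →ₗ[k] H).rTensor M)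
        (c.lTensor (Bosonization k H R) (c m)) := by
    rw [thetaCoact, LinearMap.comp_apply]
    generalize c m = t
    induction t with
    | zero => simp only [map_zero]
    | add s t hs ht => simp only [map_add, hs, ht]
    | tmul a m => simp [projCoact]
  rw [glueCoact, LinearMap.comp_apply, LinearMap.comp_apply, h1, ← hc]
  generalize c m = t
  induction t with
  | zero => simp only [map_zero]
  | add s t hs ht => simp only [map_add, hs, ht]
  | tmul a m =>
    have h2 : ∀ s : Bosonization k H R ⊗[k] Bosonization k H R,
        glue k H R M (TensorProduct.map (theta k H R)
          ((proj k H R : Bosonization k H R →ₗ[k] H).rTensor M)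
          (TensorProduct.assoc k _ _ M (s ⊗ₜ m))) =
        Bosonization.mk (TensorProduct.map (theta k H R)
          (proj k H R : Bosonization k H R →ₗ[k] H) s) ⊗ₜ m := by
      intro s
      induction s with
      | zero => simp only [map_zero, TensorProduct.zero_tmul]
      | add s t hs ht => simp only [map_add, TensorProduct.add_tmul, hs, ht]
      | tmul a b => simp
    rw [LinearMap.rTensor_tmul, h2, Bosonization.map_theta_proj_comul, LinearEquiv.apply_symm_apply]

/-- The `R`-coaction is `H`-linear: `ϑ` turns the right multiplication by `H` in the antipode-free
compatibility into the counit, and the left multiplication into the action on `R`. -/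
theorem thetaCoact_act {aH : H →ₗ[k] Module.End k M} {c : M →ₗ[k] Bosonization k H R ⊗[k] M}
    (h : FreeLeft (incl k H R) aH c) (b : H) (m : M) :
    thetaCoact c (aH b m) = tensorAct act aH b (thetaCoact c m) := by
  have h1 : ∀ y, (theta k H R).rTensor M ∘ₗ rmulL (incl k H R) M y =
      counit (R := k) y • (theta k H R).rTensor M := fun y => by
    refine TensorProduct.ext' fun a m => ?_
    refine (congrArg (· ⊗ₜ[k] m) (Bosonization.theta_mul_inclH (k := k) a y)).trans ?_
    simp [TensorProduct.smul_tmul']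
  have h2 : ∀ x y, (theta k H R).rTensor M ∘ₗ lmulL (incl k H R) M x ∘ₗ
      (aH y).lTensor (Bosonization k H R) =
      TensorProduct.map (act x) (aH y) ∘ₗ (theta k H R).rTensor M := fun x y => by
    refine TensorProduct.ext' fun a m => ?_
    exact congrArg (· ⊗ₜ[k] (aH y m)) (Bosonization.theta_inclH_mul (k := k) x a)
  have e := congrArg (LinearMap.llcomp k M _ _ ((theta k H R).rTensor M))
    (LinearMap.congr_fun h b)
  rw [map_conv, map_conv] at e
  -- `e1` inserts a counit, so that the left side becomes comparable with `e` factor by factor.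
  have e1 := conv_counit_right (revComp k M (Bosonization k H R ⊗[k] M) (R ⊗[k] M))
    (LinearMap.llcomp k M M _ c ∘ₗ aH)
    (g := LinearMap.toSpanSingleton k _ ((theta k H R).rTensor M) ∘ₗ counit)
    (e := (theta k H R).rTensor M) (fun b => rfl) b
  have e2 := map_conv ((LinearMap.llcomp k M (R ⊗[k] M) (R ⊗[k] M)).flip (thetaCoact c))
    (TensorProduct.mapBilinear (RingHom.id k) R M R M) act aH b
  refine LinearMap.congr_fun
    (e1.symm.trans ((LinearMap.congr_fun (conv_congr fun x y => ?_) b).trans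
    (e.trans ((LinearMap.congr_fun (conv_congr fun x y => ?_) b).trans e2.symm)))) m
  · exact (congrArg (fun f => f ∘ₗ c ∘ₗ aH x) (h1 y)).symm
  · exact congrArg (fun f => f ∘ₗ c) (h2 x y)

/-- The `R`-coaction is `H`-colinear: both sides arise from the comultiplication of `R # H`, the
left one through `∑ ϑ(a₍₁₎)₍₋₁₎ π(a₍₂₎) ⊗ ϑ(a₍₁₎)₍₀₎`, the right one through
`∑ π(a₍₁₎) ⊗ ϑ(a₍₂₎)`. -/
theorem thetaCoact_coact {c : M →ₗ[k] Bosonization k H R ⊗[k] M}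
    (hc : ∀ m, TensorProduct.assoc k _ _ M (comul.rTensor M (c m)) =
      c.lTensor (Bosonization k H R) (c m)) (m : M) :
    tensorCoactLeft coact (projCoact c) (thetaCoact c m) =
      (thetaCoact c).lTensor H (projCoact c m) := by
  have h1 : (thetaCoact c).lTensor H (projCoact c m) =
      TensorProduct.map (proj k H R : Bosonization k H R →ₗ[k] H) ((theta k H R).rTensor M)
        (c.lTensor (Bosonization k H R) (c m)) := by
    rw [projCoact, LinearMap.comp_apply]
    generalize c m = t
    induction t with
    | zero => simp only [map_zero]
    | add s t hs ht => simp only [map_add, hs, ht]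
    | tmul a m => simp [thetaCoact]
  have h2 : tensorCoactLeft coact (projCoact c) (thetaCoact c m) = mixL k H R M
      (TensorProduct.map (coact ∘ₗ theta k H R)
        ((proj k H R : Bosonization k H R →ₗ[k] H).rTensor M)
        (c.lTensor (Bosonization k H R) (c m))) := by
    rw [thetaCoact, LinearMap.comp_apply]
    generalize c m = t
    induction t with
    | zero => simp only [map_zero]
    | add s t hs ht => simp only [map_add, hs, ht]
    | tmul a m => simp [projCoact, tensorCoactLeft_tmul]
  rw [h1, h2, ← hc]
  generalize c m = t
  induction t with
  | zero => simp only [map_zero]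
  | add s t hs ht => simp only [map_add, hs, ht]
  | tmul a m =>
    have h3 : ∀ s : Bosonization k H R ⊗[k] Bosonization k H R,
        TensorProduct.map (coact ∘ₗ theta k H R)
          ((proj k H R : Bosonization k H R →ₗ[k] H).rTensor M)
          (TensorProduct.assoc k _ _ M (s ⊗ₜ m)) =
        TensorProduct.map (coact : R →ₗ[k] H ⊗[k] R) ((TensorProduct.mk k H M).flip m)
          (TensorProduct.map (theta k H R) (proj k H R : Bosonization k H R →ₗ[k] H) s) := by
      intro s
      induction s with
      | zero => simp only [map_zero, TensorProduct.zero_tmul]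
      | add s t hs ht => simp only [map_add, TensorProduct.add_tmul, hs, ht]
      | tmul a b => simp
    have h4 : ∀ s : Bosonization k H R ⊗[k] Bosonization k H R,
        TensorProduct.map (proj k H R : Bosonization k H R →ₗ[k] H) ((theta k H R).rTensor M)
          (TensorProduct.assoc k _ _ M (s ⊗ₜ m)) =
        TensorProduct.assoc k _ _ _ (TensorProduct.map
          (proj k H R : Bosonization k H R →ₗ[k] H) (theta k H R) s ⊗ₜ m) := by
      intro s
      induction s with
      | zero => simp only [map_zero, TensorProduct.zero_tmul]
      | add s t hs ht => simp only [map_add, TensorProduct.add_tmul, hs, ht]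
      | tmul a b => simp
    rw [LinearMap.rTensor_tmul, h3, h4, Bosonization.map_theta_proj_comul]
    refine Bosonization.mul_induction (p := fun a => mixL k H R M
        (TensorProduct.map (coact : R →ₗ[k] H ⊗[k] R) ((TensorProduct.mk k H M).flip m)
          (Bosonization.mk.symm a)) = TensorProduct.assoc k _ _ _
        (TensorProduct.map (proj k H R : Bosonization k H R →ₗ[k] H) (theta k H R)
          (comul a) ⊗ₜ m)) a (fun r h => ?_) (fun a b ha hb => ?_)
    · rw [Bosonization.map_proj_theta_comul, Bosonization.inclR_mul_inclH,
        LinearEquiv.symm_apply_apply, TensorProduct.map_tmul]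
      generalize (coact r : H ⊗[k] R) = t
      induction t with
      | zero => simp only [map_zero, TensorProduct.zero_tmul]
      | add s t hs ht => simp only [map_add, TensorProduct.add_tmul, hs, ht]
      | tmul g x => simp
    · simp only [map_add, ha, hb, TensorProduct.add_tmul]

/-- Corestriction along `π` gives a Yetter-Drinfeld module over `H`. -/
theorem IsLeftYD.projCoact {aH : H →ₗ[k] Module.End k M}
    {c : M →ₗ[k] Bosonization k H R ⊗[k] M} (h : IsLeftYD (incl k H R) aH c) :
    IsLeftYD (BialgHom.id k H) aH (projCoact c) where
  act_one := h.act_one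
  act_mul := h.act_mul
  coassoc := coassoc_corestrict (f := (proj k H R : Bosonization k H R →ₗ[k] H))
    (CoalgHomClass.map_comp_comul_apply (proj k H R)) h.coassoc
  counit m := by
    have e : Coalgebra.counit ∘ₗ (proj k H R : Bosonization k H R →ₗ[k] H) =
        Coalgebra.counit (R := k) := CoalgHomClass.counit_comp (proj k H R)
    refine Eq.trans ?_ (h.counit m)
    rw [← e, LinearMap.rTensor_comp]
    rfl
  compat := (freeLeft_iff _ _ _).1 (freeLeft_corestrict (proj k H R)
    (τ := BialgHom.id k H) (fun b => Bosonization.projAlg_inclH b)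
    ((freeLeft_iff _ _ _).2 h.compat))

theorem Bosonization.counit_theta :
    Coalgebra.counit ∘ₗ theta k H R = Coalgebra.counit (R := k) := by
  ext a
  refine Bosonization.mul_induction (p := fun a => counit (R := k) (theta k H R a) =
    counit (R := k) a) a (fun r h => ?_) (fun a b ha hb => by simp only [map_add, ha, hb])
  rw [Bosonization.theta_mul_inclH, Bosonization.theta_inclR, Bialgebra.counit_mul,
    Bosonization.counit_eq, Bosonization.counit_eq]
  simp [mul_comm]

theorem thetaCoact_coassoc {c : M →ₗ[k] Bosonization k H R ⊗[k] M}
    (hc : ∀ m, TensorProduct.assoc k _ _ M (comul.rTensor M (c m)) =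
      c.lTensor (Bosonization k H R) (c m)) (m : M) :
    TensorProduct.assoc k R R M (comul.rTensor M (thetaCoact c m)) =
      (thetaCoact c).lTensor R (thetaCoact c m) :=
  coassoc_corestrict (f := theta k H R) Bosonization.map_theta_theta_comul hc m

theorem thetaCoact_counit {c : M →ₗ[k] Bosonization k H R ⊗[k] M}
    (hc : ∀ m, counit.rTensor M (c m) = (1 : k) ⊗ₜ[k] m) (m : M) :
    counit.rTensor M (thetaCoact c m) = (1 : k) ⊗ₜ[k] m := by
  refine Eq.trans ?_ (hc m)
  rw [← Bosonization.counit_theta, LinearMap.rTensor_comp]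
  rfl

/-- A left `H`-module and `R # H`-comodule with the relative Yetter-Drinfeld compatibility is an
`R`-comodule in the category of Yetter-Drinfeld modules over `H`. -/
theorem IsLeftYD.isYDComodule {aH : H →ₗ[k] Module.End k M}
    {c : M →ₗ[k] Bosonization k H R ⊗[k] M} (h : IsLeftYD (incl k H R) aH c) :
    IsYDComodule aH (RelYD.projCoact c) (thetaCoact c) where
  isYD := h.projCoact
  coassoc := thetaCoact_coassoc h.coassoc
  counit := thetaCoact_counit h.counit
  hom := ⟨thetaCoact_act ((freeLeft_iff _ _ _).2 h.compat), thetaCoact_coact h.coassoc⟩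

end Comodule


/-! ### Braided comodules as comodules over the bosonization -/

section ComoduleConverse

open RelYD.YDHopfAlgebra (act coact)
open RelYD.Bosonization (proj incl theta inclR inclH)

variable {k : Type u} [Field k] {H : Type v} [Ring H] [HopfAlgebra k H]
  {R : Type w} [Ring R] [Algebra k R] [Coalgebra k R] [YDHopfAlgebra k H R]
  {M : Type*} [AddCommGroup M] [Module k M]

theorem thetaCoact_glueCoact {cH : M →ₗ[k] H ⊗[k] M}
    (hH : ∀ m, counit.rTensor M (cH m) = (1 : k) ⊗ₜ[k] m) (cR : M →ₗ[k] R ⊗[k] M) :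
    thetaCoact (glueCoact cH cR) = cR := by
  have h1 : (theta k H R).rTensor M ∘ₗ glue k H R M ∘ₗ cH.lTensor R = LinearMap.id := by
    refine TensorProduct.ext' fun r m => ?_
    have h2 : ∀ t : H ⊗[k] M, (theta k H R).rTensor M (glue k H R M (r ⊗ₜ t)) =
        r ⊗ₜ TensorProduct.lid k M (counit.rTensor M t) := by
      intro t
      induction t with
      | zero => simp only [map_zero, TensorProduct.tmul_zero]
      | add s t hs ht => simp only [map_add, TensorProduct.tmul_add, hs, ht]
      | tmul h m => simp [Bosonization.theta_mk, TensorProduct.smul_tmul]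
    simp [h2, hH]
  exact congrArg (fun f => f ∘ₗ cR) h1

theorem projCoact_glueCoact (cH : M →ₗ[k] H ⊗[k] M) {cR : M →ₗ[k] R ⊗[k] M}
    (hR : ∀ m, counit.rTensor M (cR m) = (1 : k) ⊗ₜ[k] m) :
    projCoact (glueCoact cH cR) = cH := by
  have h1 : ∀ x : R ⊗[k] M, (proj k H R : Bosonization k H R →ₗ[k] H).rTensor M
      (glue k H R M (cH.lTensor R x)) = cH (TensorProduct.lid k M (counit.rTensor M x)) := by
    intro x
    induction x with
    | zero => simp only [map_zero]
    | add s t hs ht => simp only [map_add, hs, ht]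
    | tmul r m =>
      simp only [LinearMap.lTensor_tmul, LinearMap.rTensor_tmul, TensorProduct.lid_tmul, map_smul]
      generalize cH m = t
      induction t with
      | zero => simp only [map_zero, TensorProduct.tmul_zero, smul_zero]
      | add s t hs ht => simp only [map_add, TensorProduct.tmul_add, smul_add, hs, ht]
      | tmul h m => simp [Bosonization.proj_mk, TensorProduct.smul_tmul']
  ext m
  refine (h1 (cR m)).trans ?_
  simp [hR]

/-- `r ⊗ (g ⊗ (h ⊗ m)) ↦ r₍₋₁₎ g ⊗ ((r₍₀₎ # h) ⊗ m)`. -/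
noncomputable def crossGlue :
    R ⊗[k] (H ⊗[k] (H ⊗[k] M)) →ₗ[k] H ⊗[k] (Bosonization k H R ⊗[k] M) :=
  (glue k H R M).lTensor H ∘ₗ mixL k H R (H ⊗[k] M) ∘ₗ
    (coact : R →ₗ[k] H ⊗[k] R).rTensor (H ⊗[k] (H ⊗[k] M))

/-- Colinearity of the `R`-coaction, expressed through `crossGlue`. -/
theorem lTensor_glueCoact {cH : M →ₗ[k] H ⊗[k] M} {cR : M →ₗ[k] R ⊗[k] M}
    (h : ∀ m, tensorCoactLeft coact cH (cR m) = cR.lTensor H (cH m)) (m : M) :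
    (glueCoact cH cR).lTensor H (cH m) = crossGlue ((cH.lTensor H ∘ₗ cH).lTensor R (cR m)) := by
  have h1 : ∀ x : R ⊗[k] M, (cH.lTensor R).lTensor H (tensorCoactLeft coact cH x) =
      mixL k H R (H ⊗[k] M) (TensorProduct.map coact (cH.lTensor H ∘ₗ cH) x) := by
    intro x
    induction x with
    | zero => simp only [map_zero]
    | add s t hs ht => simp only [map_add, hs, ht]
    | tmul r m =>
      rw [tensorCoactLeft_tmul, TensorProduct.map_tmul, LinearMap.comp_apply]
      generalize (coact r : H ⊗[k] R) = s
      generalize cH m = t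
      induction s with
      | zero => simp only [map_zero, TensorProduct.zero_tmul]
      | add s s' hs hs' => simp only [map_add, TensorProduct.add_tmul, hs, hs']
      | tmul g r =>
        induction t with
        | zero => simp only [map_zero, TensorProduct.tmul_zero]
        | add s s' hs hs' => simp only [map_add, TensorProduct.tmul_add, hs, hs']
        | tmul h m => simp
  rw [glueCoact, LinearMap.lTensor_comp, LinearMap.lTensor_comp, LinearMap.comp_apply,
    LinearMap.comp_apply, ← h, h1, ← LinearMap.rTensor_comp_lTensor]
  rfl

/-- The comultiplication of `R # H` on `r # h`, computed from those of `R` and `H`; the middle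
factors are interchanged by `crossGlue`. -/
theorem assoc_comul_glue (x : R ⊗[k] (H ⊗[k] M)) :
    TensorProduct.assoc k _ _ M (comul.rTensor M (glue k H R M x)) =
      glue k H R (Bosonization k H R ⊗[k] M) (crossGlue.lTensor R (TensorProduct.assoc k R R _
        (TensorProduct.map comul ((TensorProduct.assoc k H H M).toLinearMap ∘ₗ comul.rTensor M)
          x))) := by
  induction x with
  | zero => simp only [map_zero]
  | add s t hs ht => simp only [map_add, hs, ht]
  | tmul r x =>
    induction x with
    | zero => simp only [map_zero, TensorProduct.tmul_zero]
    | add s t hs ht => simp only [map_add, TensorProduct.tmul_add, hs, ht]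
    | tmul h m =>
      rw [glue_tmul, LinearMap.rTensor_tmul, ← Bosonization.inclR_mul_inclH,
        Bosonization.comul_inclR_mul_inclH, TensorProduct.map_tmul, LinearMap.comp_apply,
        LinearMap.rTensor_tmul]
      generalize comul (R := k) r = s
      generalize comul (R := k) h = t
      induction s with
      | zero => simp only [map_zero, TensorProduct.zero_tmul, zero_mul]
      | add s s' hs hs' => simp only [map_add, TensorProduct.add_tmul, add_mul, hs, hs']
      | tmul a b =>
        induction t with
        | zero => simp only [map_zero, TensorProduct.zero_tmul, TensorProduct.tmul_zero, mul_zero]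
        | add s s' hs hs' =>
          simp only [map_add, TensorProduct.add_tmul, TensorProduct.tmul_add, mul_add, hs, hs']
        | tmul c d =>
          simp only [Bosonization.Phi_tmul, Bosonization.u_apply, crossGlue,
            TensorProduct.assoc_tmul, LinearMap.lTensor_tmul, LinearMap.comp_apply,
            LinearMap.rTensor_tmul, LinearEquiv.coe_coe]
          generalize (coact b : H ⊗[k] R) = z
          induction z with
          | zero => simp only [map_zero, TensorProduct.zero_tmul, TensorProduct.tmul_zero, mul_zero,
              zero_mul]
          | add s s' hs hs' =>
            simp only [map_add, TensorProduct.add_tmul, TensorProduct.tmul_add, mul_add, add_mul,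
              hs, hs']
          | tmul g b =>
            simp [← Bosonization.inclR_mul_inclH, mul_assoc]

/-- The composed coaction is coassociative, since the two coactions are and the one of `R` is
`H`-colinear. -/
theorem glueCoact_coassoc {cH : M →ₗ[k] H ⊗[k] M} {cR : M →ₗ[k] R ⊗[k] M}
    (hH : ∀ m, TensorProduct.assoc k H H M (comul.rTensor M (cH m)) = cH.lTensor H (cH m))
    (hR : ∀ m, TensorProduct.assoc k R R M (comul.rTensor M (cR m)) = cR.lTensor R (cR m))
    (h : ∀ m, tensorCoactLeft coact cH (cR m) = cR.lTensor H (cH m)) (m : M) :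
    TensorProduct.assoc k _ _ M (comul.rTensor M (glueCoact cH cR m)) =
      (glueCoact cH cR).lTensor (Bosonization k H R) (glueCoact cH cR m) := by
  have hH' : (TensorProduct.assoc k H H M).toLinearMap ∘ₗ comul.rTensor M ∘ₗ cH =
      cH.lTensor H ∘ₗ cH := LinearMap.ext hH
  have h' : (glueCoact cH cR).lTensor H ∘ₗ cH =
      crossGlue ∘ₗ (cH.lTensor H ∘ₗ cH).lTensor R ∘ₗ cR := LinearMap.ext (lTensor_glueCoact h)
  have h1 : ∀ x : R ⊗[k] M, TensorProduct.assoc k R R _ (TensorProduct.map comul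
      ((TensorProduct.assoc k H H M).toLinearMap ∘ₗ comul.rTensor M) (cH.lTensor R x)) =
      ((cH.lTensor H ∘ₗ cH).lTensor R).lTensor R
        (TensorProduct.assoc k R R M (comul.rTensor M x)) := by
    intro x
    rw [← hH']
    induction x with
    | zero => simp only [map_zero]
    | add s t hs ht => simp only [map_add, hs, ht]
    | tmul r m =>
      simp only [LinearMap.lTensor_tmul, LinearMap.rTensor_tmul, TensorProduct.map_tmul]
      generalize comul (R := k) r = s
      induction s with
      | zero => simp only [map_zero, TensorProduct.zero_tmul]
      | add s t hs ht => simp only [map_add, TensorProduct.add_tmul, hs, ht]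
      | tmul a b => simp
  have h2 : ∀ x : R ⊗[k] (H ⊗[k] M), (glueCoact cH cR).lTensor (Bosonization k H R)
      (glue k H R M x) = glue k H R _ (((glueCoact cH cR).lTensor H).lTensor R x) := by
    intro x
    induction x with
    | zero => simp only [map_zero]
    | add s t hs ht => simp only [map_add, hs, ht]
    | tmul r x =>
      induction x with
      | zero => simp only [map_zero, TensorProduct.tmul_zero]
      | add s t hs ht => simp only [map_add, TensorProduct.tmul_add, hs, ht]
      | tmul h m => simp
  have e1 : glueCoact cH cR m = glue k H R M (cH.lTensor R (cR m)) := rfl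
  rw [e1, assoc_comul_glue, h1, h2, ← LinearMap.lTensor_comp_apply R ((glueCoact cH cR).lTensor H),
    h', hR, ← LinearMap.lTensor_comp_apply, ← LinearMap.lTensor_comp_apply,
    LinearMap.comp_assoc]

/-- Left multiplication by `x` in `H` on `r # h` is `∑ x₍₁₎ r # x₍₂₎ h`. -/
theorem lmulL_glue (x : H) : lmulL (incl k H R) M x ∘ₗ glue k H R M =
    glue k H R M ∘ₗ conv (TensorProduct.mapBilinear (RingHom.id k) R (H ⊗[k] M) R (H ⊗[k] M))
      act (lmulL (BialgHom.id k H) M) x := by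
  ext r h m
  have h1 : inclH x * Bosonization.mk (r ⊗ₜ[k] h) =
      Bosonization.mk
        (tensorAct (act : H →ₗ[k] Module.End k R) (LinearMap.mul k H) x (r ⊗ₜ h)) := by
    have h2 : LinearMap.mul k R 1 = LinearMap.id := by ext; simp
    rw [Bosonization.inclH_apply, Bosonization.mk_mul, Bosonization.lmul_tmul,
      Bosonization.lmulR, h2, LinearMap.rTensor_id]
    rfl
  have h2 := map_conv (LinearMap.applyₗ (r ⊗ₜ[k] (h ⊗ₜ[k] m)))
    (TensorProduct.mapBilinear (RingHom.id k) R (H ⊗[k] M) R (H ⊗[k] M))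
      act (lmulL (BialgHom.id k H) M) x
  have h3 := map_conv ((TensorProduct.assoc k R H M).toLinearMap ∘ₗ
    (TensorProduct.mk k _ _).flip m ∘ₗ LinearMap.applyₗ (r ⊗ₜ[k] h))
    (TensorProduct.mapBilinear (RingHom.id k) R H R H) act (LinearMap.mul k H) x
  have h4 : conv (TensorProduct.mapBilinear (RingHom.id k) R (H ⊗[k] M) R (H ⊗[k] M))
      act (lmulL (BialgHom.id k H) M) x (r ⊗ₜ[k] (h ⊗ₜ[k] m)) = TensorProduct.assoc k R H M
      (tensorAct (act : H →ₗ[k] Module.End k R) (LinearMap.mul k H) x (r ⊗ₜ h) ⊗ₜ m) :=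
    h2.trans ((LinearMap.congr_fun (conv_congr fun x y => rfl) x).trans h3.symm)
  change (inclH x * Bosonization.mk (r ⊗ₜ[k] h)) ⊗ₜ[k] m = glue k H R M _
  refine (congrArg (· ⊗ₜ[k] m) h1).trans ((congrArg (glue k H R M) h4).trans ?_).symm
  simp [glue]

/-- The composed coaction is compatible with the action of `H`. After gluing, the two sides are
`∑ b₍₁₎ r ⊗ (b₍₂₎ m)₍₋₁₎ b₍₃₎ ⊗ (b₍₂₎ m)₍₀₎` and `∑ b₍₁₎ r ⊗ b₍₂₎ m₍₋₁₎ ⊗ b₍₃₎ m₍₀₎` for the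
coaction `r ⊗ m` of `R`, and these agree by the compatibility of `H` with itself on `M`. -/
theorem glueCoact_freeLeft {aH : H →ₗ[k] Module.End k M} {cH : M →ₗ[k] H ⊗[k] M}
    {cR : M →ₗ[k] R ⊗[k] M} (h : FreeLeft (BialgHom.id k H) aH cH)
    (hR : ∀ b m, cR (aH b m) = tensorAct act aH b (cR m)) :
    FreeLeft (incl k H R) aH (glueCoact cH cR) := by
  have hR' : ∀ b, cR ∘ₗ aH b = tensorAct act aH b ∘ₗ cR := fun b => LinearMap.ext (hR b)
  have h1 : ∀ y, rmulL (incl k H R) M y ∘ₗ glue k H R M =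
      glue k H R M ∘ₗ (rmulL (BialgHom.id k H) M y).lTensor R := fun y => by
    ext r h m
    change (Bosonization.mk (r ⊗ₜ[k] h) * inclH y) ⊗ₜ[k] m =
      Bosonization.mk (r ⊗ₜ[k] (h * y)) ⊗ₜ[k] m
    rw [← Bosonization.inclR_mul_inclH, ← Bosonization.inclR_mul_inclH, map_mul, mul_assoc]
  have h2 : ∀ f : M →ₗ[k] M, f.lTensor (Bosonization k H R) ∘ₗ glue k H R M =
      glue k H R M ∘ₗ (f.lTensor H).lTensor R := fun f => by
    ext r h m
    simp
  -- `μ₁`, `μ₃` and `μ₅` are the outer products of the convolutions with three factors, grouped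
  -- on the left, on the right, and on the left again.
  let μ₁ : Module.End k (R ⊗[k] M) →ₗ[k] Module.End k (H ⊗[k] M) →ₗ[k]
      (M →ₗ[k] Bosonization k H R ⊗[k] M) :=
    (revComp k M (R ⊗[k] (H ⊗[k] M)) (Bosonization k H R ⊗[k] M)).compl₁₂
      (LinearMap.llcomp k M _ _ (cH.lTensor R) ∘ₗ (LinearMap.llcomp k M _ _).flip cR)
      (LinearMap.llcomp k _ _ _ (glue k H R M) ∘ₗ LinearMap.lTensorHom R)
  let μ₃ : Module.End k R →ₗ[k] (M →ₗ[k] H ⊗[k] M) →ₗ[k] (M →ₗ[k] Bosonization k H R ⊗[k] M) :=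
    (TensorProduct.mapBilinear (RingHom.id k) R M R (H ⊗[k] M)).compr₂
      (LinearMap.llcomp k M _ _ (glue k H R M) ∘ₗ (LinearMap.llcomp k M _ _).flip cR)
  let μ₅ : Module.End k (R ⊗[k] (H ⊗[k] M)) →ₗ[k] (M →ₗ[k] H ⊗[k] M) →ₗ[k]
      (M →ₗ[k] Bosonization k H R ⊗[k] M) :=
    (LinearMap.llcomp k M (R ⊗[k] (H ⊗[k] M)) (Bosonization k H R ⊗[k] M)).compl₁₂
      (LinearMap.llcomp k _ _ _ (glue k H R M))
      ((LinearMap.llcomp k M _ _).flip cR ∘ₗ LinearMap.lTensorHom R)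
  have e1 : conv (revComp k M _ _) (LinearMap.llcomp k M M _ (glueCoact cH cR) ∘ₗ aH)
      (rmulL (incl k H R) M) =
      conv μ₁ (tensorAct act aH) (rmulL (BialgHom.id k H) M) := conv_congr fun x y => by
    change (rmulL (incl k H R) M y ∘ₗ glue k H R M) ∘ₗ cH.lTensor R ∘ₗ (cR ∘ₗ aH x) = _
    rw [h1, hR']
    rfl
  have e2 : conv μ₁ (tensorAct act aH) (rmulL (BialgHom.id k H) M) =
      conv μ₃ act (conv (revComp k M _ _) (LinearMap.llcomp k M M _ cH ∘ₗ aH)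
        (rmulL (BialgHom.id k H) M)) := conv_assoc fun a b c => by
    change glue k H R M ∘ₗ (rmulL (BialgHom.id k H) M c).lTensor R ∘ₗ cH.lTensor R ∘ₗ
      TensorProduct.map (act a) (aH b) ∘ₗ cR = glue k H R M ∘ₗ TensorProduct.map (act a)
        (rmulL (BialgHom.id k H) M c ∘ₗ cH ∘ₗ aH b) ∘ₗ cR
    rw [← LinearMap.comp_assoc (cR), ← LinearMap.comp_assoc (cR), LinearMap.lTensor_comp_map,
      LinearMap.lTensor_comp_map]
  have e3 : conv μ₅ (conv (TensorProduct.mapBilinear (RingHom.id k) R (H ⊗[k] M) R (H ⊗[k] M))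
      act (lmulL (BialgHom.id k H) M)) (actCoL aH cH) =
      conv μ₃ act (conv (LinearMap.llcomp k M _ _) (lmulL (BialgHom.id k H) M) (actCoL aH cH)) :=
    conv_assoc fun a b c => by
      change glue k H R M ∘ₗ TensorProduct.map (act a) (lmulL (BialgHom.id k H) M b) ∘ₗ
        (actCoL aH cH c).lTensor R ∘ₗ cR = glue k H R M ∘ₗ TensorProduct.map (act a)
        (lmulL (BialgHom.id k H) M b ∘ₗ actCoL aH cH c) ∘ₗ cR
      rw [← LinearMap.comp_assoc (cR), LinearMap.map_comp_lTensor]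
  have e4 : conv (LinearMap.llcomp k M _ _) (lmulL (incl k H R) M) (actCoL aH (glueCoact cH cR)) =
      conv μ₅ (conv (TensorProduct.mapBilinear (RingHom.id k) R (H ⊗[k] M) R (H ⊗[k] M))
        act (lmulL (BialgHom.id k H) M)) (actCoL aH cH) := conv_congr fun x y => by
    change lmulL (incl k H R) M x ∘ₗ ((aH y).lTensor _ ∘ₗ glue k H R M) ∘ₗ cH.lTensor R ∘ₗ cR =
      glue k H R M ∘ₗ conv _ _ _ x ∘ₗ ((aH y).lTensor H ∘ₗ cH).lTensor R ∘ₗ cR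
    rw [h2, LinearMap.comp_assoc, ← LinearMap.comp_assoc _ (glue k H R M), lmulL_glue,
      LinearMap.lTensor_comp]
    rfl
  rw [FreeLeft] at h ⊢
  rw [e1, e2, h, ← e3, e4]

/-- An `R`-comodule in the category of Yetter-Drinfeld modules over `H` is an `H`-module and
`R # H`-comodule with the relative Yetter-Drinfeld compatibility. -/
theorem IsYDComodule.isLeftYD {aH : H →ₗ[k] Module.End k M} {cH : M →ₗ[k] H ⊗[k] M}
    {cR : M →ₗ[k] R ⊗[k] M} (h : IsYDComodule aH cH cR) :
    IsLeftYD (incl k H R) aH (glueCoact cH cR) where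
  act_one := h.isYD.act_one
  act_mul := h.isYD.act_mul
  coassoc := glueCoact_coassoc h.isYD.coassoc h.coassoc h.hom.map_coact
  counit m := by
    have e := congrFun (congrArg DFunLike.coe (thetaCoact_glueCoact h.isYD.counit cR)) m
    refine Eq.trans ?_ (h.counit m)
    rw [← e, ← Bosonization.counit_theta, LinearMap.rTensor_comp]
    rfl
  compat := (freeLeft_iff _ _ _).1 (glueCoact_freeLeft ((freeLeft_iff _ _ _).2 h.isYD.compat)
    h.hom.map_act)

end ComoduleConverse


/-! ### Coactions and rational actions -/

section Evaluation

variable {k : Type u} [Field k] {V W M N X : Type*} [AddCommGroup V] [Module k V] [AddCommGroup W]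
  [Module k W] [AddCommGroup M] [Module k M] [AddCommGroup N] [Module k N] [AddCommGroup X]
  [Module k X]

/-- `v ↦ (w ⊗ m ↦ ⟨v, w⟩ m)`. -/
noncomputable def ev (p : V →ₗ[k] W →ₗ[k] k) (M : Type*) [AddCommGroup M] [Module k M] :
    V →ₗ[k] (W ⊗[k] M →ₗ[k] M) :=
  LinearMap.llcomp k _ _ _ (TensorProduct.lid k M).toLinearMap ∘ₗ LinearMap.rTensorHom M ∘ₗ p

@[simp] theorem ev_tmul (p : V →ₗ[k] W →ₗ[k] k) (v : V) (w : W) (m : M) :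
    ev p M v (w ⊗ₜ m) = p v w • m := by simp [ev]

theorem ev_lTensor (p : V →ₗ[k] W →ₗ[k] k) (v : V) (f : M →ₗ[k] N) (x : W ⊗[k] M) :
    ev p N v (f.lTensor W x) = f (ev p M v x) := by
  induction x with
  | zero => simp only [map_zero]
  | add s t hs ht => simp only [map_add, hs, ht]
  | tmul w m => simp

/-- Nondegeneracy of the pairing in its second argument persists after tensoring with a vector
space. -/
theorem eq_zero_of_ev_eq_zero {p : V →ₗ[k] W →ₗ[k] k} (hp : p.SeparatingRight) {x : W ⊗[k] M}
    (hx : ∀ v, ev p M v x = 0) : x = 0 := by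
  let b := Module.Basis.ofVectorSpace k M
  obtain ⟨c, rfl⟩ := TensorProduct.eq_repr_basis_right b x
  have hc : ∀ i, c i = 0 := by
    intro i
    refine hp _ fun v => ?_
    have h1 : (c.mapRange (p v) (map_zero _)).sum (fun i a => a • b i) = 0 := by
      rw [← hx v, Finsupp.sum_mapRange_index (by simp)]
      simp [Finsupp.sum, map_sum]
    have h2 := linearIndependent_iff.1 b.linearIndependent (c.mapRange (p v) (map_zero _)) h1
    exact DFunLike.congr_fun h2 i
  simp [Finsupp.sum, hc]

theorem eq_of_ev_eq {p : V →ₗ[k] W →ₗ[k] k} (hp : p.SeparatingRight) {x y : W ⊗[k] M}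
    (h : ∀ v, ev p M v x = ev p M v y) : x = y :=
  sub_eq_zero.1 (eq_zero_of_ev_eq_zero hp fun v => by rw [map_sub, h, sub_self])

/-- The family of maps `m ↦ ⟨v, m₍₋₁₎⟩ m₍₀₎` obtained from `m ↦ m₍₋₁₎ ⊗ m₍₀₎`. -/
noncomputable def pairAct (p : V →ₗ[k] W →ₗ[k] k) :
    (M →ₗ[k] W ⊗[k] N) →ₗ[k] V →ₗ[k] (M →ₗ[k] N) :=
  LinearMap.lcomp k (M →ₗ[k] N) (ev p N) ∘ₗ (LinearMap.llcomp k M (W ⊗[k] N) N).flip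

@[simp] theorem pairAct_apply (p : V →ₗ[k] W →ₗ[k] k) (c : M →ₗ[k] W ⊗[k] N) (v : V) (m : M) :
    pairAct p c v m = ev p N v (c m) := rfl

theorem pairAct_injective {p : V →ₗ[k] W →ₗ[k] k} (hp : p.SeparatingRight) :
    Function.Injective (pairAct p : (M →ₗ[k] W ⊗[k] N) →ₗ[k] V →ₗ[k] (M →ₗ[k] N)) :=
  fun _ _ h => LinearMap.ext fun m => eq_of_ev_eq hp fun v =>
    LinearMap.congr_fun (LinearMap.congr_fun h v) m

theorem exists_comp_eq_of_ker_le (q : V →ₗ[k] X) (f : V →ₗ[k] M)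
    (h : LinearMap.ker q ≤ LinearMap.ker f) : ∃ g : X →ₗ[k] M, g ∘ₗ q = f := by
  obtain ⟨l, hl⟩ := LinearMap.exists_leftInverse_of_injective
    ((LinearMap.ker q).liftQ q le_rfl) (Submodule.ker_liftQ_eq_bot _ _ _ le_rfl)
  refine ⟨(LinearMap.ker q).liftQ f h ∘ₗ l, LinearMap.ext fun v => ?_⟩
  have e := LinearMap.congr_fun hl ((LinearMap.ker q).mkQ v)
  simp only [LinearMap.comp_apply, Submodule.mkQ_apply, Submodule.liftQ_apply,
    LinearMap.id_apply] at e ⊢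
  rw [e, Submodule.liftQ_apply]

/-- A linear map that vanishes on `E^⊥`, for a finite-dimensional `E`, is given by the pairing
with an element of `E ⊗ M`. -/
theorem exists_ev_eq (p : V →ₗ[k] W →ₗ[k] k) (f : V →ₗ[k] M) (E : Submodule k W)
    [FiniteDimensional k E] (h : ∀ v ∈ perp p E, f v = 0) : ∃ x, ∀ v, ev p M v x = f v := by
  -- `f` factors through the dual of `E`, which is finite-dimensional and has a dual basis.
  obtain ⟨g, hg⟩ := exists_comp_eq_of_ker_le (LinearMap.lcomp k k E.subtype ∘ₗ p) f
    (fun v hv => h v fun w hw => LinearMap.congr_fun hv ⟨w, hw⟩)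
  let b := Module.finBasis k E
  refine ⟨∑ i, (b i : W) ⊗ₜ g (b.coord i), fun v => ?_⟩
  have e : ∑ i, p v (b i) • b.coord i = p v ∘ₗ E.subtype := by
    refine b.ext fun j => ?_
    simp [Finsupp.single_apply]
  rw [← hg, LinearMap.comp_apply, map_sum]
  simp only [ev_tmul, ← map_smul]
  rw [← map_sum, e]
  rfl

theorem exists_perp_ev_eq_zero (p : V →ₗ[k] W →ₗ[k] k) (x : W ⊗[k] M) :
    ∃ E : Submodule k W, FiniteDimensional k E ∧ ∀ v ∈ perp p E, ev p M v x = 0 := by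
  induction x with
  | zero => exact ⟨⊥, inferInstance, fun v _ => map_zero _⟩
  | add s t hs ht =>
    obtain ⟨E, hE, h1⟩ := hs
    obtain ⟨E', hE', h2⟩ := ht
    refine ⟨E ⊔ E', inferInstance, fun v hv => ?_⟩
    rw [map_add, h1 v fun w hw => hv w (Submodule.mem_sup_left hw),
      h2 v fun w hw => hv w (Submodule.mem_sup_right hw), add_zero]
  | tmul w m =>
    refine ⟨Submodule.span k {w}, inferInstance, fun v hv => ?_⟩
    rw [ev_tmul, hv w (Submodule.mem_span_singleton_self w), zero_smul]

/-- Rational families of endomorphisms come from coactions. -/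
theorem exists_pairAct_eq {p : V →ₗ[k] W →ₗ[k] k} (hp : p.SeparatingRight)
    (a : V →ₗ[k] Module.End k M) (ha : ∀ m, ∃ E : Submodule k W, FiniteDimensional k E ∧
      ∀ v ∈ perp p E, a v m = 0) : ∃ c : M →ₗ[k] W ⊗[k] M, pairAct p c = a := by
  have hJ : Function.Injective (ev p M).flip := fun x y h =>
    eq_of_ev_eq hp fun v => LinearMap.congr_fun h v
  have hm : ∀ m, a.flip m ∈ LinearMap.range (ev p M).flip := fun m => by
    obtain ⟨E, hE, h⟩ := ha m
    obtain ⟨x, hx⟩ := exists_ev_eq p (a.flip m) E h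
    exact ⟨x, LinearMap.ext hx⟩
  let e := LinearEquiv.ofInjective (ev p M).flip hJ
  refine ⟨e.symm.toLinearMap ∘ₗ a.flip.codRestrict _ hm, LinearMap.ext fun v =>
    LinearMap.ext fun m => ?_⟩
  have h1 : ∀ z, (ev p M).flip (e.symm z) = z := fun z =>
    congrArg Subtype.val (e.apply_symm_apply z)
  exact LinearMap.congr_fun (h1 (a.flip.codRestrict _ hm m)) v

theorem conv_pairAct {H : Type*} [Ring H] [HopfAlgebra k H] (aV : H →ₗ[k] Module.End k V)
    (p : V →ₗ[k] W →ₗ[k] k) (f : H →ₗ[k] (M →ₗ[k] W ⊗[k] M)) (h : H) (v : V) (m : M) :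
    conv (LinearMap.llcomp k V V (M →ₗ[k] M)).flip aV (pairAct p ∘ₗ f) h v m =
    conv (ev p M) (aV.flip v) (f.flip m) h :=
  (map_conv (LinearMap.applyₗ m ∘ₗ LinearMap.applyₗ v) _ _ _ h).trans
    (LinearMap.congr_fun (conv_congr fun _ _ => rfl) h)

theorem lift_pairAct_tensorAct {H : Type*} [Ring H] [HopfAlgebra k H]
    (aV : H →ₗ[k] Module.End k V) (p : V →ₗ[k] W →ₗ[k] k) (aM : H →ₗ[k] Module.End k M)
    (c : M →ₗ[k] W ⊗[k] M) (h : H) (v : V) (m : M) :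
    TensorProduct.lift (pairAct p c) (tensorAct aV aM h (v ⊗ₜ m)) =
      conv (ev p M) (aV.flip v) ((LinearMap.llcomp k M M _ c ∘ₗ aM).flip m) h :=
  (map_conv (TensorProduct.lift (pairAct p c) ∘ₗ LinearMap.applyₗ (v ⊗ₜ m)) _ _ _ h).trans
    (LinearMap.congr_fun (conv_congr fun _ _ => rfl) h)

end Evaluation

/-! ### The coaction of `H` behind a pairing -/

section Untwist

open RelYD.YDHopfAlgebra (act coact)

variable {k : Type u} [Field k] {H : Type v} [Ring H] [HopfAlgebra k H]
  {R : Type w} [Ring R] [Algebra k R] [Coalgebra k R] [YDHopfAlgebra k H R]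
  {M : Type*} [AddCommGroup M] [Module k M] {hH : Function.Bijective (antipode k : H →ₗ[k] H)}

/-- `h ⊗ (r ⊗ m) ↦ S⁻¹(r₍₋₁₎) h ⊗ (r₍₀₎ ⊗ m)`. -/
noncomputable def untwist (hH : Function.Bijective (antipode k : H →ₗ[k] H)) :
    H ⊗[k] (R ⊗[k] M) →ₗ[k] H ⊗[k] (R ⊗[k] M) :=
  (TensorProduct.assoc k H R M).toLinearMap ∘ₗ
    (twist coact (LinearMap.mul k H ∘ₗ antipodeInv hH)).rTensor M ∘ₗ
    (TensorProduct.assoc k H R M).symm.toLinearMap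

/-- The inverse is `h ⊗ (r ⊗ m) ↦ r₍₋₁₎ h ⊗ (r₍₀₎ ⊗ m)`. -/
theorem untwist_injective (hH : Function.Bijective (antipode k : H →ₗ[k] H)) :
    Function.Injective (untwist (R := R) (M := M) hH) := by
  have hYD := YDHopfAlgebra.isYD (k := k) (H := H) (R := R)
  have h1 : ∀ x : H ⊗[k] R, twist coact (LinearMap.mul k H)
      (twist coact (LinearMap.mul k H ∘ₗ antipodeInv hH) x) = x := fun x =>
    twist_cancel hYD.coassoc hYD.counit (conv_antipodeInv_left hH (by ext; simp)
      (by intro a b; ext; simp [mul_assoc])) x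
  suffices h : Function.Injective
      ((twist (coact : R →ₗ[k] H ⊗[k] R) (LinearMap.mul k H ∘ₗ antipodeInv hH)).rTensor M) from
    (TensorProduct.assoc k H R M).injective.comp
      (h.comp (TensorProduct.assoc k H R M).symm.injective)
  refine Function.LeftInverse.injective
    (g := (twist (coact : R →ₗ[k] H ⊗[k] R) (LinearMap.mul k H)).rTensor M) fun x => ?_
  rw [← LinearMap.rTensor_comp_apply, show _ ∘ₗ _ = LinearMap.id from LinearMap.ext h1,
    LinearMap.rTensor_id, LinearMap.id_apply]

theorem untwist_tmul (h : H) (r : R) (m : M) : untwist hH (h ⊗ₜ[k] (r ⊗ₜ[k] m)) =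
    TensorProduct.map ((LinearMap.mul k H).flip h ∘ₗ antipodeInv hH)
      ((TensorProduct.mk k R M).flip m) (coact r) := by
  simp only [untwist, LinearMap.comp_apply, LinearEquiv.coe_coe, TensorProduct.assoc_symm_tmul,
    LinearMap.rTensor_tmul, twist_tmul]
  generalize (coact r : H ⊗[k] R) = t
  induction t with
  | zero => simp only [map_zero, TensorProduct.zero_tmul]
  | add s t hs ht => simp only [map_add, TensorProduct.add_tmul, hs, ht]
  | tmul g r => simp

/-- `∑ S⁻¹(r₍₋₁₎) r₍₋₂₎ m₍₋₁₎ ⟨ξ, r₍₀₎⟩ ⊗ m₍₀₎ = ⟨ξ, r⟩ m₍₋₁₎ ⊗ m₍₀₎`. -/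
theorem ev_untwist_tensorCoactLeft {V : Type*} [AddCommGroup V] [Module k V]
    (p : V →ₗ[k] R →ₗ[k] k) (hH : Function.Bijective (antipode k : H →ₗ[k] H))
    (cH : M →ₗ[k] H ⊗[k] M) (ξ : V)
    (x : R ⊗[k] M) : ev p (H ⊗[k] M) ξ (TensorProduct.leftComm k H R M
      (untwist hH (tensorCoactLeft coact cH x))) = cH (ev p M ξ x) := by
  have hYD := YDHopfAlgebra.isYD (k := k) (H := H) (R := R)
  induction x with
  | zero => simp only [map_zero]
  | add s t hs ht => simp only [map_add, hs, ht]
  | tmul r m =>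
    rw [tensorCoactLeft_tmul, ev_tmul, map_smul]
    generalize cH m = t
    induction t with
    | zero => simp only [map_zero, TensorProduct.tmul_zero, smul_zero]
    | add s t hs ht => simp only [map_add, TensorProduct.tmul_add, smul_add, hs, ht]
    | tmul h m =>
      have h1 : ∀ z : H ⊗[k] R, untwist hH (mixL k H R M (z ⊗ₜ (h ⊗ₜ m))) =
          TensorProduct.map ((LinearMap.mul k H).flip h) ((TensorProduct.mk k R M).flip m)
            (twist coact (LinearMap.mul k H ∘ₗ antipodeInv hH) z) := by
        intro z
        induction z with
        | zero => simp only [map_zero, TensorProduct.zero_tmul]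
        | add s t hs ht => simp only [map_add, TensorProduct.add_tmul, hs, ht]
        | tmul g r =>
          rw [mixL_tmul, untwist_tmul, twist_tmul]
          generalize (coact r : H ⊗[k] R) = t
          induction t with
          | zero => simp only [map_zero]
          | add s t hs ht => simp only [map_add, hs, ht]
          | tmul g' r => simp [mul_assoc]
      have h2 : (coact r : H ⊗[k] R) = twist coact (LinearMap.mul k H) ((1 : H) ⊗ₜ r) := by
        rw [twist_tmul, show (LinearMap.mul k H).flip 1 = LinearMap.id by ext; simp,
          LinearMap.rTensor_id, LinearMap.id_apply]
      rw [h1, h2, twist_cancel hYD.coassoc hYD.counit (conv_antipodeInv_right hH (by ext; simp)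
        (by intro a b; ext; simp [mul_assoc]))]
      simp

end Untwist

/-! ### Braided comodules over `R` and braided modules over the dual -/

section Pairing

open RelYD.YDHopfAlgebra (act coact)

variable {k : Type u} [Field k] {H : Type v} [Ring H] [HopfAlgebra k H]
  {R : Type w} [Ring R] [Algebra k R] [Coalgebra k R] [YDHopfAlgebra k H R]
  {Rd : Type x} [Ring Rd] [Algebra k Rd] [Coalgebra k Rd] [YDHopfAlgebra k H Rd]
  {M : Type*} [AddCommGroup M] [Module k M]
  {hH : Function.Bijective (antipode k : H →ₗ[k] H)} {p : Rd →ₗ[k] R →ₗ[k] k}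

/-- `M` is a left `R`-module in the category of left Yetter-Drinfeld modules over `H`: a
Yetter-Drinfeld module with an `R`-action that is `H`-linear and `H`-colinear. -/
structure IsYDModule (aH : H →ₗ[k] Module.End k M) (cH : M →ₗ[k] H ⊗[k] M)
    (aR : R →ₗ[k] Module.End k M) : Prop where
  isYD : IsLeftYD (BialgHom.id k H) aH cH
  one_act : ∀ m, aR 1 m = m
  mul_act : ∀ r s m, aR (r * s) m = aR r (aR s m)
  hom : IsLeftHom (tensorAct act aH) (tensorCoactLeft coact cH) aH cH (TensorProduct.lift aR)

namespace IsDualPair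

theorem ev_one (hp : IsDualPair hH p) (x : R ⊗[k] M) :
    ev p M 1 x = TensorProduct.lid k M (counit.rTensor M x) := by
  induction x with
  | zero => simp only [map_zero]
  | add s t hs ht => simp only [map_add, hs, ht]
  | tmul w m => simp [hp.one_pair]

theorem ev_mul (hp : IsDualPair hH p) (ξ η : Rd) (x : R ⊗[k] M) : ev p M (ξ * η) x =
    ev p M ξ (ev p (R ⊗[k] M) η (TensorProduct.assoc k R R M (comul.rTensor M x))) := by
  induction x with
  | zero => simp only [map_zero]
  | add s t hs ht => simp only [map_add, hs, ht]
  | tmul r m =>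
    rw [ev_tmul, hp.mul_pair, LinearMap.rTensor_tmul]
    generalize comul (R := k) r = t
    induction t with
    | zero => simp only [map_zero, TensorProduct.zero_tmul, zero_smul]
    | add s t hs ht => simp only [map_add, TensorProduct.add_tmul, add_smul, hs, ht]
    | tmul a b => simp [mul_smul]

/-- Unitality of the action of `R^∨` is counitality of the coaction of `R`. -/
theorem pairAct_one_iff (hp : IsDualPair hH p) (cR : M →ₗ[k] R ⊗[k] M) :
    (∀ m, pairAct p cR 1 m = m) ↔ ∀ m, counit.rTensor M (cR m) = (1 : k) ⊗ₜ[k] m := by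
  refine forall_congr' fun m => ?_
  rw [pairAct_apply, hp.ev_one, ← LinearEquiv.eq_symm_apply, TensorProduct.lid_symm_apply]

/-- Multiplicativity of the action of `R^∨` is coassociativity of the coaction of `R`. -/
theorem pairAct_mul_iff (hp : IsDualPair hH p) (cR : M →ₗ[k] R ⊗[k] M) :
    (∀ ξ η m, pairAct p cR (ξ * η) m = pairAct p cR ξ (pairAct p cR η m)) ↔
      ∀ m, TensorProduct.assoc k R R M (comul.rTensor M (cR m)) = cR.lTensor R (cR m) := by
  simp only [pairAct_apply, hp.ev_mul]
  constructor
  · intro h m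
    refine eq_of_ev_eq hp.nondegenerate.2 fun η => eq_of_ev_eq hp.nondegenerate.2 fun ξ => ?_
    rw [h, ev_lTensor]
  · intro h ξ η m
    rw [h, ev_lTensor]

/-- `∑ ⟨h₍₁₎ ξ, h₍₂₎ r⟩ = ε(h) ⟨ξ, r⟩`: the pairing is `H`-invariant. -/
theorem conv_pair_act (hp : IsDualPair hH p) (ξ : Rd) (r : R) (h : H) :
    conv p ((act : H →ₗ[k] Module.End k Rd).flip ξ) ((act : H →ₗ[k] Module.End k R).flip r) h =
      counit (R := k) h • p ξ r := by
  have hYD := YDHopfAlgebra.isYD (k := k) (H := H) (R := R)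
  refine (LinearMap.congr_fun (conv_congr fun x y => ?_) h).trans
    ((conv_antipode_left (p ξ ∘ₗ (act : H →ₗ[k] Module.End k R).flip r)
      (BialgHom.id k H) h).trans ?_)
  · refine (hp.pair_act x ξ _).trans (congrArg (p ξ) ?_)
    exact (hYD.act_mul _ _ _).symm
  · simp [hYD.act_one]

/-- `∑ ⟨h₍₁₎ ξ, h₍₂₎ r⟩ h₍₃₎ m = ⟨ξ, r⟩ h m`. -/
theorem conv_ev_tensorAct (hp : IsDualPair hH p) (aH : H →ₗ[k] Module.End k M) (ξ : Rd)
    (x : R ⊗[k] M) (h : H) :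
    conv (ev p M) ((act : H →ₗ[k] Module.End k Rd).flip ξ)
      ((tensorAct (act : H →ₗ[k] Module.End k R) aH).flip x) h = aH h (ev p M ξ x) := by
  have h1 : ∀ x : R ⊗[k] M, conv (LinearMap.llcomp k (R ⊗[k] M) (R ⊗[k] M) M)
      (ev p M ∘ₗ (act : H →ₗ[k] Module.End k Rd).flip ξ)
      (tensorAct (act : H →ₗ[k] Module.End k R) aH) h x =
      conv (ev p M) ((act : H →ₗ[k] Module.End k Rd).flip ξ)
      ((tensorAct (act : H →ₗ[k] Module.End k R) aH).flip x) h := fun x =>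
    (map_conv (LinearMap.applyₗ x) _ _ _ h).trans
      (LinearMap.congr_fun (conv_congr fun _ _ => rfl) h)
  rw [← h1]
  suffices e : conv (LinearMap.llcomp k (R ⊗[k] M) (R ⊗[k] M) M)
      (ev p M ∘ₗ (act : H →ₗ[k] Module.End k Rd).flip ξ)
      (tensorAct (act : H →ₗ[k] Module.End k R) aH) h = aH h ∘ₗ ev p M ξ from
    LinearMap.congr_fun e x
  refine TensorProduct.ext' fun r m => (h1 _).trans ?_
  have h2 : (tensorAct (act : H →ₗ[k] Module.End k R) aH).flip (r ⊗ₜ m) =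
      conv (TensorProduct.mk k R M) ((act : H →ₗ[k] Module.End k R).flip r) (aH.flip m) :=
    LinearMap.ext fun b => (map_conv (LinearMap.applyₗ (r ⊗ₜ m)) _ _ _ b).trans
      (LinearMap.congr_fun (conv_congr fun _ _ => rfl) b)
  rw [h2, ← conv_assoc (μ₁ := LinearMap.lsmul k M) (μ₂ := p)
    (f := (act : H →ₗ[k] Module.End k Rd).flip ξ) (g := (act : H →ₗ[k] Module.End k R).flip r)
    (h := aH.flip m) (fun a b c => by simp), conv_counit_left _ _ (hp.conv_pair_act ξ r)]
  simp

/-- `H`-linearity of the action of `R^∨` is `H`-linearity of the coaction of `R`. For the first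
direction, the action of `h₍₁₎` on `ξ` is removed by convolution with `S⁻¹`. -/
theorem pairAct_map_act_iff (hp : IsDualPair hH p) {aH : H →ₗ[k] Module.End k M}
    (cR : M →ₗ[k] R ⊗[k] M) :
    (∀ h x, TensorProduct.lift (pairAct p cR)
        (tensorAct (act : H →ₗ[k] Module.End k Rd) aH h x) =
        aH h (TensorProduct.lift (pairAct p cR) x)) ↔
      ∀ h m, cR (aH h m) = tensorAct (act : H →ₗ[k] Module.End k R) aH h (cR m) := by
  have hYD := YDHopfAlgebra.isYD (k := k) (H := H) (R := Rd)
  constructor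
  · intro h
    let f₁ := LinearMap.llcomp k M M (R ⊗[k] M) cR ∘ₗ aH
    let f₂ := (LinearMap.llcomp k M (R ⊗[k] M) (R ⊗[k] M)).flip cR ∘ₗ
      tensorAct (act : H →ₗ[k] Module.End k R) aH
    have e1 : conv (LinearMap.llcomp k Rd Rd (M →ₗ[k] M)).flip
        (act : H →ₗ[k] Module.End k Rd) (pairAct p ∘ₗ f₁) =
        conv (LinearMap.llcomp k Rd Rd (M →ₗ[k] M)).flip
        (act : H →ₗ[k] Module.End k Rd) (pairAct p ∘ₗ f₂) := by
      refine LinearMap.ext fun b => LinearMap.ext fun ξ => LinearMap.ext fun m => ?_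
      rw [conv_pairAct, conv_pairAct]
      have l := lift_pairAct_tensorAct (act : H →ₗ[k] Module.End k Rd) p aH cR b ξ m
      rw [h, TensorProduct.lift.tmul, pairAct_apply, ← hp.conv_ev_tensorAct aH ξ (cR m) b] at l
      exact l.symm
    -- Convolution with the action of `R^∨` composed with `S⁻¹` is a left inverse.
    have e2 : ∀ f : H →ₗ[k] (Rd →ₗ[k] (M →ₗ[k] M)),
        conv (LinearMap.llcomp k Rd Rd (M →ₗ[k] M)).flip (act ∘ₗ antipodeInv hH)
          (conv (LinearMap.llcomp k Rd Rd (M →ₗ[k] M)).flip act f) = f := fun f =>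
      conv_cancel_left (ν := (LinearMap.mul k (Module.End k Rd)).flip) (e := 1)
        (fun _ _ _ => rfl) (fun _ => rfl) f
        (conv_antipodeInv_left hH (LinearMap.ext hYD.act_one)
          fun a b => LinearMap.ext (hYD.act_mul a b))
    have e3 : pairAct p ∘ₗ f₁ = pairAct p ∘ₗ f₂ := by rw [← e2 (pairAct p ∘ₗ f₁), e1, e2]
    intro b m
    exact LinearMap.congr_fun (pairAct_injective hp.nondegenerate.2 (LinearMap.congr_fun e3 b)) m
  · intro h b x
    induction x with
    | zero => simp only [map_zero]
    | add s t hs ht => simp only [map_add, hs, ht]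
    | tmul ξ m =>
      rw [lift_pairAct_tensorAct]
      refine Eq.trans ?_ (hp.conv_ev_tensorAct aH ξ (cR m) b)
      refine LinearMap.congr_fun (conv_congr fun x y => ?_) b
      exact congrArg _ (h y m)

/-- Elements of `H ⊗ (R ⊗ M)` are separated by the pairing also after `untwist`. -/
theorem eq_of_ev_untwist (hp : IsDualPair hH p) {x y : H ⊗[k] (R ⊗[k] M)}
    (h : ∀ ξ, ev p (H ⊗[k] M) ξ (TensorProduct.leftComm k H R M (untwist hH x)) =
      ev p (H ⊗[k] M) ξ (TensorProduct.leftComm k H R M (untwist hH y))) : x = y :=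
  untwist_injective hH ((TensorProduct.leftComm k H R M).injective
    (eq_of_ev_eq hp.nondegenerate.2 h))

/-- `∑ ξ₍₋₁₎ h ⊗ ξ₍₀₎ m = ∑ S⁻¹(m₍₋₁₎₍₋₁₎) h ⟨ξ, m₍₋₁₎₍₀₎⟩ ⊗ m₍₀₎`, where `m ↦ m₍₋₁₎ ⊗ m₍₀₎` is the
coaction of `R`. -/
theorem lift_pairAct_mixL (hp : IsDualPair hH p) (cR : M →ₗ[k] R ⊗[k] M) (ξ : Rd)
    (t : H ⊗[k] M) : (TensorProduct.lift (pairAct p cR)).lTensor H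
      (mixL k H Rd M (coact ξ ⊗ₜ t)) =
    ev p (H ⊗[k] M) ξ (TensorProduct.leftComm k H R M (untwist hH (cR.lTensor H t))) := by
  induction t with
  | zero => simp only [map_zero, TensorProduct.tmul_zero]
  | add s t hs ht => simp only [map_add, TensorProduct.tmul_add, hs, ht]
  | tmul h m =>
    have h1 : ∀ z : H ⊗[k] Rd, (TensorProduct.lift (pairAct p cR)).lTensor H
        (mixL k H Rd M (z ⊗ₜ (h ⊗ₜ m))) = TensorProduct.map ((LinearMap.mul k H).flip h)
          ((ev p M).flip (cR m)) z := by
      intro z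
      induction z with
      | zero => simp only [map_zero, TensorProduct.zero_tmul]
      | add s t hs ht => simp only [map_add, TensorProduct.add_tmul, hs, ht]
      | tmul g η => simp
    rw [h1, LinearMap.lTensor_tmul]
    generalize cR m = x
    induction x with
    | zero => simp only [map_zero, TensorProduct.tmul_zero, TensorProduct.map_zero_right,
        LinearMap.zero_apply]
    | add s t hs ht => simp only [map_add, TensorProduct.tmul_add, TensorProduct.map_add_right,
        LinearMap.add_apply, hs, ht]
    | tmul r m =>
      have h2 : ∀ z : H ⊗[k] Rd, TensorProduct.map ((LinearMap.mul k H).flip h)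
          ((ev p M).flip (r ⊗ₜ m)) z = TensorProduct.map ((LinearMap.mul k H).flip h)
            (LinearMap.toSpanSingleton k M m) ((p.flip r).lTensor H z) := by
        intro z
        induction z with
        | zero => simp only [map_zero]
        | add s t hs ht => simp only [map_add, hs, ht]
        | tmul g η => simp
      rw [h2, hp.pair_coact, untwist_tmul]
      generalize (coact r : H ⊗[k] R) = z
      induction z with
      | zero => simp only [map_zero]
      | add s t hs ht => simp only [map_add, hs, ht]
      | tmul g r => simp

/-- `H`-colinearity of the action of `R^∨` is `H`-colinearity of the coaction of `R`, compared
after `untwist` because the pairing turns the coaction of `R^∨` into `S⁻¹` of the one of `R`. -/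
theorem pairAct_map_coact_iff (hp : IsDualPair hH p) {cH : M →ₗ[k] H ⊗[k] M}
    (cR : M →ₗ[k] R ⊗[k] M) :
    (∀ x, cH (TensorProduct.lift (pairAct p cR) x) =
        (TensorProduct.lift (pairAct p cR)).lTensor H
          (tensorCoactLeft (coact : Rd →ₗ[k] H ⊗[k] Rd) cH x)) ↔
      ∀ m, tensorCoactLeft (coact : R →ₗ[k] H ⊗[k] R) cH (cR m) = cR.lTensor H (cH m) := by
  constructor
  · intro h m
    refine hp.eq_of_ev_untwist fun ξ => ?_
    rw [ev_untwist_tensorCoactLeft, ← hp.lift_pairAct_mixL]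
    exact h (ξ ⊗ₜ m)
  · intro h x
    induction x with
    | zero => simp only [map_zero]
    | add s t hs ht => simp only [map_add, hs, ht]
    | tmul ξ m =>
      rw [tensorCoactLeft_tmul, hp.lift_pairAct_mixL, ← h, ev_untwist_tensorCoactLeft]
      rfl

/-- Coactions of `R` correspond to actions of the dual `R^∨`. -/
theorem isYDModule_pairAct_iff (hp : IsDualPair hH p) {aH : H →ₗ[k] Module.End k M}
    {cH : M →ₗ[k] H ⊗[k] M} {cR : M →ₗ[k] R ⊗[k] M} :
    IsYDModule aH cH (pairAct p cR) ↔ IsYDComodule aH cH cR :=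
  ⟨fun h => ⟨h.isYD, (hp.pairAct_mul_iff cR).1 h.mul_act, (hp.pairAct_one_iff cR).1 h.one_act,
      (hp.pairAct_map_act_iff cR).1 h.hom.map_act, (hp.pairAct_map_coact_iff cR).1 h.hom.map_coact⟩,
    fun h => ⟨h.isYD, (hp.pairAct_one_iff cR).2 h.counit, (hp.pairAct_mul_iff cR).2 h.coassoc,
      (hp.pairAct_map_act_iff cR).2 h.hom.map_act, (hp.pairAct_map_coact_iff cR).2 h.hom.map_coact⟩⟩

end IsDualPair

end Pairing


/-! ### Multiplicativity of the Yetter-Drinfeld compatibility -/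

section CompatAt

variable {k : Type u} [Field k] {B : Type v} [Ring B] [HopfAlgebra k B]
  {C : Type w} [Ring C] [HopfAlgebra k C] {M : Type*} [AddCommGroup M] [Module k M]

/-- The antipode-free Yetter-Drinfeld compatibility for the action of a single element. -/
def CompatAt (ρ : B →ₐc[k] C) (a : B →ₗ[k] Module.End k M) (c : M →ₗ[k] C ⊗[k] M) (b : B) :
    Prop :=
  conv (revComp k M (C ⊗[k] M) (C ⊗[k] M)) (LinearMap.llcomp k M M (C ⊗[k] M) c ∘ₗ a)
      (rmulL ρ M) b =
    conv (LinearMap.llcomp k M (C ⊗[k] M) (C ⊗[k] M)) (lmulL ρ M) (actCoL a c) b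

theorem freeLeft_iff_compatAt {ρ : B →ₐc[k] C} {a : B →ₗ[k] Module.End k M}
    {c : M →ₗ[k] C ⊗[k] M} : FreeLeft ρ a c ↔ ∀ b, CompatAt ρ a c b :=
  LinearMap.ext_iff

theorem CompatAt.add {ρ : B →ₐc[k] C} {a : B →ₗ[k] Module.End k M} {c : M →ₗ[k] C ⊗[k] M}
    {b b' : B} (h : CompatAt ρ a c b) (h' : CompatAt ρ a c b') : CompatAt ρ a c (b + b') := by
  rw [CompatAt] at *
  rw [map_add, map_add, h, h']

/-- With `V b f = ∑ ρ(b₍₂₎) f b₍₁₎` and `U b f = ∑ (ρ(b₍₁₎) ⊗ b₍₂₎) f`, the compatibility at `b`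
says that `V b c = U b c`. It passes to products because `V` is anti-multiplicative, `U` is
multiplicative, and the two commute. -/
theorem CompatAt.mul {ρ : B →ₐc[k] C} {a : B →ₗ[k] Module.End k M} {c : M →ₗ[k] C ⊗[k] M}
    (ha : ∀ b b' m, a (b * b') m = a b (a b' m)) {b b' : B} (h : CompatAt ρ a c b)
    (h' : CompatAt ρ a c b') : CompatAt ρ a c (b * b') := by
  let E := Module.End k (M →ₗ[k] C ⊗[k] M)
  let μV : Module.End k M →ₗ[k] Module.End k (C ⊗[k] M) →ₗ[k] E :=
    (LinearMap.mul k E).compl₁₂ (LinearMap.llcomp k M M (C ⊗[k] M)).flip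
      (LinearMap.llcomp k M (C ⊗[k] M) (C ⊗[k] M))
  let μU : Module.End k (C ⊗[k] M) →ₗ[k] Module.End k M →ₗ[k] E :=
    (LinearMap.mul k E).compl₁₂ (LinearMap.llcomp k M (C ⊗[k] M) (C ⊗[k] M))
      (LinearMap.llcomp k M (C ⊗[k] M) (C ⊗[k] M) ∘ₗ LinearMap.lTensorHom C)
  have ha' : ∀ b b', a (b * b') = a b ∘ₗ a b' := fun b b' => LinearMap.ext (ha b b')
  have hV : ∀ b b', conv μV a (rmulL ρ M) (b * b') =
      conv μV a (rmulL ρ M) b' * conv μV a (rmulL ρ M) b := fun b b' =>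
    conv_mul_eq (ν := (LinearMap.mul k E).flip) (fun x y z w => by
      have e : rmulL ρ M (y * w) = rmulL ρ M w ∘ₗ rmulL ρ M y := by
        refine TensorProduct.ext' fun d m => ?_
        simp [mul_assoc]
      refine LinearMap.ext fun f => ?_
      change rmulL ρ M (y * w) ∘ₗ f ∘ₗ a (x * z) = rmulL ρ M w ∘ₗ (rmulL ρ M y ∘ₗ f ∘ₗ a x) ∘ₗ a z
      rw [e, ha']
      rfl) b b'
  have hU : ∀ b b', conv μU (lmulL ρ M) a (b * b') =
      conv μU (lmulL ρ M) a b * conv μU (lmulL ρ M) a b' := fun b b' =>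
    conv_mul_eq (ν := LinearMap.mul k E) (fun x y z w => by
      have e : lmulL ρ M (x * z) ∘ₗ (a (y * w)).lTensor C =
          lmulL ρ M x ∘ₗ (a y).lTensor C ∘ₗ lmulL ρ M z ∘ₗ (a w).lTensor C := by
        refine TensorProduct.ext' fun d m => ?_
        simp [mul_assoc, ha]
      exact LinearMap.ext fun f => congrArg (fun g => g ∘ₗ f) e) b b'
  have hUV : ∀ b b', conv μU (lmulL ρ M) a b * conv μV a (rmulL ρ M) b' =
      conv μV a (rmulL ρ M) b' * conv μU (lmulL ρ M) a b := fun b b' => by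
    have e : ∀ s t : B ⊗[k] B, TensorProduct.lift (μU.compl₁₂ (lmulL ρ M) a) s *
        TensorProduct.lift (μV.compl₁₂ a (rmulL ρ M)) t =
        TensorProduct.lift (μV.compl₁₂ a (rmulL ρ M)) t *
        TensorProduct.lift (μU.compl₁₂ (lmulL ρ M) a) s := by
      intro s t
      induction s with
      | zero => simp only [map_zero, zero_mul, mul_zero]
      | add s s' hs hs' => simp only [map_add, add_mul, mul_add, hs, hs']
      | tmul x y =>
        induction t with
        | zero => simp only [map_zero, zero_mul, mul_zero]
        | add s s' hs hs' => simp only [map_add, add_mul, mul_add, hs, hs']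
        | tmul z w =>
          have e : lmulL ρ M x ∘ₗ (a y).lTensor C ∘ₗ rmulL ρ M w =
              rmulL ρ M w ∘ₗ lmulL ρ M x ∘ₗ (a y).lTensor C := by
            refine TensorProduct.ext' fun d m => ?_
            simp [mul_assoc]
          exact LinearMap.ext fun f => congrArg (fun g => g ∘ₗ f ∘ₗ a z) e
    exact e _ _
  have key : ∀ b, CompatAt ρ a c b ↔ conv μV a (rmulL ρ M) b c = conv μU (lmulL ρ M) a b c := by
    intro b
    have e1 := (map_conv (LinearMap.applyₗ c) μV a (rmulL ρ M) b).trans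
      (LinearMap.congr_fun (conv_congr (μ' := revComp k M (C ⊗[k] M) (C ⊗[k] M))
        (f' := LinearMap.llcomp k M M (C ⊗[k] M) c ∘ₗ a) (g' := rmulL ρ M) fun _ _ => rfl) b)
    have e2 := (map_conv (LinearMap.applyₗ c) μU (lmulL ρ M) a b).trans
      (LinearMap.congr_fun (conv_congr (μ' := LinearMap.llcomp k M (C ⊗[k] M) (C ⊗[k] M))
        (f' := lmulL ρ M) (g' := actCoL a c) fun _ _ => rfl) b)
    exact ⟨fun h => e1.trans (h.trans e2.symm), fun h => e1.symm.trans (Eq.trans h e2)⟩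
  rw [key] at h h' ⊢
  rw [hV, hU, Module.End.mul_apply, Module.End.mul_apply, ← h', h, ← Module.End.mul_apply,
    ← Module.End.mul_apply, hUV]

/-- The compatibility at `τ(d)` is the compatibility at `d` of the restricted action. -/
theorem compatAt_comp {D : Type*} [Ring D] [HopfAlgebra k D] (τ : D →ₐc[k] B) {ρ : B →ₐc[k] C}
    {σ : D →ₐc[k] C} (hσ : ∀ d, σ d = ρ (τ d)) {a : B →ₗ[k] Module.End k M}
    {c : M →ₗ[k] C ⊗[k] M} (d : D) :
    CompatAt ρ a c (τ d) ↔ CompatAt σ (a ∘ₗ (τ : D →ₗ[k] B)) c d := by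
  have h1 : (ρ : B →ₗ[k] C) ∘ₗ (τ : D →ₗ[k] B) = (σ : D →ₗ[k] C) :=
    LinearMap.ext fun d => (hσ d).symm
  rw [CompatAt, CompatAt, conv_comp, conv_comp]
  simp only [rmulL, lmulL, LinearMap.comp_assoc, h1]

end CompatAt

/-! ### Modules over the bosonization as braided modules -/

section SmashAction

open RelYD.YDHopfAlgebra (act coact)
open RelYD.Bosonization (proj incl theta inclR inclH)

variable {k : Type u} [Field k] {H : Type v} [Ring H] [HopfAlgebra k H]
  {R : Type w} [Ring R] [Algebra k R] [Coalgebra k R] [YDHopfAlgebra k H R]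
  {M : Type*} [AddCommGroup M] [Module k M]

/-- `∑ π(r₍₁₎) ⊗ r₍₂₎ = r₍₋₁₎ ⊗ r₍₀₎` for the comultiplication of `R # H`. -/
theorem Bosonization.rTensor_proj_comul_inclR (r : R) :
    (proj k H R : Bosonization k H R →ₗ[k] H).rTensor (Bosonization k H R)
      (comul (inclR r : Bosonization k H R)) = inclR.toLinearMap.lTensor H (coact r) := by
  have h1 : ∀ t : R ⊗[k] R, (proj k H R : Bosonization k H R →ₗ[k] H).rTensor (Bosonization k H R)
      (Bosonization.Phi t) = inclR.toLinearMap.lTensor H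
        (coact (TensorProduct.lid k R (counit.rTensor R t))) := by
    intro t
    induction t with
    | zero => simp only [map_zero]
    | add s t hs ht => simp only [map_add, hs, ht]
    | tmul a b =>
      rw [Bosonization.Phi_tmul, Bosonization.u_apply, LinearMap.rTensor_tmul,
        TensorProduct.lid_tmul, map_smul]
      generalize (coact b : H ⊗[k] R) = s
      induction s with
      | zero => simp only [map_zero, mul_zero, smul_zero]
      | add s t hs ht => simp only [map_add, mul_add, smul_add, hs, ht]
      | tmul h y =>
        have hp : proj k H R (inclR a * inclH h) = counit (R := k) a • h := by
          rw [Bosonization.inclR_mul_inclH, Bosonization.proj_mk]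
        simp [hp, TensorProduct.smul_tmul']
  rw [Bosonization.comul_eq, Bosonization.comulHom_inclR, h1, rTensor_counit_comul]
  simp

/-- `∑ r₍₁₎ ⊗ π(r₍₂₎) = r ⊗ 1` for the comultiplication of `R # H`. -/
theorem Bosonization.lTensor_proj_comul_inclR (r : R) :
    (proj k H R : Bosonization k H R →ₗ[k] H).lTensor (Bosonization k H R)
      (comul (inclR r : Bosonization k H R)) = inclR r ⊗ₜ 1 := by
  have h := Bosonization.lTensor_proj_comul (k := k) (H := H) r 1
  rw [map_one, mul_one, Bialgebra.comul_one, Algebra.TensorProduct.one_def,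
    LinearMap.rTensor_tmul] at h
  rw [h]
  simp

/-- The action `(r # h) m = r (h m)`. -/
noncomputable def smashAct (aR : R →ₗ[k] Module.End k M) (aH : H →ₗ[k] Module.End k M) :
    Bosonization k H R →ₗ[k] Module.End k M :=
  TensorProduct.lift ((LinearMap.mul k (Module.End k M)).compl₁₂ aR aH) ∘ₗ
    Bosonization.mk.symm.toLinearMap

theorem smashAct_mul (aR : R →ₗ[k] Module.End k M) (aH : H →ₗ[k] Module.End k M) (r : R) (h : H) :
    smashAct aR aH (inclR r * inclH h) = aR r * aH h := by
  rw [Bosonization.inclR_mul_inclH]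
  simp [smashAct]

theorem smashAct_inclR (aR : R →ₗ[k] Module.End k M) {aH : H →ₗ[k] Module.End k M}
    (h1 : ∀ m, aH 1 m = m) (r : R) : smashAct aR aH (inclR r) = aR r := by
  have h := smashAct_mul aR aH r 1
  rwa [map_one, mul_one, show aH 1 = 1 from LinearMap.ext h1, mul_one] at h

theorem smashAct_inclH {aR : R →ₗ[k] Module.End k M} (aH : H →ₗ[k] Module.End k M)
    (h1 : ∀ m, aR 1 m = m) (h : H) : smashAct aR aH (inclH h) = aH h := by
  have h := smashAct_mul aR aH 1 h
  rwa [map_one, one_mul, show aR 1 = 1 from LinearMap.ext h1, one_mul] at h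

/-- Every action of `R # H` is composed of its restrictions to `R` and `H`. -/
theorem smashAct_comp {a : Bosonization k H R →ₗ[k] Module.End k M}
    (ha : ∀ b b' m, a (b * b') m = a b (a b' m)) :
    smashAct (a ∘ₗ inclR.toLinearMap) (a ∘ₗ inclH.toLinearMap) = a := by
  ext1 b
  refine Bosonization.mul_induction (p := fun b => smashAct (a ∘ₗ inclR.toLinearMap)
    (a ∘ₗ inclH.toLinearMap) b = a b) b (fun r h => ?_)
    (fun b b' h h' => by simp only [map_add, h, h'])
  rw [smashAct_mul]
  exact (LinearMap.ext (ha _ _)).symm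

theorem lift_tensorAct_tmul (aR : R →ₗ[k] Module.End k M) (aH : H →ₗ[k] Module.End k M) (h : H)
    (r : R) (m : M) : TensorProduct.lift aR (tensorAct act aH h (r ⊗ₜ m)) =
      LinearMap.mul' k (Module.End k M) (TensorProduct.map
        (aR ∘ₗ (act : H →ₗ[k] Module.End k R).flip r) aH (comul h)) m := by
  rw [tensorAct_apply]
  generalize comul (R := k) h = t
  induction t with
  | zero => simp only [map_zero, LinearMap.zero_apply]
  | add s t hs ht => simp only [map_add, LinearMap.add_apply, hs, ht]
  | tmul a b => simp

/-- At an element of `R`, the compatibility of an action of `R # H` with an `H`-coaction is the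
`H`-colinearity of the action of `R`. -/
theorem compatAt_inclR_iff {a : Bosonization k H R →ₗ[k] Module.End k M}
    {aR : R →ₗ[k] Module.End k M} {cH : M →ₗ[k] H ⊗[k] M} (haR : ∀ r, a (inclR r) = aR r) (r : R) :
    CompatAt (proj k H R) a cH (inclR r) ↔ ∀ m, cH (aR r m) =
      (TensorProduct.lift aR).lTensor H (tensorCoactLeft coact cH (r ⊗ₜ m)) := by
  let L : Bosonization k H R ⊗[k] H →ₗ[k] (M →ₗ[k] H ⊗[k] M) :=
    TensorProduct.lift ((revComp k M (H ⊗[k] M) (H ⊗[k] M)).compl₁₂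
      (LinearMap.llcomp k M M (H ⊗[k] M) cH ∘ₗ a) (rmulL (BialgHom.id k H) M))
  let Q : H ⊗[k] Bosonization k H R →ₗ[k] (M →ₗ[k] H ⊗[k] M) :=
    TensorProduct.lift ((LinearMap.llcomp k M (H ⊗[k] M) (H ⊗[k] M)).compl₁₂
      (lmulL (BialgHom.id k H) M) (actCoL a cH))
  have e1 : conv (revComp k M (H ⊗[k] M) (H ⊗[k] M)) (LinearMap.llcomp k M M (H ⊗[k] M) cH ∘ₗ a)
      (rmulL (proj k H R) M) (inclR r) = cH ∘ₗ aR r := by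
    rw [lift_conv_congr (T := L ∘ₗ (proj k H R : Bosonization k H R →ₗ[k] H).lTensor _)
      (fun x y => rfl), LinearMap.comp_apply, Bosonization.lTensor_proj_comul_inclR, ← haR]
    refine LinearMap.ext fun m => ?_
    change (((LinearMap.mul k H).flip 1).rTensor M) (cH (a (inclR r) m)) = _
    rw [show (LinearMap.mul k H).flip 1 = LinearMap.id by ext; simp, LinearMap.rTensor_id]
    rfl
  have e2 : ∀ m, conv (LinearMap.llcomp k M (H ⊗[k] M) (H ⊗[k] M)) (lmulL (proj k H R) M)
      (actCoL a cH) (inclR r) m =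
      (TensorProduct.lift aR).lTensor H (tensorCoactLeft coact cH (r ⊗ₜ m)) := by
    intro m
    rw [lift_conv_congr (T := Q ∘ₗ (proj k H R : Bosonization k H R →ₗ[k] H).rTensor _)
      (fun x y => rfl), LinearMap.comp_apply, Bosonization.rTensor_proj_comul_inclR,
      tensorCoactLeft_tmul]
    generalize (coact r : H ⊗[k] R) = t
    induction t with
    | zero => simp only [map_zero, LinearMap.zero_apply, TensorProduct.zero_tmul]
    | add s t hs ht => simp only [map_add, LinearMap.add_apply, TensorProduct.add_tmul, hs, ht]
    | tmul g r =>
      change ((LinearMap.mul k H g).rTensor M) ((a (inclR r)).lTensor H (cH m)) = _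
      rw [haR]
      generalize cH m = t
      induction t with
      | zero => simp only [map_zero, TensorProduct.tmul_zero]
      | add s t hs ht => simp only [map_add, TensorProduct.tmul_add, hs, ht]
      | tmul h m => simp
  rw [CompatAt, e1, LinearMap.ext_iff]
  exact forall_congr' fun m => by rw [e2]; rfl

/-- An `R # H`-module with a compatible `H`-coaction is an `R`-module in the category of
Yetter-Drinfeld modules over `H`. -/
theorem IsLeftYD.isYDModule {a : Bosonization k H R →ₗ[k] Module.End k M}
    {cH : M →ₗ[k] H ⊗[k] M} (h : IsLeftYD (proj k H R) a cH) :
    IsYDModule (a ∘ₗ inclH.toLinearMap) cH (a ∘ₗ inclR.toLinearMap) where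
  isYD :=
    { act_one := fun m => (congrArg (fun b => a b m) (map_one inclH)).trans (h.act_one m)
      act_mul := fun b b' m =>
        (congrArg (fun b => a b m) (map_mul inclH b b')).trans (h.act_mul _ _ m)
      coassoc := h.coassoc
      counit := h.counit
      compat := (freeLeft_iff _ _ _).1 (freeLeft_iff_compatAt.2 fun b =>
        (compatAt_comp (incl k H R) (ρ := proj k H R) (σ := BialgHom.id k H)
          (fun d => (Bosonization.projAlg_inclH d).symm) b).1
            (freeLeft_iff_compatAt.1 ((freeLeft_iff _ _ _).2 h.compat) _)) }
  one_act m := (congrArg (fun b => a b m) (map_one inclR)).trans (h.act_one m)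
  mul_act b b' m := (congrArg (fun b => a b m) (map_mul inclR b b')).trans (h.act_mul _ _ m)
  hom :=
    { map_act := fun b x => by
        induction x with
        | zero => simp only [map_zero]
        | add s t hs ht => simp only [map_add, hs, ht]
        | tmul r m =>
          refine Eq.trans ?_ (h.act_mul (inclH b) (inclR r) m)
          rw [lift_tensorAct_tmul, Bosonization.inclH_mul_inclR]
          generalize comul (R := k) b = t
          induction t with
          | zero => simp only [map_zero]
          | add s t hs ht => simp only [map_add, LinearMap.add_apply, hs, ht]
          | tmul x y =>
            rw [TensorProduct.map_tmul, TensorProduct.map_tmul, ← Bosonization.inclR_mul_inclH]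
            exact (h.act_mul _ _ m).symm
      map_coact := fun x => by
        induction x with
        | zero => simp only [map_zero]
        | add s t hs ht => simp only [map_add, hs, ht]
        | tmul r m =>
          have e : CompatAt (proj k H R) a cH (inclR r) :=
            freeLeft_iff_compatAt.1 ((freeLeft_iff _ _ _).2 h.compat) _
          exact (compatAt_inclR_iff (aR := a ∘ₗ inclR.toLinearMap) (fun _ => rfl) r).1 e m }

/-- An `R`-module in the category of Yetter-Drinfeld modules over `H` is an `R # H`-module with a
compatible `H`-coaction. -/
theorem IsYDModule.isLeftYD {aH : H →ₗ[k] Module.End k M} {cH : M →ₗ[k] H ⊗[k] M}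
    {aR : R →ₗ[k] Module.End k M} (h : IsYDModule aH cH aR) :
    IsLeftYD (proj k H R) (smashAct aR aH) cH := by
  let f : R →ₐ[k] Module.End k M := AlgHom.ofLinearMap aR (LinearMap.ext h.one_act)
    fun r s => LinearMap.ext (h.mul_act r s)
  let g : H →ₐ[k] Module.End k M := AlgHom.ofLinearMap aH (LinearMap.ext h.isYD.act_one)
    fun r s => LinearMap.ext (h.isYD.act_mul r s)
  let F := Bosonization.lift f g fun x r => LinearMap.ext fun m =>
    (h.hom.map_act x (r ⊗ₜ m)).symm.trans (lift_tensorAct_tmul aR aH x r m)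
  have hF : ∀ b, smashAct aR aH b = F b := fun b =>
    Bosonization.mul_induction (p := fun b => smashAct aR aH b = F b) b
      (fun r x => by
        rw [smashAct_mul, map_mul, Bosonization.lift_inclR, Bosonization.lift_inclH]
        rfl)
      (fun b b' h h' => by rw [map_add, map_add, h, h'])
  have hmul : ∀ b b' m, smashAct aR aH (b * b') m = smashAct aR aH b (smashAct aR aH b' m) :=
    fun b b' m => by rw [hF, hF, hF, map_mul]; rfl
  refine ⟨fun m => by rw [hF, map_one]; rfl, hmul, h.isYD.coassoc, h.isYD.counit,
    (freeLeft_iff _ _ _).1 (freeLeft_iff_compatAt.2 fun b =>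
      Bosonization.mul_induction (p := CompatAt (proj k H R) (smashAct aR aH) cH) b
        (fun r x => CompatAt.mul hmul ?_ ?_) fun _ _ => CompatAt.add)⟩
  · exact (compatAt_inclR_iff (smashAct_inclR aR h.isYD.act_one) r).2
      fun m => h.hom.map_coact (r ⊗ₜ m)
  · have e : smashAct aR aH ∘ₗ (incl k H R : H →ₗ[k] Bosonization k H R) = aH :=
      LinearMap.ext fun x => smashAct_inclH aH h.one_act x
    refine (compatAt_comp (incl k H R) (ρ := proj k H R) (σ := BialgHom.id k H)
      (fun d => (Bosonization.projAlg_inclH d).symm) x).2 ?_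
    rw [e]
    exact freeLeft_iff_compatAt.1 ((freeLeft_iff _ _ _).2 h.isYD.compat) x

end SmashAction


/-! ### The functor on objects and morphisms -/

section Formulas

open RelYD.Bosonization (proj incl)

variable {k : Type u} [Field k] {H : Type v} [Ring H] [HopfAlgebra k H]
  {R : Type w} [Ring R] [Algebra k R] [Coalgebra k R] [YDHopfAlgebra k H R]
  {Rd : Type x} [Ring Rd] [Algebra k Rd]

theorem firstActR_eq (p : Rd →ₗ[k] R →ₗ[k] k) (M : RightYD (incl k H R)) :
    firstActR p M = pairAct p (thetaCoact (leftCoact M.coact)) := by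
  refine LinearMap.ext fun ξ => LinearMap.ext fun m => ?_
  simp only [firstActR, LinearMap.coe_mk, AddHom.coe_mk, LinearMap.comp_apply, pairAct_apply,
    thetaCoact, leftCoact]
  generalize M.coact m = t
  induction t with
  | zero => simp only [map_zero]
  | add s t hs ht => simp only [map_add, hs, ht]
  | tmul m a => simp

theorem firstCoact_eq (M : RightYD (incl k H R)) :
    firstCoact M = projCoact (leftCoact M.coact) := by
  refine LinearMap.ext fun m => ?_
  simp only [firstCoact, LinearMap.comp_apply, projCoact, leftCoact]
  generalize M.coact m = t
  induction t with
  | zero => simp only [map_zero]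
  | add s t hs ht => simp only [map_add, hs, ht]
  | tmul m a => simp

end Formulas

section ObjectsAndMorphisms

open RelYD.YDHopfAlgebra (act coact)
open RelYD.Bosonization (proj incl theta inclR inclH)

variable {k : Type u} [Field k] {H : Type v} [Ring H] [HopfAlgebra k H]
  {R : Type w} [Ring R] [Algebra k R] [Coalgebra k R] [YDHopfAlgebra k H R]
  {Rd : Type x} [Ring Rd] [Algebra k Rd] [Coalgebra k Rd] [YDHopfAlgebra k H Rd]
  {hH : Function.Bijective (antipode k : H →ₗ[k] H)} {p : Rd →ₗ[k] R →ₗ[k] k}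

theorem firstAct_eq (hH : Function.Bijective (antipode k : H →ₗ[k] H)) (p : Rd →ₗ[k] R →ₗ[k] k)
    (M : RightYD (incl k H R)) : firstAct hH p M =
      smashAct (pairAct p (thetaCoact (leftCoact M.coact))) (leftAct hH M.act) := by
  rw [← firstActR_eq]
  rfl

/-- A right relative Yetter-Drinfeld module, transformed to the left. -/
theorem RightYD.isLeftYD (hH : Function.Bijective (antipode k : H →ₗ[k] H))
    (hR : Function.Bijective (YDHopfAlgebra.antipode H : R →ₗ[k] R)) (M : RightYD (incl k H R)) :
    IsLeftYD (incl k H R) (leftAct hH M.act) (leftCoact M.coact) :=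
  (isLeftYD_leftAct_iff hH (Bosonization.antipode_bijective hH hR) (incl k H R)
    Bosonization.incl_antipode M.act M.coact).2 M.isYD

theorem IsDualPair.isYDModule_first (hp : IsDualPair hH p)
    (hR : Function.Bijective (YDHopfAlgebra.antipode H : R →ₗ[k] R)) (M : RightYD (incl k H R)) :
    IsYDModule (leftAct hH M.act) (firstCoact M)
      (pairAct p (thetaCoact (leftCoact M.coact))) := by
  rw [firstCoact_eq]
  exact hp.isYDModule_pairAct_iff.2 (M.isLeftYD hH hR).isYDComodule

theorem IsDualPair.isLeftYD_first (hp : IsDualPair hH p)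
    (hR : Function.Bijective (YDHopfAlgebra.antipode H : R →ₗ[k] R)) (M : RightYD (incl k H R)) :
    IsLeftYD (proj k H Rd) (firstAct hH p M) (firstCoact M) := by
  rw [firstAct_eq]
  exact (hp.isYDModule_first hR M).isLeftYD

theorem IsDualPair.firstAct_inclR (hp : IsDualPair hH p)
    (hR : Function.Bijective (YDHopfAlgebra.antipode H : R →ₗ[k] R)) (M : RightYD (incl k H R))
    (ξ : Rd) : firstAct hH p M (inclR ξ) = pairAct p (thetaCoact (leftCoact M.coact)) ξ := by
  rw [firstAct_eq]
  exact smashAct_inclR _ (hp.isYDModule_first hR M).isYD.act_one ξ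

theorem IsDualPair.firstAct_inclH (hp : IsDualPair hH p)
    (hR : Function.Bijective (YDHopfAlgebra.antipode H : R →ₗ[k] R)) (M : RightYD (incl k H R))
    (h : H) : firstAct hH p M (inclH h) = leftAct hH M.act h := by
  rw [firstAct_eq]
  exact smashAct_inclH _ (hp.isYDModule_first hR M).one_act h

/-- Only finitely many elements of `R` occur in the coaction of a given element. -/
theorem IsDualPair.rational_first (hp : IsDualPair hH p)
    (hR : Function.Bijective (YDHopfAlgebra.antipode H : R →ₗ[k] R)) (M : RightYD (incl k H R)) :
    rational p ⟨M.carrier, firstAct hH p M, firstCoact M, hp.isLeftYD_first hR M⟩ := fun m => by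
  obtain ⟨E, hE, h⟩ := exists_perp_ev_eq_zero p (thetaCoact (leftCoact M.coact) m)
  refine ⟨E, hE, fun ξ hξ => ?_⟩
  exact (LinearMap.congr_fun (hp.firstAct_inclR hR M ξ) m).trans (h ξ hξ)

theorem glueCoact_natural {M N : Type*} [AddCommGroup M] [Module k M] [AddCommGroup N] [Module k N]
    {cM : M →ₗ[k] H ⊗[k] M} {cN : N →ₗ[k] H ⊗[k] N} {dM : M →ₗ[k] R ⊗[k] M}
    {dN : N →ₗ[k] R ⊗[k] N} {f : M →ₗ[k] N} (hc : ∀ m, cN (f m) = f.lTensor H (cM m))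
    (hd : ∀ m, dN (f m) = f.lTensor R (dM m)) (m : M) :
    glueCoact cN dN (f m) = f.lTensor (Bosonization k H R) (glueCoact cM dM m) := by
  have h1 : ∀ x : R ⊗[k] (H ⊗[k] M), glue k H R N ((f.lTensor H).lTensor R x) =
      f.lTensor (Bosonization k H R) (glue k H R M x) := by
    intro x
    induction x with
    | zero => simp only [map_zero]
    | add s t hs ht => simp only [map_add, hs, ht]
    | tmul r x =>
      induction x with
      | zero => simp only [map_zero, TensorProduct.tmul_zero]
      | add s t hs ht => simp only [map_add, TensorProduct.tmul_add, hs, ht]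
      | tmul h m => simp
  have hc' : cN ∘ₗ f = f.lTensor H ∘ₗ cM := LinearMap.ext hc
  simp only [glueCoact, LinearMap.comp_apply]
  rw [hd, ← h1, ← LinearMap.lTensor_comp_apply, ← LinearMap.lTensor_comp_apply, hc']

/-- Linear maps that are morphisms for the transformed structures are morphisms. -/
theorem IsDualPair.isRightHom_of_first (hp : IsDualPair hH p)
    (hR : Function.Bijective (YDHopfAlgebra.antipode H : R →ₗ[k] R)) {M N : RightYD (incl k H R)}
    {f : M.carrier →ₗ[k] N.carrier}
    (hf : IsLeftHom (firstAct hH p M) (firstCoact M) (firstAct hH p N) (firstCoact N) f) :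
    IsRightHom M.act M.coact N.act N.coact f where
  map_act h m := by
    have e := hf.map_act (inclH (antipode k h)) m
    rw [hp.firstAct_inclH hR, hp.firstAct_inclH hR] at e
    simpa only [leftAct, LinearMap.comp_apply, antipodeInv_antipode] using e
  map_coact m := by
    have h1 : ∀ m, thetaCoact (leftCoact N.coact) (f m) =
        f.lTensor R (thetaCoact (leftCoact M.coact) m) := fun m => by
      refine eq_of_ev_eq hp.nondegenerate.2 fun ξ => ?_
      have e := hf.map_act (inclR ξ) m
      rw [hp.firstAct_inclR hR, hp.firstAct_inclR hR] at e
      rw [ev_lTensor]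
      exact e.symm
    have h2 : ∀ m, projCoact (leftCoact N.coact) (f m) =
        f.lTensor H (projCoact (leftCoact M.coact) m) := by
      rw [← firstCoact_eq, ← firstCoact_eq]
      exact hf.map_coact
    have h3 := glueCoact_natural h2 h1 m
    rw [glueCoact_thetaCoact_projCoact (M.isLeftYD hH hR).coassoc,
      glueCoact_thetaCoact_projCoact (N.isLeftYD hH hR).coassoc] at h3
    apply (flipAntipode_bijective (Bosonization.antipode_bijective hH hR)).1
    refine h3.trans ?_
    rw [leftCoact, LinearMap.comp_apply]
    generalize M.coact m = t
    induction t with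
    | zero => simp only [map_zero]
    | add s t hs ht => simp only [map_add, hs, ht]
    | tmul m a => simp

/-- Every rational structure is transformed from a right relative Yetter-Drinfeld module. -/
theorem IsDualPair.exists_first_eq (hp : IsDualPair hH p)
    (hR : Function.Bijective (YDHopfAlgebra.antipode H : R →ₗ[k] R)) (N : LeftYD (proj k H Rd))
    (hN : rational p N) : ∃ (a : H →ₗ[k] Module.End k N.carrier)
      (c : N.carrier →ₗ[k] N.carrier ⊗[k] Bosonization k H R) (h : IsRightYD (incl k H R) a c),
      firstAct hH p ⟨N.carrier, a, c, h⟩ = N.act ∧ firstCoact ⟨N.carrier, a, c, h⟩ = N.coact := by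
  have hmod := N.isYD.isYDModule
  obtain ⟨cR, hcR⟩ := exists_pairAct_eq hp.nondegenerate.2 (N.act ∘ₗ inclR.toLinearMap) hN
  rw [← hcR] at hmod
  have hcomod := hp.isYDModule_pairAct_iff.1 hmod
  have hA := Bosonization.antipode_bijective hH hR
  let e := LinearEquiv.ofBijective (flipAntipode k (Bosonization k H R) N.carrier)
    (flipAntipode_bijective hA)
  let a : H →ₗ[k] Module.End k N.carrier := (N.act ∘ₗ inclH.toLinearMap) ∘ₗ antipode k
  let c := e.symm.toLinearMap ∘ₗ glueCoact N.coact cR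
  have ha : leftAct hH a = N.act ∘ₗ inclH.toLinearMap := LinearMap.ext fun h =>
    congrArg (N.act ∘ₗ inclH.toLinearMap) (antipode_antipodeInv h)
  have hc : leftCoact c = glueCoact N.coact cR := LinearMap.ext fun m =>
    e.apply_symm_apply _
  have h : IsRightYD (incl k H R) a c :=
    (isLeftYD_leftAct_iff hH hA (incl k H R) Bosonization.incl_antipode a c).1 (by
      rw [ha, hc]
      exact hcomod.isLeftYD)
  refine ⟨a, c, h, ?_, ?_⟩
  · rw [firstAct_eq, ha, hc, thetaCoact_glueCoact hcomod.isYD.counit, hcR]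
    exact smashAct_comp N.isYD.act_mul
  · rw [firstCoact_eq, hc, projCoact_glueCoact _ hcomod.counit]

end ObjectsAndMorphisms

/-! ### The isomorphism of categories -/

section Inverse

/-- A fully faithful functor that is bijective on objects is an isomorphism of categories. -/
theorem exists_inverse_functor {C D : Type*} [Category C] [Category D] (F : C ⥤ D) [F.Full]
    [F.Faithful] (hF : Function.Bijective F.obj) :
    ∃ G : D ⥤ C, F ⋙ G = 𝟭 C ∧ G ⋙ F = 𝟭 D := by
  let g := (Equiv.ofBijective F.obj hF).symm
  have e : ∀ Y, F.obj (g Y) = Y := (Equiv.ofBijective F.obj hF).apply_symm_apply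
  have e' : ∀ X, g (F.obj X) = X := (Equiv.ofBijective F.obj hF).symm_apply_apply
  let G : D ⥤ C :=
    { obj := g
      map := fun {Y Z} f => F.preimage (eqToHom (e Y) ≫ f ≫ eqToHom (e Z).symm)
      map_id := fun Y => F.map_injective (by simp)
      map_comp := fun f f' => F.map_injective (by simp) }
  refine ⟨G, CategoryTheory.Functor.ext e' fun X Y f => F.map_injective ?_,
    CategoryTheory.Functor.ext e fun X Y f => ?_⟩
  · simp [G, eqToHom_map]
  · simp [G]

end Inverse

section Isomorphism

open RelYD.Bosonization (proj incl theta inclR inclH)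

variable {k : Type u} [Field k] {H : Type v} [Ring H] [HopfAlgebra k H]
  {R : Type w} [Ring R] [Algebra k R] [Coalgebra k R] [YDHopfAlgebra k H R]
  {Rd : Type x} [Ring Rd] [Algebra k Rd] [Coalgebra k Rd] [YDHopfAlgebra k H Rd]
  {hH : Function.Bijective (antipode k : H →ₗ[k] H)} {p : Rd →ₗ[k] R →ₗ[k] k}

/-- Two objects with the same image have equal structures, because the identity is a morphism
between them. -/
theorem IsDualPair.firstFunctor_injective (hp : IsDualPair hH p)
    (hR : Function.Bijective (YDHopfAlgebra.antipode H : R →ₗ[k] R)) (hYD) (hrat) :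
    Function.Injective (firstFunctor (R := R) hp hYD hrat).obj := by
  intro M N h
  have h0 : (⟨M.carrier, firstAct hH p M, firstCoact M, hYD M⟩ : LeftYD (proj k H Rd)) =
      ⟨N.carrier, firstAct hH p N, firstCoact N, hYD N⟩ := congrArg (fun X => X.obj) h
  have key : ∀ {V : Type _} [i : AddCommGroup V] [j : Module k V]
      (a a' : H →ₗ[k] Module.End k V) (c c' : V →ₗ[k] V ⊗[k] Bosonization k H R)
      (h : IsRightYD (incl k H R) a c) (h' : IsRightYD (incl k H R) a' c'),
      firstAct hH p ⟨V, a, c, h⟩ = firstAct hH p ⟨V, a', c', h'⟩ →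
      firstCoact ⟨V, a, c, h⟩ = firstCoact ⟨V, a', c', h'⟩ → a = a' ∧ c = c' := by
    intro V i j a a' c c' h h' h1 h2
    have := hp.isRightHom_of_first hR (M := ⟨V, a, c, h⟩) (N := ⟨V, a', c', h'⟩)
      (f := LinearMap.id) ⟨fun b m => congrArg (fun g => g b m) h1, fun m => by
        rw [LinearMap.lTensor_id, LinearMap.id_apply, LinearMap.id_apply, h2]⟩
    refine ⟨LinearMap.ext fun b => LinearMap.ext fun m => this.map_act b m,
      LinearMap.ext fun m => ?_⟩
    have e := this.map_coact m
    rw [LinearMap.rTensor_id] at e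
    exact e.symm
  obtain ⟨V, a, c, hM⟩ := M
  obtain ⟨V', a', c', hN⟩ := N
  rw [LeftYD.mk.injEq] at h0
  obtain ⟨hV, h1, h2, h3, h4⟩ := h0
  dsimp only at hV h1 h2
  subst hV
  obtain rfl := eq_of_heq h1
  obtain rfl := eq_of_heq h2
  obtain ⟨rfl, rfl⟩ := key a a' c c' hM hN (eq_of_heq h3) (eq_of_heq h4)
  rfl

theorem IsDualPair.firstFunctor_surjective (hp : IsDualPair hH p)
    (hR : Function.Bijective (YDHopfAlgebra.antipode H : R →ₗ[k] R)) (hYD) (hrat) :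
    Function.Surjective (firstFunctor (R := R) hp hYD hrat).obj := by
  rintro ⟨N, hN⟩
  obtain ⟨a, c, h, h1, h2⟩ := hp.exists_first_eq hR N hN
  refine ⟨⟨N.carrier, a, c, h⟩, ?_⟩
  have e : (⟨N.carrier, firstAct hH p ⟨N.carrier, a, c, h⟩, firstCoact ⟨N.carrier, a, c, h⟩,
      hYD _⟩ : LeftYD (proj k H Rd)) = N := by
    obtain ⟨V, b, d, hV⟩ := N
    rw [LeftYD.mk.injEq]
    exact ⟨rfl, HEq.rfl, HEq.rfl, heq_of_eq h1, heq_of_eq h2⟩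
  change (⟨_, _⟩ : (rational (H := H) p).FullSubcategory) = ⟨_, _⟩
  congr

theorem IsDualPair.exists_inverse (hp : IsDualPair hH p)
    (hR : Function.Bijective (YDHopfAlgebra.antipode H : R →ₗ[k] R)) (hYD) (hrat) :
    ∃ G : RatYD hp ⥤ RightYD (incl k H R), firstFunctor hp hYD hrat ⋙ G = 𝟭 _ ∧
      G ⋙ firstFunctor hp hYD hrat = 𝟭 _ := by
  have : (firstFunctor (R := R) hp hYD hrat).Faithful :=
    ⟨fun h => RightYD.hom_ext (congrArg (fun f => f.hom.lin) h)⟩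
  have : (firstFunctor (R := R) hp hYD hrat).Full :=
    ⟨fun f => ⟨⟨f.hom.lin, hp.isRightHom_of_first hR f.hom.isHom⟩, rfl⟩⟩
  exact exists_inverse_functor _ ⟨hp.firstFunctor_injective hR hYD hrat,
    hp.firstFunctor_surjective hR hYD hrat⟩

end Isomorphism


/-! ### Naturality and linearity of the twist -/

section TwistHom

variable {k : Type u} [Field k] {H : Type v} [Ring H] [HopfAlgebra k H]
  {X Y M N P : Type*} [AddCommGroup X] [Module k X] [AddCommGroup Y] [Module k Y]
  [AddCommGroup M] [Module k M] [AddCommGroup N] [Module k N] [AddCommGroup P] [Module k P]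

/-- The twist is natural in the module. -/
theorem twist_natural (c : M →ₗ[k] H ⊗[k] M) {f : H →ₗ[k] Module.End k X}
    {g : H →ₗ[k] Module.End k Y} {φ : X →ₗ[k] Y} (h : ∀ b x, φ (f b x) = g b (φ x))
    (x : X ⊗[k] M) : φ.rTensor M (twist c f x) = twist c g (φ.rTensor M x) := by
  induction x with
  | zero => simp only [map_zero]
  | add s t hs ht => simp only [map_add, hs, ht]
  | tmul x m =>
    have e : φ ∘ₗ f.flip x = g.flip (φ x) := LinearMap.ext fun b => h b x
    rw [LinearMap.rTensor_tmul, twist_tmul, twist_tmul, ← LinearMap.rTensor_comp_apply, e]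

/-- The twist is natural in the comodule. -/
theorem twist_natural_right {c : M →ₗ[k] H ⊗[k] M} {d : N →ₗ[k] H ⊗[k] N} {g : M →ₗ[k] N}
    (f : H →ₗ[k] Module.End k X) (h : ∀ m, d (g m) = g.lTensor H (c m)) (x : X ⊗[k] M) :
    g.lTensor X (twist c f x) = twist d f (g.lTensor X x) := by
  induction x with
  | zero => simp only [map_zero]
  | add s t hs ht => simp only [map_add, hs, ht]
  | tmul x m =>
    rw [LinearMap.lTensor_tmul, twist_tmul, twist_tmul, h]
    generalize c m = t
    induction t with
    | zero => simp only [map_zero]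
    | add s t hs ht => simp only [map_add, hs, ht]
    | tmul b m => simp

/-- The action `h (m ⊗ n) = h₍₂₎ m ⊗ h₍₁₎ n`. -/
noncomputable def coTensorAct (aM : H →ₗ[k] Module.End k M) (aN : H →ₗ[k] Module.End k N) :
    H →ₗ[k] Module.End k (M ⊗[k] N) :=
  conv (TensorProduct.mapBilinear (RingHom.id k) M N M N).flip aN aM

/-- The coaction `m ⊗ n ↦ n₍₋₁₎ m₍₋₁₎ ⊗ (m₍₀₎ ⊗ n₍₀₎)`. -/
noncomputable def coTensorCoact {C : Type*} [Ring C] [Algebra k C] (cM : M →ₗ[k] C ⊗[k] M)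
    (cN : N →ₗ[k] C ⊗[k] N) : M ⊗[k] N →ₗ[k] C ⊗[k] (M ⊗[k] N) :=
  (TensorProduct.comm k N M).toLinearMap.lTensor C ∘ₗ mixL k C N M ∘ₗ TensorProduct.map cN cM ∘ₗ
    (TensorProduct.comm k M N).toLinearMap

theorem coTensorCoact_tmul {C : Type*} [Ring C] [Algebra k C] (cM : M →ₗ[k] C ⊗[k] M)
    (cN : N →ₗ[k] C ⊗[k] N) (m : M) (n : N) : coTensorCoact cM cN (m ⊗ₜ n) =
      (TensorProduct.comm k N M).toLinearMap.lTensor C (mixL k C N M (cN n ⊗ₜ cM m)) := rfl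

/-- `m ⊗ n ↦ n₍₋₁₎ m ⊗ n₍₀₎` is linear from the co-opposite to the diagonal action. -/
theorem twist_coTensorAct {aM : H →ₗ[k] Module.End k M} {aN : H →ₗ[k] Module.End k N}
    {cN : N →ₗ[k] H ⊗[k] N} (hM : ∀ b b' m, aM (b * b') m = aM b (aM b' m))
    (hN : FreeLeft (BialgHom.id k H) aN cN) (h : H) (x : M ⊗[k] N) :
    twist cN aM (coTensorAct aM aN h x) = tensorAct aM aN h (twist cN aM x) := by
  induction x with
  | zero => simp only [map_zero]
  | add s t hs ht => simp only [map_add, hs, ht]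
  | tmul m n =>
    -- `e` is the antipode-free compatibility of `N`, applied to `n` and then acting on `m`.
    let Λ : (N →ₗ[k] H ⊗[k] N) →ₗ[k] M ⊗[k] N := (aM.flip m).rTensor N ∘ₗ LinearMap.applyₗ n
    have e := congrArg Λ (LinearMap.congr_fun hN h)
    rw [map_conv, map_conv] at e
    have e1 := map_conv (twist cN aM ∘ₗ LinearMap.applyₗ (m ⊗ₜ n))
      (TensorProduct.mapBilinear (RingHom.id k) M N M N).flip aN aM h
    have e2 := map_conv (LinearMap.applyₗ (twist cN aM (m ⊗ₜ n)))
      (TensorProduct.mapBilinear (RingHom.id k) M N M N) aM aN h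
    refine e1.trans ((LinearMap.congr_fun (conv_congr fun x y => ?_) h).trans
      (e.trans ((LinearMap.congr_fun (conv_congr fun x y => ?_) h).trans e2.symm)))
    · change twist cN aM (aM y m ⊗ₜ aN x n) =
        (aM.flip m).rTensor N (((LinearMap.mul k H).flip y).rTensor N (cN (aN x n)))
      have e' : aM.flip m ∘ₗ (LinearMap.mul k H).flip y = aM.flip (aM y m) :=
        LinearMap.ext fun b => hM b y m
      rw [twist_tmul, ← LinearMap.rTensor_comp_apply, e']
    · change (aM.flip m).rTensor N ((LinearMap.mul k H x).rTensor N ((aN y).lTensor H (cN n))) =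
        TensorProduct.map (aM x) (aN y) (twist cN aM (m ⊗ₜ n))
      rw [twist_tmul]
      generalize cN n = t
      induction t with
      | zero => simp only [map_zero]
      | add s t hs ht => simp only [map_add, hs, ht]
      | tmul b n => simp [hM]

/-- `m ⊗ n ↦ n₍₋₁₎ m ⊗ n₍₀₎` is colinear from the opposite to the diagonal coaction. -/
theorem tensorCoactLeft_twist {aM : H →ₗ[k] Module.End k M} {cM : M →ₗ[k] H ⊗[k] M}
    {cN : N →ₗ[k] H ⊗[k] N} (hM : FreeLeft (BialgHom.id k H) aM cM)
    (hN : ∀ n, TensorProduct.assoc k H H N (comul.rTensor N (cN n)) = cN.lTensor H (cN n))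
    (x : M ⊗[k] N) : tensorCoactLeft cM cN (twist cN aM x) =
      (twist cN aM).lTensor H (coTensorCoact cM cN x) := by
  induction x with
  | zero => simp only [map_zero]
  | add s t hs ht => simp only [map_add, hs, ht]
  | tmul m n =>
    -- `hT` is the antipode-free compatibility of `M` at the element `m`. Both sides of the claim
    -- are images of `∑ n₍₋₂₎ ⊗ n₍₋₁₎ ⊗ n₍₀₎`, under `T₁` and `T₂` on the first two factors.
    let T₁ : H ⊗[k] H →ₗ[k] H ⊗[k] M := LinearMap.applyₗ m ∘ₗ
      TensorProduct.lift ((revComp k M (H ⊗[k] M) (H ⊗[k] M)).compl₁₂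
        (LinearMap.llcomp k M M (H ⊗[k] M) cM ∘ₗ aM) (rmulL (BialgHom.id k H) M))
    let T₂ : H ⊗[k] H →ₗ[k] H ⊗[k] M := LinearMap.applyₗ m ∘ₗ
      TensorProduct.lift ((LinearMap.llcomp k M (H ⊗[k] M) (H ⊗[k] M)).compl₁₂
        (lmulL (BialgHom.id k H) M) (actCoL aM cM))
    have hT : T₁ ∘ₗ comul = T₂ ∘ₗ comul := LinearMap.ext fun h =>
      congrArg (fun f => f m) (LinearMap.congr_fun hM h)
    have h1 : ∀ t : H ⊗[k] N, tensorCoactLeft cM cN ((aM.flip m).rTensor N t) =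
        TensorProduct.assoc k H M N (T₁.rTensor N
          ((TensorProduct.assoc k H H N).symm (cN.lTensor H t))) := by
      intro t
      induction t with
      | zero => simp only [map_zero]
      | add s t hs ht => simp only [map_add, hs, ht]
      | tmul h n =>
        rw [LinearMap.rTensor_tmul, tensorCoactLeft_tmul, LinearMap.lTensor_tmul]
        generalize cN n = t
        induction t with
        | zero => simp only [map_zero, TensorProduct.tmul_zero]
        | add s t hs ht => simp only [map_add, TensorProduct.tmul_add, hs, ht]
        | tmul g n =>
          have e : T₁ (h ⊗ₜ g) = ((LinearMap.mul k H).flip g).rTensor M (cM (aM h m)) := rfl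
          rw [TensorProduct.assoc_symm_tmul, LinearMap.rTensor_tmul, e, LinearMap.flip_apply]
          generalize cM (aM h m) = t
          induction t with
          | zero => simp only [map_zero, TensorProduct.zero_tmul]
          | add s t hs ht => simp only [map_add, TensorProduct.add_tmul, hs, ht]
          | tmul g' m => simp
    have h2 : ∀ t : H ⊗[k] N, (twist cN aM).lTensor H
        ((TensorProduct.comm k N M).toLinearMap.lTensor H (mixL k H N M (t ⊗ₜ cM m))) =
        TensorProduct.assoc k H M N (T₂.rTensor N
          ((TensorProduct.assoc k H H N).symm (cN.lTensor H t))) := by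
      intro t
      induction t with
      | zero => simp only [map_zero, TensorProduct.zero_tmul]
      | add s t hs ht => simp only [map_add, TensorProduct.add_tmul, hs, ht]
      | tmul h n =>
        let Ψ : (H ⊗[k] M) ⊗[k] (H ⊗[k] N) →ₗ[k] H ⊗[k] (M ⊗[k] N) :=
          TensorProduct.map (LinearMap.mul k H h) ((TensorProduct.lift aM.flip).rTensor N ∘ₗ
            (TensorProduct.assoc k M H N).symm.toLinearMap) ∘ₗ
            (TensorProduct.assoc k H M (H ⊗[k] N)).toLinearMap
        have h3 : ∀ s : H ⊗[k] M, (twist cN aM).lTensor H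
            ((TensorProduct.comm k N M).toLinearMap.lTensor H (mixL k H N M ((h ⊗ₜ n) ⊗ₜ s))) =
            Ψ (s ⊗ₜ cN n) := by
          intro s
          induction s with
          | zero => simp only [map_zero, TensorProduct.zero_tmul, TensorProduct.tmul_zero]
          | add s t hs ht =>
            simp only [map_add, TensorProduct.add_tmul, TensorProduct.tmul_add, hs, ht]
          | tmul g m => rfl
        have h4 : ∀ t : H ⊗[k] N, TensorProduct.assoc k H M N (T₂.rTensor N
            ((TensorProduct.assoc k H H N).symm (h ⊗ₜ t))) = Ψ (cM m ⊗ₜ t) := by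
          intro t
          induction t with
          | zero => simp only [map_zero, TensorProduct.tmul_zero]
          | add s t hs ht => simp only [map_add, TensorProduct.tmul_add, hs, ht]
          | tmul g n =>
            have e : T₂ (h ⊗ₜ g) = (LinearMap.mul k H h).rTensor M ((aM g).lTensor H (cM m)) := rfl
            rw [TensorProduct.assoc_symm_tmul, LinearMap.rTensor_tmul, e]
            generalize cM m = s
            induction s with
            | zero => simp only [map_zero, TensorProduct.zero_tmul]
            | add s t hs ht => simp only [map_add, TensorProduct.add_tmul, hs, ht]
            | tmul g' m => rfl
        rw [h3, LinearMap.lTensor_tmul, h4]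
    rw [twist_tmul, h1, coTensorCoact_tmul, h2, ← hN, LinearEquiv.symm_apply_apply,
      ← LinearMap.rTensor_comp_apply, ← LinearMap.rTensor_comp_apply, hT]

end TwistHom


/-! ### The coaction of `R` on a tensor product -/

section TensorCoaction

open RelYD.YDHopfAlgebra (act coact)
open RelYD.Bosonization (proj incl theta inclR inclH)

variable {k : Type u} [Field k] {H : Type v} [Ring H] [HopfAlgebra k H]
  {R : Type w} [Ring R] [Algebra k R] [Coalgebra k R] [YDHopfAlgebra k H R]
  {M N : Type*} [AddCommGroup M] [Module k M] [AddCommGroup N] [Module k N]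

/-- The map `s ⊗ n ↦ n₍₋₁₎ s ⊗ n₍₀₎` on `(R ⊗ M) ⊗ N`, where `H` acts on the factor `R` only. -/
noncomputable def actTwist (R : Type w) [Ring R] [Algebra k R] [Coalgebra k R]
    [YDHopfAlgebra k H R] (M : Type*) [AddCommGroup M] [Module k M] (cH : N →ₗ[k] H ⊗[k] N) :
    (R ⊗[k] M) ⊗[k] N →ₗ[k] (R ⊗[k] M) ⊗[k] N :=
  twist cH (LinearMap.rTensorHom M ∘ₗ (act : H →ₗ[k] Module.End k R))

/-- For `w = s ⊗ m`, the map `r ⊗ n ↦ r (n₍₋₁₎ s) ⊗ (m ⊗ n₍₀₎)`. -/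
noncomputable def crossMul (cH : N →ₗ[k] H ⊗[k] N) (w : R ⊗[k] M) :
    R ⊗[k] N →ₗ[k] R ⊗[k] (M ⊗[k] N) :=
  TensorProduct.lift ((LinearMap.rTensorHom (M ⊗[k] N) ∘ₗ LinearMap.mul k R).compl₂
    ((TensorProduct.assoc k R M N).toLinearMap ∘ₗ actTwist R M cH ∘ₗ
      TensorProduct.mk k (R ⊗[k] M) N w))

theorem crossMul_tmul (cH : N →ₗ[k] H ⊗[k] N) (w : R ⊗[k] M) (r : R) (n : N) :
    crossMul cH w (r ⊗ₜ n) = (LinearMap.mul k R r).rTensor (M ⊗[k] N)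
      (TensorProduct.assoc k R M N (actTwist R M cH (w ⊗ₜ n))) := rfl

/-- The `R`-coaction behind the tensor product of comodules over `R # H`. -/
theorem thetaCoact_coTensorCoact (cM : M →ₗ[k] Bosonization k H R ⊗[k] M)
    (cH : N →ₗ[k] H ⊗[k] N) (cR : N →ₗ[k] R ⊗[k] N) (m : M) (n : N) :
    thetaCoact (coTensorCoact cM (glueCoact cH cR)) (m ⊗ₜ n) =
      crossMul cH (thetaCoact cM m) (cR n) := by
  simp only [thetaCoact, LinearMap.comp_apply, coTensorCoact_tmul, glueCoact]
  generalize cR n = x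
  induction x with
  | zero => simp only [map_zero, TensorProduct.zero_tmul]
  | add s t hs ht => simp only [map_add, TensorProduct.add_tmul, hs, ht]
  | tmul r n =>
    rw [crossMul_tmul, LinearMap.lTensor_tmul, actTwist, twist_tmul]
    generalize cH n = z
    induction z with
    | zero => simp only [map_zero, TensorProduct.zero_tmul, TensorProduct.tmul_zero]
    | add s t hs ht =>
      simp only [map_add, TensorProduct.add_tmul, TensorProduct.tmul_add, hs, ht]
    | tmul h n =>
      rw [glue_tmul, LinearMap.rTensor_tmul, LinearMap.flip_apply, LinearMap.comp_apply,
        LinearMap.coe_rTensorHom]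
      generalize cM m = y
      induction y with
      | zero => simp only [map_zero, TensorProduct.tmul_zero, TensorProduct.zero_tmul]
      | add s t hs ht =>
        simp only [map_add, TensorProduct.tmul_add, TensorProduct.add_tmul, hs, ht]
      | tmul a m =>
        have e : theta k H R (Bosonization.mk (r ⊗ₜ h) * a) =
            r * (act h : R →ₗ[k] R) (theta k H R a) := by
          rw [← Bosonization.inclR_mul_inclH, mul_assoc, Bosonization.theta_inclR_mul,
            Bosonization.theta_inclH_mul]
        simp [mixL, e]

end TensorCoaction

/-! ### The action of the dual on a tensor product -/

section CrossAct

open RelYD.YDHopfAlgebra (act coact)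
open RelYD.Bosonization (proj incl theta inclR inclH)

variable {k : Type u} [Field k] {H : Type v} [Ring H] [HopfAlgebra k H]
  {R : Type w} [Ring R] [Algebra k R] [Coalgebra k R] [YDHopfAlgebra k H R]
  {Rd : Type x} [AddCommGroup Rd] [Module k Rd]
  {M N : Type*} [AddCommGroup M] [Module k M] [AddCommGroup N] [Module k N]

/-- The map `m ⊗ n ↦ ⟨η, n₍₋₁₎ r⟩ m₍₀₎ ⊗ n₍₀₎`, where `r ⊗ m₍₀₎` is the coaction of `R` on `m`. -/
noncomputable def crossAct (p : Rd →ₗ[k] R →ₗ[k] k) (cR : M →ₗ[k] R ⊗[k] M)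
    (cH : N →ₗ[k] H ⊗[k] N) : Rd →ₗ[k] Module.End k (M ⊗[k] N) :=
  LinearMap.lcomp k (M ⊗[k] N) (actTwist R M cH ∘ₗ cR.rTensor N) ∘ₗ
    LinearMap.rTensorHom N ∘ₗ ev p M

theorem crossAct_apply (p : Rd →ₗ[k] R →ₗ[k] k) (cR : M →ₗ[k] R ⊗[k] M)
    (cH : N →ₗ[k] H ⊗[k] N) (η : Rd) (x : M ⊗[k] N) : crossAct p cR cH η x =
      (ev p M η).rTensor N (actTwist R M cH (cR.rTensor N x)) := rfl

/-- `m ⊗ n ↦ n₍₋₁₎ m ⊗ n₍₀₎` carries the crossed action of `η` to its action on the first factor. -/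
theorem twist_crossAct {aH : H →ₗ[k] Module.End k M} {cR : M →ₗ[k] R ⊗[k] M}
    {cH : N →ₗ[k] H ⊗[k] N}
    (hcH : ∀ n, TensorProduct.assoc k H H N (comul.rTensor N (cH n)) = cH.lTensor H (cH n))
    (h : ∀ b m, cR (aH b m) = tensorAct act aH b (cR m)) (p : Rd →ₗ[k] R →ₗ[k] k) (η : Rd)
    (x : M ⊗[k] N) : twist cH aH (crossAct p cR cH η x) =
      (pairAct p cR η).rTensor N (twist cH aH x) := by
  have e : conv (LinearMap.mul k (Module.End k (R ⊗[k] M))).flip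
      (LinearMap.rTensorHom M ∘ₗ (act : H →ₗ[k] Module.End k R))
      (LinearMap.lTensorHom R ∘ₗ aH) = tensorAct act aH :=
    conv_congr fun x y => TensorProduct.ext' fun _ _ => rfl
  have e' : pairAct p cR η = ev p M η ∘ₗ cR := rfl
  rw [crossAct_apply, ← twist_natural cH (f := LinearMap.lTensorHom R ∘ₗ aH) (g := aH)
    (fun b w => ev_lTensor p η (aH b) w), actTwist, twist_twist hcH, e,
    ← twist_natural cH h, e', LinearMap.rTensor_comp_apply]

end CrossAct

section DualAction

open RelYD.YDHopfAlgebra (act coact)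
open RelYD.Bosonization (proj incl theta inclR inclH)

variable {k : Type u} [Field k] {H : Type v} [Ring H] [HopfAlgebra k H]
  {R : Type w} [Ring R] [Algebra k R] [Coalgebra k R] [YDHopfAlgebra k H R]
  {Rd : Type x} [Ring Rd] [Algebra k Rd] [Coalgebra k Rd] [YDHopfAlgebra k H Rd]
  {hH : Function.Bijective (antipode k : H →ₗ[k] H)} {p : Rd →ₗ[k] R →ₗ[k] k}
  {M N : Type*} [AddCommGroup M] [Module k M] [AddCommGroup N] [Module k N]

/-- `⟨ξ, r s⟩ = ⟨ξ₍₁₎, s⟩ ⟨ξ₍₂₎, r⟩` for elements `s ⊗ m ⊗ n` in place of `s`. -/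
theorem IsDualPair.ev_mul_assoc (hp : IsDualPair hH p) (ξ : Rd) (r : R)
    (z : (R ⊗[k] M) ⊗[k] N) :
    ev p (M ⊗[k] N) ξ ((LinearMap.mul k R r).rTensor _ (TensorProduct.assoc k R M N z)) =
      TensorProduct.rid k (M ⊗[k] N) (TensorProduct.map (LinearMap.applyₗ z ∘ₗ
        LinearMap.rTensorHom N ∘ₗ ev p M) (p.flip r) (comul ξ)) := by
  induction z with
  | zero => simp only [map_zero, LinearMap.zero_comp, TensorProduct.map_zero_left,
      LinearMap.zero_apply]
  | add s t hs ht => simp only [map_add, LinearMap.add_comp, TensorProduct.map_add_left,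
      LinearMap.add_apply, hs, ht]
  | tmul x n =>
    induction x with
    | zero => simp only [TensorProduct.zero_tmul, map_zero, LinearMap.zero_comp,
        TensorProduct.map_zero_left, LinearMap.zero_apply]
    | add s t hs ht => simp only [TensorProduct.add_tmul, map_add, LinearMap.add_comp,
        TensorProduct.map_add_left, LinearMap.add_apply, hs, ht]
    | tmul s m =>
      rw [TensorProduct.assoc_tmul, LinearMap.rTensor_tmul, ev_tmul, LinearMap.mul_apply',
        hp.pair_mul]
      generalize (comul ξ : Rd ⊗[k] Rd) = t
      induction t with
      | zero => simp only [map_zero, zero_smul]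
      | add s t hs ht => simp only [map_add, add_smul, hs, ht]
      | tmul η ζ => simp [TensorProduct.smul_tmul', smul_smul, mul_comm]

/-- Pairing `ξ` with the coaction of `R` on `m ⊗ n` gives the crossed action of `ξ₍₁₎` on
`m ⊗ ξ₍₂₎ n`. -/
theorem IsDualPair.ev_crossMul (hp : IsDualPair hH p) (cR : M →ₗ[k] R ⊗[k] M)
    (cH : N →ₗ[k] H ⊗[k] N) (ξ : Rd) (m : M) (x : R ⊗[k] N) :
    ev p (M ⊗[k] N) ξ (crossMul cH (cR m) x) = TensorProduct.lift (crossAct p cR cH)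
      ((TensorProduct.mk k M N m ∘ₗ (ev p N).flip x).lTensor Rd (comul ξ)) := by
  induction x with
  | zero => simp only [map_zero, LinearMap.comp_zero, LinearMap.lTensor_zero, LinearMap.zero_apply]
  | add s t hs ht => simp only [map_add, LinearMap.comp_add, LinearMap.lTensor_add,
      LinearMap.add_apply, hs, ht]
  | tmul r n =>
    rw [crossMul_tmul, hp.ev_mul_assoc]
    generalize (comul ξ : Rd ⊗[k] Rd) = t
    induction t with
    | zero => simp only [map_zero]
    | add s t hs ht => simp only [map_add, hs, ht]
    | tmul η ζ => simp [crossAct_apply]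

/-- The diagonal action of `ξ` on `n₍₋₁₎ m ⊗ n₍₀₎`. -/
theorem IsYDModule.tensorAct_inclR_twist {aM : H →ₗ[k] Module.End k M}
    {aN : H →ₗ[k] Module.End k N} {cN : N →ₗ[k] H ⊗[k] N} {bM : R →ₗ[k] Module.End k M}
    {bN : R →ₗ[k] Module.End k N} (hM : ∀ b b' m, aM (b * b') m = aM b (aM b' m))
    (hN : IsYDModule aN cN bN) (ξ : R) (m : M) (n : N) :
    tensorAct (smashAct bM aM) (smashAct bN aN) (inclR ξ) (twist cN aM (m ⊗ₜ n)) =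
      TensorProduct.lift (LinearMap.lcomp k (M ⊗[k] N) (twist cN aM) ∘ₗ
        LinearMap.rTensorHom N ∘ₗ bM)
        ((TensorProduct.mk k M N m ∘ₗ bN.flip n).lTensor R (comul ξ)) := by
  rw [tensorAct_apply, Bosonization.comul_eq, Bosonization.comulHom_inclR]
  generalize (comul ξ : R ⊗[k] R) = t
  induction t with
  | zero => simp only [map_zero, LinearMap.zero_apply]
  | add s t hs ht => simp only [map_add, LinearMap.add_apply, hs, ht]
  | tmul η ζ =>
    have e := hN.hom.map_coact (ζ ⊗ₜ n)
    rw [TensorProduct.lift.tmul, tensorCoactLeft_tmul] at e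
    rw [LinearMap.lTensor_tmul, TensorProduct.lift.tmul]
    change _ = (bM η).rTensor N (twist cN aM (m ⊗ₜ bN ζ n))
    rw [twist_tmul, twist_tmul, e, Bosonization.Phi_tmul, Bosonization.u_apply]
    generalize (coact ζ : H ⊗[k] R) = s
    generalize cN n = t
    induction s with
    | zero => simp only [map_zero, mul_zero, LinearMap.zero_apply, TensorProduct.zero_tmul]
    | add s s' hs hs' => simp only [map_add, mul_add, LinearMap.add_apply, TensorProduct.add_tmul,
        hs, hs']
    | tmul h y =>
      induction t with
      | zero => simp only [map_zero, TensorProduct.tmul_zero]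
      | add s t hs ht => simp only [map_add, TensorProduct.tmul_add, hs, ht]
      | tmul g n =>
        rw [Bosonization.J_tmul, Algebra.TensorProduct.tmul_mul_tmul, one_mul]
        simp [smashAct_mul, smashAct_inclR bN hN.isYD.act_one, mixL, hM]

end DualAction


/-! ### Tensor products under the passage from right to left -/

section TensorStructures

variable {k : Type u} [Field k] {M N : Type*} [AddCommGroup M] [Module k M] [AddCommGroup N]
  [Module k N]

theorem leftAct_tensorAct {B : Type v} [Ring B] [HopfAlgebra k B]
    (hB : Function.Bijective (antipode k : B →ₗ[k] B)) (aM : B →ₗ[k] Module.End k M)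
    (aN : B →ₗ[k] Module.End k N) :
    leftAct hB (tensorAct aM aN) = coTensorAct (leftAct hB aM) (leftAct hB aN) :=
  LinearMap.ext fun b => conv_antipodeInv hB _ aM aN b

theorem leftCoact_tensorCoactRight {C : Type w} [Ring C] [HopfAlgebra k C] (cM : M →ₗ[k] M ⊗[k] C)
    (cN : N →ₗ[k] N ⊗[k] C) :
    leftCoact (tensorCoactRight cM cN) = coTensorCoact (leftCoact cM) (leftCoact cN) := by
  refine TensorProduct.ext' fun m n => ?_
  rw [coTensorCoact_tmul]
  simp only [leftCoact, LinearMap.comp_apply, tensorCoactRight_tmul]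
  generalize cM m = s
  generalize cN n = t
  induction s with
  | zero => simp only [map_zero, TensorProduct.zero_tmul, TensorProduct.tmul_zero]
  | add s s' hs hs' =>
    simp only [map_add, TensorProduct.add_tmul, TensorProduct.tmul_add, hs, hs']
  | tmul m a =>
    induction t with
    | zero => simp only [map_zero, TensorProduct.zero_tmul, TensorProduct.tmul_zero]
    | add s s' hs hs' =>
      simp only [map_add, TensorProduct.add_tmul, TensorProduct.tmul_add, hs, hs']
    | tmul n b => simp [mixL, mixR, antipode_mul_antidistrib]

theorem projCoact_coTensorCoact {H : Type v} [Ring H] [HopfAlgebra k H] {R : Type w} [Ring R]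
    [Algebra k R] [Coalgebra k R] [YDHopfAlgebra k H R] (cM : M →ₗ[k] Bosonization k H R ⊗[k] M)
    (cN : N →ₗ[k] Bosonization k H R ⊗[k] N) :
    projCoact (coTensorCoact cM cN) = coTensorCoact (projCoact cM) (projCoact cN) := by
  refine TensorProduct.ext' fun m n => ?_
  rw [coTensorCoact_tmul]
  simp only [projCoact, LinearMap.comp_apply, coTensorCoact_tmul]
  generalize cM m = s
  generalize cN n = t
  induction s with
  | zero => simp only [map_zero, TensorProduct.tmul_zero]
  | add s s' hs hs' => simp only [map_add, TensorProduct.tmul_add, hs, hs']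
  | tmul a m =>
    induction t with
    | zero => simp only [map_zero, TensorProduct.zero_tmul]
    | add s s' hs hs' => simp only [map_add, TensorProduct.add_tmul, hs, hs']
    | tmul b n => simp [mixL]

end TensorStructures

/-! ### The twist as a morphism -/

section Comultiplication

open RelYD.YDHopfAlgebra (act coact)
open RelYD.Bosonization (proj incl theta inclR inclH)

variable {k : Type u} [Field k] {H : Type v} [Ring H] [HopfAlgebra k H]
  {R : Type w} [Ring R] [Algebra k R] [Coalgebra k R] [YDHopfAlgebra k H R]
  {Rd : Type x} [Ring Rd] [Algebra k Rd] [Coalgebra k Rd] [YDHopfAlgebra k H Rd]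
  {hH : Function.Bijective (antipode k : H →ₗ[k] H)} {p : Rd →ₗ[k] R →ₗ[k] k}

/-- The coaction of `R # H` on a tensor product, transformed to the left. -/
theorem leftCoact_tensorObj (M N : RightYD (incl k H R)) :
    leftCoact (MonoidalCategoryStruct.tensorObj M N).coact =
      coTensorCoact (leftCoact M.coact) (leftCoact N.coact) :=
  leftCoact_tensorCoactRight M.coact N.coact

theorem firstCoact_tensorObj (M N : RightYD (incl k H R)) :
    firstCoact (MonoidalCategoryStruct.tensorObj M N) =
      coTensorCoact (firstCoact M) (firstCoact N) := by
  rw [firstCoact_eq, firstCoact_eq, firstCoact_eq, leftCoact_tensorObj]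
  exact projCoact_coTensorCoact _ _

/-- The diagonal action of `R^∨ # H` restricts to the diagonal action of `H`. -/
theorem IsDualPair.tensorAct_firstAct_inclH (hp : IsDualPair hH p)
    (hR : Function.Bijective (YDHopfAlgebra.antipode H : R →ₗ[k] R)) (M N : RightYD (incl k H R))
    (h : H) : tensorAct (firstAct hH p M) (firstAct hH p N) (inclH h) =
      tensorAct (leftAct hH M.act) (leftAct hH N.act) h := by
  have eM : firstAct hH p M ∘ₗ (incl k H Rd : H →ₗ[k] Bosonization k H Rd) = leftAct hH M.act :=
    LinearMap.ext (hp.firstAct_inclH hR M)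
  have eN : firstAct hH p N ∘ₗ (incl k H Rd : H →ₗ[k] Bosonization k H Rd) = leftAct hH N.act :=
    LinearMap.ext (hp.firstAct_inclH hR N)
  refine (conv_comp (incl k H Rd) _ (firstAct hH p M) (firstAct hH p N) h).trans ?_
  rw [eM, eN]
  rfl

/-- The twist is linear over `R^∨`. On `m ⊗ n`, an element `ξ` acts through `F(M ⊗ N)` by
`crossAct` of `ξ₍₁₎` on `m ⊗ ξ₍₂₎ n`, and the twist turns `crossAct` into the action on the first
factor, which is how `ξ` acts diagonally on `n₍₋₁₎ m ⊗ n₍₀₎`. -/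
theorem IsDualPair.twist_first_inclR (hp : IsDualPair hH p)
    (hR : Function.Bijective (YDHopfAlgebra.antipode H : R →ₗ[k] R)) (M N : RightYD (incl k H R))
    (ξ : Rd) (x : M.carrier ⊗[k] N.carrier) :
    twist (firstCoact N) (leftAct hH M.act)
      (firstAct hH p (MonoidalCategoryStruct.tensorObj M N) (inclR ξ) x) =
    tensorAct (firstAct hH p M) (firstAct hH p N) (inclR ξ)
      (twist (firstCoact N) (leftAct hH M.act) x) := by
  have hM := hp.isYDModule_first hR M
  have hN := hp.isYDModule_first hR N
  have hcM := (M.isLeftYD hH hR).isYDComodule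
  induction x with
  | zero => simp only [map_zero]
  | add s t hs ht => simp only [map_add, hs, ht]
  | tmul m n =>
    rw [firstAct_eq hH p M, firstAct_eq hH p N, hN.tensorAct_inclR_twist hM.isYD.act_mul,
      hp.firstAct_inclR hR, leftCoact_tensorObj]
    have e1 : leftCoact N.coact = glueCoact (firstCoact N) (thetaCoact (leftCoact N.coact)) := by
      rw [firstCoact_eq, glueCoact_thetaCoact_projCoact (N.isLeftYD hH hR).coassoc]
    have e2 : pairAct p (thetaCoact (coTensorCoact (leftCoact M.coact) (leftCoact N.coact))) ξ
        (m ⊗ₜ[k] n) = TensorProduct.lift (crossAct p (thetaCoact (leftCoact M.coact))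
          (firstCoact N)) ((TensorProduct.mk k M.carrier N.carrier m ∘ₗ
            (pairAct p (thetaCoact (leftCoact N.coact))).flip n).lTensor Rd (comul ξ)) := by
      conv_lhs => rw [e1]
      rw [pairAct_apply, thetaCoact_coTensorCoact, hp.ev_crossMul]
      rfl
    refine (congrArg (twist (firstCoact N) (leftAct hH M.act)) e2).trans ?_
    generalize (TensorProduct.mk k M.carrier N.carrier m ∘ₗ
      (pairAct p (thetaCoact (leftCoact N.coact))).flip n).lTensor Rd (comul ξ) = t
    induction t with
    | zero => simp only [map_zero]
    | add s t hs ht => simp only [map_add, hs, ht]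
    | tmul η y => exact twist_crossAct hN.isYD.coassoc hcM.hom.map_act p η y

/-- `m ⊗ n ↦ n₍₋₁₎ m ⊗ n₍₀₎` is a morphism from `F(M ⊗ N)` to `F(M) ⊗ F(N)`. -/
theorem IsDualPair.isLeftHom_twist (hp : IsDualPair hH p)
    (hR : Function.Bijective (YDHopfAlgebra.antipode H : R →ₗ[k] R))
    (M N : RightYD (incl k H R)) :
    IsLeftHom (firstAct hH p (MonoidalCategoryStruct.tensorObj M N))
      (firstCoact (MonoidalCategoryStruct.tensorObj M N))
      (tensorAct (firstAct hH p M) (firstAct hH p N))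
      (tensorCoactLeft (firstCoact M) (firstCoact N))
      (twist (firstCoact N) (leftAct hH M.act)) where
  map_act b x := by
    have hM := (hp.isYDModule_first hR M).isYD
    have hN := (hp.isYDModule_first hR N).isYD
    refine Bosonization.mul_induction (p := fun b => twist (firstCoact N) (leftAct hH M.act)
      (firstAct hH p (MonoidalCategoryStruct.tensorObj M N) b x) =
      tensorAct (firstAct hH p M) (firstAct hH p N) b
        (twist (firstCoact N) (leftAct hH M.act) x)) b (fun ξ h => ?_)
      (fun b c hb hc => by simp only [map_add, LinearMap.add_apply, hb, hc])
    rw [(hp.isLeftYD_first hR _).act_mul, hp.twist_first_inclR hR,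
      tensorAct_mul (hp.isLeftYD_first hR M).act_mul (hp.isLeftYD_first hR N).act_mul,
      hp.firstAct_inclH hR, hp.tensorAct_firstAct_inclH hR]
    refine congrArg _ (Eq.trans ?_ (twist_coTensorAct hM.act_mul
      ((freeLeft_iff _ _ _).2 hN.compat) h x))
    exact congrArg (fun f => twist (firstCoact N) (leftAct hH M.act) (f h x))
      (leftAct_tensorAct hH M.act N.act)
  map_coact x := by
    have hM := (hp.isYDModule_first hR M).isYD
    have hN := (hp.isYDModule_first hR N).isYD
    rw [firstCoact_tensorObj]
    exact tensorCoactLeft_twist ((freeLeft_iff _ _ _).2 hM.compat) hN.coassoc x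

end Comultiplication


/-! ### Associativity and unit -/

section TwistCoherence

variable {k : Type u} [Field k] {H : Type v} [Ring H] [HopfAlgebra k H]
  {M N P : Type*} [AddCommGroup M] [Module k M] [AddCommGroup N] [Module k N]
  [AddCommGroup P] [Module k P]

/-- Both iterations send `(m ⊗ n) ⊗ p` to `p₍₋₂₎ n₍₋₁₎ m ⊗ (p₍₋₁₎ n₍₀₎ ⊗ p₍₀₎)`. -/
theorem twist_assoc {aM : H →ₗ[k] Module.End k M} {aN : H →ₗ[k] Module.End k N}
    {cN : N →ₗ[k] H ⊗[k] N} {cP : P →ₗ[k] H ⊗[k] P}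
    (hM : ∀ b b' m, aM (b * b') m = aM b (aM b' m)) (hN : FreeLeft (BialgHom.id k H) aN cN)
    (hP : ∀ p, TensorProduct.assoc k H H P (comul.rTensor P (cP p)) = cP.lTensor H (cP p))
    (x : (M ⊗[k] N) ⊗[k] P) :
    TensorProduct.assoc k M N P ((twist cN aM).rTensor P (twist cP (coTensorAct aM aN) x)) =
      (twist cP aN).lTensor M (twist (coTensorCoact cN cP) aM
        (TensorProduct.assoc k M N P x)) := by
  rw [twist_natural cP (twist_coTensorAct hM hN)]
  induction x with
  | zero => simp only [map_zero]
  | add s t hs ht => simp only [map_add, hs, ht]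
  | tmul y p =>
    induction y with
    | zero => simp only [map_zero, TensorProduct.zero_tmul]
    | add s t hs ht => simp only [map_add, TensorProduct.add_tmul, hs, ht]
    | tmul m n =>
      rw [LinearMap.rTensor_tmul, twist_tmul cN, TensorProduct.assoc_tmul,
        twist_tmul (coTensorCoact cN cP), coTensorCoact_tmul]
      generalize cN n = t
      induction t with
      | zero => simp only [map_zero, TensorProduct.zero_tmul, TensorProduct.tmul_zero]
      | add s t hs ht =>
        simp only [map_add, TensorProduct.add_tmul, TensorProduct.tmul_add, hs, ht]
      | tmul h n =>
        let T : H ⊗[k] H →ₗ[k] M ⊗[k] N :=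
          LinearMap.applyₗ (aM h m ⊗ₜ n) ∘ₗ TensorProduct.homTensorHomMap (RingHom.id k) M N M N ∘ₗ
            TensorProduct.map aM aN
        have e : (tensorAct aM aN).flip (aM h m ⊗ₜ n) = T ∘ₗ comul :=
          LinearMap.ext fun b => tensorAct_apply aM aN b _
        rw [LinearMap.rTensor_tmul, twist_tmul, LinearMap.flip_apply, e,
          LinearMap.rTensor_comp_apply,
          ← (TensorProduct.assoc k H H P).symm_apply_apply (comul.rTensor P (cP p)), hP]
        generalize cP p = s
        induction s with
        | zero => simp only [map_zero, TensorProduct.zero_tmul]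
        | add s t hs ht => simp only [map_add, TensorProduct.add_tmul, hs, ht]
        | tmul g p =>
          have e' : (twist cP aN).lTensor M ((aM.flip m).rTensor (N ⊗[k] P)
              ((TensorProduct.comm k P N).toLinearMap.lTensor H
                (mixL k H P N ((g ⊗ₜ p) ⊗ₜ (h ⊗ₜ n))))) =
              aM (g * h) m ⊗ₜ twist cP aN (n ⊗ₜ p) := rfl
          rw [e', LinearMap.lTensor_tmul, twist_tmul, hM]
          generalize cP p = t
          induction t with
          | zero => simp only [map_zero, TensorProduct.tmul_zero]
          | add s t hs ht => simp only [map_add, TensorProduct.tmul_add, hs, ht]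
          | tmul b p => simp [T]

end TwistCoherence

section UnitAndTensorator

open RelYD.YDHopfAlgebra (act coact)
open RelYD.Bosonization (proj incl theta inclR inclH)

variable {k : Type u} [Field k] {H : Type v} [Ring H] [HopfAlgebra k H]
  {R : Type w} [Ring R] [Algebra k R] [Coalgebra k R] [YDHopfAlgebra k H R]

/-- The projection commutes with the antipodes. -/
theorem Bosonization.proj_antipode (a : Bosonization k H R) :
    proj k H R (antipode k a) = antipode k (proj k H R a) := by
  exact LinearMap.congr_fun (conv_left_inv_eq_right_inv
    (conv_antipode_left LinearMap.id (proj k H R))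
    (conv_antipode_right' LinearMap.id (proj k H R))) a

/-- The tensorator is the inverse of `m ⊗ n ↦ n₍₋₁₎ m ⊗ n₍₀₎`. -/
theorem firstTensorator_eq (hH : Function.Bijective (antipode k : H →ₗ[k] H))
    (M N : RightYD (incl k H R)) : firstTensorator hH M N =
      twist (firstCoact N) (leftAct hH M.act ∘ₗ antipodeInv hH) := by
  refine TensorProduct.ext' fun m n => ?_
  rw [twist_tmul]
  simp only [firstTensorator, firstCoact, LinearMap.comp_apply, LinearMap.lTensor_tmul,
    LinearEquiv.coe_coe]
  generalize N.coact n = t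
  induction t with
  | zero => simp only [map_zero, TensorProduct.tmul_zero]
  | add s t hs ht => simp only [map_add, TensorProduct.tmul_add, hs, ht]
  | tmul n a => simp [leftAct, Bosonization.proj_antipode, antipodeInv_antipode]

theorem leftCoact_tensorUnit : leftCoact (MonoidalCategoryStruct.tensorUnit
    (RightYD (incl k H R))).coact = TensorProduct.mk k (Bosonization k H R) k 1 := by
  refine LinearMap.ext fun (a : k) => ?_
  change flipAntipode k (Bosonization k H R) k (a ⊗ₜ 1) = 1 ⊗ₜ a
  rw [flipAntipode_tmul, antipode_one]

theorem firstCoact_tensorUnit : firstCoact (MonoidalCategoryStruct.tensorUnit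
    (RightYD (incl k H R))) = trivCoactLeft k H := by
  rw [firstCoact_eq, leftCoact_tensorUnit]
  refine LinearMap.ext fun (a : k) => ?_
  change (proj k H R : Bosonization k H R →ₗ[k] H).rTensor k (1 ⊗ₜ a) = 1 ⊗ₜ a
  simp

theorem leftAct_trivAct {B : Type v} [Ring B] [HopfAlgebra k B]
    (hB : Function.Bijective (antipode k : B →ₗ[k] B)) : leftAct hB (trivAct k B) = trivAct k B :=
  LinearMap.ext fun b => congrArg (LinearMap.mul k k) (counit_antipodeInv hB b)

variable {Rd : Type x} [Ring Rd] [Algebra k Rd] [Coalgebra k Rd] [YDHopfAlgebra k H Rd]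
  {hH : Function.Bijective (antipode k : H →ₗ[k] H)} {p : Rd →ₗ[k] R →ₗ[k] k}

theorem IsDualPair.firstAct_tensorUnit (hp : IsDualPair hH p) :
    firstAct hH p (MonoidalCategoryStruct.tensorUnit (RightYD (incl k H R))) =
      trivAct k (Bosonization k H Rd) := by
  rw [firstAct_eq, leftCoact_tensorUnit]
  refine LinearMap.ext fun b => Bosonization.mul_induction (p := fun b =>
    smashAct (pairAct p (thetaCoact (TensorProduct.mk k (Bosonization k H R) k 1)))
      (leftAct hH (trivAct k H)) b = trivAct k (Bosonization k H Rd) b) b (fun ξ h => ?_)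
    (fun b c hb hc => by rw [map_add, map_add, hb, hc])
  rw [smashAct_mul, leftAct_trivAct]
  refine LinearMap.ext fun (a : k) => ?_
  have e : theta k H R 1 = 1 := by
    rw [← map_one (inclR (k := k) (H := H) (R := R)), Bosonization.theta_inclR]
  change ev p k ξ ((theta k H R).rTensor k (1 ⊗ₜ (counit h * a))) =
    counit (R := k) (inclR ξ * inclH h : Bosonization k H Rd) * a
  rw [LinearMap.rTensor_tmul, e, ev_tmul, hp.pair_one, Bosonization.counit_eq, map_mul,
    Bosonization.counitHom_inclR, Bosonization.counitHom_inclH, smul_eq_mul, mul_assoc]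

end UnitAndTensorator


/-! ### The monoidal structure -/

section Monoidal

open RelYD.Bosonization (proj incl theta inclR inclH)
open CategoryTheory.MonoidalCategory

variable {k : Type u} [Field k] {H : Type v} [Ring H] [HopfAlgebra k H]
  {R : Type w} [Ring R] [Algebra k R] [Coalgebra k R] [YDHopfAlgebra k H R]
  {Rd : Type x} [Ring Rd] [Algebra k Rd] [Coalgebra k Rd] [YDHopfAlgebra k H Rd]
  {hH : Function.Bijective (antipode k : H →ₗ[k] H)} {p : Rd →ₗ[k] R →ₗ[k] k}

theorem RatYD.hom_ext {hp : IsDualPair hH p} {X Y : RatYD hp} {f g : X ⟶ Y}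
    (h : f.hom.lin = g.hom.lin) : f = g :=
  ObjectProperty.hom_ext _ (LeftYD.hom_ext h)

theorem RatYD.isIso {hp : IsDualPair hH p} {X Y : RatYD hp} (f : X ⟶ Y)
    (e : X.obj.carrier ≃ₗ[k] Y.obj.carrier) (h : f.hom.lin = e.toLinearMap) : IsIso f := by
  have h1 : f.hom = (LeftYD.isoMk e (h ▸ f.hom.isHom)).hom := LeftYD.hom_ext h
  have h2 : IsIso f.hom := by
    rw [h1]
    infer_instance
  exact (ObjectProperty.isIso_hom_iff f).1 h2

/-- The functor sends the unit object to the unit object. -/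
theorem IsDualPair.isLeftHom_unit (hp : IsDualPair hH p) :
    IsLeftHom (firstAct hH p (𝟙_ (RightYD (incl k H R)))) (firstCoact (𝟙_ (RightYD (incl k H R))))
      (trivAct k (Bosonization k H Rd)) (trivCoactLeft k H) (LinearMap.id : k →ₗ[k] k) where
  map_act b m := congrArg (fun f => f b m) hp.firstAct_tensorUnit
  map_coact m := by
    exact (LinearMap.congr_fun firstCoact_tensorUnit m).symm.trans
      (LinearMap.congr_fun (LinearMap.lTensor_id H k)
        (firstCoact (𝟙_ (RightYD (incl k H R))) m)).symm

/-- The oplax monoidal structure on the functor given by `m ⊗ n ↦ n₍₋₁₎ m ⊗ n₍₀₎`. -/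
noncomputable abbrev IsDualPair.firstOplaxMonoidal (hp : IsDualPair hH p)
    (hR : Function.Bijective (YDHopfAlgebra.antipode H : R →ₗ[k] R)) (hYD) (hrat) :
    (firstFunctor (R := R) hp hYD hrat).OplaxMonoidal where
  η := ⟨⟨(LinearMap.id : k →ₗ[k] k), hp.isLeftHom_unit⟩⟩
  δ M N := ⟨⟨twist (firstCoact N) (leftAct hH M.act), hp.isLeftHom_twist hR M N⟩⟩
  δ_natural_left {M M'} f N := RatYD.hom_ext (LinearMap.ext fun x =>
    twist_natural (firstCoact N) (f := leftAct hH M.act) (g := leftAct hH M'.act)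
      (fun b m => f.isHom.map_act (antipodeInv hH b) m) x)
  δ_natural_right {N N'} M f := RatYD.hom_ext (LinearMap.ext fun x =>
    twist_natural_right (leftAct hH M.act) (firstHom hH p f).map_coact x)
  oplax_associativity M N P := RatYD.hom_ext (LinearMap.ext fun x => by
    have hN := (hp.isYDModule_first hR N).isYD
    have e := twist_assoc (aM := leftAct hH M.act) (hp.isYDModule_first hR M).isYD.act_mul
      ((freeLeft_iff _ _ _).2 hN.compat) (hp.isYDModule_first hR P).isYD.coassoc x
    rw [← leftAct_tensorAct, ← firstCoact_tensorObj] at e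
    exact e)
  oplax_left_unitality M := RatYD.hom_ext (LinearMap.ext fun (x : M.carrier) => by
    have e := twist_counit (hp.isYDModule_first hR M).isYD.counit
      (f := leftAct hH (trivAct k H)) (fun b => by rw [leftAct_trivAct]; ext; rfl)
      ((1 : k) ⊗ₜ[k] x)
    exact e.symm.trans (LinearMap.congr_fun (TensorProduct.map_id (R := k)) _).symm)
  oplax_right_unitality M := RatYD.hom_ext (LinearMap.ext fun (x : M.carrier) => by
    have e : twist (firstCoact (𝟙_ (RightYD (incl k H R)))) (leftAct hH M.act) (x ⊗ₜ[k] (1 : k)) =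
        x ⊗ₜ[k] (1 : k) := by
      refine (LinearMap.congr_fun (congrArg (fun c : k →ₗ[k] H ⊗[k] k => twist c
        (leftAct hH M.act)) firstCoact_tensorUnit) (x ⊗ₜ[k] (1 : k))).trans ?_
      rw [twist_tmul]
      change leftAct hH M.act 1 x ⊗ₜ[k] (1 : k) = _
      rw [(hp.isYDModule_first hR M).isYD.act_one]
    exact e.symm.trans (LinearMap.congr_fun (TensorProduct.map_id (R := k)) _).symm)

/-- The monoidal structure on the functor, with the inverse of `m ⊗ n ↦ n₍₋₁₎ m ⊗ n₍₀₎` as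
tensorator. -/
theorem IsDualPair.exists_monoidal (hp : IsDualPair hH p)
    (hR : Function.Bijective (YDHopfAlgebra.antipode H : R →ₗ[k] R)) (hYD) (hrat) :
    ∃ _ : (firstFunctor (R := R) hp hYD hrat).Monoidal,
      (Functor.LaxMonoidal.ε (firstFunctor hp hYD hrat)).hom.lin = LinearMap.id ∧
      ∀ M N : RightYD (incl k H R),
        (Functor.LaxMonoidal.μ (firstFunctor hp hYD hrat) M N).hom.lin =
          firstTensorator hH M N := by
  let F := firstFunctor (R := R) hp hYD hrat
  let _ : F.OplaxMonoidal := hp.firstOplaxMonoidal hR hYD hrat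
  let e (M N : RightYD (incl k H R)) := twistEquiv hH (firstCoact N) (leftAct hH M.act)
    (hp.isYDModule_first hR N).isYD.coassoc (hp.isYDModule_first hR N).isYD.counit
    (LinearMap.ext (hp.isYDModule_first hR M).isYD.act_one)
    (fun a b => LinearMap.ext ((hp.isYDModule_first hR M).isYD.act_mul a b))
  have : IsIso (Functor.OplaxMonoidal.η F) := RatYD.isIso _ (LinearEquiv.refl k k) rfl
  have (M N : RightYD (incl k H R)) : IsIso (Functor.OplaxMonoidal.δ F M N) :=
    RatYD.isIso _ (e M N) rfl
  refine ⟨Functor.Monoidal.ofOplaxMonoidal F, ?_, fun M N => ?_⟩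
  · exact congrArg (fun f => f.hom.lin) (IsIso.inv_hom_id (Functor.OplaxMonoidal.η F))
  · rw [firstTensorator_eq]
    refine LinearMap.ext fun x => (e M N).injective ?_
    refine Eq.trans ?_ ((e M N).apply_symm_apply x).symm
    exact congrArg (fun f => f.hom.lin x) (IsIso.inv_hom_id (Functor.OplaxMonoidal.δ F M N))

end Monoidal

end RelYD

theorem mainTheorem2 {k : Type u} [Field k] {H : Type v} [Ring H] [HopfAlgebra k H]
    {R : Type w} [Ring R] [Algebra k R] [Coalgebra k R] [YDHopfAlgebra k H R]
    {Rd : Type x} [Ring Rd] [Algebra k Rd] [Coalgebra k Rd] [YDHopfAlgebra k H Rd]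
    (hH : Function.Bijective (antipode k : H →ₗ[k] H))
    (hR : Function.Bijective (YDHopfAlgebra.antipode H : R →ₗ[k] R))
    (hRd : Function.Bijective (YDHopfAlgebra.antipode H : Rd →ₗ[k] Rd))
    (p : Rd →ₗ[k] R →ₗ[k] k) (hp : IsDualPair hH p) :
    ∃ (hYD : ∀ M : RightYD (Bosonization.incl k H R),
        IsLeftYD (Bosonization.proj k H Rd) (firstAct hH p M) (firstCoact M))
      (hrat : ∀ M : RightYD (Bosonization.incl k H R),
        rational p ⟨M.carrier, firstAct hH p M, firstCoact M, hYD M⟩)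
      (_ : (firstFunctor hp hYD hrat).Monoidal),
      (∃ G : RatYD hp ⥤ RightYD (Bosonization.incl k H R),
        firstFunctor hp hYD hrat ⋙ G = 𝟭 _ ∧ G ⋙ firstFunctor hp hYD hrat = 𝟭 _) ∧
      (Functor.LaxMonoidal.ε (firstFunctor hp hYD hrat)).hom.lin = LinearMap.id ∧
      ∀ M N : RightYD (Bosonization.incl k H R),
        (Functor.LaxMonoidal.μ (firstFunctor hp hYD hrat) M N).hom.lin =
          firstTensorator hH M N := by
  obtain ⟨hmon, hunit, htensor⟩ := hp.exists_monoidal hR (fun M => hp.isLeftYD_first hR M)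
    (fun M => hp.rational_first hR M)
  exact ⟨_, _, hmon, hp.exists_inverse hR _ _, hunit, htensor⟩
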